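/- Regard $\mathbb C$ as the real algebraic variety $R_{\mathbb C/\mathbb R}(\mathbb A^1)=\mathbb A^2_{\mathbb R}$ and $\mathbb C^*$ as the real algebraic group $R_{\mathbb C/\mathbb R}(\mathbb G_m)$ acting on it by multiplication. Let $\mathrm{Bun}_\nabla(\mathbb C;\mathbb C^*)$ be the category of $\mathbb C^*$-equivariant real algebraic vector bundles $E$ on $\mathbb C$ equipped with a $\mathbb C^*$-invariant real algebraic connection $\nabla$, not assumed flat; morphisms are the equivariant horizontal morphisms of bundles, and the tensor product is that of equivariant bundles with connection. Let $\mathrm{MHS}_{\mathbb R}$ be the category of real mixed Hodge structures: finite-dimensional real vector spaces $V$ with a finite increasing filtration $W_\bullet$ of $V$ and a finite decreasing filtration $F^\bullet$ of $V_{\mathbb C}=V\otimes_{\mathbb R}\mathbb C$ such that $\mathrm{gr}_F^p\,\mathrm{gr}_{\overline F}^q\,\mathrm{gr}_n^W(V_{\mathbb C})=0$ for $n\ne p+q$; morphisms are the linear maps compatible with $W_\bullet$ and $F^\bullet$, and the tensor product is that of filtered spaces. Both are abelian $\mathbb R$-linear symmetric tensor categories, and there is an $\mathbb R$-linear equivalence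 of symmetric tensor categories $$h:\mathrm{Bun}_\nabla(\mathbb C;\mathbb C^*)\longrightarrow \mathrm{MHS}_{\mathbb R}$$ with the following properties. Let $(V,W_\bullet,F^\bullet)=h(E,\nabla)$. (a) There is an isomorphism $\mathrm{gr}^W_\bullet(V)=\bigoplus_n \mathrm{gr}^W_n(V)\cong E_0$ with the fiber of $E$ at $0$, natural in $(E,\nabla)$. Its complexification maps $F^p\,\mathrm{gr}_n^W(V)_{\mathbb C}$ onto $\bigoplus_{p'\ge p}E_0^{p',\,n-p'}$, where $E_0^{p,q}\subset E_0\otimes_{\mathbb R}\mathbb C$ is the subspace on which each $z\in\mathbb C^*$ acts by $z^{-p}\bar z^{-q}$. (b) There is an isomorphism, natural in $(E,\nabla)$, of the vector space $V$ with the space $H^0_\nabla(\{\mathrm{Re}(t)=-1/2\},E)$ of covariantly constant (algebraic) sections of $E$ over the real line $\mathrm{Re}(t)=-1/2$. (c) $\nabla$ is flat if and only if $V$ is split, i.e. isomorphic to a finite direct sum of pure Hodge structures. (d) There is an isomorphism, natural in $(E,\nabla)$, in the derived category of real vector spaces, $$R\mathrm{Hom}_{\mathrm{MHS}_{\mathbb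 R}}(\mathbb R(0),V)\;\cong\;\Gamma\bigl(\mathbb C,\{E\xrightarrow{\ \nabla\ }E\otimes\Omega^1_{\mathbb C}\}\bigr)^{\mathbb C^*},$$ where the right-hand side is the two-term complex, in degrees $0$ and $1$, of $\mathbb C^*$-invariant global sections, $\Omega^1_{\mathbb C}$ is the sheaf of (algebraic) real $1$-forms on $\mathbb C=\mathbb A^2_{\mathbb R}$, and $\mathbb R(0)$ is the unit object. -/

import Mathlib

open CategoryTheory MonoidalCategory TensorProduct

noncomputable section

namespace HodgeConn

/-! ### The plane and the torus -/

/-- The coordinate ring `ℝ[x, y]` of `ℂ`, regarded as the real algebraic plane with coordinates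
`x = Re t` (the variable `X 0`) and `y = Im t` (the variable `X 1`). -/
abbrev Poly : Type := MvPolynomial (Fin 2) ℝ

/-- The Jacobian matrix of the map `t ↦ z⁻¹ t` of the plane:
`jac z i j = ∂ (j-th coordinate of z⁻¹ t) / ∂ (i-th coordinate of t)`. -/
def jac (z : ℂˣ) : Matrix (Fin 2) (Fin 2) ℝ :=
  !![((z⁻¹ : ℂˣ) : ℂ).re, ((z⁻¹ : ℂˣ) : ℂ).im; -((z⁻¹ : ℂˣ) : ℂ).im, ((z⁻¹ : ℂˣ) : ℂ).re]

/-- The action of `ℂ^*` on functions on the plane, `(z · f)(t) = f (z⁻¹ t)`. -/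
def act (z : ℂˣ) : Poly →ₐ[ℝ] Poly :=
  MvPolynomial.aeval fun j => ∑ i, MvPolynomial.C (jac z i j) * MvPolynomial.X i

/-- The regular functions on the real algebraic group `ℂ^*`, i.e. on the Weil restriction of the
multiplicative group: the polynomials in `Re z`, `Im z` and `|z|⁻²`. -/
def regularFunctions : Subalgebra ℝ (ℂˣ → ℝ) :=
  Algebra.adjoin ℝ {(fun z : ℂˣ => (z : ℂ).re), (fun z : ℂˣ => (z : ℂ).im),
    (fun z : ℂˣ => (Complex.normSq (z : ℂ))⁻¹)}

/-- A map from `ℂ^*` to a real vector space is regular if it is a finite sum of terms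
`z ↦ f z • m` with `f` a regular function. -/
def IsRegularMap {M : Type} [AddCommGroup M] [Module ℝ M] (g : ℂˣ → M) : Prop :=
  g ∈ Submodule.span ℝ {g : ℂˣ → M | ∃ f ∈ regularFunctions, ∃ m : M, g = fun z => f z • m}

theorem jac_one : jac 1 = 1 := by
  ext i j; fin_cases i <;> fin_cases j <;> simp [jac]

theorem jac_mul (z w : ℂˣ) : jac (z * w) = jac z * jac w := by
  ext i j; fin_cases i <;> fin_cases j <;>
    simp [jac, mul_inv_rev, Matrix.mul_apply, Fin.sum_univ_two] <;> ring

theorem act_X (z : ℂˣ) (j : Fin 2) :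
    act z (MvPolynomial.X j) = ∑ i, MvPolynomial.C (jac z i j) * MvPolynomial.X i := by
  simp [act]

theorem act_one : act 1 = AlgHom.id ℝ Poly := by
  ext j : 1
  rw [act_X, jac_one]
  fin_cases j <;> simp [Matrix.one_apply]

theorem act_mul (z w : ℂˣ) : act (z * w) = (act z).comp (act w) := by
  ext j : 1
  rw [act_X, jac_mul, AlgHom.comp_apply, act_X]
  simp only [map_mul, act_X, Matrix.mul_apply, Fin.sum_univ_two, map_add]
  have h : ∀ r : ℝ, act z (MvPolynomial.C r) = MvPolynomial.C r := fun r => (act z).commutes r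
  simp only [h]
  ring

theorem pderiv_act (z : ℂˣ) (i : Fin 2) (f : Poly) :
    MvPolynomial.pderiv i (act z f) = ∑ j, jac z i j • act z (MvPolynomial.pderiv j f) := by
  have hC : ∀ r : ℝ, act z (MvPolynomial.C r) = MvPolynomial.C r := fun r => (act z).commutes r
  induction f using MvPolynomial.induction_on with
  | C a => simp [hC]
  | add p q hp hq => simp only [map_add, hp, hq, smul_add, Finset.sum_add_distrib]
  | mul_X p k hp =>
    simp only [map_mul, Derivation.leibniz, hp, act_X, Fin.sum_univ_two, map_add,
      MvPolynomial.pderiv_X, MvPolynomial.pderiv_C, smul_eq_mul]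
    fin_cases i <;> fin_cases k <;>
      simp [MvPolynomial.smul_eq_C_mul] <;> ring

section regular

variable {M N : Type} [AddCommGroup M] [Module ℝ M] [AddCommGroup N] [Module ℝ N]

theorem IsRegularMap.add {g h : ℂˣ → M} (hg : IsRegularMap g) (hh : IsRegularMap h) :
    IsRegularMap (fun z => g z + h z) := Submodule.add_mem _ hg hh

theorem isRegularMap_zero : IsRegularMap (fun _ => (0 : M)) := Submodule.zero_mem _

theorem isRegularMap_smul {f : ℂˣ → ℝ} (hf : f ∈ regularFunctions) (m : M) :
    IsRegularMap (fun z => f z • m) := Submodule.subset_span ⟨f, hf, m, rfl⟩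

theorem IsRegularMap.map {g : ℂˣ → M} (hg : IsRegularMap g) (L : M →ₗ[ℝ] N) :
    IsRegularMap (fun z => L (g z)) := by
  unfold IsRegularMap at hg
  induction hg using Submodule.span_induction with
  | mem x hx =>
    obtain ⟨f, hf, m, rfl⟩ := hx
    simpa using isRegularMap_smul hf (L m)
  | zero => simpa using isRegularMap_zero
  | add x y _ _ hx hy => simpa using hx.add hy
  | smul a x _ hx =>
    refine (congrArg (· ∈ _) ?_).mp (Submodule.smul_mem _ a hx)
    funext z; simp

theorem IsRegularMap.bilin {P : Type} [AddCommGroup P] [Module ℝ P] {g : ℂˣ → M} {h : ℂˣ → N}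
    (hg : IsRegularMap g) (hh : IsRegularMap h) (B : M →ₗ[ℝ] N →ₗ[ℝ] P) :
    IsRegularMap (fun z => B (g z) (h z)) := by
  unfold IsRegularMap at hg
  induction hg using Submodule.span_induction with
  | zero => simpa using isRegularMap_zero
  | add x y _ _ hx hy => simpa using hx.add hy
  | smul a x _ hx =>
    refine (congrArg (· ∈ _) ?_).mp (Submodule.smul_mem _ a hx)
    funext z; simp
  | mem x hx =>
    obtain ⟨f, hf, m, rfl⟩ := hx
    unfold IsRegularMap at hh
    induction hh using Submodule.span_induction with
    | zero => simpa using isRegularMap_zero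
    | add x y _ _ hx hy => simpa using hx.add hy
    | smul a x _ hx =>
      have := Submodule.smul_mem _ a hx
      refine (congrArg (· ∈ _) ?_).mp this
      funext z; simp [smul_smul]
    | mem y hy =>
      obtain ⟨f', hf', n, rfl⟩ := hy
      refine (congrArg IsRegularMap ?_).mp (isRegularMap_smul (mul_mem hf' hf) (B m n))
      funext z; simp [mul_smul]

theorem jac_regular (i j : Fin 2) : (fun z => jac z i j) ∈ regularFunctions := by
  have hre : (fun z : ℂˣ => (z : ℂ).re) ∈ regularFunctions := Algebra.subset_adjoin (by simp)
  have him : (fun z : ℂˣ => (z : ℂ).im) ∈ regularFunctions := Algebra.subset_adjoin (by simp)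
  have hn : (fun z : ℂˣ => (Complex.normSq z)⁻¹) ∈ regularFunctions :=
    Algebra.subset_adjoin (by simp)
  have h1 : (fun z : ℂˣ => ((z⁻¹ : ℂˣ) : ℂ).re) ∈ regularFunctions := by
    refine (congrArg (· ∈ regularFunctions) ?_).mp (mul_mem hre hn)
    funext z; simp [Complex.inv_re, div_eq_mul_inv]
  have h2 : (fun z : ℂˣ => ((z⁻¹ : ℂˣ) : ℂ).im) ∈ regularFunctions := by
    refine (congrArg (· ∈ regularFunctions) ?_).mp (neg_mem (mul_mem him hn))
    funext z; simp [Complex.inv_im, div_eq_mul_inv]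
  fin_cases i <;> fin_cases j
  · simpa [jac] using h1
  · simpa [jac] using h2
  · have := neg_mem h2
    refine (congrArg (· ∈ regularFunctions) ?_).mp this
    funext z; simp [jac]
  · simpa [jac] using h1

theorem act_regular (f : Poly) : IsRegularMap (fun z => act z f) := by
  induction f using MvPolynomial.induction_on with
  | C a =>
    have h : ∀ z, act z (MvPolynomial.C a) = MvPolynomial.C a := fun z => (act z).commutes a
    simp only [h]
    simpa using isRegularMap_smul (one_mem regularFunctions) (MvPolynomial.C a : Poly)
  | add p q hp hq => simpa using hp.add hq
  | mul_X p k hp =>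
    have hX : IsRegularMap (fun z => act z (MvPolynomial.X k)) := by
      simp only [act_X, Fin.sum_univ_two, ← MvPolynomial.smul_eq_C_mul]
      exact (isRegularMap_smul (jac_regular _ _) _).add (isRegularMap_smul (jac_regular _ _) _)
    simpa using hp.bilin hX (LinearMap.mul ℝ Poly)

end regular

/-! ### Equivariant sheaves with connection -/

/-- The action of `ℂ^*` on sections of `E ⊗ Ω¹`, where `E` is an equivariant sheaf on the plane
with space of global sections `M`.  Since `Ω¹` is free with basis `dx`, `dy`, an `E`-valued
`1`-form `ω 0 dx + ω 1 dy` is the same as a pair `ω : Fin 2 → M`; the form `dx_j` is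
transformed by pull back along `t ↦ z⁻¹ t`, so it goes to `∑ i, jac z i j dx_i`. -/
def formAct {M : Type} [AddCommGroup M] [Module ℝ M] (ρ : Representation ℝ ℂˣ M) (z : ℂˣ) :
    (Fin 2 → M) →ₗ[ℝ] (Fin 2 → M) :=
  LinearMap.pi fun i => ∑ j, jac z i j • (ρ z ∘ₗ LinearMap.proj j)

/-- A quasi-coherent sheaf on the real algebraic plane `ℂ`, given by its module of global
sections over `ℝ[x, y]`, equivariant under the real algebraic group `ℂ^*` and equipped with an
invariant connection `∇ = ∇₀ dx + ∇₁ dy`, which need not be flat.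

Global sections transform by `(z · s)(t) = z (s (z⁻¹ t))`.  The real points are
Zariski dense in the group, so an algebraic equivariant structure is the same as
a semilinear action of the group `ℂ^*` on global sections that is regular. -/
structure EqConn : Type 1 where
  /-- the space of global sections -/
  carrier : Type
  [addCommGroup : AddCommGroup carrier]
  [moduleReal : Module ℝ carrier]
  [modulePoly : Module Poly carrier]
  [isScalarTower : IsScalarTower ℝ Poly carrier]
  /-- the action of `ℂ^*` on global sections -/
  ρ : Representation ℝ ℂˣ carrier
  ρ_smul : ∀ z (f : Poly) m, ρ z (f • m) = act z f • ρ z m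
  ρ_regular : ∀ m, IsRegularMap fun z => ρ z m
  /-- the covariant derivatives along `∂/∂x` and `∂/∂y` -/
  nabla : Fin 2 → carrier →ₗ[ℝ] carrier
  leibniz : ∀ i (f : Poly) m, nabla i (f • m) = MvPolynomial.pderiv i f • m + f • nabla i m
  invariant : ∀ z m, (fun i => nabla i (ρ z m)) = formAct ρ z (fun i => nabla i m)

attribute [instance] EqConn.addCommGroup EqConn.moduleReal EqConn.modulePoly EqConn.isScalarTower

instance : CoeSort EqConn Type := ⟨EqConn.carrier⟩

theorem EqConn.nabla_ρ (E : EqConn) (i : Fin 2) (z : ℂˣ) (m : E) :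
    E.nabla i (E.ρ z m) = ∑ j, jac z i j • E.ρ z (E.nabla j m) := by
  have := congrFun (E.invariant z m) i
  simpa [formAct] using this

/-- Morphisms: equivariant horizontal maps. -/
@[ext]
structure EqConn.Hom (E E' : EqConn) : Type where
  /-- the underlying map of sheaves -/
  toLin : E →ₗ[Poly] E'
  map_ρ : ∀ z m, toLin (E.ρ z m) = E'.ρ z (toLin m)
  map_nabla : ∀ i m, toLin (E.nabla i m) = E'.nabla i (toLin m)

instance : Category EqConn where
  Hom := EqConn.Hom
  id E := ⟨LinearMap.id, fun _ _ => rfl, fun _ _ => rfl⟩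
  comp f g := ⟨g.toLin ∘ₗ f.toLin, fun z m => by simp [f.map_ρ, g.map_ρ],
    fun i m => by simp [f.map_nabla, g.map_nabla]⟩

namespace EqConn

variable {E E' E'' : EqConn}

@[ext]
theorem hom_ext {f g : E ⟶ E'} (h : f.toLin = g.toLin) : f = g := Hom.ext h

@[simp] theorem id_toLin : Hom.toLin (𝟙 E) = LinearMap.id := rfl
@[simp] theorem comp_toLin (f : E ⟶ E') (g : E' ⟶ E'') :
    (f ≫ g).toLin = g.toLin ∘ₗ f.toLin := rfl

/-- The underlying `ℝ`-linear map of a morphism. -/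
def Hom.toReal (f : Hom E E') : E →ₗ[ℝ] E' := f.toLin.restrictScalars ℝ

@[simp] theorem Hom.toReal_apply (f : Hom E E') (m : E) : f.toReal m = f.toLin m := rfl

theorem Hom.map_real_smul (f : Hom E E') (r : ℝ) (m : E) : f.toLin (r • m) = r • f.toLin m :=
  f.toReal.map_smul r m

instance : Zero (E ⟶ E') := ⟨⟨0, by simp, by simp⟩⟩
instance : Add (E ⟶ E') := ⟨fun f g => ⟨f.toLin + g.toLin,
  by simp [f.map_ρ, g.map_ρ], by simp [f.map_nabla, g.map_nabla]⟩⟩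
instance : Neg (E ⟶ E') := ⟨fun f => ⟨-f.toLin, by simp [f.map_ρ], by simp [f.map_nabla]⟩⟩
instance : Sub (E ⟶ E') := ⟨fun f g => ⟨f.toLin - g.toLin,
  by simp [f.map_ρ, g.map_ρ], by simp [f.map_nabla, g.map_nabla]⟩⟩
instance : SMul ℕ (E ⟶ E') := ⟨fun n f => ⟨n • f.toLin, by simp [f.map_ρ],
  by simp [f.map_nabla]⟩⟩
instance : SMul ℤ (E ⟶ E') := ⟨fun n f => ⟨n • f.toLin, by simp [f.map_ρ],
  by simp [f.map_nabla]⟩⟩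
instance : SMul ℝ (E ⟶ E') := ⟨fun n f => ⟨n • f.toLin, by simp [f.map_ρ],
  by simp [f.map_nabla]⟩⟩

@[simp] theorem add_toLin (f g : E ⟶ E') : (f + g).toLin = f.toLin + g.toLin := rfl
@[simp] theorem smul_toLin (r : ℝ) (f : E ⟶ E') : (r • f).toLin = r • f.toLin := rfl

instance : AddCommGroup (E ⟶ E') :=
  Function.Injective.addCommGroup (fun f : E ⟶ E' => f.toLin) (fun _ _ h => Hom.ext h) rfl
    (fun _ _ => rfl) (fun _ => rfl) (fun _ _ => rfl) (fun _ _ => rfl) (fun _ _ => rfl)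

instance : Module ℝ (E ⟶ E') :=
  Function.Injective.module ℝ
    (⟨⟨fun f : E ⟶ E' => f.toLin, rfl⟩, fun _ _ => rfl⟩ : (E ⟶ E') →+ (E →ₗ[Poly] E'))
    (fun _ _ h => Hom.ext h) (fun _ _ => rfl)

instance : Preadditive EqConn where
  add_comp _ _ _ _ _ _ := by ext; simp
  comp_add _ _ _ _ _ _ := by ext; simp

instance : Linear ℝ EqConn where
  smul_comp _ _ _ _ f g := by ext; simp
  comp_smul _ _ _ _ _ _ := by ext; simp

/-! #### Tensor products -/

/-- `ρ z` as a semilinear map over `ℝ[x, y]`. -/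
def ρSemi (E : EqConn) (z : ℂˣ) : E →ₛₗ[(act z : Poly →+* Poly)] E where
  toFun := E.ρ z
  map_add' := map_add _
  map_smul' f m := E.ρ_smul z f m

/-- The diagonal action `z · (m ⊗ n) = z m ⊗ z n`. -/
def tensorρ (E E' : EqConn) (z : ℂˣ) : (E ⊗[Poly] E') →ₗ[ℝ] (E ⊗[Poly] E') where
  toFun := TensorProduct.map (E.ρSemi z) (E'.ρSemi z)
  map_add' := map_add _
  map_smul' r x := by
    have h : act z (algebraMap ℝ Poly r) = algebraMap ℝ Poly r := (act z).commutes r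
    rw [← algebraMap_smul Poly r x, LinearMap.map_smulₛₗ]
    simp only [RingHom.coe_coe, h, RingHom.id_apply, algebraMap_smul]

@[simp] theorem tensorρ_tmul (z : ℂˣ) (m : E) (n : E') :
    tensorρ E E' z (m ⊗ₜ n) = E.ρ z m ⊗ₜ E'.ρ z n := rfl

/-- The tensor product connection as an additive map: `∇ (m ⊗ n) = ∇ m ⊗ n + m ⊗ ∇ n`. -/
def tensorNablaAdd (E E' : EqConn) (i : Fin 2) : (E ⊗[Poly] E') →+ (E ⊗[Poly] E') :=
  TensorProduct.liftAddHom
    (AddMonoidHom.mk' (fun m => AddMonoidHom.mk'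
      (fun n => E.nabla i m ⊗ₜ[Poly] n + m ⊗ₜ[Poly] E'.nabla i n)
      (fun a b => by simp only [map_add, tmul_add]; abel))
      (fun a b => by
        ext n
        simp only [map_add, add_tmul, AddMonoidHom.mk'_apply, AddMonoidHom.add_apply]; abel))
    (fun f m n => by
      simp only [AddMonoidHom.mk'_apply, E.leibniz, E'.leibniz, add_tmul, tmul_add,
        smul_tmul]
      abel)

@[simp] theorem tensorNablaAdd_tmul (i : Fin 2) (m : E) (n : E') :
    tensorNablaAdd E E' i (m ⊗ₜ n) = E.nabla i m ⊗ₜ n + m ⊗ₜ E'.nabla i n := rfl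

/-- The tensor product connection: `∇ (m ⊗ n) = ∇ m ⊗ n + m ⊗ ∇ n`. -/
def tensorNabla (E E' : EqConn) (i : Fin 2) : (E ⊗[Poly] E') →ₗ[ℝ] (E ⊗[Poly] E') where
  __ := tensorNablaAdd E E' i
  map_smul' r x := by
    induction x with
    | zero => simp
    | add x y hx hy => simp_all [smul_add]
    | tmul m n =>
      change tensorNablaAdd E E' i (r • m ⊗ₜ n) = r • tensorNablaAdd E E' i (m ⊗ₜ n)
      simp [TensorProduct.smul_tmul']

@[simp] theorem tensorNabla_tmul (i : Fin 2) (m : E) (n : E') :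
    tensorNabla E E' i (m ⊗ₜ n) = E.nabla i m ⊗ₜ n + m ⊗ₜ E'.nabla i n := rfl

/-- The tensor product of two equivariant sheaves with connection. -/
def tensor (E E' : EqConn) : EqConn where
  carrier := E ⊗[Poly] E'
  ρ :=
    { toFun := tensorρ E E'
      map_one' := by
        ext x
        induction x with
        | zero => simp
        | add x y hx hy => simp only [map_add, hx, hy]
        | tmul m n => simp
      map_mul' := fun z w => by
        ext x
        induction x with
        | zero => simp
        | add x y hx hy => simp only [map_add, hx, hy]
        | tmul m n => simp }
  ρ_smul z f x := (TensorProduct.map (E.ρSemi z) (E'.ρSemi z)).map_smulₛₗ f x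
  ρ_regular x := by
    change IsRegularMap fun z => tensorρ E E' z x
    induction x with
    | zero => simpa using isRegularMap_zero
    | add x y hx hy => simpa using hx.add hy
    | tmul m n =>
      let B : E →ₗ[ℝ] E' →ₗ[ℝ] (E ⊗[Poly] E') :=
        LinearMap.mk₂ ℝ (fun m n => m ⊗ₜ[Poly] n) (fun _ _ _ => add_tmul _ _ _)
          (fun _ _ _ => rfl) (fun _ _ _ => tmul_add _ _ _) (fun _ _ _ => by simp)
      exact (E.ρ_regular m).bilin (E'.ρ_regular n) B
  nabla := tensorNabla E E'
  leibniz i f x := by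
    induction x with
    | zero => simp
    | add x y hx hy => simp only [smul_add, map_add, hx, hy]; abel
    | tmul m n =>
      simp only [TensorProduct.smul_tmul', tensorNabla_tmul, E.leibniz, add_tmul, smul_add]
      abel
  invariant z x := by
    funext i
    simp only [formAct, LinearMap.pi_apply, LinearMap.sum_apply, LinearMap.smul_apply,
      LinearMap.comp_apply, LinearMap.proj_apply]
    change tensorNabla E E' i (tensorρ E E' z x) =
      ∑ j, jac z i j • tensorρ E E' z (tensorNabla E E' j x)
    induction x with
    | zero => simp
    | add x y hx hy => simp only [smul_add, map_add, hx, hy, Finset.sum_add_distrib]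
    | tmul m n =>
      simp only [tensorρ_tmul, tensorNabla_tmul, nabla_ρ, Fin.sum_univ_two, map_add, add_tmul,
        tmul_add, smul_add, TensorProduct.smul_tmul', TensorProduct.tmul_smul]
      abel

/-- The structure sheaf with the connection `d`. -/
def unit : EqConn where
  carrier := Poly
  ρ :=
    { toFun := fun z => (act z).toLinearMap
      map_one' := by rw [act_one]; rfl
      map_mul' := fun z w => by rw [act_mul]; rfl }
  ρ_smul z f m := by simp
  ρ_regular m := act_regular m
  nabla i := (MvPolynomial.pderiv i).toLinearMap
  leibniz i f m := by simp [Derivation.leibniz]; ring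
  invariant z m := by
    funext i
    simpa [formAct] using pderiv_act z i m

theorem real_ext {P : Type} [AddCommGroup P] [Module ℝ P] {A B : tensor E E' →ₗ[ℝ] P}
    (h : ∀ m n, A (m ⊗ₜ[Poly] n) = B (m ⊗ₜ[Poly] n)) (x : tensor E E') : A x = B x := by
  refine TensorProduct.induction_on (motive := fun x => A x = B x) x ?_ h ?_
  · exact A.map_zero.trans B.map_zero.symm
  · intro x y hx hy
    exact (A.map_add x y).trans ((congrArg₂ _ hx hy).trans (B.map_add x y).symm)

theorem real_ext₃ {P : Type} [AddCommGroup P] [Module ℝ P]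
    {A B : tensor (tensor E E') E'' →ₗ[ℝ] P}
    (h : ∀ m n k, A ((m ⊗ₜ[Poly] n) ⊗ₜ[Poly] k) = B ((m ⊗ₜ[Poly] n) ⊗ₜ[Poly] k))
    (x : tensor (tensor E E') E'') : A x = B x := by
  refine real_ext (fun y k => ?_) x
  let mkR : tensor E E' →ₗ[ℝ] tensor (tensor E E') E'' :=
    { toFun := fun y => y ⊗ₜ[Poly] k
      map_add' := fun _ _ => add_tmul _ _ _
      map_smul' := fun _ _ => rfl }
  exact real_ext (A := A ∘ₗ mkR) (B := B ∘ₗ mkR) (fun m n => h m n k) y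

/-- Constructor for isomorphisms. -/
def mkIso (e : E ≃ₗ[Poly] E') (h₁ : ∀ z m, e (E.ρ z m) = E'.ρ z (e m))
    (h₂ : ∀ i m, e (E.nabla i m) = E'.nabla i (e m)) : E ≅ E' where
  hom := ⟨e, h₁, h₂⟩
  inv := ⟨e.symm, fun z m => by
      apply e.injective; simp [h₁], fun i m => by apply e.injective; simp [h₂]⟩
  hom_inv_id := by ext; simp
  inv_hom_id := by ext; simp

/-- The tensor product of two morphisms. -/
def tensorMap {E₁ E₂ E₁' E₂' : EqConn} (f : E₁ ⟶ E₂) (g : E₁' ⟶ E₂') :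
    tensor E₁ E₁' ⟶ tensor E₂ E₂' :=
  let L : tensor E₁ E₁' →ₗ[Poly] tensor E₂ E₂' := TensorProduct.map f.toLin g.toLin
  { toLin := L
    map_ρ := fun z => real_ext
      (A := L.restrictScalars ℝ ∘ₗ (tensor E₁ E₁').ρ z)
      (B := (tensor E₂ E₂').ρ z ∘ₗ L.restrictScalars ℝ) fun m n => by
        change f.toLin (E₁.ρ z m) ⊗ₜ[Poly] g.toLin (E₁'.ρ z n) =
          E₂.ρ z (f.toLin m) ⊗ₜ[Poly] E₂'.ρ z (g.toLin n)
        rw [f.map_ρ, g.map_ρ]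
    map_nabla := fun i => real_ext
      (A := L.restrictScalars ℝ ∘ₗ (tensor E₁ E₁').nabla i)
      (B := (tensor E₂ E₂').nabla i ∘ₗ L.restrictScalars ℝ) fun m n => by
        change f.toLin (E₁.nabla i m) ⊗ₜ[Poly] g.toLin n +
            f.toLin m ⊗ₜ[Poly] g.toLin (E₁'.nabla i n) =
          E₂.nabla i (f.toLin m) ⊗ₜ[Poly] g.toLin n + f.toLin m ⊗ₜ[Poly] E₂'.nabla i (g.toLin n)
        rw [f.map_nabla, g.map_nabla] }

/-- The associativity isomorphism. -/
def assocIso (E E' E'' : EqConn) : tensor (tensor E E') E'' ≅ tensor E (tensor E' E'') :=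
  let e : tensor (tensor E E') E'' ≃ₗ[Poly] tensor E (tensor E' E'') :=
    TensorProduct.assoc Poly E E' E''
  let L : tensor (tensor E E') E'' →ₗ[ℝ] tensor E (tensor E' E'') :=
    e.toLinearMap.restrictScalars ℝ
  mkIso e
    (fun z => real_ext₃ (A := L ∘ₗ (tensor (tensor E E') E'').ρ z)
      (B := (tensor E (tensor E' E'')).ρ z ∘ₗ L) fun _ _ _ => rfl)
    (fun i => real_ext₃ (A := L ∘ₗ (tensor (tensor E E') E'').nabla i)
      (B := (tensor E (tensor E' E'')).nabla i ∘ₗ L) fun m n k => by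
        change TensorProduct.assoc Poly E E' E''
          ((E.nabla i m ⊗ₜ n + m ⊗ₜ E'.nabla i n) ⊗ₜ k + (m ⊗ₜ n) ⊗ₜ E''.nabla i k) =
          E.nabla i m ⊗ₜ (n ⊗ₜ k) + m ⊗ₜ (E'.nabla i n ⊗ₜ k + n ⊗ₜ E''.nabla i k)
        simp only [add_tmul, tmul_add, map_add, TensorProduct.assoc_tmul, add_assoc])

/-- The left unit isomorphism. -/
def leftUnitIso (E : EqConn) : tensor unit E ≅ E :=
  let e : tensor unit E ≃ₗ[Poly] E := TensorProduct.lid Poly E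
  let L : tensor unit E →ₗ[ℝ] E := e.toLinearMap.restrictScalars ℝ
  mkIso e
    (fun z => real_ext (A := L ∘ₗ (tensor unit E).ρ z) (B := E.ρ z ∘ₗ L)
      fun f m => (E.ρ_smul z f m).symm)
    (fun i => real_ext (A := L ∘ₗ (tensor unit E).nabla i) (B := E.nabla i ∘ₗ L)
      fun f m => (E.leibniz i f m).symm)

/-- The symmetry isomorphism. -/
def swapIso (E E' : EqConn) : tensor E E' ≅ tensor E' E :=
  let e : tensor E E' ≃ₗ[Poly] tensor E' E := TensorProduct.comm Poly E E'
  let L : tensor E E' →ₗ[ℝ] tensor E' E := e.toLinearMap.restrictScalars ℝ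
  mkIso e
    (fun z => real_ext (A := L ∘ₗ (tensor E E').ρ z) (B := (tensor E' E).ρ z ∘ₗ L)
      fun _ _ => rfl)
    (fun i => real_ext (A := L ∘ₗ (tensor E E').nabla i) (B := (tensor E' E).nabla i ∘ₗ L)
      fun m n => add_comm (n ⊗ₜ[Poly] E.nabla i m) (E'.nabla i n ⊗ₜ[Poly] m))

/-- The right unit isomorphism. -/
def rightUnitIso (E : EqConn) : tensor E unit ≅ E := swapIso E unit ≪≫ leftUnitIso E

instance : MonoidalCategoryStruct EqConn where
  tensorObj := tensor
  tensorUnit := unit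
  tensorHom := tensorMap
  whiskerLeft E _ _ f := tensorMap (𝟙 E) f
  whiskerRight f E := tensorMap f (𝟙 E)
  associator := assocIso
  leftUnitor := leftUnitIso
  rightUnitor := rightUnitIso

theorem tensor_hom_ext {f g : tensor E E' ⟶ E''}
    (h : ∀ m n, f.toLin (m ⊗ₜ[Poly] n) = g.toLin (m ⊗ₜ[Poly] n)) : f = g :=
  hom_ext (TensorProduct.ext' h)

theorem tensor_hom_ext₃ {E₃ : EqConn} {f g : tensor (tensor E E') E'' ⟶ E₃}
    (h : ∀ m n k, f.toLin ((m ⊗ₜ[Poly] n) ⊗ₜ[Poly] k) = g.toLin ((m ⊗ₜ[Poly] n) ⊗ₜ[Poly] k)) :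
    f = g :=
  hom_ext (TensorProduct.ext_threefold h)

instance : MonoidalCategory EqConn where
  tensorHom_def f g := tensor_hom_ext fun _ _ => rfl
  id_tensorHom_id _ _ := tensor_hom_ext fun _ _ => rfl
  tensorHom_comp_tensorHom _ _ _ _ := tensor_hom_ext fun _ _ => rfl
  whiskerLeft_id _ _ := tensor_hom_ext fun _ _ => rfl
  id_whiskerRight _ _ := tensor_hom_ext fun _ _ => rfl
  associator_naturality _ _ _ := tensor_hom_ext₃ fun _ _ _ => rfl
  leftUnitor_naturality f := tensor_hom_ext fun r m => (f.toLin.map_smul r m).symm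
  rightUnitor_naturality f := tensor_hom_ext fun m r => (f.toLin.map_smul r m).symm
  pentagon _ _ _ _ := hom_ext (TensorProduct.ext_fourfold fun _ _ _ _ => rfl)
  triangle E E' := tensor_hom_ext₃ fun m (r : Poly) n => by
    change m ⊗ₜ[Poly] (r • n) = (r • m) ⊗ₜ[Poly] n
    rw [TensorProduct.smul_tmul]

instance : SymmetricCategory EqConn where
  braiding := swapIso
  braiding_naturality_right _ _ _ _ := tensor_hom_ext fun _ _ => rfl
  braiding_naturality_left _ _ := tensor_hom_ext fun _ _ => rfl
  hexagon_forward _ _ _ := tensor_hom_ext₃ fun _ _ _ => rfl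
  hexagon_reverse X Y Z := by
    rw [← cancel_epi (α_ X Y Z).hom]
    exact tensor_hom_ext₃ fun _ _ _ => rfl
  symmetry _ _ := tensor_hom_ext fun _ _ => rfl

/-! #### Flatness, fibres, horizontal sections, the invariant de Rham complex -/

/-- The connection is flat: its curvature, which is `[∇₀, ∇₁] dx ∧ dy`, vanishes. -/
def IsFlat (E : EqConn) : Prop := ∀ m, E.nabla 0 (E.nabla 1 m) = E.nabla 1 (E.nabla 0 m)

/-- The submodule `I E` of sections, for an ideal `I` of functions, as a real subspace. -/
def idealSections (E : EqConn) (I : Ideal Poly) : Submodule ℝ E :=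
  (I • (⊤ : Submodule Poly E)).restrictScalars ℝ

/-- Global sections of the restriction of `E` to the closed subscheme with ideal `I`. -/
abbrev Restrict (E : EqConn) (I : Ideal Poly) : Type := E ⧸ E.idealSections I

theorem smul_mem_idealSections (E : EqConn) {I : Ideal Poly} {f : Poly} (hf : f ∈ I) (m : E) :
    f • m ∈ E.idealSections I := by
  have h : f • m ∈ I • (⊤ : Submodule Poly E) := Submodule.smul_mem_smul hf Submodule.mem_top
  exact h

theorem idealSections_le_comap (E : EqConn) {E' : EqConn} (I : Ideal Poly) (L : E →ₗ[ℝ] E')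
    (h : ∀ f ∈ I, ∀ m, L (f • m) ∈ E'.idealSections I) :
    E.idealSections I ≤ (E'.idealSections I).comap L := by
  intro x hx
  replace hx : x ∈ I • (⊤ : Submodule Poly E) := hx
  rw [Submodule.mem_comap]
  induction hx using Submodule.smul_induction_on' with
  | smul f hf m _ => exact h f hf m
  | add x hx y hy h1 h2 =>
    rw [map_add]
    exact add_mem h1 h2

/-- The restriction of a morphism to a closed subscheme. -/
def Hom.restrict (f : Hom E E') (I : Ideal Poly) : E.Restrict I →ₗ[ℝ] E'.Restrict I :=
  Submodule.mapQ _ _ f.toReal (idealSections_le_comap E I _ fun g hg m => by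
    rw [Hom.toReal_apply, map_smul]
    exact smul_mem_idealSections E' hg _)

/-- The ideal of the origin. -/
def originIdeal : Ideal Poly := Ideal.span {MvPolynomial.X 0, MvPolynomial.X 1}

/-- The fibre `E_0` at the origin. -/
abbrev Fiber (E : EqConn) : Type := E.Restrict originIdeal

theorem act_mem_originIdeal (z : ℂˣ) {f : Poly} (hf : f ∈ originIdeal) :
    act z f ∈ originIdeal := by
  have h : originIdeal ≤ originIdeal.comap (act z : Poly →+* Poly) := by
    refine Ideal.span_le.2 ?_
    have h0 : (MvPolynomial.X 0 : Poly) ∈ originIdeal := Ideal.subset_span (by simp)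
    have h1 : (MvPolynomial.X 1 : Poly) ∈ originIdeal := Ideal.subset_span (by simp)
    have key : ∀ j, act z (MvPolynomial.X j) ∈ originIdeal := fun j => by
      rw [act_X, Fin.sum_univ_two]
      exact add_mem (Ideal.mul_mem_left _ _ h0) (Ideal.mul_mem_left _ _ h1)
    rintro x (rfl | rfl)
    exacts [key 0, key 1]
  exact h hf

/-- The action of `ℂ^*` on the fibre at the origin, which is a fixed point. -/
def fiberρ (E : EqConn) (z : ℂˣ) : E.Fiber →ₗ[ℝ] E.Fiber :=
  Submodule.mapQ _ _ (E.ρ z) (idealSections_le_comap E _ _ fun f hf m => by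
    rw [E.ρ_smul]
    exact smul_mem_idealSections E (act_mem_originIdeal z hf) _)

/-- The subspace of the complexified fibre at the origin on which `z ∈ ℂ^*` acts by
`z ^ (-p) * conj z ^ (-q)`. -/
def fiberPiece (E : EqConn) (p q : ℤ) : Submodule ℂ (ℂ ⊗[ℝ] E.Fiber) :=
  ⨅ z : ℂˣ, Module.End.eigenspace ((E.fiberρ z).baseChange ℂ)
    ((z : ℂ) ^ (-p) * (starRingEnd ℂ (z : ℂ)) ^ (-q))

/-- The functor `E ↦ E_0`. -/
def fiberFunctor : EqConn ⥤ ModuleCat.{0} ℝ where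
  obj E := ModuleCat.of ℝ E.Fiber
  map f := ModuleCat.ofHom (f.restrict originIdeal)
  map_id E := by
    ext x
    rfl
  map_comp f g := by
    ext x
    rfl

/-- The ideal of the line `Re t = -1/2`. -/
def lineIdeal : Ideal Poly := Ideal.span {MvPolynomial.X 0 + MvPolynomial.C (1 / 2)}

/-- The restriction of `∇` to the line `Re t = -1/2`, on which `y` is a coordinate: the covariant
derivative along `∂/∂y`. -/
def lineNabla (E : EqConn) : E.Restrict lineIdeal →ₗ[ℝ] E.Restrict lineIdeal :=
  Submodule.mapQ _ _ (E.nabla 1) (idealSections_le_comap E _ _ fun f hf m => by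
    obtain ⟨g, rfl⟩ := Ideal.mem_span_singleton'.1 hf
    rw [E.leibniz, ← add_mem_cancel_right (smul_mem_idealSections E hf (-E.nabla 1 m)), smul_neg,
      add_neg_cancel_right]
    refine smul_mem_idealSections E (Ideal.mem_span_singleton'.2
      ⟨MvPolynomial.pderiv 1 g, ?_⟩) m
    simp [Derivation.leibniz, MvPolynomial.pderiv_X, mul_comm])

/-- The space of covariantly constant sections of `E` over the line `Re t = -1/2`. -/
def lineSections (E : EqConn) : Submodule ℝ (E.Restrict lineIdeal) := LinearMap.ker E.lineNabla

/-- The functor `E ↦ H⁰_∇({Re t = -1/2}, E)`. -/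
def lineSectionsFunctor : EqConn ⥤ ModuleCat.{0} ℝ where
  obj E := ModuleCat.of ℝ E.lineSections
  map {E E'} f := ModuleCat.ofHom ((f.restrict lineIdeal).restrict
    (p := E.lineSections) (q := E'.lineSections) (by
      rintro x hx
      induction x using Submodule.Quotient.induction_on with
      | H m =>
        have h1 : E.lineNabla (Submodule.Quotient.mk m) = 0 := hx
        have h2 : f.restrict lineIdeal (E.lineNabla (Submodule.Quotient.mk m)) =
            E'.lineNabla (f.restrict lineIdeal (Submodule.Quotient.mk m)) :=
          congrArg Submodule.Quotient.mk (f.map_nabla 1 m)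
        rw [h1, map_zero] at h2
        exact h2.symm))
  map_id E := by
    ext ⟨x, hx⟩
    induction x using Submodule.Quotient.induction_on
    rfl
  map_comp f g := by
    ext ⟨x, hx⟩
    induction x using Submodule.Quotient.induction_on
    rfl

/-- Invariant global sections of `E`. -/
def invSections (E : EqConn) : Submodule ℝ E := E.ρ.invariants

/-- Invariant global sections of `E ⊗ Ω¹`. -/
def invForms (E : EqConn) : Submodule ℝ (Fin 2 → E) where
  carrier := {ω | ∀ z, formAct E.ρ z ω = ω}
  add_mem' h h' z := by rw [map_add, h z, h' z]
  zero_mem' z := map_zero _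
  smul_mem' r ω h z := by rw [map_smul, h z]

/-- The connection as a map `Γ(E) → Γ(E ⊗ Ω¹)`, `m ↦ ∇₀ m dx + ∇₁ m dy`. -/
def nablaForm (E : EqConn) : E →ₗ[ℝ] (Fin 2 → E) := LinearMap.pi E.nabla

/-- The connection on invariant sections. -/
def invNabla (E : EqConn) : E.invSections →ₗ[ℝ] E.invForms :=
  E.nablaForm.restrict fun m hm z => by
    have h := E.invariant z m
    rw [hm z] at h
    exact h.symm

/-- The map induced by a morphism on invariant sections. -/
def Hom.mapInvSections (f : Hom E E') : E.invSections →ₗ[ℝ] E'.invSections :=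
  f.toReal.restrict fun m hm z => by
    rw [Hom.toReal_apply, ← f.map_ρ, hm z]

/-- The map induced by a morphism on invariant forms. -/
def Hom.mapInvForms (f : Hom E E') : E.invForms →ₗ[ℝ] E'.invForms :=
  (f.toReal.compLeft (Fin 2)).restrict fun ω hω z => by
    funext i
    have h := congrArg f.toLin (congrFun (hω z) i)
    simpa [formAct, f.map_ρ, Hom.map_real_smul] using h

theorem rel01 : (ComplexShape.up ℤ).Rel 0 1 := rfl

/-- The invariant global de Rham sequence
`Γ(E)^{ℂ^*} → Γ(E ⊗ Ω¹)^{ℂ^*}`, as a two-term complex in degrees `0` and `1`. -/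
abbrev deRhamComplex (E : EqConn) : CochainComplex (ModuleCat.{0} ℝ) ℤ :=
  HomologicalComplex.double (ModuleCat.ofHom E.invNabla) rel01

/-- The map induced by a morphism on invariant global de Rham sequences. -/
def deRhamMap (f : E ⟶ E') : E.deRhamComplex ⟶ E'.deRhamComplex :=
  HomologicalComplex.mkHomFromDouble rel01 zero_ne_one
    (ModuleCat.ofHom f.mapInvSections ≫
      (HomologicalComplex.doubleXIso₀ (ModuleCat.ofHom E'.invNabla) rel01).inv)
    (ModuleCat.ofHom f.mapInvForms ≫
      (HomologicalComplex.doubleXIso₁ (ModuleCat.ofHom E'.invNabla) rel01 zero_ne_one).inv)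
    (by
      have h : ModuleCat.ofHom f.mapInvSections ≫ ModuleCat.ofHom E'.invNabla =
          ModuleCat.ofHom E.invNabla ≫ ModuleCat.ofHom f.mapInvForms := by
        ext m i
        exact (f.map_nabla i m.1).symm
      have hd := HomologicalComplex.double_d (ModuleCat.ofHom E'.invNabla) rel01 zero_ne_one
      rw [hd]
      simp [reassoc_of% h])
    (fun k hk => by
      rw [HomologicalComplex.double_d_eq_zero₀ _ _ _ _ one_ne_zero, Limits.comp_zero])

/-- The functor sending `E` to its invariant global de Rham sequence. -/
def deRhamFunctor : EqConn ⥤ CochainComplex (ModuleCat.{0} ℝ) ℤ where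
  obj := deRhamComplex
  map := deRhamMap
  map_id E := by
    apply HomologicalComplex.from_double_hom_ext
    · have h : ModuleCat.ofHom (Hom.mapInvSections (𝟙 E)) = 𝟙 _ := rfl
      simp [deRhamMap, h, deRhamComplex]
    · have h : ModuleCat.ofHom (Hom.mapInvForms (𝟙 E)) = 𝟙 _ := rfl
      simp [deRhamMap, h, deRhamComplex]
  map_comp {E E' E''} f g := by
    apply HomologicalComplex.from_double_hom_ext
    · have h : ModuleCat.ofHom (Hom.mapInvSections (f ≫ g)) =
        ModuleCat.ofHom f.mapInvSections ≫ ModuleCat.ofHom g.mapInvSections := rfl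
      simp [deRhamMap, h, deRhamComplex]
    · have h : ModuleCat.ofHom (Hom.mapInvForms (f ≫ g)) =
        ModuleCat.ofHom f.mapInvForms ≫ ModuleCat.ofHom g.mapInvForms := rfl
      simp [deRhamMap, h, deRhamComplex]

end EqConn

/-- The sheaf is an algebraic vector bundle: its module of global sections is
finitely generated and projective. -/
def isVectorBundle : ObjectProperty EqConn :=
  fun E => Module.Finite Poly E ∧ Module.Projective Poly E

instance : isVectorBundle.IsMonoidal where
  prop_unit := ⟨inferInstanceAs (Module.Finite Poly Poly),
    inferInstanceAs (Module.Projective Poly Poly)⟩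
  prop_tensor E E' h h' := by
    obtain ⟨_, _⟩ := h
    obtain ⟨_, _⟩ := h'
    exact ⟨inferInstanceAs (Module.Finite Poly (E ⊗[Poly] E')),
      inferInstanceAs (Module.Projective Poly (E ⊗[Poly] E'))⟩

/-- The category of `ℂ^*`-equivariant real algebraic vector bundles on `ℂ` with an invariant
connection. -/
abbrev Bun : Type 1 := isVectorBundle.FullSubcategory

/-! ### Mixed Hodge structures -/

/-- A real vector space `V` with an increasing filtration `W` of `V` and a decreasing filtration
`F` of its complexification. -/
structure FiltSpace : Type 1 where
  /-- the real vector space -/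
  carrier : Type
  [addCommGroup : AddCommGroup carrier]
  [module : Module ℝ carrier]
  /-- the weight filtration -/
  W : ℤ → Submodule ℝ carrier
  /-- the Hodge filtration -/
  F : ℤ → Submodule ℂ (ℂ ⊗[ℝ] carrier)
  W_mono : Monotone W
  F_anti : Antitone F

attribute [instance] FiltSpace.addCommGroup FiltSpace.module

instance : CoeSort FiltSpace Type := ⟨FiltSpace.carrier⟩

/-- Morphisms: linear maps compatible with both filtrations. -/
@[ext]
structure FiltSpace.Hom (V V' : FiltSpace) : Type where
  /-- the underlying linear map -/
  toLin : V →ₗ[ℝ] V'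
  map_W : ∀ n, ∀ v ∈ V.W n, toLin v ∈ V'.W n
  map_F : ∀ p, ∀ v ∈ V.F p, toLin.baseChange ℂ v ∈ V'.F p

instance : Category FiltSpace where
  Hom := FiltSpace.Hom
  id V := ⟨LinearMap.id, fun _ _ h => h, fun p v h => by simpa using h⟩
  comp f g := ⟨g.toLin ∘ₗ f.toLin, fun n v h => g.map_W n _ (f.map_W n v h),
    fun p v h => by
      rw [LinearMap.baseChange_comp]
      exact g.map_F p _ (f.map_F p v h)⟩

namespace FiltSpace

variable {V V' V'' : FiltSpace}

@[ext]
theorem hom_ext {f g : V ⟶ V'} (h : f.toLin = g.toLin) : f = g := Hom.ext h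

@[simp] theorem id_toLin : Hom.toLin (𝟙 V) = LinearMap.id := rfl
@[simp] theorem comp_toLin (f : V ⟶ V') (g : V' ⟶ V'') :
    (f ≫ g).toLin = g.toLin ∘ₗ f.toLin := rfl

instance : SMul ℝ (V ⟶ V') := ⟨fun r f => ⟨r • f.toLin,
  fun n v h => Submodule.smul_mem _ r (f.map_W n v h),
  fun p v h => by
    rw [LinearMap.baseChange_smul, LinearMap.smul_apply]
    exact Submodule.smul_of_tower_mem _ r (f.map_F p v h)⟩⟩
instance : Zero (V ⟶ V') := ⟨⟨0, fun _ _ _ => Submodule.zero_mem _,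
  fun _ _ _ => by simp⟩⟩
instance : Add (V ⟶ V') := ⟨fun f g => ⟨f.toLin + g.toLin,
  fun n v h => Submodule.add_mem _ (f.map_W n v h) (g.map_W n v h),
  fun p v h => by
    rw [LinearMap.baseChange_add]
    exact Submodule.add_mem _ (f.map_F p v h) (g.map_F p v h)⟩⟩
instance : Neg (V ⟶ V') := ⟨fun f => ⟨-f.toLin,
  fun n v h => Submodule.neg_mem _ (f.map_W n v h),
  fun p v h => by
    rw [LinearMap.baseChange_neg]
    exact Submodule.neg_mem _ (f.map_F p v h)⟩⟩
instance : Sub (V ⟶ V') := ⟨fun f g => ⟨f.toLin - g.toLin,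
  fun n v h => Submodule.sub_mem _ (f.map_W n v h) (g.map_W n v h),
  fun p v h => by
    rw [LinearMap.baseChange_sub]
    exact Submodule.sub_mem _ (f.map_F p v h) (g.map_F p v h)⟩⟩
instance : SMul ℕ (V ⟶ V') := ⟨fun n f => ⟨n • f.toLin,
  by rw [← Nat.cast_smul_eq_nsmul ℝ]; exact ((n : ℝ) • f).map_W,
  by rw [← Nat.cast_smul_eq_nsmul ℝ]; exact ((n : ℝ) • f).map_F⟩⟩
instance : SMul ℤ (V ⟶ V') := ⟨fun n f => ⟨n • f.toLin,
  by rw [← Int.cast_smul_eq_zsmul ℝ]; exact ((n : ℝ) • f).map_W,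
  by rw [← Int.cast_smul_eq_zsmul ℝ]; exact ((n : ℝ) • f).map_F⟩⟩

@[simp] theorem add_toLin (f g : V ⟶ V') : (f + g).toLin = f.toLin + g.toLin := rfl
@[simp] theorem smul_toLin (r : ℝ) (f : V ⟶ V') : (r • f).toLin = r • f.toLin := rfl

instance : AddCommGroup (V ⟶ V') :=
  Function.Injective.addCommGroup (fun f : V ⟶ V' => f.toLin) (fun _ _ h => Hom.ext h) rfl
    (fun _ _ => rfl) (fun _ => rfl) (fun _ _ => rfl) (fun _ _ => rfl) (fun _ _ => rfl)

instance : Module ℝ (V ⟶ V') :=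
  Function.Injective.module ℝ
    (⟨⟨fun f : V ⟶ V' => f.toLin, rfl⟩, fun _ _ => rfl⟩ : (V ⟶ V') →+ (V →ₗ[ℝ] V'))
    (fun _ _ h => Hom.ext h) (fun _ _ => rfl)

instance : Preadditive FiltSpace where
  add_comp _ _ _ _ _ _ := by ext; simp
  comp_add _ _ _ _ _ _ := by ext; simp

instance : Linear ℝ FiltSpace where
  smul_comp _ _ _ _ f g := by ext; simp
  comp_smul _ _ _ _ _ _ := by ext; simp

/-! #### Tensor products -/

/-- The natural bilinear map `V_ℂ × V'_ℂ → (V ⊗ V')_ℂ`. -/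
def cmul (V V' : Type) [AddCommGroup V] [Module ℝ V] [AddCommGroup V'] [Module ℝ V'] :
    (ℂ ⊗[ℝ] V) →ₗ[ℂ] (ℂ ⊗[ℝ] V') →ₗ[ℂ] (ℂ ⊗[ℝ] (V ⊗[ℝ] V')) :=
  (TensorProduct.mk ℂ (ℂ ⊗[ℝ] V) (ℂ ⊗[ℝ] V')).compr₂
    (TensorProduct.AlgebraTensorModule.distribBaseChange ℝ ℂ V V').symm.toLinearMap

@[simp] theorem cmul_tmul {V V' : Type} [AddCommGroup V] [Module ℝ V] [AddCommGroup V']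
    [Module ℝ V'] (a b : ℂ) (v : V) (v' : V') :
    cmul V V' (a ⊗ₜ v) (b ⊗ₜ v') = (a * b) ⊗ₜ (v ⊗ₜ v') := by
  simp [cmul]

/-- The weight filtration `W_n (V ⊗ V') = ∑_{i + j = n} W_i V ⊗ W_j V'`. -/
def tensorW (V V' : FiltSpace) (n : ℤ) : Submodule ℝ (V ⊗[ℝ] V') :=
  ⨆ i : ℤ, Submodule.map₂ (TensorProduct.mk ℝ V V') (V.W i) (V'.W (n - i))

/-- The Hodge filtration `F^p (V ⊗ V') = ∑_{i + j = p} F^i V ⊗ F^j V'`. -/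
def tensorF (V V' : FiltSpace) (p : ℤ) : Submodule ℂ (ℂ ⊗[ℝ] (V ⊗[ℝ] V')) :=
  ⨆ i : ℤ, Submodule.map₂ (cmul V V') (V.F i) (V'.F (p - i))

/-- The tensor product of two filtered spaces. -/
def tensor (V V' : FiltSpace) : FiltSpace where
  carrier := V ⊗[ℝ] V'
  W := tensorW V V'
  F := tensorF V V'
  W_mono m n h := iSup_mono fun i => Submodule.map₂_le_map₂_right (V'.W_mono (by omega))
  F_anti m n h := iSup_mono fun i => Submodule.map₂_le_map₂_right (V'.F_anti (by omega))

theorem tmul_mem_W {i j n : ℤ} (h : i + j = n) {v : V} {v' : V'} (hv : v ∈ V.W i)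
    (hv' : v' ∈ V'.W j) : v ⊗ₜ[ℝ] v' ∈ (tensor V V').W n := by
  obtain rfl : j = n - i := by omega
  exact Submodule.mem_iSup_of_mem i (Submodule.apply_mem_map₂ (TensorProduct.mk ℝ V V') hv hv')

theorem cmul_mem_F {i j n : ℤ} (h : i + j = n) {v : ℂ ⊗[ℝ] V} {v' : ℂ ⊗[ℝ] V'} (hv : v ∈ V.F i)
    (hv' : v' ∈ V'.F j) : cmul V V' v v' ∈ (tensor V V').F n := by
  obtain rfl : j = n - i := by omega
  exact Submodule.mem_iSup_of_mem i (Submodule.apply_mem_map₂ (cmul V V') hv hv')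

theorem tensorW_le {n : ℤ} {S : Submodule ℝ (tensor V V')}
    (h : ∀ i j, i + j = n → ∀ v ∈ V.W i, ∀ v' ∈ V'.W j, v ⊗ₜ[ℝ] v' ∈ S) :
    (tensor V V').W n ≤ S :=
  iSup_le fun i => Submodule.map₂_le.2 fun v hv v' hv' => h i (n - i) (by omega) v hv v' hv'

theorem tensorF_le {n : ℤ} {S : Submodule ℂ (ℂ ⊗[ℝ] (tensor V V'))}
    (h : ∀ i j, i + j = n → ∀ v ∈ V.F i, ∀ v' ∈ V'.F j, cmul V V' v v' ∈ S) :
    (tensor V V').F n ≤ S :=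
  iSup_le fun i => Submodule.map₂_le.2 fun v hv v' hv' => h i (n - i) (by omega) v hv v' hv'

/-- The unit object `ℝ(0)`: the space `ℝ`, of weight `0` and Hodge type `(0, 0)`. -/
def unit : FiltSpace where
  carrier := ℝ
  W n := if 0 ≤ n then ⊤ else ⊥
  F p := if p ≤ 0 then ⊤ else ⊥
  W_mono m n h := by
    dsimp only
    split_ifs with h1 h2
    · exact le_rfl
    · omega
    · exact bot_le
    · exact le_rfl
  F_anti m n h := by
    dsimp only
    split_ifs with h1 h2
    · exact le_rfl
    · omega
    · exact bot_le
    · exact le_rfl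

/-- Constructor for isomorphisms. -/
def mkIso (e : V ≃ₗ[ℝ] V') (h₁ : ∀ n, ∀ v ∈ V.W n, e v ∈ V'.W n)
    (h₂ : ∀ p, ∀ v ∈ V.F p, e.toLinearMap.baseChange ℂ v ∈ V'.F p)
    (h₃ : ∀ n, ∀ v ∈ V'.W n, e.symm v ∈ V.W n)
    (h₄ : ∀ p, ∀ v ∈ V'.F p, e.symm.toLinearMap.baseChange ℂ v ∈ V.F p) : V ≅ V' where
  hom := ⟨e, h₁, h₂⟩
  inv := ⟨e.symm, h₃, h₄⟩
  hom_inv_id := by ext; simp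
  inv_hom_id := by ext; simp

theorem baseChange_map_cmul {A A' B B' : Type} [AddCommGroup A] [Module ℝ A] [AddCommGroup A']
    [Module ℝ A'] [AddCommGroup B] [Module ℝ B] [AddCommGroup B'] [Module ℝ B']
    (f : A →ₗ[ℝ] B) (g : A' →ₗ[ℝ] B') (v : ℂ ⊗[ℝ] A) (v' : ℂ ⊗[ℝ] A') :
    (TensorProduct.map f g).baseChange ℂ (cmul A A' v v') =
      cmul B B' (f.baseChange ℂ v) (g.baseChange ℂ v') := by
  induction v with
  | zero => simp
  | add x y hx hy => simp only [map_add, LinearMap.add_apply, hx, hy]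
  | tmul a m =>
    induction v' with
    | zero => simp
    | add x y hx hy => simp only [map_add, hx, hy]
    | tmul b n => simp

theorem baseChange_assoc_cmul {A B C : Type} [AddCommGroup A] [Module ℝ A] [AddCommGroup B]
    [Module ℝ B] [AddCommGroup C] [Module ℝ C] (a : ℂ ⊗[ℝ] A) (b : ℂ ⊗[ℝ] B) (c : ℂ ⊗[ℝ] C) :
    (TensorProduct.assoc ℝ A B C).toLinearMap.baseChange ℂ (cmul _ C (cmul A B a b) c) =
      cmul A _ a (cmul B C b c) := by
  induction a with
  | zero => simp
  | add x y hx hy => simp only [map_add, LinearMap.add_apply, hx, hy]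
  | tmul r a =>
    induction b with
    | zero => simp
    | add x y hx hy => simp only [map_add, LinearMap.add_apply, hx, hy]
    | tmul s b =>
      induction c with
      | zero => simp
      | add x y hx hy => simp only [map_add, hx, hy]
      | tmul t c => simp [mul_assoc]

theorem baseChange_assoc_symm_cmul {A B C : Type} [AddCommGroup A] [Module ℝ A] [AddCommGroup B]
    [Module ℝ B] [AddCommGroup C] [Module ℝ C] (a : ℂ ⊗[ℝ] A) (b : ℂ ⊗[ℝ] B) (c : ℂ ⊗[ℝ] C) :
    (TensorProduct.assoc ℝ A B C).symm.toLinearMap.baseChange ℂ (cmul A _ a (cmul B C b c)) =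
      cmul _ C (cmul A B a b) c := by
  rw [← baseChange_assoc_cmul, ← LinearMap.comp_apply, ← LinearMap.baseChange_comp]
  simp

theorem baseChange_comm_cmul {A B : Type} [AddCommGroup A] [Module ℝ A] [AddCommGroup B]
    [Module ℝ B] (a : ℂ ⊗[ℝ] A) (b : ℂ ⊗[ℝ] B) :
    (TensorProduct.comm ℝ A B).toLinearMap.baseChange ℂ (cmul A B a b) = cmul B A b a := by
  induction a with
  | zero => simp
  | add x y hx hy => simp only [map_add, LinearMap.add_apply, hx, hy]
  | tmul r a =>
    induction b with
    | zero => simp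
    | add x y hx hy => simp only [map_add, LinearMap.add_apply, hx, hy]
    | tmul s b => simp [mul_comm]

theorem baseChange_lid_cmul {A : Type} [AddCommGroup A] [Module ℝ A] (r : ℂ ⊗[ℝ] ℝ)
    (a : ℂ ⊗[ℝ] A) :
    (TensorProduct.lid ℝ A).toLinearMap.baseChange ℂ (cmul ℝ A r a) =
      (TensorProduct.rid ℝ ℂ r) • a := by
  induction r with
  | zero => simp
  | add x y hx hy => simp only [map_add, LinearMap.add_apply, hx, hy, add_smul]
  | tmul r s =>
    induction a with
    | zero => simp
    | add x y hx hy => simp only [map_add, hx, hy, smul_add]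
    | tmul t a =>
      simp [TensorProduct.smul_tmul', mul_assoc]

theorem baseChange_lid_symm {A : Type} [AddCommGroup A] [Module ℝ A] (a : ℂ ⊗[ℝ] A) :
    (TensorProduct.lid ℝ A).symm.toLinearMap.baseChange ℂ a =
      cmul ℝ A ((1 : ℂ) ⊗ₜ (1 : ℝ)) a := by
  induction a with
  | zero => simp
  | add x y hx hy => simp only [map_add, hx, hy]
  | tmul t a => simp

theorem mem_of_eq {K X : Type} [Ring K] [AddCommGroup X] [Module K X] {S : Submodule K X}
    {a b : X} (h : a = b) (hb : b ∈ S) : a ∈ S := h ▸ hb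

/-- The tensor product of two morphisms. -/
def tensorMap {V₁ V₂ V₁' V₂' : FiltSpace} (f : V₁ ⟶ V₂) (g : V₁' ⟶ V₂') :
    tensor V₁ V₁' ⟶ tensor V₂ V₂' :=
  let L : tensor V₁ V₁' →ₗ[ℝ] tensor V₂ V₂' := TensorProduct.map f.toLin g.toLin
  { toLin := L
    map_W := fun n => tensorW_le (S := ((tensor V₂ V₂').W n).comap L)
      fun _ _ h v hv v' hv' => tmul_mem_W h (f.map_W _ v hv) (g.map_W _ v' hv')
    map_F := fun n => tensorF_le (S := ((tensor V₂ V₂').F n).comap (L.baseChange ℂ))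
      fun _ _ h v hv v' hv' =>
        mem_of_eq (S := (tensor V₂ V₂').F n) (baseChange_map_cmul f.toLin g.toLin v v')
          (cmul_mem_F h (f.map_F _ v hv) (g.map_F _ v' hv')) }

/-- The associativity isomorphism. -/
def assocIso (V V' V'' : FiltSpace) : tensor (tensor V V') V'' ≅ tensor V (tensor V' V'') :=
  let e : tensor (tensor V V') V'' ≃ₗ[ℝ] tensor V (tensor V' V'') :=
    TensorProduct.assoc ℝ V V' V''
  mkIso e
    (fun n => tensorW_le (S := ((tensor V (tensor V' V'')).W n).comap e.toLinearMap)
      fun i j hij v hv v'' hv'' =>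
        tensorW_le (S := ((tensor V (tensor V' V'')).W n).comap
          (e.toLinearMap ∘ₗ (TensorProduct.mk ℝ (tensor V V') V'').flip v''))
          (fun k l hkl v hv v' hv' =>
            tmul_mem_W (by omega) hv (tmul_mem_W (n := l + j) rfl hv' hv'')) hv)
    (fun n => tensorF_le
      (S := ((tensor V (tensor V' V'')).F n).comap (e.toLinearMap.baseChange ℂ))
      fun i j hij v hv v'' hv'' =>
        tensorF_le (S := ((tensor V (tensor V' V'')).F n).comap
          (e.toLinearMap.baseChange ℂ ∘ₗ (cmul (tensor V V') V'').flip v''))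
          (fun k l hkl v hv v' hv' => by
            have := cmul_mem_F (V := V) (V' := tensor V' V'') (n := n) (by omega) hv
              (cmul_mem_F (n := l + j) rfl hv' hv'')
            exact mem_of_eq (S := (tensor V (tensor V' V'')).F n)
              (baseChange_assoc_cmul (A := V) (B := V') (C := V'') v v' v'') this) hv)
    (fun n => tensorW_le (S := ((tensor (tensor V V') V'').W n).comap e.symm.toLinearMap)
      fun i j hij v hv v'' hv'' =>
        tensorW_le (S := ((tensor (tensor V V') V'').W n).comap
          (e.symm.toLinearMap ∘ₗ (TensorProduct.mk ℝ V (tensor V' V'')) v))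
          (fun k l hkl v' hv' v'' hv'' =>
            tmul_mem_W (V := tensor V V') (i := i + k) (by omega) (tmul_mem_W rfl hv hv') hv'')
          hv'')
    (fun n => tensorF_le
      (S := ((tensor (tensor V V') V'').F n).comap (e.symm.toLinearMap.baseChange ℂ))
      fun i j hij v hv v'' hv'' =>
        tensorF_le (S := ((tensor (tensor V V') V'').F n).comap
          (e.symm.toLinearMap.baseChange ℂ ∘ₗ (cmul V (tensor V' V'')) v))
          (fun k l hkl v' hv' v'' hv'' => by
            have := cmul_mem_F (V := tensor V V') (V' := V'') (i := i + k) (n := n) (by omega)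
              (cmul_mem_F rfl hv hv') hv''
            exact mem_of_eq (S := (tensor (tensor V V') V'').F n)
              (baseChange_assoc_symm_cmul (A := V) (B := V') (C := V'') v v' v'') this) hv'')

/-- The left unit isomorphism. -/
def leftUnitIso (V : FiltSpace) : tensor unit V ≅ V :=
  let e : tensor unit V ≃ₗ[ℝ] V := TensorProduct.lid ℝ V
  mkIso e
    (fun n => tensorW_le (S := (V.W n).comap e.toLinearMap)
      fun i j hij (r : ℝ) hr v hv => by
        change r • v ∈ V.W n
        by_cases hi : 0 ≤ i
        · exact Submodule.smul_mem _ r (V.W_mono (by omega) hv)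
        · have hr' : r ∈ (if 0 ≤ i then (⊤ : Submodule ℝ ℝ) else ⊥) := hr
          rw [if_neg hi, Submodule.mem_bot] at hr'
          rw [hr', zero_smul]
          exact Submodule.zero_mem _)
    (fun n => tensorF_le (S := (V.F n).comap (e.toLinearMap.baseChange ℂ))
      fun i j hij (r : ℂ ⊗[ℝ] ℝ) hr v hv => by
        change (TensorProduct.lid ℝ V).toLinearMap.baseChange ℂ (cmul ℝ V r v) ∈ V.F n
        rw [baseChange_lid_cmul]
        by_cases hi : i ≤ 0
        · exact Submodule.smul_mem _ _ (V.F_anti (by omega) hv)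
        · have hr' : r ∈ (if i ≤ 0 then (⊤ : Submodule ℂ (ℂ ⊗[ℝ] ℝ)) else ⊥) := hr
          rw [if_neg hi, Submodule.mem_bot] at hr'
          rw [hr', map_zero, zero_smul]
          exact Submodule.zero_mem _)
    (fun n v hv => tmul_mem_W (V := unit) (v := (1 : ℝ)) (zero_add n)
      (by
        change (1 : ℝ) ∈ (if (0 : ℤ) ≤ 0 then (⊤ : Submodule ℝ ℝ) else ⊥)
        simp) hv)
    (fun n v hv => by
      have h := cmul_mem_F (V := unit) (V' := V) (v := (1 : ℂ) ⊗ₜ[ℝ] (1 : ℝ)) (zero_add n)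
        (by
          change _ ∈ (if (0 : ℤ) ≤ 0 then (⊤ : Submodule ℂ (ℂ ⊗[ℝ] ℝ)) else ⊥)
          rw [if_pos le_rfl]
          exact Submodule.mem_top) hv
      exact mem_of_eq (S := (tensor unit V).F n) (baseChange_lid_symm v) h)

theorem swap_W (V V' : FiltSpace) (n : ℤ) :
    ∀ v ∈ (tensor V V').W n, TensorProduct.comm ℝ V V' v ∈ (tensor V' V).W n :=
  tensorW_le (S := ((tensor V' V).W n).comap (TensorProduct.comm ℝ V V').toLinearMap)
    fun i j hij _ hv _ hv' => tmul_mem_W (by omega) hv' hv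

theorem swap_F (V V' : FiltSpace) (n : ℤ) :
    ∀ v ∈ (tensor V V').F n,
      (TensorProduct.comm ℝ V V').toLinearMap.baseChange ℂ v ∈ (tensor V' V).F n :=
  tensorF_le (S := ((tensor V' V).F n).comap
      ((TensorProduct.comm ℝ V V').toLinearMap.baseChange ℂ))
    fun i j hij v hv v' hv' =>
      mem_of_eq (S := (tensor V' V).F n) (baseChange_comm_cmul v v')
        (cmul_mem_F (by omega) hv' hv)

/-- The symmetry isomorphism. -/
def swapIso (V V' : FiltSpace) : tensor V V' ≅ tensor V' V :=
  let e : tensor V V' ≃ₗ[ℝ] tensor V' V := TensorProduct.comm ℝ V V'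
  mkIso e (swap_W V V') (swap_F V V') (swap_W V' V) (swap_F V' V)

/-- The right unit isomorphism. -/
def rightUnitIso (V : FiltSpace) : tensor V unit ≅ V := swapIso V unit ≪≫ leftUnitIso V

instance : MonoidalCategoryStruct FiltSpace where
  tensorObj := tensor
  tensorUnit := unit
  tensorHom := tensorMap
  whiskerLeft V _ _ f := tensorMap (𝟙 V) f
  whiskerRight f V := tensorMap f (𝟙 V)
  associator := assocIso
  leftUnitor := leftUnitIso
  rightUnitor := rightUnitIso

theorem tensor_hom_ext {f g : tensor V V' ⟶ V''}
    (h : ∀ m n, f.toLin (m ⊗ₜ[ℝ] n) = g.toLin (m ⊗ₜ[ℝ] n)) : f = g :=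
  hom_ext (TensorProduct.ext' h)

theorem tensor_hom_ext₃ {V₃ : FiltSpace} {f g : tensor (tensor V V') V'' ⟶ V₃}
    (h : ∀ m n k, f.toLin ((m ⊗ₜ[ℝ] n) ⊗ₜ[ℝ] k) = g.toLin ((m ⊗ₜ[ℝ] n) ⊗ₜ[ℝ] k)) :
    f = g :=
  hom_ext (TensorProduct.ext_threefold h)

instance : MonoidalCategory FiltSpace where
  tensorHom_def f g := tensor_hom_ext fun _ _ => rfl
  id_tensorHom_id _ _ := tensor_hom_ext fun _ _ => rfl
  tensorHom_comp_tensorHom _ _ _ _ := tensor_hom_ext fun _ _ => rfl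
  whiskerLeft_id _ _ := tensor_hom_ext fun _ _ => rfl
  id_whiskerRight _ _ := tensor_hom_ext fun _ _ => rfl
  associator_naturality _ _ _ := tensor_hom_ext₃ fun _ _ _ => rfl
  leftUnitor_naturality f := tensor_hom_ext fun (r : ℝ) m => (f.toLin.map_smul r m).symm
  rightUnitor_naturality f := tensor_hom_ext fun m (r : ℝ) => (f.toLin.map_smul r m).symm
  pentagon _ _ _ _ := hom_ext (TensorProduct.ext_fourfold fun _ _ _ _ => rfl)
  triangle V V' := tensor_hom_ext₃ fun m (r : ℝ) n => by
    change m ⊗ₜ[ℝ] (r • n) = (r • m) ⊗ₜ[ℝ] n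
    rw [TensorProduct.smul_tmul]

instance : SymmetricCategory FiltSpace where
  braiding := swapIso
  braiding_naturality_right _ _ _ _ := tensor_hom_ext fun _ _ => rfl
  braiding_naturality_left _ _ := tensor_hom_ext fun _ _ => rfl
  hexagon_forward _ _ _ := tensor_hom_ext₃ fun _ _ _ => rfl
  hexagon_reverse X Y Z := by
    rw [← cancel_epi (α_ X Y Z).hom]
    exact tensor_hom_ext₃ fun _ _ _ => rfl
  symmetry _ _ := tensor_hom_ext fun _ _ => rfl

/-! #### Graded pieces and the mixed Hodge condition -/

section graded

variable {K X : Type} [Field K] [AddCommGroup X] [Module K X]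

/-- The subquotient `A / B`, for subspaces `B ≤ A`. -/
abbrev Gr (A B : Submodule K X) : Type := A ⧸ B.submoduleOf A

/-- The subspace of `A / B` induced by a subspace `G`: the image of `G ∩ A`. -/
def induced (A B G : Submodule K X) : Submodule K (Gr A B) :=
  (G.submoduleOf A).map (B.submoduleOf A).mkQ

end graded

/-- Complex conjugation on the complexification of a real vector space. -/
def conj (X : Type) [AddCommGroup X] [Module ℝ X] :
    (ℂ ⊗[ℝ] X) →ₛₗ[starRingEnd ℂ] (ℂ ⊗[ℝ] X) where
  toFun := LinearMap.rTensor X Complex.conjAe.toLinearMap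
  map_add' := map_add _
  map_smul' r x := by
    induction x with
    | zero => simp
    | add x y hx hy => simp only [smul_add, map_add, hx, hy]
    | tmul a v => simp [TensorProduct.smul_tmul']

@[simp] theorem conj_tmul {X : Type} [AddCommGroup X] [Module ℝ X] (a : ℂ) (v : X) :
    conj X (a ⊗ₜ v) = (starRingEnd ℂ a) ⊗ₜ v := rfl

/-- The conjugate filtration of `F`. -/
def Fbar (V : FiltSpace) (q : ℤ) : Submodule ℂ (ℂ ⊗[ℝ] V) := (V.F q).map (conj V)

/-- The filtration of the complexification induced by `W`. -/
def Wc (V : FiltSpace) (n : ℤ) : Submodule ℂ (ℂ ⊗[ℝ] V) := (V.W n).baseChange ℂ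

/-- The space `gr_n^W (V_ℂ)`. -/
abbrev GrWc (V : FiltSpace) (n : ℤ) : Type := Gr (V.Wc n) (V.Wc (n - 1))

/-- The filtration of `gr_n^W (V_ℂ)` induced by `F`. -/
def FonGr (V : FiltSpace) (n p : ℤ) : Submodule ℂ (V.GrWc n) :=
  induced (V.Wc n) (V.Wc (n - 1)) (V.F p)

/-- The filtration of `gr_n^W (V_ℂ)` induced by the conjugate of `F`. -/
def FbarOnGr (V : FiltSpace) (n q : ℤ) : Submodule ℂ (V.GrWc n) :=
  induced (V.Wc n) (V.Wc (n - 1)) (V.Fbar q)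

/-- The space `gr^q_{Fbar} gr_n^W (V_ℂ)`. -/
abbrev GrFbarGrWc (V : FiltSpace) (n q : ℤ) : Type := Gr (V.FbarOnGr n q) (V.FbarOnGr n (q + 1))

/-- The filtration of `gr^q_{Fbar} gr_n^W (V_ℂ)` induced by `F`. -/
def FonGrGr (V : FiltSpace) (n q p : ℤ) : Submodule ℂ (V.GrFbarGrWc n q) :=
  induced (V.FbarOnGr n q) (V.FbarOnGr n (q + 1)) (V.FonGr n p)

/-- The space `gr^p_F gr^q_{Fbar} gr_n^W (V_ℂ)`. -/
abbrev GrGrGr (V : FiltSpace) (p q n : ℤ) : Type := Gr (V.FonGrGr n q p) (V.FonGrGr n q (p + 1))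

/-- The space `gr_n^W V`. -/
abbrev GrW (V : FiltSpace) (n : ℤ) : Type := Gr (V.W n) (V.W (n - 1))

/-- The map induced by a morphism on `gr_n^W`. -/
def Hom.mapGrW (f : Hom V V') (n : ℤ) : V.GrW n →ₗ[ℝ] V'.GrW n :=
  Submodule.mapQ _ _ (f.toLin.restrict (f.map_W n)) fun v hv => f.map_W (n - 1) v.1 hv

/-- The functor `V ↦ gr^W V`, the direct sum of the spaces `gr_n^W V`. -/
def grWFunctor : FiltSpace ⥤ ModuleCat.{0} ℝ where
  obj V := ModuleCat.of ℝ (DirectSum ℤ fun n => V.GrW n)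
  map f := ModuleCat.ofHom (DirectSum.lmap fun n => f.mapGrW n)
  map_id V := by
    have h : (fun n => Hom.mapGrW (𝟙 V) n) = fun _ => LinearMap.id := by
      funext n
      ext x
      rfl
    rw [h, DirectSum.lmap_id]
    rfl
  map_comp f g := by
    have h : (fun n => Hom.mapGrW (f ≫ g) n) = fun n => g.mapGrW n ∘ₗ f.mapGrW n := by
      funext n
      ext x
      rfl
    rw [h, DirectSum.lmap_comp]
    rfl

/-- The filtration induced by `F` on the complexification of `gr_n^W V`: the image of
`F^p ∩ (W_n)_ℂ`. -/
def FonGrW (V : FiltSpace) (n p : ℤ) : Submodule ℂ (ℂ ⊗[ℝ] V.GrW n) :=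
  ((V.F p).comap ((V.W n).subtype.baseChange ℂ)).map
    (((V.W (n - 1)).submoduleOf (V.W n)).mkQ.baseChange ℂ)

/-- The underlying vector space. -/
def forgetFunctor : FiltSpace ⥤ ModuleCat.{0} ℝ where
  obj V := ModuleCat.of ℝ V
  map f := ModuleCat.ofHom f.toLin

end FiltSpace

/-- A filtered space is a real mixed Hodge structure if it is finite dimensional,
both filtrations are finite, and `gr^p_F gr^q_{Fbar} gr_n^W (V_ℂ) = 0` for `n ≠ p + q`. -/
structure IsMHS (V : FiltSpace) : Prop where
  finite : FiniteDimensional ℝ V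
  W_bot : ∃ n, V.W n = ⊥
  W_top : ∃ n, V.W n = ⊤
  F_bot : ∃ p, V.F p = ⊥
  F_top : ∃ p, V.F p = ⊤
  opposed : ∀ p q n, n ≠ p + q → Subsingleton (V.GrGrGr p q n)

/-- The property of being a real mixed Hodge structure. -/
def isMHS : ObjectProperty FiltSpace := IsMHS

/-- The category of real mixed Hodge structures. -/
abbrev MHS : Type 1 := isMHS.FullSubcategory

/-- `V` is pure of weight `k`: `gr_n^W V` vanishes for `n ≠ k`. -/
def IsPureOfWeight (V : MHS) (k : ℤ) : Prop := ∀ n, n ≠ k → Subsingleton (V.obj.GrW n)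

/-- `V` is split: isomorphic to a (finite) direct sum of pure Hodge structures. -/
def IsSplit (V : MHS) : Prop :=
  ∃ (m : ℕ) (X : Fin m → MHS) (b : Limits.Bicone X),
    (∀ i, ∃ k, IsPureOfWeight (X i) k) ∧ Nonempty b.IsBilimit ∧ Nonempty (V ≅ b.pt)

/-! ### Abelian categories and derived functors of Hom -/

/-- A preadditive category is abelian. -/
structure IsAbelianCat (C : Type 1) [Category.{0} C] [Preadditive C] : Prop where
  normalMono : IsNormalMonoCategory C
  normalEpi : IsNormalEpiCategory C
  finiteProducts : Limits.HasFiniteProducts C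
  kernels : Limits.HasKernels C
  cokernels : Limits.HasCokernels C

/-- The corresponding instance of Mathlib's class `Abelian`. -/
@[reducible]
def IsAbelianCat.abelian {C : Type 1} [Category.{0} C] [Preadditive C] (h : IsAbelianCat C) :
    Abelian C :=
  { (inferInstance : Preadditive C), h.normalMono, h.normalEpi with
    has_finite_products := h.finiteProducts
    has_kernels := h.kernels
    has_cokernels := h.cokernels }

section RHom

variable (C : Type 1) [Category.{0} C] [Abelian C] [Linear ℝ C]
  [HasDerivedCategory.{1} C] [HasDerivedCategory.{1} (ModuleCat.{0} ℝ)]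

/-- The functor `Y ↦ Hom(X, Y)` on complexes up to homotopy, with values in the
derived category of real vector spaces. -/
def homFunctor (X : C) :
    HomotopyCategory C (ComplexShape.up ℤ) ⥤ DerivedCategory (ModuleCat.{0} ℝ) :=
  ((linearCoyoneda ℝ C).obj (Opposite.op X)).mapHomotopyCategory (ComplexShape.up ℤ) ⋙
    DerivedCategory.Qh

/-- The functor `T` on `C` is `Y ↦ RHom(X, Y)`: it is the restriction to objects of `C`, placed in
degree `0`, of the total right derived functor of `Y ↦ Hom(X, Y)`. -/
def IsRHom (X : C) (T : C ⥤ DerivedCategory (ModuleCat.{0} ℝ)) : Prop :=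
  ∃ (RF : DerivedCategory C ⥤ DerivedCategory (ModuleCat.{0} ℝ))
    (α : homFunctor C X ⟶ DerivedCategory.Qh ⋙ RF),
    RF.IsRightDerivedFunctor α (HomotopyCategory.quasiIso C (ComplexShape.up ℤ)) ∧
      Nonempty (T ≅ DerivedCategory.singleFunctor C 0 ⋙ RF)

end RHom

end HodgeConn

end

set_option linter.unusedSectionVars false

noncomputable section

namespace HodgeConn

/-! ### Weights of complex representations of the torus -/

section weights

/-- The character `z ↦ z ^ (-p) * conj z ^ (-q)`. -/
def chi (a : ℤ × ℤ) : ℂˣ →* ℂ where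
  toFun z := (z : ℂ) ^ (-a.1) * (starRingEnd ℂ (z : ℂ)) ^ (-a.2)
  map_one' := by simp
  map_mul' z w := by simp only [Units.val_mul, map_mul, mul_zpow]; ring

theorem chi_apply (a : ℤ × ℤ) (z : ℂˣ) :
    chi a z = (z : ℂ) ^ (-a.1) * (starRingEnd ℂ (z : ℂ)) ^ (-a.2) := rfl

theorem conj_unit_ne_zero (z : ℂˣ) : starRingEnd ℂ (z : ℂ) ≠ 0 := by simp

theorem chi_add (a b : ℤ × ℤ) (z : ℂˣ) : chi (a + b) z = chi a z * chi b z := by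
  simp only [chi_apply, Prod.fst_add, Prod.snd_add, neg_add, zpow_add₀ z.ne_zero,
    zpow_add₀ (conj_unit_ne_zero z)]
  ring

theorem chi_neg (a : ℤ × ℤ) (z : ℂˣ) : chi (-a) z = (chi a z)⁻¹ := by
  refine eq_inv_of_mul_eq_one_left ?_
  rw [← chi_add]
  simp [chi_apply]

theorem conj_chi (a : ℤ × ℤ) (z : ℂˣ) : starRingEnd ℂ (chi a z) = chi a.swap z := by
  simp [chi_apply, mul_comm]

theorem chi_injective : Function.Injective chi := by
  intro a b h
  have h2 := DFunLike.congr_fun h (Units.mk0 2 two_ne_zero)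
  simp only [chi_apply, Units.val_mk0, map_ofNat] at h2
  rw [← zpow_add₀ two_ne_zero, ← zpow_add₀ two_ne_zero] at h2
  have hs : a.1 + a.2 = b.1 + b.2 := by
    have h3 := congrArg norm h2
    simp only [norm_zpow, Complex.norm_ofNat] at h3
    have := zpow_right_injective₀ (by norm_num : (0 : ℝ) < 2) (by norm_num) h3
    omega
  by_contra hne
  have hk : a.1 - b.1 ≠ 0 := by
    intro h0
    exact hne (Prod.ext (by omega) (by omega))
  have hkc : ((a.1 - b.1 : ℤ) : ℂ) ≠ 0 := by exact_mod_cast hk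
  let w : ℂ := Complex.exp (Real.pi / (2 * ((a.1 - b.1 : ℤ) : ℂ)) * Complex.I)
  have hw : w ≠ 0 := Complex.exp_ne_zero _
  have hcw : starRingEnd ℂ w = w⁻¹ := by
    simp only [w]
    rw [← Complex.exp_conj, ← Complex.exp_neg]
    congr 1
    have h2 : starRingEnd ℂ 2 = 2 := map_ofNat _ 2
    simp [h2]
  have h1 := DFunLike.congr_fun h (Units.mk0 w hw)
  simp only [chi_apply, Units.val_mk0, hcw, inv_zpow', neg_neg, ← zpow_add₀ hw] at h1
  have e : w ^ (2 * (a.1 - b.1)) = 1 := by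
    have : 2 * (a.1 - b.1) = (-b.1 + b.2) - (-a.1 + a.2) := by omega
    rw [this, zpow_sub₀ hw, h1, div_self (zpow_ne_zero _ hw)]
  simp only [w] at e
  rw [← Complex.exp_int_mul] at e
  have : ((2 * (a.1 - b.1) : ℤ) : ℂ) * (Real.pi / (2 * ((a.1 - b.1 : ℤ) : ℂ)) * Complex.I) =
      Real.pi * Complex.I := by
    push_cast at hkc ⊢
    field_simp
  rw [this, Complex.exp_pi_mul_I] at e
  norm_num at e

theorem linearIndependent_chi :
    LinearIndependent ℂ (fun a : ℤ × ℤ => (chi a : ℂˣ → ℂ)) :=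
  (linearIndependent_monoidHom ℂˣ ℂ).comp chi chi_injective

variable {X : Type*} [AddCommGroup X] [Module ℂ X]

theorem eq_zero_of_sum_chi_smul (s : Finset (ℤ × ℤ)) (v : ℤ × ℤ → X)
    (h : ∀ z, ∑ a ∈ s, chi a z • v a = 0) : ∀ a ∈ s, v a = 0 := by
  intro a ha
  rw [← Module.forall_dual_apply_eq_zero_iff ℂ]
  intro f
  refine linearIndependent_iff'.1 linearIndependent_chi s (fun a => f (v a)) ?_ a ha
  funext z
  have := congrArg f (h z)
  simpa [mul_comm] using this

variable (ρ : Representation ℂ ℂˣ X)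

/-- The weight space of type `a = (p, q)`. -/
def wt (a : ℤ × ℤ) : Submodule ℂ X := ⨅ z, Module.End.eigenspace (ρ z) (chi a z)

variable {ρ} in
theorem mem_wt {a : ℤ × ℤ} {v : X} : v ∈ wt ρ a ↔ ∀ z, ρ z v = chi a z • v := by
  simp [wt]

/-- The sum of the weight spaces with type in `S`. -/
def wtSub (S : Set (ℤ × ℤ)) : Submodule ℂ X := ⨆ a ∈ S, wt ρ a

/-- The representation is the sum of its weight spaces. -/
def IsDiag : Prop := wtSub ρ Set.univ = ⊤

variable {ρ}

theorem wt_le_wtSub {S : Set (ℤ × ℤ)} {a : ℤ × ℤ} (h : a ∈ S) : wt ρ a ≤ wtSub ρ S :=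
  le_iSup₂_of_le a h le_rfl

theorem wtSub_le {S : Set (ℤ × ℤ)} {N : Submodule ℂ X} (h : ∀ a ∈ S, wt ρ a ≤ N) :
    wtSub ρ S ≤ N := iSup₂_le h

theorem wtSub_mono {S T : Set (ℤ × ℤ)} (h : S ⊆ T) : wtSub ρ S ≤ wtSub ρ T :=
  wtSub_le fun _ ha => wt_le_wtSub (h ha)

theorem iSupIndep_wt : iSupIndep (wt ρ) := by
  classical
  refine iSupIndep_of_dfinsupp_lsum_injective _ ?_
  rw [injective_iff_map_eq_zero]
  intro x hx
  have key : ∀ z, ∑ a ∈ x.support, chi a z • ((x a : wt ρ a) : X) = 0 := by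
    intro z
    have := congrArg (ρ z) hx
    rw [map_zero, DFinsupp.lsum_apply_apply, DFinsupp.sumAddHom_apply, DFinsupp.sum, map_sum]
      at this
    rw [← this]
    refine Finset.sum_congr rfl fun a _ => ?_
    exact (mem_wt.1 (x a).2 z).symm
  have h0 := eq_zero_of_sum_chi_smul x.support (fun a => ((x a : wt ρ a) : X)) key
  ext a
  by_cases ha : a ∈ x.support
  · simpa using h0 a ha
  · simpa using ha

theorem IsDiag.isInternal (h : IsDiag ρ) : DirectSum.IsInternal (wt ρ) := by
  classical
  refine (DirectSum.isInternal_submodule_iff_iSupIndep_and_iSup_eq_top _).2 ⟨iSupIndep_wt, ?_⟩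
  simpa [IsDiag, wtSub] using h

/-- Two linear maps that agree on weight vectors are equal. -/
theorem IsDiag.ext (h : IsDiag ρ) {X' : Type*} [AddCommGroup X'] [Module ℂ X'] {f g : X →ₗ[ℂ] X'}
    (hfg : ∀ a, ∀ v ∈ wt ρ a, f v = g v) : f = g := by
  have : wtSub ρ Set.univ ≤ LinearMap.eqLocus f g := wtSub_le fun a _ v hv => hfg a v hv
  rw [h] at this
  ext v
  exact this (Submodule.mem_top (x := v))

/-- Two semilinear maps that agree on weight vectors are equal. -/
theorem IsDiag.ext_semi (h : IsDiag ρ) {X' : Type*} [AddCommGroup X'] [Module ℂ X']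
    {f g : X →ₛₗ[starRingEnd ℂ] X'}
    (hfg : ∀ a, ∀ v ∈ wt ρ a, f v = g v) : f = g := by
  have : wtSub ρ Set.univ ≤ LinearMap.eqLocus f g := wtSub_le fun a _ v hv => hfg a v hv
  rw [h] at this
  ext v
  exact this (Submodule.mem_top (x := v))

/-- The linear map acting on the weight space of type `a` by the scalar `κ a`. -/
def scale (h : IsDiag ρ) (κ : ℤ × ℤ → ℂ) : X →ₗ[ℂ] X :=
  DirectSum.toModule ℂ (ℤ × ℤ) X (fun a => κ a • (wt ρ a).subtype) ∘ₗ
    (LinearEquiv.ofBijective (DirectSum.coeLinearMap (wt ρ)) h.isInternal).symm.toLinearMap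

theorem scale_of_mem (h : IsDiag ρ) (κ : ℤ × ℤ → ℂ) {a : ℤ × ℤ} {v : X} (hv : v ∈ wt ρ a) :
    scale h κ v = κ a • v := by
  have : (LinearEquiv.ofBijective (DirectSum.coeLinearMap (wt ρ)) h.isInternal).symm v =
      DirectSum.lof ℂ (ℤ × ℤ) (fun a => wt ρ a) a ⟨v, hv⟩ := by
    rw [LinearEquiv.symm_apply_eq]
    exact (DirectSum.coeLinearMap_lof (wt ρ) a ⟨v, hv⟩).symm
  simp [scale, this]

theorem scale_comp (h : IsDiag ρ) (κ κ' : ℤ × ℤ → ℂ) :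
    scale h κ ∘ₗ scale h κ' = scale h (κ * κ') := by
  refine h.ext fun a v hv => ?_
  rw [LinearMap.comp_apply, scale_of_mem h _ hv, map_smul, scale_of_mem h _ hv,
    scale_of_mem h _ hv, smul_smul]
  simp [mul_comm]

theorem scale_scale (h : IsDiag ρ) (κ κ' : ℤ × ℤ → ℂ) (v : X) :
    scale h κ (scale h κ' v) = scale h (κ * κ') v := LinearMap.congr_fun (scale_comp h κ κ') v

theorem scale_one (h : IsDiag ρ) : scale h 1 = LinearMap.id :=
  h.ext fun a v hv => by simp [scale_of_mem h _ hv]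

theorem scale_add (h : IsDiag ρ) (κ κ' : ℤ × ℤ → ℂ) :
    scale h (κ + κ') = scale h κ + scale h κ' :=
  h.ext fun a v hv => by simp [scale_of_mem h _ hv, add_smul]

theorem scale_zero (h : IsDiag ρ) : scale h 0 = 0 :=
  h.ext fun a v hv => by simp [scale_of_mem h _ hv]

theorem scale_chi (h : IsDiag ρ) (z : ℂˣ) : scale h (fun a => chi a z) = ρ z :=
  h.ext fun a v hv => by rw [scale_of_mem h _ hv, mem_wt.1 hv]

theorem scale_congr (h : IsDiag ρ) {κ κ' : ℤ × ℤ → ℂ} {S : Set (ℤ × ℤ)}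
    (hS : ∀ a ∈ S, κ a = κ' a) {v : X} (hv : v ∈ wtSub ρ S) : scale h κ v = scale h κ' v := by
  have : wtSub ρ S ≤ LinearMap.eqLocus (scale h κ) (scale h κ') := wtSub_le fun a ha v hv => by
    rw [LinearMap.mem_eqLocus, scale_of_mem h _ hv, scale_of_mem h _ hv, hS a ha]
  exact this hv

theorem scale_mem_wtSub (h : IsDiag ρ) {κ : ℤ × ℤ → ℂ} {S T : Set (ℤ × ℤ)}
    (hκ : ∀ a ∈ S, a ∉ T → κ a = 0) {v : X} (hv : v ∈ wtSub ρ S) : scale h κ v ∈ wtSub ρ T := by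
  have : wtSub ρ S ≤ (wtSub ρ T).comap (scale h κ) := wtSub_le fun a ha v hv => by
    rw [Submodule.mem_comap, scale_of_mem h _ hv]
    by_cases haT : a ∈ T
    · exact Submodule.smul_mem _ _ (wt_le_wtSub haT hv)
    · rw [hκ a ha haT, zero_smul]
      exact Submodule.zero_mem _
  exact this hv

theorem IsDiag.mem_univ (h : IsDiag ρ) (v : X) : v ∈ wtSub ρ Set.univ := by
  rw [h]; exact Submodule.mem_top

open Classical in
/-- The indicator function of a set of types. -/
def ind (S : Set (ℤ × ℤ)) : ℤ × ℤ → ℂ := fun a => if a ∈ S then 1 else 0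

theorem ind_of_mem {S : Set (ℤ × ℤ)} {a : ℤ × ℤ} (h : a ∈ S) : ind S a = 1 := if_pos h

theorem ind_of_notMem {S : Set (ℤ × ℤ)} {a : ℤ × ℤ} (h : a ∉ S) : ind S a = 0 := if_neg h

theorem mem_wtSub_iff (h : IsDiag ρ) {S : Set (ℤ × ℤ)} {v : X} :
    v ∈ wtSub ρ S ↔ scale h (ind S) v = v := by
  constructor
  · intro hv
    rw [scale_congr h (κ' := 1) (fun a ha => ind_of_mem ha) hv, scale_one]
    rfl
  · intro hv
    rw [← hv]
    exact scale_mem_wtSub h (fun a _ ha => ind_of_notMem ha) (h.mem_univ v)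

theorem scale_eq_zero (h : IsDiag ρ) {κ : ℤ × ℤ → ℂ} {S : Set (ℤ × ℤ)}
    (hκ : ∀ a ∈ S, κ a = 0) {v : X} (hv : v ∈ wtSub ρ S) : scale h κ v = 0 := by
  rw [scale_congr h (κ' := 0) hκ hv, scale_zero]; rfl

theorem mem_wtSub_inter (h : IsDiag ρ) {S T : Set (ℤ × ℤ)} {v : X} (hS : v ∈ wtSub ρ S)
    (hT : v ∈ wtSub ρ T) : v ∈ wtSub ρ (S ∩ T) := by
  rw [← (mem_wtSub_iff h).1 hS]
  exact scale_mem_wtSub h (T := S ∩ T)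
    (fun a haT ha => ind_of_notMem fun haS => ha ⟨haS, haT⟩) hT

theorem mem_wtSub_union (h : IsDiag ρ) {S T : Set (ℤ × ℤ)} {v : X} (hv : v ∈ wtSub ρ (S ∪ T)) :
    ∃ x ∈ wtSub ρ S, ∃ y ∈ wtSub ρ T, v = x + y := by
  refine ⟨scale h (ind S) v, scale_mem_wtSub h (fun a _ ha => ind_of_notMem ha) hv,
    scale h (1 - ind S) v, scale_mem_wtSub h (fun a ha haT => ?_) hv, ?_⟩
  · simp [ind_of_mem (ha.resolve_right haT)]
  · rw [← LinearMap.add_apply, ← scale_add, add_sub_cancel, scale_one]; rfl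

theorem wtSub_empty : wtSub ρ ∅ = ⊥ := by simp [wtSub]

theorem wtSub_singleton (a : ℤ × ℤ) : wtSub ρ {a} = wt ρ a := by simp [wtSub]

/-- A vector has only finitely many types. -/
theorem IsDiag.exists_finset (h : IsDiag ρ) (v : X) :
    ∃ s : Finset (ℤ × ℤ), v ∈ wtSub ρ (s : Set (ℤ × ℤ)) := by
  classical
  have hv : v ∈ ⨆ a, wt ρ a := by
    have := h.mem_univ v
    simpa [wtSub] using this
  obtain ⟨s, hs⟩ := Submodule.exists_finset_of_mem_iSup _ hv
  exact ⟨s, by simpa [wtSub] using hs⟩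

theorem IsDiag.exists_finset_of_finite (h : IsDiag ρ) [FiniteDimensional ℂ X] :
    ∃ s : Finset (ℤ × ℤ), wtSub ρ (s : Set (ℤ × ℤ)) = ⊤ := by
  classical
  obtain ⟨t, ht⟩ := (inferInstance : Module.Finite ℂ X)
  choose s hs using h.exists_finset
  refine ⟨t.biUnion s, top_le_iff.1 ?_⟩
  rw [← ht, Submodule.span_le]
  intro v hv
  exact wtSub_mono (Finset.coe_subset.2 (Finset.subset_biUnion_of_mem s hv)) (hs v)

section maps

variable {X' X'' : Type*} [AddCommGroup X'] [Module ℂ X'] [AddCommGroup X''] [Module ℂ X'']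
  {ρ' : Representation ℂ ℂˣ X'} {ρ'' : Representation ℂ ℂˣ X''}

theorem map_mem_wt {f : X →ₗ[ℂ] X'} (hf : ∀ z v, f (ρ z v) = ρ' z (f v)) {a : ℤ × ℤ} {v : X}
    (hv : v ∈ wt ρ a) : f v ∈ wt ρ' a :=
  mem_wt.2 fun z => by rw [← hf, mem_wt.1 hv, map_smul]

theorem map_mem_wtSub {f : X →ₗ[ℂ] X'} (hf : ∀ z v, f (ρ z v) = ρ' z (f v)) {S : Set (ℤ × ℤ)}
    {v : X} (hv : v ∈ wtSub ρ S) : f v ∈ wtSub ρ' S := by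
  have : wtSub ρ S ≤ (wtSub ρ' S).comap f := wtSub_le fun a ha v hv =>
    wt_le_wtSub ha (map_mem_wt hf hv)
  exact this hv

theorem map_scale (h : IsDiag ρ) (h' : IsDiag ρ') {f : X →ₗ[ℂ] X'}
    (hf : ∀ z v, f (ρ z v) = ρ' z (f v)) (κ : ℤ × ℤ → ℂ) (v : X) :
    f (scale h κ v) = scale h' κ (f v) := by
  refine LinearMap.congr_fun (h.ext (f := f ∘ₗ scale h κ) (g := scale h' κ ∘ₗ f)
    fun a v hv => ?_) v
  rw [LinearMap.comp_apply, LinearMap.comp_apply, scale_of_mem h _ hv,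
    scale_of_mem h' _ (map_mem_wt hf hv), map_smul]

theorem bilin_mem_wt {B : X →ₗ[ℂ] X' →ₗ[ℂ] X''}
    (hB : ∀ z v w, B (ρ z v) (ρ' z w) = ρ'' z (B v w)) {a b : ℤ × ℤ} {v : X} {w : X'}
    (hv : v ∈ wt ρ a) (hw : w ∈ wt ρ' b) : B v w ∈ wt ρ'' (a + b) :=
  mem_wt.2 fun z => by
    rw [← hB, mem_wt.1 hv, mem_wt.1 hw, chi_add]
    simp [smul_smul, mul_comm]

theorem bilin_mem_wtSub {B : X →ₗ[ℂ] X' →ₗ[ℂ] X''}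
    (hB : ∀ z v w, B (ρ z v) (ρ' z w) = ρ'' z (B v w)) {S S' T : Set (ℤ × ℤ)}
    (hT : ∀ a ∈ S, ∀ b ∈ S', a + b ∈ T) {v : X} {w : X'}
    (hv : v ∈ wtSub ρ S) (hw : w ∈ wtSub ρ' S') : B v w ∈ wtSub ρ'' T := by
  have h1 : wtSub ρ S ≤ (wtSub ρ'' T).comap (B.flip w) := wtSub_le fun a ha v hv => by
    have h2 : wtSub ρ' S' ≤ (wtSub ρ'' T).comap (B v) := wtSub_le fun b hb w hw =>
      wt_le_wtSub (hT a ha b hb) (bilin_mem_wt hB hv hw)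
    exact h2 hw
  exact h1 hv

theorem semi_mem_wt {f : X →ₛₗ[starRingEnd ℂ] X'} (hf : ∀ z v, f (ρ z v) = ρ' z (f v))
    {a : ℤ × ℤ} {v : X} (hv : v ∈ wt ρ a) : f v ∈ wt ρ' a.swap :=
  mem_wt.2 fun z => by rw [← hf, mem_wt.1 hv, LinearMap.map_smulₛₗ, conj_chi]

theorem semi_mem_wtSub {f : X →ₛₗ[starRingEnd ℂ] X'} (hf : ∀ z v, f (ρ z v) = ρ' z (f v))
    {S T : Set (ℤ × ℤ)} (hT : ∀ a ∈ S, a.swap ∈ T) {v : X} (hv : v ∈ wtSub ρ S) :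
    f v ∈ wtSub ρ' T := by
  have : wtSub ρ S ≤ (wtSub ρ' T).comap f := wtSub_le fun a ha v hv =>
    wt_le_wtSub (hT a ha) (semi_mem_wt hf hv)
  exact this hv

theorem semi_scale (h : IsDiag ρ) (h' : IsDiag ρ') {f : X →ₛₗ[starRingEnd ℂ] X'}
    (hf : ∀ z v, f (ρ z v) = ρ' z (f v)) (κ : ℤ × ℤ → ℂ) (v : X) :
    f (scale h κ v) = scale h' (fun a => starRingEnd ℂ (κ a.swap)) (f v) := by
  refine LinearMap.congr_fun (h.ext_semi (f := f.comp (scale h κ))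
    (g := (scale h' (fun a => starRingEnd ℂ (κ a.swap))).comp f) fun a v hv => ?_) v
  rw [LinearMap.comp_apply, LinearMap.comp_apply, scale_of_mem h _ hv,
    scale_of_mem h' _ (semi_mem_wt hf hv), LinearMap.map_smulₛₗ, Prod.swap_swap]

/-- A representation generated by the image of two diagonalizable ones under an equivariant
bilinear map is diagonalizable. -/
theorem IsDiag.of_bilin (h : IsDiag ρ) (h' : IsDiag ρ') {B : X →ₗ[ℂ] X' →ₗ[ℂ] X''}
    (hB : ∀ z v w, B (ρ z v) (ρ' z w) = ρ'' z (B v w))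
    (hs : Submodule.span ℂ {x | ∃ v w, x = B v w} = ⊤) : IsDiag ρ'' := by
  rw [IsDiag, ← top_le_iff, ← hs, Submodule.span_le]
  rintro _ ⟨v, w, rfl⟩
  exact bilin_mem_wtSub hB (fun _ _ _ _ => Set.mem_univ _) (h.mem_univ v) (h'.mem_univ w)

end maps

end weights

/-! ### Complexification and real structures -/

section complexification

variable {V V' V'' : Type} [AddCommGroup V] [Module ℝ V] [AddCommGroup V'] [Module ℝ V']
  [AddCommGroup V''] [Module ℝ V'']

/-- The inclusion of a real vector space in its complexification. -/
def ofR (V : Type) [AddCommGroup V] [Module ℝ V] : V →ₗ[ℝ] ℂ ⊗[ℝ] V := TensorProduct.mk ℝ ℂ V 1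

theorem ofR_apply (v : V) : ofR V v = (1 : ℂ) ⊗ₜ[ℝ] v := rfl

/-- The real part of a vector in the complexification. -/
def reC (V : Type) [AddCommGroup V] [Module ℝ V] : (ℂ ⊗[ℝ] V) →ₗ[ℝ] V :=
  (TensorProduct.lid ℝ V).toLinearMap ∘ₗ LinearMap.rTensor V Complex.reLm

/-- The imaginary part of a vector in the complexification. -/
def imC (V : Type) [AddCommGroup V] [Module ℝ V] : (ℂ ⊗[ℝ] V) →ₗ[ℝ] V :=
  (TensorProduct.lid ℝ V).toLinearMap ∘ₗ LinearMap.rTensor V Complex.imLm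

@[simp] theorem reC_tmul (a : ℂ) (v : V) : reC V (a ⊗ₜ v) = a.re • v := by simp [reC]

@[simp] theorem imC_tmul (a : ℂ) (v : V) : imC V (a ⊗ₜ v) = a.im • v := by simp [imC]

@[simp] theorem reC_ofR (v : V) : reC V (ofR V v) = v := by simp [ofR_apply]

theorem ofR_injective : Function.Injective (ofR V) :=
  Function.LeftInverse.injective (g := reC V) reC_ofR

theorem tmul_eq_smul_ofR (a : ℂ) (v : V) : a ⊗ₜ[ℝ] v = a • ofR V v := by
  simp [ofR_apply, TensorProduct.smul_tmul']

theorem ofR_smul (r : ℝ) (v : V) : ofR V (r • v) = (r : ℂ) • ofR V v := by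
  rw [← tmul_eq_smul_ofR, ofR_apply, ← TensorProduct.smul_tmul, Complex.real_smul, mul_one]

theorem reC_add_imC (v : ℂ ⊗[ℝ] V) : ofR V (reC V v) + Complex.I • ofR V (imC V v) = v := by
  induction v with
  | zero => simp
  | add x y hx hy =>
    simp only [map_add, smul_add]
    nth_rw 3 [← hx]
    nth_rw 3 [← hy]
    abel
  | tmul a v =>
    rw [reC_tmul, imC_tmul, ofR_smul, ofR_smul, smul_smul, ← add_smul, mul_comm,
      Complex.re_add_im, tmul_eq_smul_ofR]

@[simp] theorem conj_ofR (v : V) : FiltSpace.conj V (ofR V v) = ofR V v := by simp [ofR_apply]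

@[simp] theorem conj_conj (v : ℂ ⊗[ℝ] V) : FiltSpace.conj V (FiltSpace.conj V v) = v := by
  induction v with
  | zero => simp
  | add x y hx hy => simp only [map_add, hx, hy]
  | tmul a v => simp

theorem conj_eq (v : ℂ ⊗[ℝ] V) :
    FiltSpace.conj V v = ofR V (reC V v) - Complex.I • ofR V (imC V v) := by
  conv_lhs => rw [← reC_add_imC v]
  simp [sub_eq_add_neg]

theorem ofR_reC (v : ℂ ⊗[ℝ] V) :
    ofR V (reC V v) = (1 / 2 : ℂ) • (v + FiltSpace.conj V v) := by
  rw [conj_eq]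
  nth_rw 2 [← reC_add_imC v]
  rw [add_add_sub_cancel, ← two_smul ℂ, smul_smul]
  norm_num

theorem ofR_imC (v : ℂ ⊗[ℝ] V) :
    ofR V (imC V v) = (-Complex.I / 2) • (v - FiltSpace.conj V v) := by
  rw [conj_eq]
  nth_rw 2 [← reC_add_imC v]
  rw [add_sub_sub_cancel, ← two_smul ℂ, smul_smul, smul_smul]
  have : -Complex.I / 2 * 2 * Complex.I = 1 := by
    have := Complex.I_mul_I
    linear_combination -this
  rw [this, one_smul]

theorem ofR_reC_of_conj {v : ℂ ⊗[ℝ] V} (h : FiltSpace.conj V v = v) : ofR V (reC V v) = v := by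
  rw [ofR_reC, h, ← two_smul ℂ, smul_smul]
  norm_num

/-- Complex linear maps out of a complexification are determined on real vectors. -/
theorem cplx_ext {X : Type*} [AddCommGroup X] [Module ℂ X] {f g : (ℂ ⊗[ℝ] V) →ₗ[ℂ] X}
    (h : ∀ v, f (ofR V v) = g (ofR V v)) : f = g := by
  ext v
  exact h v

@[simp] theorem baseChange_ofR (f : V →ₗ[ℝ] V') (v : V) :
    f.baseChange ℂ (ofR V v) = ofR V' (f v) := by simp [ofR_apply]

theorem conj_baseChange (f : V →ₗ[ℝ] V') (v : ℂ ⊗[ℝ] V) :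
    FiltSpace.conj V' (f.baseChange ℂ v) = f.baseChange ℂ (FiltSpace.conj V v) := by
  induction v with
  | zero => simp
  | add x y hx hy => simp only [map_add, hx, hy]
  | tmul a v => simp

theorem reC_baseChange (f : V →ₗ[ℝ] V') (v : ℂ ⊗[ℝ] V) :
    reC V' (f.baseChange ℂ v) = f (reC V v) := by
  induction v with
  | zero => simp
  | add x y hx hy => simp only [map_add, hx, hy]
  | tmul a v => simp

/-- The real linear map underlying the real part of a complex linear map. -/
def descend (N : (ℂ ⊗[ℝ] V) →ₗ[ℂ] (ℂ ⊗[ℝ] V')) : V →ₗ[ℝ] V' :=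
  reC V' ∘ₗ N.restrictScalars ℝ ∘ₗ ofR V

theorem descend_baseChange {N : (ℂ ⊗[ℝ] V) →ₗ[ℂ] (ℂ ⊗[ℝ] V')}
    (h : ∀ v, FiltSpace.conj V' (N v) = N (FiltSpace.conj V v)) :
    (descend N).baseChange ℂ = N := by
  refine cplx_ext fun v => ?_
  rw [baseChange_ofR]
  refine ofR_reC_of_conj (v := N (ofR V v)) ?_
  rw [h, conj_ofR]

theorem baseChange_injective {f g : V →ₗ[ℝ] V'} (h : f.baseChange ℂ = g.baseChange ℂ) : f = g := by
  ext v
  apply ofR_injective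
  rw [← baseChange_ofR, h, baseChange_ofR]

/-- Complex conjugation on complex linear maps between complexifications. -/
def conjHom (V V' : Type) [AddCommGroup V] [Module ℝ V] [AddCommGroup V'] [Module ℝ V'] :
    ((ℂ ⊗[ℝ] V) →ₗ[ℂ] (ℂ ⊗[ℝ] V')) →ₛₗ[starRingEnd ℂ] ((ℂ ⊗[ℝ] V) →ₗ[ℂ] (ℂ ⊗[ℝ] V')) where
  toFun N := (FiltSpace.conj V').comp (N.comp (FiltSpace.conj V))
  map_add' N N' := by ext; simp
  map_smul' r N := by ext; simp

theorem conjHom_apply (N : (ℂ ⊗[ℝ] V) →ₗ[ℂ] (ℂ ⊗[ℝ] V')) (v : ℂ ⊗[ℝ] V) :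
    conjHom V V' N v = FiltSpace.conj V' (N (FiltSpace.conj V v)) := rfl

@[simp] theorem conjHom_conjHom (N : (ℂ ⊗[ℝ] V) →ₗ[ℂ] (ℂ ⊗[ℝ] V')) :
    conjHom V V' (conjHom V V' N) = N := by
  ext v
  simp [conjHom_apply]

@[simp] theorem conjHom_baseChange (f : V →ₗ[ℝ] V') :
    conjHom V V' (f.baseChange ℂ) = f.baseChange ℂ := by
  ext v
  simp [conjHom_apply]

theorem exists_baseChange_of_conjHom {N : (ℂ ⊗[ℝ] V) →ₗ[ℂ] (ℂ ⊗[ℝ] V')}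
    (h : conjHom V V' N = N) : ∃ f : V →ₗ[ℝ] V', f.baseChange ℂ = N :=
  ⟨descend N, descend_baseChange fun v => by
    nth_rw 1 [← h]
    simp [conjHom_apply]⟩

/-- The real vectors of a subspace of the complexification. -/
def realSub (S : Submodule ℂ (ℂ ⊗[ℝ] V)) : Submodule ℝ V :=
  (S.restrictScalars ℝ).comap (ofR V)

theorem mem_realSub {S : Submodule ℂ (ℂ ⊗[ℝ] V)} {v : V} : v ∈ realSub S ↔ ofR V v ∈ S := Iff.rfl

theorem ofR_mem_baseChange {S : Submodule ℝ V} {v : V} (h : v ∈ S) : ofR V v ∈ S.baseChange ℂ :=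
  Submodule.tmul_mem_baseChange_of_mem 1 h

theorem baseChange_le {S : Submodule ℝ V} {T : Submodule ℂ (ℂ ⊗[ℝ] V)}
    (h : ∀ v ∈ S, ofR V v ∈ T) : S.baseChange ℂ ≤ T := by
  rw [Submodule.baseChange_eq_span, Submodule.span_le]
  rintro _ ⟨v, hv, rfl⟩
  exact h v hv

theorem baseChange_realSub {S : Submodule ℂ (ℂ ⊗[ℝ] V)}
    (h : ∀ v ∈ S, FiltSpace.conj V v ∈ S) : (realSub S).baseChange ℂ = S := by
  refine le_antisymm (baseChange_le fun v hv => hv) fun v hv => ?_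
  rw [← reC_add_imC v]
  refine add_mem (ofR_mem_baseChange ?_) (Submodule.smul_mem _ _ (ofR_mem_baseChange ?_))
  · rw [mem_realSub, ofR_reC]
    exact Submodule.smul_mem _ _ (add_mem hv (h v hv))
  · rw [mem_realSub, ofR_imC]
    exact Submodule.smul_mem _ _ (sub_mem hv (h v hv))

theorem conj_mem_baseChange {S : Submodule ℝ V} {v : ℂ ⊗[ℝ] V} (hv : v ∈ S.baseChange ℂ) :
    FiltSpace.conj V v ∈ S.baseChange ℂ := by
  have : S.baseChange ℂ ≤ (S.baseChange ℂ).comap (FiltSpace.conj V) := baseChange_le fun v hv => by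
    rw [Submodule.mem_comap, conj_ofR]
    exact ofR_mem_baseChange hv
  exact this hv

theorem reC_mem_of_mem_baseChange {S : Submodule ℝ V} {v : ℂ ⊗[ℝ] V} (hv : v ∈ S.baseChange ℂ) :
    reC V v ∈ S := by
  have hv' : v ∈ LinearMap.range (S.subtype.baseChange ℂ) := by
    refine baseChange_le (T := LinearMap.range (S.subtype.baseChange ℂ)) (fun v hv => ?_) hv
    exact ⟨ofR S ⟨v, hv⟩, baseChange_ofR _ _⟩
  obtain ⟨w, rfl⟩ := hv'
  rw [reC_baseChange]
  exact (reC S w).2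

theorem ofR_mem_baseChange_iff {S : Submodule ℝ V} {v : V} :
    ofR V v ∈ S.baseChange ℂ ↔ v ∈ S :=
  ⟨fun h => by simpa using reC_mem_of_mem_baseChange h, ofR_mem_baseChange⟩

/-- The complexification of a real representation of the torus. -/
def cplx (ρ : Representation ℝ ℂˣ V) : Representation ℂ ℂˣ (ℂ ⊗[ℝ] V) where
  toFun z := (ρ z).baseChange ℂ
  map_one' := by
    rw [map_one]
    exact LinearMap.baseChange_id
  map_mul' z w := by
    rw [map_mul]
    exact LinearMap.baseChange_comp _ _

theorem cplx_apply (ρ : Representation ℝ ℂˣ V) (z : ℂˣ) : cplx ρ z = (ρ z).baseChange ℂ := rfl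

theorem conj_cplx (ρ : Representation ℝ ℂˣ V) (z : ℂˣ) (v : ℂ ⊗[ℝ] V) :
    FiltSpace.conj V (cplx ρ z v) = cplx ρ z (FiltSpace.conj V v) := conj_baseChange _ _

theorem baseChange_equivariant {ρ : Representation ℝ ℂˣ V} {ρ' : Representation ℝ ℂˣ V'}
    {f : V →ₗ[ℝ] V'} (hf : ∀ z v, f (ρ z v) = ρ' z (f v)) (z : ℂˣ) (v : ℂ ⊗[ℝ] V) :
    f.baseChange ℂ (cplx ρ z v) = cplx ρ' z (f.baseChange ℂ v) := by
  refine LinearMap.congr_fun (f := f.baseChange ℂ ∘ₗ cplx ρ z) (g := cplx ρ' z ∘ₗ f.baseChange ℂ)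
    (cplx_ext fun v => ?_) v
  simp [cplx_apply, hf]

/-- A map from the torus to a complex vector space that is a finite sum of characters with
vector coefficients. -/
theorem exists_chi_of_regularFunctions {f : ℂˣ → ℝ} (hf : f ∈ regularFunctions) :
    (fun z => (f z : ℂ)) ∈ Submodule.span ℂ (Set.range fun a : ℤ × ℤ => (chi a : ℂˣ → ℂ)) := by
  have hmul : ∀ x ∈ Submodule.span ℂ (Set.range fun a : ℤ × ℤ => (chi a : ℂˣ → ℂ)),
      ∀ y ∈ Submodule.span ℂ (Set.range fun a : ℤ × ℤ => (chi a : ℂˣ → ℂ)),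
      x * y ∈ Submodule.span ℂ (Set.range fun a : ℤ × ℤ => (chi a : ℂˣ → ℂ)) := by
    intro x hx y hy
    have := Submodule.mul_mem_mul hx hy
    rw [Submodule.span_mul_span] at this
    refine Submodule.span_mono ?_ this
    rintro _ ⟨_, ⟨a, rfl⟩, _, ⟨b, rfl⟩, rfl⟩
    exact ⟨a + b, funext fun z => chi_add a b z⟩
  have hchi : ∀ a, (chi a : ℂˣ → ℂ) ∈
      Submodule.span ℂ (Set.range fun a : ℤ × ℤ => (chi a : ℂˣ → ℂ)) :=
    fun a => Submodule.subset_span ⟨a, rfl⟩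
  induction hf using Algebra.adjoin_induction with
  | mem x hx =>
    rcases hx with rfl | rfl | rfl
    · convert Submodule.smul_mem _ (1 / 2 : ℂ) (add_mem (hchi (-1, 0)) (hchi (0, -1))) using 1
      funext z
      simp [chi_apply, Complex.re_eq_add_conj]
      ring
    · convert Submodule.smul_mem _ (1 / (2 * Complex.I) : ℂ)
        (sub_mem (hchi (-1, 0)) (hchi (0, -1))) using 1
      funext z
      simp [chi_apply, Complex.im_eq_sub_conj, div_eq_mul_inv]
      ring
    · convert hchi (1, 1) using 1
      funext z
      simp [chi_apply, Complex.normSq_eq_conj_mul_self, mul_comm]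
  | algebraMap r =>
    convert Submodule.smul_mem _ (r : ℂ) (hchi 0) using 1
    funext z
    simp [chi_apply]
  | add x y _ _ hx hy =>
    convert add_mem hx hy using 1
    funext z
    simp
  | mul x y _ _ hx hy =>
    convert hmul _ hx _ hy using 1
    funext z
    simp

theorem isDiag_cplx {ρ : Representation ℝ ℂˣ V} (h : ∀ v, IsRegularMap fun z => ρ z v) :
    IsDiag (cplx ρ) := by
  classical
  have key : ∀ g : ℂˣ → V, IsRegularMap g → (fun z => ofR V (g z)) ∈
      Submodule.span ℂ {g : ℂˣ → ℂ ⊗[ℝ] V | ∃ a v, g = fun z => chi a z • v} := by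
    intro g hg
    unfold IsRegularMap at hg
    induction hg using Submodule.span_induction with
    | zero =>
      convert Submodule.zero_mem _ using 1
      funext z
      exact map_zero (ofR V)
    | add x y _ _ hx hy =>
      convert add_mem hx hy using 1
      funext z
      exact map_add (ofR V) _ _
    | smul a x _ hx =>
      convert Submodule.smul_mem _ (a : ℂ) hx using 1
      funext z
      exact ofR_smul a _
    | mem x hx =>
      obtain ⟨f, hf, m, rfl⟩ := hx
      have := exists_chi_of_regularFunctions hf
      have h2 := Submodule.mem_map_of_mem (f := LinearMap.pi (φ := fun _ : ℂˣ => ℂ ⊗[ℝ] V) fun z =>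
        (LinearMap.toSpanSingleton ℂ _ (ofR V m)) ∘ₗ
          (LinearMap.proj z : (ℂˣ → ℂ) →ₗ[ℂ] ℂ)) this
      rw [Submodule.map_span] at h2
      convert Submodule.span_mono ?_ h2 using 1
      · funext z
        exact ofR_smul (f z) m
      · rintro _ ⟨_, ⟨a, rfl⟩, rfl⟩
        exact ⟨a, ofR V m, rfl⟩
  have key2 : ∀ g ∈ Submodule.span ℂ {g : ℂˣ → ℂ ⊗[ℝ] V | ∃ a v, g = fun z => chi a z • v},
      ∃ (x : (ℤ × ℤ) →₀ (ℂ ⊗[ℝ] V)), ∀ z, g z = x.sum fun a v => chi a z • v := by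
    intro g hg
    induction hg using Submodule.span_induction with
    | zero => exact ⟨0, by simp⟩
    | add x y _ _ hx hy =>
      obtain ⟨x', hx'⟩ := hx
      obtain ⟨y', hy'⟩ := hy
      refine ⟨x' + y', fun z => ?_⟩
      rw [Finsupp.sum_add_index' (by simp) (by simp), ← hx', ← hy', Pi.add_apply]
    | smul a x _ hx =>
      obtain ⟨x', hx'⟩ := hx
      refine ⟨a • x', fun z => ?_⟩
      rw [Finsupp.sum_smul_index' (by simp), Pi.smul_apply, hx', Finsupp.smul_sum]
      simp [smul_comm a]
    | mem x hx =>
      obtain ⟨a, v, rfl⟩ := hx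
      exact ⟨Finsupp.single a v, by simp⟩
  have key3 : ∀ m : V, ofR V m ∈ wtSub (cplx ρ) Set.univ := by
    intro m
    obtain ⟨x, hx⟩ := key2 _ (key _ (h m))
    have hwt : ∀ a ∈ x.support, x a ∈ wt (cplx ρ) a := by
      intro a ha
      refine mem_wt.2 fun w => sub_eq_zero.1 ?_
      refine eq_zero_of_sum_chi_smul x.support (fun a => cplx ρ w (x a) - chi a w • x a) ?_ a ha
      intro z
      have h1 := hx (w * z)
      have h2 := congrArg (cplx ρ w) (hx z)
      rw [cplx_apply, baseChange_ofR, ← Module.End.mul_apply, ← map_mul, h1] at h2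
      simp only [Finsupp.sum, map_sum, map_smul, map_mul] at h2
      simp only [smul_sub, Finset.sum_sub_distrib, sub_eq_zero]
      rw [cplx_apply, ← h2]
      refine Finset.sum_congr rfl fun a _ => ?_
      rw [smul_smul, mul_comm]
    have h1 := hx 1
    simp only [map_one, Module.End.one_apply, one_smul] at h1
    rw [h1]
    exact Submodule.sum_mem _ fun a ha => wt_le_wtSub (Set.mem_univ a) (hwt a ha)
  rw [IsDiag, ← top_le_iff]
  rintro v -
  rw [← reC_add_imC v]
  exact add_mem (key3 _) (Submodule.smul_mem _ _ (key3 _))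

end complexification

section hom

variable {X X' X'' : Type*} [AddCommGroup X] [Module ℂ X] [AddCommGroup X'] [Module ℂ X']
  [AddCommGroup X''] [Module ℂ X'']
  {ρ : Representation ℂ ℂˣ X} {ρ' : Representation ℂ ℂˣ X'} {ρ'' : Representation ℂ ℂˣ X''}

theorem linHom_apply_apply (z : ℂˣ) (N : X →ₗ[ℂ] X') (v : X) :
    Representation.linHom ρ ρ' z N (ρ z v) = ρ' z (N v) := by
  simp [Representation.linHom_apply]

theorem linHom_comp (z : ℂˣ) (N' : X' →ₗ[ℂ] X'') (N : X →ₗ[ℂ] X') :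
    Representation.linHom ρ' ρ'' z N' ∘ₗ Representation.linHom ρ ρ' z N =
      Representation.linHom ρ ρ'' z (N' ∘ₗ N) := by
  ext v
  simp [Representation.linHom_apply]

theorem apply_mem_wtSub {S S' T : Set (ℤ × ℤ)} (hT : ∀ a ∈ S, ∀ b ∈ S', a + b ∈ T)
    {N : X →ₗ[ℂ] X'} {v : X} (hN : N ∈ wtSub (Representation.linHom ρ ρ') S)
    (hv : v ∈ wtSub ρ S') : N v ∈ wtSub ρ' T :=
  bilin_mem_wtSub (B := LinearMap.id) (fun z N v => linHom_apply_apply z N v) hT hN hv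

theorem comp_mem_wtSub {S S' T : Set (ℤ × ℤ)} (hT : ∀ a ∈ S, ∀ b ∈ S', a + b ∈ T)
    {N' : X' →ₗ[ℂ] X''} {N : X →ₗ[ℂ] X'} (hN' : N' ∈ wtSub (Representation.linHom ρ' ρ'') S)
    (hN : N ∈ wtSub (Representation.linHom ρ ρ') S') :
    N' ∘ₗ N ∈ wtSub (Representation.linHom ρ ρ'') T :=
  bilin_mem_wtSub (B := LinearMap.llcomp ℂ X X' X'') (fun z N' N => linHom_comp z N' N) hT hN' hN

theorem mem_wt_linHom (h : IsDiag ρ) {c : ℤ × ℤ} {N : X →ₗ[ℂ] X'}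
    (hN : ∀ a, ∀ v ∈ wt ρ a, N v ∈ wt ρ' (c + a)) : N ∈ wt (Representation.linHom ρ ρ') c := by
  refine mem_wt.2 fun z => h.ext fun a v hv => ?_
  have h1 : v = chi (-a) z • ρ z v := by
    rw [mem_wt.1 hv, smul_smul, ← chi_add]
    simp [chi_apply]
  nth_rw 1 [h1]
  rw [map_smul, linHom_apply_apply, mem_wt.1 (hN a v hv), smul_smul, ← chi_add]
  simp

theorem sum_scale_ind (h : IsDiag ρ) {s : Finset (ℤ × ℤ)}
    (hs : wtSub ρ (s : Set (ℤ × ℤ)) = ⊤) : ∑ a ∈ s, scale h (ind {a}) = LinearMap.id := by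
  classical
  refine h.ext fun b v hv => ?_
  rw [LinearMap.sum_apply]
  by_cases hb : b ∈ s
  · rw [Finset.sum_eq_single b]
    · simp [scale_of_mem h _ hv, ind_of_mem]
    · intro a _ ha
      rw [scale_of_mem h _ hv, ind_of_notMem (by simpa using ha.symm), zero_smul]
    · exact fun hb' => absurd hb hb'
  · have h1 : v ∈ wtSub ρ ({b} ∩ (s : Set (ℤ × ℤ))) :=
      mem_wtSub_inter h (by rwa [wtSub_singleton]) (hs ▸ Submodule.mem_top)
    have h2 : ({b} ∩ (s : Set (ℤ × ℤ))) = ∅ := by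
      ext c
      simp only [Set.mem_inter_iff, Set.mem_singleton_iff, Finset.mem_coe, Set.mem_empty_iff_false,
        iff_false, not_and]
      rintro rfl
      exact hb
    rw [h2, wtSub_empty, Submodule.mem_bot] at h1
    simp [h1]

theorem isDiag_linHom [FiniteDimensional ℂ X] [FiniteDimensional ℂ X'] (h : IsDiag ρ)
    (h' : IsDiag ρ') : IsDiag (Representation.linHom ρ ρ') := by
  classical
  obtain ⟨s, hs⟩ := h.exists_finset_of_finite
  obtain ⟨s', hs'⟩ := h'.exists_finset_of_finite
  rw [IsDiag, ← top_le_iff]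
  rintro N -
  have h2 : N = ∑ b ∈ s', ∑ a ∈ s, scale h' (ind {b}) ∘ₗ N ∘ₗ scale h (ind {a}) := by
    have h3 : N = (∑ b ∈ s', scale h' (ind {b})) ∘ₗ N ∘ₗ (∑ a ∈ s, scale h (ind {a})) := by
      rw [sum_scale_ind h hs, sum_scale_ind h' hs', LinearMap.id_comp, LinearMap.comp_id]
    nth_rw 1 [h3]
    ext v
    simp [LinearMap.sum_apply]
  rw [h2]
  refine Submodule.sum_mem _ fun b _ => Submodule.sum_mem _ fun a _ =>
    wt_le_wtSub (Set.mem_univ (b - a)) (mem_wt_linHom h fun c v hv => ?_)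
  simp only [LinearMap.comp_apply, scale_of_mem h _ hv, map_smul]
  by_cases hc : c = a
  · subst hc
    rw [sub_add_cancel]
    refine Submodule.smul_mem _ _ ?_
    rw [← wtSub_singleton]
    exact scale_mem_wtSub h' (fun b _ hb => ind_of_notMem hb) (h'.mem_univ _)
  · rw [ind_of_notMem (by simpa using hc), zero_smul]
    exact Submodule.zero_mem _

theorem scale_linHom_apply (hH : IsDiag (Representation.linHom ρ ρ')) (h' : IsDiag ρ')
    (κ : ℤ × ℤ → ℂ) (N : X →ₗ[ℂ] X') {a : ℤ × ℤ} {v : X} (hv : v ∈ wt ρ a) :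
    scale hH κ N v = scale h' (fun b => κ (b - a)) (N v) := by
  refine LinearMap.congr_fun (hH.ext (f := LinearMap.applyₗ v ∘ₗ scale hH κ)
    (g := scale h' (fun b => κ (b - a)) ∘ₗ LinearMap.applyₗ v) fun c N hN => ?_) N
  have h1 : N v ∈ wt ρ' (c + a) :=
    bilin_mem_wt (B := LinearMap.id) (fun z N v => linHom_apply_apply z N v) hN hv
  simp [scale_of_mem hH _ hN, scale_of_mem h' _ h1]

theorem mem_wtSub_linHom (hH : IsDiag (Representation.linHom ρ ρ')) (h : IsDiag ρ)
    (h' : IsDiag ρ') {S : Set (ℤ × ℤ)} {N : X →ₗ[ℂ] X'}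
    (hN : ∀ a, ∀ v ∈ wt ρ a, N v ∈ wtSub ρ' {b | b - a ∈ S}) :
    N ∈ wtSub (Representation.linHom ρ ρ') S := by
  rw [mem_wtSub_iff hH]
  refine h.ext fun a v hv => ?_
  rw [scale_linHom_apply hH h' _ _ hv, scale_congr h' (κ' := 1) _ (hN a v hv), scale_one]
  · rfl
  · intro b hb
    exact ind_of_mem hb

variable {V V' : Type} [AddCommGroup V] [Module ℝ V] [AddCommGroup V'] [Module ℝ V']

theorem conjHom_linHom (ρ : Representation ℝ ℂˣ V) (ρ' : Representation ℝ ℂˣ V') (z : ℂˣ)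
    (N : (ℂ ⊗[ℝ] V) →ₗ[ℂ] (ℂ ⊗[ℝ] V')) :
    conjHom V V' (Representation.linHom (cplx ρ) (cplx ρ') z N) =
      Representation.linHom (cplx ρ) (cplx ρ') z (conjHom V V' N) := by
  ext v
  simp [conjHom_apply, Representation.linHom_apply, conj_cplx]

end hom

/-! ### Bilinear maps and weights -/

section bilinear

variable {V V' V'' : Type} [AddCommGroup V] [Module ℝ V] [AddCommGroup V'] [Module ℝ V']
  [AddCommGroup V''] [Module ℝ V'']

/-- The complexification of a real bilinear map. -/
def cbil (β : V →ₗ[ℝ] V' →ₗ[ℝ] V'') : (ℂ ⊗[ℝ] V) →ₗ[ℂ] (ℂ ⊗[ℝ] V') →ₗ[ℂ] (ℂ ⊗[ℝ] V'') :=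
  (FiltSpace.cmul V V').compr₂ ((TensorProduct.lift β).baseChange ℂ)

@[simp] theorem cbil_tmul (β : V →ₗ[ℝ] V' →ₗ[ℝ] V'') (a b : ℂ) (v : V) (w : V') :
    cbil β (a ⊗ₜ v) (b ⊗ₜ w) = (a * b) ⊗ₜ β v w := by
  simp [cbil]

theorem cbil_ofR (β : V →ₗ[ℝ] V' →ₗ[ℝ] V'') (v : V) (w : V') :
    cbil β (ofR V v) (ofR V' w) = ofR V'' (β v w) := by
  simp [ofR_apply]

theorem cplx_ext₂ {X : Type*} [AddCommGroup X] [Module ℂ X]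
    {f g : (ℂ ⊗[ℝ] V) →ₗ[ℂ] (ℂ ⊗[ℝ] V') →ₗ[ℂ] X}
    (h : ∀ v w, f (ofR V v) (ofR V' w) = g (ofR V v) (ofR V' w)) : f = g :=
  cplx_ext fun v => cplx_ext fun w => h v w

theorem cbil_equivariant {ρ : Representation ℝ ℂˣ V} {ρ' : Representation ℝ ℂˣ V'}
    {ρ'' : Representation ℝ ℂˣ V''} {β : V →ₗ[ℝ] V' →ₗ[ℝ] V''}
    (hβ : ∀ z v w, β (ρ z v) (ρ' z w) = ρ'' z (β v w)) (z : ℂˣ) (v : ℂ ⊗[ℝ] V) (w : ℂ ⊗[ℝ] V') :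
    cbil β (cplx ρ z v) (cplx ρ' z w) = cplx ρ'' z (cbil β v w) := by
  have : (cbil β).compl₁₂ (cplx ρ z) (cplx ρ' z) = (cbil β).compr₂ (cplx ρ'' z) :=
    cplx_ext₂ fun v w => by simp [cplx_apply, cbil_ofR, hβ]
  exact LinearMap.congr_fun₂ this v w

theorem bilin_ofR_mem_wtSub {ρ : Representation ℝ ℂˣ V} {ρ' : Representation ℝ ℂˣ V'}
    {ρ'' : Representation ℝ ℂˣ V''} {β : V →ₗ[ℝ] V' →ₗ[ℝ] V''}
    (hβ : ∀ z v w, β (ρ z v) (ρ' z w) = ρ'' z (β v w)) {S S' T : Set (ℤ × ℤ)}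
    (hT : ∀ a ∈ S, ∀ b ∈ S', a + b ∈ T) {v : V} {w : V'}
    (hv : ofR V v ∈ wtSub (cplx ρ) S) (hw : ofR V' w ∈ wtSub (cplx ρ') S') :
    ofR V'' (β v w) ∈ wtSub (cplx ρ'') T := by
  rw [← cbil_ofR]
  exact bilin_mem_wtSub (cbil_equivariant hβ) hT hv hw

end bilinear

namespace EqConn

variable (E : EqConn)

/-- A function, as a section of the structure sheaf. -/
def fn (f : Poly) : unit := f

theorem fn_add (f g : Poly) : fn (f + g) = fn f + fn g := rfl

theorem fn_smul (r : ℝ) (f : Poly) : fn (r • f) = r • fn f := rfl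

theorem unit_ρ_fn (z : ℂˣ) (f : Poly) : unit.ρ z (fn f) = fn (act z f) := rfl

/-- Multiplication of sections by functions. -/
def smulBil : unit →ₗ[ℝ] E →ₗ[ℝ] E :=
  LinearMap.mk₂ ℝ (fun (f : Poly) m => f • m) (fun f g m => add_smul (R := Poly) f g m)
    (fun r f m => smul_assoc (M := ℝ) (N := Poly) r f m)
    (fun f m n => smul_add (M := Poly) f m n)
    (fun r f m => smul_comm (M := Poly) (N := ℝ) f r m)

@[simp] theorem smulBil_fn (f : Poly) (m : E) : E.smulBil (fn f) m = f • m := rfl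

theorem smulBil_equivariant (z : ℂˣ) (f : unit) (m : E) :
    E.smulBil (unit.ρ z f) (E.ρ z m) = E.ρ z (E.smulBil f m) := (E.ρ_smul z f m).symm

theorem isDiag : IsDiag (cplx E.ρ) := isDiag_cplx E.ρ_regular

/-- The coordinate function `t`. -/
def tau : ℂ ⊗[ℝ] unit :=
  ofR unit (fn (MvPolynomial.X 0)) + Complex.I • ofR unit (fn (MvPolynomial.X 1))

theorem tau_mem_wt : tau ∈ wt (cplx unit.ρ) (1, 0) := by
  refine mem_wt.2 fun z => ?_
  have h : ∀ j, cplx unit.ρ z (ofR unit (fn (MvPolynomial.X j))) =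
      ((jac z 0 j : ℝ) : ℂ) • ofR unit (fn (MvPolynomial.X 0)) +
      ((jac z 1 j : ℝ) : ℂ) • ofR unit (fn (MvPolynomial.X 1)) := fun j => by
    rw [cplx_apply, baseChange_ofR, unit_ρ_fn, act_X, Fin.sum_univ_two,
      ← MvPolynomial.smul_eq_C_mul, ← MvPolynomial.smul_eq_C_mul, fn_add, fn_smul, fn_smul,
      map_add, ofR_smul, ofR_smul]
  have hz : chi (1, 0) z = (((z⁻¹ : ℂˣ) : ℂ).re : ℂ) + (((z⁻¹ : ℂˣ) : ℂ).im : ℂ) * Complex.I := by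
    rw [Complex.re_add_im]
    simp [chi_apply]
  rw [tau, map_add, map_smul, h, h, hz]
  simp only [jac, Matrix.cons_val', Matrix.cons_val_zero, Matrix.cons_val_one, Matrix.of_apply,
    Matrix.cons_val_fin_one, smul_add, smul_smul, add_smul, Complex.ofReal_neg, neg_smul]
  have hI : ∀ r : ℂ, r * Complex.I * Complex.I = -r := fun r => by
    rw [mul_assoc, Complex.I_mul_I, mul_neg_one]
  simp only [mul_comm Complex.I, add_mul, add_smul, hI, neg_smul]
  abel

theorem conj_tau_mem_wt : FiltSpace.conj unit tau ∈ wt (cplx unit.ρ) (0, 1) := by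
  have h := semi_mem_wt (f := FiltSpace.conj unit) (conj_cplx unit.ρ) tau_mem_wt
  rwa [Prod.swap_prod_mk] at h

theorem reC_tau : reC unit tau = fn (MvPolynomial.X 0) := by
  simp [tau, ofR_apply, TensorProduct.smul_tmul']

theorem imC_tau : imC unit tau = fn (MvPolynomial.X 1) := by
  simp [tau, ofR_apply, TensorProduct.smul_tmul']

theorem X_mem_wtSub (j : Fin 2) :
    ofR unit (fn (MvPolynomial.X j)) ∈ wtSub (cplx unit.ρ) {(1, 0), (0, 1)} := by
  have h1 : tau ∈ wtSub (cplx unit.ρ) {(1, 0), (0, 1)} :=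
    wt_le_wtSub (by simp) tau_mem_wt
  have h2 : FiltSpace.conj unit tau ∈ wtSub (cplx unit.ρ) {(1, 0), (0, 1)} :=
    wt_le_wtSub (by simp) conj_tau_mem_wt
  fin_cases j
  · change ofR unit (fn (MvPolynomial.X 0)) ∈ _
    rw [← reC_tau, ofR_reC]
    exact Submodule.smul_mem _ _ (add_mem h1 h2)
  · change ofR unit (fn (MvPolynomial.X 1)) ∈ _
    rw [← imC_tau, ofR_imC]
    exact Submodule.smul_mem _ _ (sub_mem h1 h2)

theorem fn_mem_wtSub (f : Poly) :
    ofR unit (fn f) ∈ wtSub (cplx unit.ρ) {a | 0 ≤ a.1 ∧ 0 ≤ a.2} := by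
  induction f using MvPolynomial.induction_on with
  | C r =>
    refine wt_le_wtSub (a := 0) (by simp) (mem_wt.2 fun z => ?_)
    have : act z (MvPolynomial.C r) = MvPolynomial.C r := (act z).commutes r
    rw [cplx_apply, baseChange_ofR, unit_ρ_fn, this]
    simp [chi_apply]
  | add p q hp hq =>
    rw [fn_add, map_add]
    exact add_mem hp hq
  | mul_X p j hp =>
    refine bilin_ofR_mem_wtSub (β := unit.smulBil) (unit.smulBil_equivariant) ?_ hp
      (X_mem_wtSub j)
    rintro a ⟨h1, h2⟩ b (rfl | rfl)
    · exact ⟨by simp; omega, by simpa using h2⟩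
    · exact ⟨by simpa using h1, by simp; omega⟩

/-- The covariant derivative along the Euler vector field. -/
def euler : E →ₗ[ℝ] E :=
  E.smulBil (fn (MvPolynomial.X 0)) ∘ₗ E.nabla 0 + E.smulBil (fn (MvPolynomial.X 1)) ∘ₗ E.nabla 1

theorem euler_apply (m : E) : E.euler m =
    (MvPolynomial.X 0 : Poly) • E.nabla 0 m + (MvPolynomial.X 1 : Poly) • E.nabla 1 m := rfl

theorem euler_X_smul (j : Fin 2) (m : E) : E.euler ((MvPolynomial.X j : Poly) • m) =
    (MvPolynomial.X j : Poly) • (m + E.euler m) := by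
  simp only [euler_apply, E.leibniz, MvPolynomial.pderiv_X, smul_add, smul_smul]
  fin_cases j <;> simp [mul_comm, add_assoc, add_left_comm]

theorem euler_ρ (z : ℂˣ) (m : E) : E.euler (E.ρ z m) = E.ρ z (E.euler m) := by
  simp only [euler_apply, nabla_ρ, map_add, E.ρ_smul, act_X, Fin.sum_univ_two,
    ← MvPolynomial.smul_eq_C_mul, smul_add, add_smul, smul_assoc]
  simp only [smul_comm (_ : Poly) (_ : ℝ)]
  abel

variable {E} in
theorem Hom.map_euler {E' : EqConn} (f : Hom E E') (m : E) :
    f.toLin (E.euler m) = E'.euler (f.toLin m) := by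
  simp [euler_apply, f.map_nabla]

/-- The sections `∑ f_i m_i` with `f_i` homogeneous of degree `k`. -/
def degSections : ℕ → Submodule ℝ E
  | 0 => ⊤
  | k + 1 => (degSections k).map (E.smulBil (fn (MvPolynomial.X 0))) ⊔
      (degSections k).map (E.smulBil (fn (MvPolynomial.X 1)))

theorem euler_sub_mem_degSections (k : ℕ) {m : E} (hm : m ∈ E.degSections k) :
    E.euler m - (k : ℝ) • m ∈ E.degSections (k + 1) := by
  induction k generalizing m with
  | zero =>
    rw [Nat.cast_zero, zero_smul, sub_zero]
    exact Submodule.add_mem_sup ⟨_, Submodule.mem_top, rfl⟩ ⟨_, Submodule.mem_top, rfl⟩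
  | succ k ih =>
    have key : ∀ (j : Fin 2) (n : E), E.euler ((MvPolynomial.X j : Poly) • n) -
        ((k + 1 : ℕ) : ℝ) • ((MvPolynomial.X j : Poly) • n) =
        (MvPolynomial.X j : Poly) • (E.euler n - (k : ℝ) • n) := fun j n => by
      rw [euler_X_smul, smul_comm _ (MvPolynomial.X j : Poly), ← smul_sub]
      congr 1
      push_cast
      module
    rw [degSections] at hm
    obtain ⟨_, ⟨n, hn, rfl⟩, _, ⟨n', hn', rfl⟩, rfl⟩ := Submodule.mem_sup.1 hm
    rw [map_add, smul_add, add_sub_add_comm]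
    simp only [smulBil_fn]
    rw [key, key]
    exact Submodule.add_mem_sup ⟨_, ih hn, rfl⟩ ⟨_, ih hn', rfl⟩

theorem degSections_wtSub {c : ℤ} (hc : ∀ m : E, ofR E m ∈ wtSub (cplx E.ρ) {a | c ≤ a.1 + a.2})
    (k : ℕ) {m : E} (hm : m ∈ E.degSections k) :
    ofR E m ∈ wtSub (cplx E.ρ) {a | c + k ≤ a.1 + a.2} := by
  induction k generalizing m with
  | zero => simpa using hc m
  | succ k ih =>
    have key : ∀ (j : Fin 2) (n : E), n ∈ E.degSections k →
        ofR E (E.smulBil (fn (MvPolynomial.X j)) n) ∈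
          wtSub (cplx E.ρ) {a | c + (k + 1 : ℕ) ≤ a.1 + a.2} := fun j n hn => by
      refine bilin_ofR_mem_wtSub E.smulBil_equivariant ?_ (X_mem_wtSub j) (ih hn)
      rintro a (rfl | rfl) b hb <;> simp at hb ⊢ <;> omega
    rw [degSections] at hm
    obtain ⟨_, ⟨n, hn, rfl⟩, _, ⟨n', hn', rfl⟩, rfl⟩ := Submodule.mem_sup.1 hm
    rw [map_add]
    exact add_mem (key 0 n hn) (key 1 n' hn')

theorem exists_weight_bound [Module.Finite Poly E] :
    ∃ c : ℤ, ∀ m : E, ofR E m ∈ wtSub (cplx E.ρ) {a | c ≤ a.1 + a.2} := by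
  classical
  obtain ⟨t, ht⟩ := (inferInstance : Module.Finite Poly E)
  choose s hs using fun m : E => E.isDiag.exists_finset (ofR E m)
  obtain ⟨c, hc⟩ := ((t.biUnion s).image fun a => a.1 + a.2).bddBelow
  refine ⟨c, fun m => ?_⟩
  have hm : m ∈ Submodule.span Poly (t : Set E) := ht ▸ Submodule.mem_top
  induction hm using Submodule.span_induction with
  | mem x hx =>
    refine wtSub_mono (fun a ha => hc ?_) (hs x)
    simp only [Finset.coe_image, Set.mem_image, Finset.mem_coe, Finset.mem_biUnion]
    exact ⟨a, ⟨x, hx, ha⟩, rfl⟩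
  | zero => simp
  | add x y _ _ hx hy =>
    rw [map_add]
    exact add_mem hx hy
  | smul f x _ hx =>
    refine bilin_ofR_mem_wtSub E.smulBil_equivariant ?_ (fn_mem_wtSub f) hx
    rintro a ⟨h1, h2⟩ b hb
    simp at hb ⊢
    omega

/-- The polynomial `X (X - 1) ⋯ (X - (k - 1))`. -/
theorem ker_aeval_prod_le {V : Type} [AddCommGroup V] [Module ℝ V] (f : Module.End ℝ V) (k : ℕ) :
    LinearMap.ker (Polynomial.aeval f (∏ j ∈ Finset.range k, (Polynomial.X - Polynomial.C (j : ℝ))))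
      ≤ ⨆ j : ℕ, Module.End.eigenspace f (j : ℝ) := by
  induction k with
  | zero =>
    intro v hv
    have : v = 0 := by simpa using hv
    rw [this]
    exact Submodule.zero_mem _
  | succ k ih =>
    rw [Finset.prod_range_succ, ← Polynomial.sup_ker_aeval_eq_ker_aeval_mul_of_coprime]
    · refine sup_le ih (le_iSup_of_le k ?_)
      intro v hv
      rw [LinearMap.mem_ker] at hv
      rw [Module.End.mem_eigenspace_iff, ← sub_eq_zero, ← hv]
      simp [-map_natCast, Polynomial.aeval_C, Module.algebraMap_end_apply]
    · refine IsCoprime.prod_left fun j hj => ?_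
      refine Polynomial.isCoprime_X_sub_C_of_isUnit_sub (IsUnit.mk0 _ ?_)
      rw [sub_ne_zero]
      exact_mod_cast (Finset.mem_range.1 hj).ne

theorem aeval_euler_mem (k : ℕ) (m : E) :
    Polynomial.aeval E.euler (∏ j ∈ Finset.range k, (Polynomial.X - Polynomial.C (j : ℝ))) m ∈
      E.degSections k := by
  induction k with
  | zero => exact Submodule.mem_top
  | succ k ih =>
    rw [Finset.prod_range_succ, mul_comm, map_mul, Module.End.mul_apply]
    convert E.euler_sub_mem_degSections k ih using 1
    rw [map_sub, Polynomial.aeval_X, Polynomial.aeval_C]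
    rfl

theorem aeval_euler_ρ (p : Polynomial ℝ) (z : ℂˣ) (m : E) :
    Polynomial.aeval E.euler p (E.ρ z m) = E.ρ z (Polynomial.aeval E.euler p m) := by
  induction p using Polynomial.induction_on' with
  | add p q hp hq => simp [hp, hq]
  | monomial n r =>
    simp only [Polynomial.aeval_monomial, Module.End.mul_apply, Module.algebraMap_end_apply,
      map_smul]
    congr 1
    induction n with
    | zero => simp
    | succ n ih => simp only [pow_succ', Module.End.mul_apply, ih, euler_ρ]

theorem iSup_eigenspace_euler [Module.Finite Poly E] :
    ⨆ j : ℕ, Module.End.eigenspace E.euler (j : ℝ) = ⊤ := by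
  rw [← top_le_iff]
  rintro m -
  obtain ⟨c, hc⟩ := E.exists_weight_bound
  obtain ⟨s, hs⟩ := E.isDiag.exists_finset (ofR E m)
  obtain ⟨d, hd⟩ := (s.image fun a => a.1 + a.2).bddAbove
  refine ker_aeval_prod_le E.euler (d + 1 - c).toNat ?_
  rw [LinearMap.mem_ker]
  have h1 := E.degSections_wtSub hc _ (E.aeval_euler_mem (d + 1 - c).toNat m)
  have h2 : ofR E (Polynomial.aeval E.euler
      (∏ j ∈ Finset.range (d + 1 - c).toNat, (Polynomial.X - Polynomial.C (j : ℝ))) m) ∈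
      wtSub (cplx E.ρ) {a | a.1 + a.2 ≤ d} := by
    rw [← baseChange_ofR]
    refine map_mem_wtSub (baseChange_equivariant (E.aeval_euler_ρ _)) (wtSub_mono ?_ hs)
    intro a ha
    exact hd (by simpa using ⟨a.1, a.2, ha, rfl⟩)
  have h3 := mem_wtSub_inter E.isDiag h1 h2
  have h4 : {a : ℤ × ℤ | c + (d + 1 - c).toNat ≤ a.1 + a.2} ∩ {a | a.1 + a.2 ≤ d} = ∅ := by
    ext a
    simp only [Set.mem_inter_iff, Set.mem_ofPred_eq, Set.mem_empty_iff_false, iff_false, not_and]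
    omega
  rw [h4, wtSub_empty, Submodule.mem_bot] at h3
  exact ofR_injective (by rw [h3, map_zero])

end EqConn

namespace EqConn

/-! ### Radially constant sections -/

section radial

variable (E : EqConn)

/-- The space of sections that are constant along the rays. -/
def radial : Submodule ℝ E := LinearMap.ker E.euler

variable {E} in
theorem mem_radial {m : E} : m ∈ E.radial ↔ E.euler m = 0 := Iff.rfl

theorem isInternal_euler [Module.Finite Poly E] :
    DirectSum.IsInternal fun j : ℕ => Module.End.eigenspace E.euler (j : ℝ) := by
  classical
  refine (DirectSum.isInternal_submodule_iff_iSupIndep_and_iSup_eq_top _).2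
    ⟨?_, E.iSup_eigenspace_euler⟩
  exact (Module.End.eigenspaces_iSupIndep E.euler).comp Nat.cast_injective

variable {E} in
theorem euler_ext [Module.Finite Poly E] {V : Type} [AddCommGroup V] [Module ℝ V]
    {f g : E →ₗ[ℝ] V} (h : ∀ (j : ℕ) (m : E), E.euler m = (j : ℝ) • m → f m = g m) : f = g := by
  have : (⨆ j : ℕ, Module.End.eigenspace E.euler (j : ℝ)) ≤ LinearMap.eqLocus f g :=
    iSup_le fun j m hm => h j m (Module.End.mem_eigenspace_iff.1 hm)
  rw [E.iSup_eigenspace_euler] at this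
  ext m
  exact this (Submodule.mem_top (x := m))

/-- The projection to the eigenspace of the Euler operator with eigenvalue `i`. -/
def eulerProj [Module.Finite Poly E] (i : ℕ) : E →ₗ[ℝ] E :=
  DirectSum.toModule ℝ ℕ E (fun j => if j = i then
    (Module.End.eigenspace E.euler (j : ℝ)).subtype else 0) ∘ₗ
  (LinearEquiv.ofBijective (DirectSum.coeLinearMap
    fun j : ℕ => Module.End.eigenspace E.euler (j : ℝ)) E.isInternal_euler).symm.toLinearMap

variable {E}

theorem eulerProj_of_mem [Module.Finite Poly E] (i : ℕ) {j : ℕ} {m : E}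
    (hm : E.euler m = (j : ℝ) • m) : E.eulerProj i m = if j = i then m else 0 := by
  have hm' : m ∈ Module.End.eigenspace E.euler (j : ℝ) := Module.End.mem_eigenspace_iff.2 hm
  have : (LinearEquiv.ofBijective (DirectSum.coeLinearMap
      fun j : ℕ => Module.End.eigenspace E.euler (j : ℝ)) E.isInternal_euler).symm m =
      DirectSum.lof ℝ ℕ (fun j : ℕ => Module.End.eigenspace E.euler (j : ℝ)) j ⟨m, hm'⟩ := by
    rw [LinearEquiv.symm_apply_eq]
    exact (DirectSum.coeLinearMap_lof _ j ⟨m, hm'⟩).symm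
  simp only [eulerProj, LinearMap.comp_apply, LinearEquiv.coe_coe, this, DirectSum.toModule_lof]
  split_ifs <;> simp

theorem euler_eulerProj [Module.Finite Poly E] (i : ℕ) (m : E) :
    E.euler (E.eulerProj i m) = (i : ℝ) • E.eulerProj i m := by
  refine LinearMap.congr_fun (euler_ext (f := E.euler ∘ₗ E.eulerProj i)
    (g := (i : ℝ) • E.eulerProj i) fun j m hm => ?_) m
  rw [LinearMap.comp_apply, LinearMap.smul_apply, eulerProj_of_mem i hm]
  split_ifs with h
  · rw [hm, h]
  · simp

theorem euler_X_smul_of_mem {j : ℕ} {m : E} (hm : E.euler m = (j : ℝ) • m) (k : Fin 2) :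
    E.euler ((MvPolynomial.X k : Poly) • m) =
      ((j + 1 : ℕ) : ℝ) • ((MvPolynomial.X k : Poly) • m) := by
  rw [euler_X_smul, hm, smul_comm _ (MvPolynomial.X k : Poly)]
  congr 1
  push_cast
  module

theorem eulerProj_succ_X_smul [Module.Finite Poly E] (i : ℕ) (k : Fin 2) (m : E) :
    E.eulerProj (i + 1) ((MvPolynomial.X k : Poly) • m) =
      (MvPolynomial.X k : Poly) • E.eulerProj i m := by
  refine LinearMap.congr_fun (euler_ext
    (f := E.eulerProj (i + 1) ∘ₗ E.smulBil (fn (MvPolynomial.X k)))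
    (g := E.smulBil (fn (MvPolynomial.X k)) ∘ₗ E.eulerProj i) fun j m hm => ?_) m
  simp only [LinearMap.comp_apply, smulBil_fn]
  rw [eulerProj_of_mem _ (euler_X_smul_of_mem hm k), eulerProj_of_mem i hm]
  simp only [Nat.add_right_cancel_iff]
  split_ifs <;> simp

theorem eulerProj_zero_X_smul [Module.Finite Poly E] (k : Fin 2) (m : E) :
    E.eulerProj 0 ((MvPolynomial.X k : Poly) • m) = 0 := by
  refine LinearMap.congr_fun (euler_ext
    (f := E.eulerProj 0 ∘ₗ E.smulBil (fn (MvPolynomial.X k))) (g := 0) fun j m hm => ?_) m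
  simp only [LinearMap.comp_apply, smulBil_fn]
  rw [eulerProj_of_mem _ (euler_X_smul_of_mem hm k)]
  simp

theorem eulerProj_zero_smul [Module.Finite Poly E] (f : Poly) (m : E) :
    E.eulerProj 0 (f • m) = MvPolynomial.constantCoeff f • E.eulerProj 0 m := by
  induction f using MvPolynomial.induction_on generalizing m with
  | C r =>
    rw [MvPolynomial.constantCoeff_C, ← map_smul, ← MvPolynomial.algebraMap_eq, algebraMap_smul]
  | add p q hp hq => rw [add_smul, map_add, hp, hq, map_add, add_smul]
  | mul_X p k hp =>
    rw [mul_smul, hp, eulerProj_zero_X_smul]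
    simp

/-- The radially constant part of a section. -/
def radialPart (E : EqConn) [Module.Finite Poly E] : E →ₗ[ℝ] E.radial :=
  (E.eulerProj 0).codRestrict E.radial fun m => by
    rw [mem_radial, euler_eulerProj]
    simp

theorem radialPart_smul [Module.Finite Poly E] (f : Poly) (m : E) :
    E.radialPart (f • m) = MvPolynomial.constantCoeff f • E.radialPart m :=
  Subtype.ext (eulerProj_zero_smul f m)

theorem radialPart_coe [Module.Finite Poly E] (u : E.radial) : E.radialPart u = u := by
  refine Subtype.ext ?_
  have h : E.euler u = ((0 : ℕ) : ℝ) • (u : E) := by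
    rw [mem_radial.1 u.2]
    simp
  exact (eulerProj_of_mem 0 h).trans (if_pos rfl)

instance [Module.Finite Poly E] : FiniteDimensional ℝ E.radial := by
  obtain ⟨t, ht⟩ := (inferInstance : Module.Finite Poly E)
  classical
  refine ⟨t.image E.radialPart, top_le_iff.1 ?_⟩
  rintro u -
  rw [← radialPart_coe u]
  have hu : (u : E) ∈ Submodule.span Poly (t : Set E) := ht ▸ Submodule.mem_top
  generalize (u : E) = m at hu
  induction hu using Submodule.span_induction with
  | mem x hx => exact Submodule.subset_span (by simpa using ⟨x, hx, rfl⟩)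
  | zero => simp
  | add x y _ _ hx hy =>
    rw [map_add]
    exact add_mem hx hy
  | smul f x _ hx =>
    rw [radialPart_smul]
    exact Submodule.smul_mem _ _ hx

/-- The map `f ⊗ u ↦ f u`. -/
def frame (E : EqConn) : (Poly ⊗[ℝ] E.radial) →ₗ[Poly] E :=
  LinearMap.liftBaseChange Poly E.radial.subtype

@[simp] theorem frame_tmul (f : Poly) (u : E.radial) : E.frame (f ⊗ₜ u) = f • (u : E) := by
  simp [frame]

theorem frame_surjective [Module.Finite Poly E] : Function.Surjective E.frame := by
  rw [← LinearMap.range_eq_top]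
  have key : ∀ (j : ℕ) (m : E), E.euler m = (j : ℝ) • m → m ∈ LinearMap.range E.frame := by
    intro j
    induction j with
    | zero =>
      intro m hm
      have hm' : m ∈ E.radial := by
        rw [mem_radial, hm]
        simp
      exact ⟨1 ⊗ₜ ⟨m, hm'⟩, by simp⟩
    | succ j ih =>
      intro m hm
      have h1 : ((j + 1 : ℕ) : ℝ) • m = (MvPolynomial.X 0 : Poly) • E.eulerProj j (E.nabla 0 m) +
          (MvPolynomial.X 1 : Poly) • E.eulerProj j (E.nabla 1 m) := by
        rw [← eulerProj_succ_X_smul, ← eulerProj_succ_X_smul, ← map_add, ← euler_apply, hm, map_smul,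
          eulerProj_of_mem _ hm, if_pos rfl]
      have h2 : m = (MvPolynomial.C (((j + 1 : ℕ) : ℝ)⁻¹) : Poly) • (((j + 1 : ℕ) : ℝ) • m) := by
        rw [← MvPolynomial.algebraMap_eq, algebraMap_smul, smul_smul, inv_mul_cancel₀, one_smul]
        exact_mod_cast j.succ_ne_zero
      rw [h2, h1]
      exact Submodule.smul_mem _ _ (add_mem
        (Submodule.smul_mem _ _ (ih _ (euler_eulerProj j _)))
        (Submodule.smul_mem _ _ (ih _ (euler_eulerProj j _))))
  rw [← top_le_iff]
  have h := E.iSup_eigenspace_euler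
  intro m _
  have hm : m ∈ ⨆ j : ℕ, Module.End.eigenspace E.euler (j : ℝ) := h ▸ Submodule.mem_top
  have hle : (⨆ j : ℕ, Module.End.eigenspace E.euler (j : ℝ)) ≤
      (LinearMap.range E.frame).restrictScalars ℝ :=
    iSup_le fun j m hm => key j m (Module.End.mem_eigenspace_iff.1 hm)
  exact hle hm

/-- The value at the point `a` of a vector valued function. -/
def evT (U : Type) [AddCommGroup U] [Module ℝ U] (a : Fin 2 → ℝ) : (Poly ⊗[ℝ] U) →ₗ[ℝ] U :=
  (TensorProduct.lid ℝ U).toLinearMap ∘ₗ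
    LinearMap.rTensor U (MvPolynomial.aeval (R := ℝ) a).toLinearMap

@[simp] theorem evT_tmul {U : Type} [AddCommGroup U] [Module ℝ U] (a : Fin 2 → ℝ) (f : Poly)
    (u : U) : evT U a (f ⊗ₜ u) = MvPolynomial.eval a f • u := by
  simp [evT]

theorem evT_smul {U : Type} [AddCommGroup U] [Module ℝ U] (a : Fin 2 → ℝ) (f : Poly)
    (x : Poly ⊗[ℝ] U) : evT U a (f • x) = MvPolynomial.eval a f • evT U a x := by
  induction x with
  | zero => simp
  | add x y hx hy => rw [smul_add, map_add, hx, hy, map_add, smul_add]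
  | tmul g u => rw [TensorProduct.smul_tmul', smul_eq_mul, evT_tmul, evT_tmul, map_mul, mul_smul]

theorem sub_constantCoeff_mem (f : Poly) :
    f - MvPolynomial.C (MvPolynomial.constantCoeff f) ∈ originIdeal := by
  induction f using MvPolynomial.induction_on with
  | C r => simp
  | add p q hp hq =>
    rw [map_add, map_add, add_sub_add_comm]
    exact add_mem hp hq
  | mul_X p k hp =>
    simp only [map_mul, MvPolynomial.constantCoeff_X, mul_zero, map_zero, sub_zero]
    refine Ideal.mul_mem_left _ _ (Ideal.subset_span ?_)
    fin_cases k <;> simp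

theorem constantCoeff_of_mem_originIdeal {f : Poly} (hf : f ∈ originIdeal) :
    MvPolynomial.constantCoeff f = 0 := by
  have : originIdeal ≤ RingHom.ker (MvPolynomial.constantCoeff : Poly →+* ℝ) := by
    refine Ideal.span_le.2 ?_
    rintro _ (rfl | rfl) <;> simp [RingHom.mem_ker]
  exact this hf

theorem mem_originIdeal_smul {U : Type} [AddCommGroup U] [Module ℝ U] {x : Poly ⊗[ℝ] U}
    (hx : evT U 0 x = 0) : x ∈ originIdeal • (⊤ : Submodule Poly (Poly ⊗[ℝ] U)) := by
  have key : ∀ x : Poly ⊗[ℝ] U, x - 1 ⊗ₜ evT U 0 x ∈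
      originIdeal • (⊤ : Submodule Poly (Poly ⊗[ℝ] U)) := by
    intro x
    induction x with
    | zero => simp
    | add x y hx hy =>
      simp only [map_add, tmul_add, add_sub_add_comm]
      exact add_mem hx hy
    | tmul f u =>
      have h2 : f ⊗ₜ[ℝ] u - 1 ⊗ₜ evT U 0 (f ⊗ₜ u) =
          (f - MvPolynomial.C (MvPolynomial.constantCoeff f)) • ((1 : Poly) ⊗ₜ[ℝ] u) := by
        rw [TensorProduct.smul_tmul', smul_eq_mul, mul_one, sub_tmul, evT_tmul,
          MvPolynomial.eval_zero, ← TensorProduct.smul_tmul, MvPolynomial.smul_eq_C_mul, mul_one]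
      rw [h2]
      exact Submodule.smul_mem_smul (sub_constantCoeff_mem f) Submodule.mem_top
  have := key x
  rwa [hx, tmul_zero, sub_zero] at this

theorem frame_injective [Module.Finite Poly E] [Module.Projective Poly E] :
    Function.Injective E.frame := by
  rw [← LinearMap.ker_eq_bot]
  obtain ⟨s, hs⟩ := Module.projective_lifting_property E.frame LinearMap.id frame_surjective
  let r : (Poly ⊗[ℝ] E.radial) →ₗ[Poly] (Poly ⊗[ℝ] E.radial) := LinearMap.id - s ∘ₗ E.frame
  have hr : ∀ x, r x ∈ LinearMap.ker E.frame := fun x => by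
    have := LinearMap.congr_fun hs (E.frame x)
    simp only [LinearMap.comp_apply, LinearMap.id_apply] at this
    simp [r, this]
  have hle : LinearMap.ker E.frame ≤ originIdeal • LinearMap.ker E.frame := by
    intro x hx
    have h1 : x ∈ originIdeal • (⊤ : Submodule Poly (Poly ⊗[ℝ] E.radial)) := by
      refine mem_originIdeal_smul ?_
      have h2 : ∀ x : Poly ⊗[ℝ] E.radial, evT E.radial 0 x = E.radialPart (E.frame x) := by
        intro x
        induction x with
        | zero => simp
        | add x y hx hy => simp only [map_add, hx, hy]
        | tmul f u =>
          rw [frame_tmul, radialPart_smul, radialPart_coe, evT_tmul, MvPolynomial.eval_zero]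
      rw [h2, LinearMap.mem_ker.1 hx, map_zero]
    have h2 : x = r x := by simp [r, LinearMap.mem_ker.1 hx]
    rw [h2]
    have h3 : r x ∈ (originIdeal • (⊤ : Submodule Poly (Poly ⊗[ℝ] E.radial))).map r := ⟨x, h1, rfl⟩
    rw [Submodule.map_smul''] at h3
    refine Submodule.smul_mono le_rfl ?_ h3
    rintro _ ⟨y, _, rfl⟩
    exact hr y
  obtain ⟨a, ha, ha'⟩ := Submodule.exists_sub_one_mem_and_smul_eq_zero_of_fg_of_le_smul
    originIdeal _ (IsNoetherian.noetherian (LinearMap.ker E.frame)) hle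
  have ha0 : a ≠ 0 := by
    rintro rfl
    have := constantCoeff_of_mem_originIdeal ha
    simp at this
  rw [eq_bot_iff]
  intro x hx
  exact (smul_eq_zero.1 (ha' x hx)).resolve_left ha0

/-- The trivialization of a bundle by its radially constant sections. -/
def frameEquiv (E : EqConn) [Module.Finite Poly E] [Module.Projective Poly E] :
    (Poly ⊗[ℝ] E.radial) ≃ₗ[Poly] E :=
  LinearEquiv.ofBijective E.frame ⟨frame_injective, frame_surjective⟩

theorem frameEquiv_tmul [Module.Finite Poly E] [Module.Projective Poly E] (f : Poly)
    (u : E.radial) : E.frameEquiv (f ⊗ₜ u) = f • (u : E) := frame_tmul f u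

variable [Module.Finite Poly E] [Module.Projective Poly E]

/-- Real linear maps out of a bundle agree if they agree on products of functions and radially
constant sections. -/
theorem frame_ext {V : Type} [AddCommGroup V] [Module ℝ V] {A B : E →ₗ[ℝ] V}
    (h : ∀ (f : Poly) (u : E.radial), A (f • (u : E)) = B (f • (u : E))) : A = B := by
  ext m
  obtain ⟨x, rfl⟩ := E.frameEquiv.surjective m
  induction x with
  | zero => simp
  | add x y hx hy => simp only [map_add, hx, hy]
  | tmul f u =>
    rw [frameEquiv_tmul]
    exact h f u

/-- The value of a section at a point, by means of the radial trivialization. -/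
def ev (E : EqConn) [Module.Finite Poly E] [Module.Projective Poly E] (a : Fin 2 → ℝ) :
    E →ₗ[ℝ] E.radial :=
  evT E.radial a ∘ₗ (E.frameEquiv.symm.toLinearMap.restrictScalars ℝ)

theorem ev_smul (a : Fin 2 → ℝ) (f : Poly) (m : E) :
    E.ev a (f • m) = MvPolynomial.eval a f • E.ev a m := by
  simp [ev, evT_smul]

theorem ev_coe (a : Fin 2 → ℝ) (u : E.radial) : E.ev a u = u := by
  have : E.frameEquiv.symm (u : E) = 1 ⊗ₜ u := by
    rw [LinearEquiv.symm_apply_eq, frameEquiv_tmul, one_smul]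
  simp [ev, this]

theorem evT_eq_zero {U : Type} [AddCommGroup U] [Module ℝ U] [FiniteDimensional ℝ U]
    {x : Poly ⊗[ℝ] U} (h : ∀ a ≠ 0, evT U a x = 0) : x = 0 := by
  classical
  let b := Module.finBasis ℝ U
  have hb : ∀ x i a, MvPolynomial.eval a ((b.baseChange Poly).repr x i) =
      b.repr (evT U a x) i := by
    intro x i a
    induction x with
    | zero => simp
    | add x y hx hy => simp only [map_add, Finsupp.add_apply, hx, hy]
    | tmul f u => simp [MvPolynomial.smul_eval, mul_comm]
  refine (b.baseChange Poly).repr.injective (Finsupp.ext fun i => ?_)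
  rw [map_zero, Finsupp.zero_apply]
  have h1 : (MvPolynomial.X 0 ^ 2 + MvPolynomial.X 1 ^ 2 : Poly) *
      (b.baseChange Poly).repr x i = 0 := by
    refine MvPolynomial.funext fun a => ?_
    by_cases ha : a = 0
    · simp [ha]
    · simp [hb, h a ha]
  refine (mul_eq_zero.1 h1).resolve_left fun h0 => ?_
  have := congrArg (MvPolynomial.eval fun _ => (1 : ℝ)) h0
  norm_num at this

theorem eq_zero_of_ev {m : E} (h : ∀ a ≠ 0, E.ev a m = 0) : m = 0 := by
  have := evT_eq_zero (x := E.frameEquiv.symm m) h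
  simpa using this

theorem eq_of_ev {m n : E} (h : ∀ a ≠ 0, E.ev a m = E.ev a n) : m = n :=
  sub_eq_zero.1 (eq_zero_of_ev fun a ha => by rw [map_sub, h a ha, sub_self])

end radial

end EqConn

/-! ### The weight filtration of a representation -/

section weightFiltration

variable {V V' : Type} [AddCommGroup V] [Module ℝ V] [AddCommGroup V'] [Module ℝ V']
  {ρ : Representation ℝ ℂˣ V} {ρ' : Representation ℝ ℂˣ V'}

/-- The set of types of total weight at most `k`. -/
def le (k : ℤ) : Set (ℤ × ℤ) := {a | a.1 + a.2 ≤ k}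

theorem mem_le {k : ℤ} {a : ℤ × ℤ} : a ∈ le k ↔ a.1 + a.2 ≤ k := Iff.rfl

theorem le_mono {k l : ℤ} (h : k ≤ l) : le k ⊆ le l := fun _ ha => le_trans ha h

/-- The subspace of weight at most `k`. -/
def wtW (ρ : Representation ℝ ℂˣ V) (k : ℤ) : Submodule ℝ V := realSub (wtSub (cplx ρ) (le k))

theorem mem_wtW {k : ℤ} {v : V} : v ∈ wtW ρ k ↔ ofR V v ∈ wtSub (cplx ρ) (le k) := Iff.rfl

theorem wtW_mono : Monotone (wtW ρ) := fun _ _ h _ hv => wtSub_mono (le_mono h) hv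

theorem conj_mem_wtSub {S T : Set (ℤ × ℤ)} (hT : ∀ a ∈ S, a.swap ∈ T) {v : ℂ ⊗[ℝ] V}
    (hv : v ∈ wtSub (cplx ρ) S) : FiltSpace.conj V v ∈ wtSub (cplx ρ) T :=
  semi_mem_wtSub (f := FiltSpace.conj V) (conj_cplx ρ) hT hv

theorem swap_mem_le {k : ℤ} (a : ℤ × ℤ) (h : a ∈ le k) : a.swap ∈ le k := by
  rw [mem_le] at *
  simp only [Prod.fst_swap, Prod.snd_swap]
  omega

theorem baseChange_wtW (k : ℤ) : (wtW ρ k).baseChange ℂ = wtSub (cplx ρ) (le k) :=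
  baseChange_realSub fun _ hv => conj_mem_wtSub swap_mem_le hv

theorem ρ_mem_wtW {k : ℤ} (z : ℂˣ) {v : V} (hv : v ∈ wtW ρ k) : ρ z v ∈ wtW ρ k := by
  have h : (cplx ρ) z (ofR V v) = ofR V (ρ z v) := baseChange_ofR _ _
  rw [mem_wtW, ← h]
  exact map_mem_wtSub (f := cplx ρ z) (ρ := cplx ρ) (fun w x => by
    rw [← Module.End.mul_apply, ← Module.End.mul_apply, ← map_mul, ← map_mul, mul_comm]) hv

theorem map_mem_wtW {f : V →ₗ[ℝ] V'} (hf : ∀ z v, f (ρ z v) = ρ' z (f v)) {k : ℤ} {v : V}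
    (hv : v ∈ wtW ρ k) : f v ∈ wtW ρ' k := by
  rw [mem_wtW, ← baseChange_ofR]
  exact map_mem_wtSub (baseChange_equivariant hf) hv

theorem exists_wtW_eq [FiniteDimensional ℝ V] (h : IsDiag (cplx ρ)) :
    ∃ N : ℤ, ∀ a, wt (cplx ρ) a ≠ ⊥ → -N ≤ a.1 + a.2 ∧ a.1 + a.2 ≤ N := by
  obtain ⟨s, hs⟩ := h.exists_finset_of_finite
  obtain ⟨N, hN⟩ := (s.image fun a => |a.1 + a.2|).bddAbove
  refine ⟨N, fun a ha => ?_⟩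
  have has : a ∈ s := by
    by_contra has
    refine ha (eq_bot_iff.2 fun v hv => ?_)
    have h1 : v ∈ wtSub (cplx ρ) ({a} ∩ (s : Set (ℤ × ℤ))) :=
      mem_wtSub_inter h (by rwa [wtSub_singleton]) (hs ▸ Submodule.mem_top)
    have h2 : ({a} ∩ (s : Set (ℤ × ℤ))) = ∅ := by
      ext c
      simp only [Set.mem_inter_iff, Set.mem_singleton_iff, Finset.mem_coe, Set.mem_empty_iff_false,
        iff_false, not_and]
      rintro rfl
      exact has
    rwa [h2, wtSub_empty] at h1
  have := hN (Finset.mem_coe.2 (Finset.mem_image_of_mem _ has))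
  exact abs_le.1 this

theorem wtSub_eq_bot_of_forall {X : Type*} [AddCommGroup X] [Module ℂ X]
    {σ : Representation ℂ ℂˣ X} {S : Set (ℤ × ℤ)} (h : ∀ a ∈ S, wt σ a = ⊥) : wtSub σ S = ⊥ := by
  rw [eq_bot_iff]
  exact wtSub_le fun a ha => (h a ha).le

theorem exists_wtW_bot [FiniteDimensional ℝ V] (h : IsDiag (cplx ρ)) : ∃ k, wtW ρ k = ⊥ := by
  obtain ⟨N, hN⟩ := exists_wtW_eq h
  refine ⟨-N - 1, eq_bot_iff.2 fun v hv => ?_⟩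
  have h1 : wtSub (cplx ρ) (le (-N - 1)) = ⊥ := wtSub_eq_bot_of_forall fun a ha => by
    by_contra hne
    have := hN a hne
    rw [mem_le] at ha
    omega
  rw [mem_wtW, h1, Submodule.mem_bot] at hv
  exact ofR_injective (by rw [hv, map_zero])

theorem exists_wtW_top [FiniteDimensional ℝ V] (h : IsDiag (cplx ρ)) : ∃ k, wtW ρ k = ⊤ := by
  obtain ⟨N, hN⟩ := exists_wtW_eq h
  refine ⟨N, top_le_iff.1 fun v _ => ?_⟩
  have h1 : wtSub (cplx ρ) Set.univ ≤ wtSub (cplx ρ) (le N) := wtSub_le fun a _ => by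
    by_cases hne : wt (cplx ρ) a = ⊥
    · rw [hne]
      exact bot_le
    · exact wt_le_wtSub (hN a hne).2
  exact h1 (h.mem_univ _)

/-- A map lowering the weight filtration by `m` has only types of total weight at most `-m`. -/
theorem baseChange_mem_wtSub_linHom (hH : IsDiag (Representation.linHom (cplx ρ) (cplx ρ')))
    (h : IsDiag (cplx ρ)) (h' : IsDiag (cplx ρ')) {m : ℤ} {f : V →ₗ[ℝ] V'}
    (hf : ∀ k, ∀ v ∈ wtW ρ k, f v ∈ wtW ρ' (k - m)) :
    f.baseChange ℂ ∈ wtSub (Representation.linHom (cplx ρ) (cplx ρ')) (le (-m)) := by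
  refine mem_wtSub_linHom hH h h' fun a v hv => ?_
  have hv' : v ∈ (wtW ρ (a.1 + a.2)).baseChange ℂ := by
    rw [baseChange_wtW]
    exact wt_le_wtSub (mem_le.2 le_rfl) hv
  have h1 : (wtW ρ (a.1 + a.2)).baseChange ℂ ≤
      ((wtW ρ' (a.1 + a.2 - m)).baseChange ℂ).comap (f.baseChange ℂ) := baseChange_le fun v hv => by
    rw [Submodule.mem_comap, baseChange_ofR]
    exact ofR_mem_baseChange (hf _ v hv)
  have h2 := h1 hv'
  rw [Submodule.mem_comap, baseChange_wtW] at h2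
  refine wtSub_mono (fun b hb => ?_) h2
  simp only [Set.mem_ofPred_eq, mem_le, Prod.fst_sub, Prod.snd_sub] at hb ⊢
  omega

theorem isNilpotent_of_mem_wtSub {X : Type*} [AddCommGroup X] [Module ℂ X]
    [FiniteDimensional ℂ X] {σ : Representation ℂ ℂˣ X} (h : IsDiag σ) {N : Module.End ℂ X}
    (hN : N ∈ wtSub (Representation.linHom σ σ) (le (-1))) : IsNilpotent N := by
  have hH := isDiag_linHom h h
  obtain ⟨s, hs⟩ := hH.exists_finset_of_finite
  obtain ⟨B, hB⟩ := (s.image fun a => -(a.1 + a.2)).bddAbove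
  have hp : ∀ n : ℕ, N ^ (n + 1) ∈ wtSub (Representation.linHom σ σ) (le (-(n + 1))) := by
    intro n
    induction n with
    | zero => simpa using hN
    | succ n ih =>
      rw [pow_succ]
      refine comp_mem_wtSub (fun a ha b hb => ?_) ih hN
      rw [mem_le] at *
      simp only [Prod.fst_add, Prod.snd_add]
      push_cast
      omega
  refine ⟨B.toNat + 1, ?_⟩
  have h1 := mem_wtSub_inter hH (hp B.toNat) (hs ▸ Submodule.mem_top)
  have h2 : le (-((B.toNat : ℤ) + 1)) ∩ (s : Set (ℤ × ℤ)) = ∅ := by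
    ext a
    simp only [Set.mem_inter_iff, mem_le, Finset.mem_coe, Set.mem_empty_iff_false, iff_false,
      not_and]
    intro h1 h2
    have : -(a.1 + a.2) ≤ B := hB (Finset.mem_coe.2 (Finset.mem_image_of_mem _ h2))
    omega
  rwa [h2, wtSub_empty, Submodule.mem_bot] at h1

end weightFiltration

/-! ### The connection in the radial trivialization -/

namespace EqConn

section connection

variable (E : EqConn)

/-- The action of the torus on radially constant sections. -/
def radialρ : Representation ℝ ℂˣ E.radial where
  toFun z := (E.ρ z).restrict fun m hm => by
    rw [mem_radial, euler_ρ, mem_radial.1 hm, map_zero]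
  map_one' := by ext u; simp
  map_mul' z w := by ext u; simp

@[simp] theorem coe_radialρ (z : ℂˣ) (u : E.radial) : (E.radialρ z u : E) = E.ρ z u := rfl

variable {E} {E' : EqConn} [Module.Finite Poly E] [Module.Projective Poly E]
  [Module.Finite Poly E'] [Module.Projective Poly E']

theorem isDiag_radial : IsDiag (cplx E.radialρ) := by
  refine isDiag_cplx fun u => ?_
  have h := (E.ρ_regular u).map E.radialPart
  have h2 : (fun z => E.radialPart (E.ρ z u)) = fun z => E.radialρ z u := by
    funext z
    exact radialPart_coe (E.radialρ z u)
  rwa [h2] at h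

/-- The extension of a linear map of radially constant sections to all sections. -/
def extend (T : E.radial →ₗ[ℝ] E'.radial) : E →ₗ[Poly] E' :=
  E'.frame ∘ₗ T.baseChange Poly ∘ₗ E.frameEquiv.symm.toLinearMap

theorem extend_smul_coe (T : E.radial →ₗ[ℝ] E'.radial) (f : Poly) (u : E.radial) :
    extend T (f • (u : E)) = f • (T u : E') := by
  have : E.frameEquiv.symm (f • (u : E)) = f ⊗ₜ u := by
    rw [LinearEquiv.symm_apply_eq, frameEquiv_tmul]
  simp only [extend, LinearMap.comp_apply, LinearEquiv.coe_coe, this, LinearMap.baseChange_tmul,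
    frame_tmul]

theorem extend_coe (T : E.radial →ₗ[ℝ] E'.radial) (u : E.radial) :
    extend T (u : E) = (T u : E') := by
  have := extend_smul_coe T 1 u
  rwa [one_smul, one_smul] at this

theorem ev_extend (T : E.radial →ₗ[ℝ] E'.radial) (a : Fin 2 → ℝ) (m : E) :
    E'.ev a (extend T m) = T (E.ev a m) := by
  refine LinearMap.congr_fun (frame_ext (A := E'.ev a ∘ₗ (extend T).restrictScalars ℝ)
    (B := T ∘ₗ E.ev a) fun f u => ?_) m
  simp [ev_smul, ev_coe, extend_coe]

/-- The subsheaf spanned by a space of radially constant sections. -/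
def spanOf (S : Submodule ℝ E.radial) : Submodule Poly E :=
  Submodule.span Poly (E.radial.subtype '' S)

theorem coe_mem_spanOf {S : Submodule ℝ E.radial} {u : E.radial} (hu : u ∈ S) :
    (u : E) ∈ spanOf S := Submodule.subset_span ⟨u, hu, rfl⟩

theorem spanOf_induction {S : Submodule ℝ E.radial} {T : Submodule ℝ E}
    (h : ∀ (f : Poly), ∀ u ∈ S, f • (u : E) ∈ T) {m : E} (hm : m ∈ spanOf S) : m ∈ T := by
  rw [spanOf, Submodule.mem_span_image_iff_exists_fun] at hm
  obtain ⟨t, ht, c, rfl⟩ := hm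
  exact Submodule.sum_mem _ fun u _ => h _ _ (ht u.2)

theorem ev_mem_of_mem_spanOf {S : Submodule ℝ E.radial} (a : Fin 2 → ℝ) {m : E}
    (hm : m ∈ spanOf S) : E.ev a m ∈ S := by
  refine spanOf_induction (T := S.comap (E.ev a)) (fun f u hu => ?_) hm
  rw [Submodule.mem_comap, ev_smul, ev_coe]
  exact Submodule.smul_mem _ _ hu

theorem mem_spanOf {S : Submodule ℝ E.radial} {m : E} (h : ∀ a ≠ 0, E.ev a m ∈ S) :
    m ∈ spanOf S := by
  obtain ⟨p, hp⟩ := S.exists_isCompl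
  let π : E.radial →ₗ[ℝ] E.radial := S.subtype ∘ₗ S.projectionOnto p hp
  have h1 : extend π m = m := eq_of_ev fun a ha => by
    rw [ev_extend]
    exact congrArg Subtype.val (Submodule.projectionOnto_apply_left hp ⟨_, h a ha⟩)
  rw [← h1]
  obtain ⟨x, rfl⟩ := E.frameEquiv.surjective m
  clear h h1
  induction x with
  | zero => simp
  | add x y hx hy =>
    rw [map_add, map_add]
    exact add_mem hx hy
  | tmul f u =>
    rw [frameEquiv_tmul, extend_smul_coe]
    exact Submodule.smul_mem _ _ (coe_mem_spanOf (Submodule.coe_mem _))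

/-- The point of the plane given by a nonzero complex number. -/
def pt (z : ℂˣ) : Fin 2 → ℝ := ![(z : ℂ).re, (z : ℂ).im]

theorem exists_pt {a : Fin 2 → ℝ} (ha : a ≠ 0) : ∃ z, a = pt z := by
  have h : (⟨a 0, a 1⟩ : ℂ) ≠ 0 := by
    intro h
    refine ha ?_
    rw [Complex.ext_iff] at h
    ext i
    fin_cases i
    · exact h.1
    · exact h.2
  refine ⟨Units.mk0 _ h, ?_⟩
  ext i
  fin_cases i <;> simp [pt]

theorem eval_pt_act (z : ℂˣ) (f : Poly) :
    MvPolynomial.eval (pt z) (act z f) = MvPolynomial.eval (pt 1) f := by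
  have hn : (z : ℂ).re ^ 2 + (z : ℂ).im ^ 2 ≠ 0 := by
    have := Complex.normSq_pos.2 z.ne_zero
    rw [Complex.normSq_apply, ← sq, ← sq] at this
    exact this.ne'
  induction f using MvPolynomial.induction_on with
  | C r =>
    have : act z (MvPolynomial.C r) = MvPolynomial.C r := (act z).commutes r
    simp [this]
  | add p q hp hq => simp [hp, hq]
  | mul_X p k hp =>
    rw [map_mul, map_mul, hp, map_mul, act_X]
    congr 1
    fin_cases k <;>
    · simp [Fin.sum_univ_two, jac, pt, Complex.inv_re, Complex.inv_im, Complex.normSq_apply,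
        ← sq]
      field_simp
      try ring

theorem ev_pt_ρ (z : ℂˣ) (m : E) : E.ev (pt z) (E.ρ z m) = E.radialρ z (E.ev (pt 1) m) := by
  refine LinearMap.congr_fun (frame_ext (A := E.ev (pt z) ∘ₗ E.ρ z)
    (B := E.radialρ z ∘ₗ E.ev (pt 1)) fun f u => ?_) m
  rw [LinearMap.comp_apply, LinearMap.comp_apply, E.ρ_smul, ev_smul, eval_pt_act, ← coe_radialρ,
    ev_coe, ev_smul, ev_coe, map_smul]

/-- The connection form at the point `1`, along `∂/∂y`. -/
def connOp (E : EqConn) [Module.Finite Poly E] [Module.Projective Poly E] :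
    E.radial →ₗ[ℝ] E.radial :=
  E.ev (pt 1) ∘ₗ E.nabla 1 ∘ₗ E.radial.subtype

theorem connOp_apply (u : E.radial) : E.connOp u = E.ev (pt 1) (E.nabla 1 u) := rfl

theorem ev_one_nabla_zero (u : E.radial) : E.ev (pt 1) (E.nabla 0 u) = 0 := by
  have h := congrArg (E.ev (pt 1)) (mem_radial.1 u.2)
  rw [euler_apply, map_add, ev_smul, ev_smul, map_zero] at h
  simpa [pt] using h

theorem ev_nabla_ρ (z : ℂˣ) (i : Fin 2) (u : E.radial) :
    E.ev (pt z) (E.nabla i (E.ρ z u)) = jac z i 1 • E.radialρ z (E.connOp u) := by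
  rw [E.nabla_ρ, Fin.sum_univ_two, map_add, map_smul, map_smul, ev_pt_ρ, ev_pt_ρ,
    ev_one_nabla_zero, connOp_apply]
  simp

theorem ev_nabla (z : ℂˣ) (i : Fin 2) (u : E.radial) :
    E.ev (pt z) (E.nabla i u) =
      jac z i 1 • E.radialρ z (E.connOp (E.radialρ z⁻¹ u)) := by
  rw [← ev_nabla_ρ, ← coe_radialρ, ← Module.End.mul_apply, ← map_mul]
  simp

end connection

end EqConn

/-- The set of types with both entries negative. -/
def negSet : Set (ℤ × ℤ) := {a | a.1 < 0 ∧ a.2 < 0}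

theorem bilin_mem_of_wtSub {X X' X'' : Type*} [AddCommGroup X] [Module ℂ X] [AddCommGroup X']
    [Module ℂ X'] [AddCommGroup X''] [Module ℂ X''] {ρ : Representation ℂ ℂˣ X}
    {ρ' : Representation ℂ ℂˣ X'} {B : X →ₗ[ℂ] X' →ₗ[ℂ] X''} {S S' : Set (ℤ × ℤ)}
    {N : Submodule ℂ X''} (h : ∀ a ∈ S, ∀ b ∈ S', ∀ v ∈ wt ρ a, ∀ w ∈ wt ρ' b, B v w ∈ N)
    {v : X} {w : X'} (hv : v ∈ wtSub ρ S) (hw : w ∈ wtSub ρ' S') : B v w ∈ N := by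
  have h1 : wtSub ρ S ≤ N.comap (B.flip w) := wtSub_le fun a ha v hv => by
    have h2 : wtSub ρ' S' ≤ N.comap (B v) := wtSub_le fun b hb w hw => h a ha b hb v hv w hw
    exact h2 hw
  exact h1 hv

namespace EqConn

section connection

variable {E E' : EqConn} [Module.Finite Poly E] [Module.Projective Poly E]
  [Module.Finite Poly E'] [Module.Projective Poly E']

/-- Multiplication of radially constant sections by functions. -/
def frameBil (E : EqConn) : unit →ₗ[ℝ] E.radial →ₗ[ℝ] E := E.smulBil.compl₂ E.radial.subtype

theorem frameBil_fn (f : Poly) (u : E.radial) : E.frameBil (fn f) u = f • (u : E) := rfl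

theorem frameBil_equivariant (z : ℂˣ) (f : unit) (u : E.radial) :
    E.frameBil (unit.ρ z f) (E.radialρ z u) = E.ρ z (E.frameBil f u) :=
  smulBil_equivariant E z f u

theorem cplx_frame_induction {N : Submodule ℂ (ℂ ⊗[ℝ] E)}
    (h : ∀ a ∈ {a : ℤ × ℤ | 0 ≤ a.1 ∧ 0 ≤ a.2}, ∀ b, ∀ f ∈ wt (cplx unit.ρ) a,
      ∀ u ∈ wt (cplx E.radialρ) b, cbil E.frameBil f u ∈ N) (m : ℂ ⊗[ℝ] E) : m ∈ N := by
  have key : ∀ m : E, ofR E m ∈ N := by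
    intro m
    obtain ⟨x, rfl⟩ := E.frameEquiv.surjective m
    induction x with
    | zero => simp
    | add x y hx hy =>
      rw [map_add, map_add]
      exact add_mem hx hy
    | tmul f u =>
      rw [frameEquiv_tmul, ← frameBil_fn, ← cbil_ofR]
      exact bilin_mem_of_wtSub (S' := Set.univ) (fun a ha b _ => h a ha b) (fn_mem_wtSub f)
        (isDiag_radial.mem_univ _)
  rw [← reC_add_imC m]
  exact add_mem (key _) (Submodule.smul_mem _ _ (key _))

theorem ev_baseChange_cbil (p : Fin 2 → ℝ) (f : ℂ ⊗[ℝ] unit) (u : ℂ ⊗[ℝ] E.radial) :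
    ∃ c : ℂ, (E.ev p).baseChange ℂ (cbil E.frameBil f u) = c • u := by
  have h1 : ∀ f : Poly, (E.ev p).baseChange ℂ (cbil E.frameBil (ofR unit (fn f)) u) =
      ((MvPolynomial.eval p f : ℝ) : ℂ) • u := by
    intro f
    refine LinearMap.congr_fun (f := (E.ev p).baseChange ℂ ∘ₗ cbil E.frameBil (ofR unit (fn f)))
      (g := ((MvPolynomial.eval p f : ℝ) : ℂ) • LinearMap.id) (cplx_ext fun u => ?_) u
    rw [LinearMap.comp_apply, cbil_ofR, baseChange_ofR, frameBil_fn, ev_smul, ev_coe, ofR_smul]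
    rfl
  rw [← reC_add_imC f, map_add, map_smul, LinearMap.add_apply, map_add, LinearMap.smul_apply,
    map_smul]
  refine ⟨((MvPolynomial.eval p (reC unit f : Poly) : ℝ) : ℂ) +
    Complex.I * ((MvPolynomial.eval p (imC unit f : Poly) : ℝ) : ℂ), ?_⟩
  rw [add_smul, mul_smul]
  exact congrArg₂ (· + ·) (h1 (reC unit f)) (congrArg (Complex.I • ·) (h1 (imC unit f)))

theorem ev_mem_wtSub (p : Fin 2 → ℝ) {a : ℤ × ℤ} {m : ℂ ⊗[ℝ] E} (hm : m ∈ wt (cplx E.ρ) a) :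
    (E.ev p).baseChange ℂ m ∈ wtSub (cplx E.radialρ) {c | c.1 ≤ a.1 ∧ c.2 ≤ a.2} := by
  have key : ∀ m, (E.ev p).baseChange ℂ (scale E.isDiag (ind {a}) m) ∈
      wtSub (cplx E.radialρ) {c | c.1 ≤ a.1 ∧ c.2 ≤ a.2} := by
    intro m
    refine cplx_frame_induction (N := (wtSub (cplx E.radialρ) {c | c.1 ≤ a.1 ∧ c.2 ≤ a.2}).comap
      ((E.ev p).baseChange ℂ ∘ₗ scale E.isDiag (ind {a}))) (fun k hk b f hf u hu => ?_) m
    have h1 : cbil E.frameBil f u ∈ wt (cplx E.ρ) (k + b) :=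
      bilin_mem_wt (cbil_equivariant frameBil_equivariant) hf hu
    rw [Submodule.mem_comap, LinearMap.comp_apply, scale_of_mem _ _ h1, map_smul]
    by_cases hab : k + b = a
    · obtain ⟨c, hc⟩ := ev_baseChange_cbil p f u
      rw [hc]
      refine Submodule.smul_mem _ _ (Submodule.smul_mem _ _ (wt_le_wtSub ?_ hu))
      subst hab
      obtain ⟨h1, h2⟩ := hk
      constructor
      · simp only [Prod.fst_add]; omega
      · simp only [Prod.snd_add]; omega
    · rw [ind_of_notMem (by simpa using hab), zero_smul]
      exact Submodule.zero_mem _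
  have h := key m
  rwa [scale_of_mem _ _ hm, ind_of_mem (Set.mem_singleton a), one_smul] at h

/-- The covariant derivatives along `∂/∂t` and `∂/∂(conj t)`, up to a scalar. -/
theorem nabla_mem_wt {a : ℤ × ℤ} {m : ℂ ⊗[ℝ] E} (hm : m ∈ wt (cplx E.ρ) a) :
    (E.nabla 1).baseChange ℂ m + Complex.I • (E.nabla 0).baseChange ℂ m ∈
        wt (cplx E.ρ) (a - (1, 0)) ∧
      (E.nabla 1).baseChange ℂ m - Complex.I • (E.nabla 0).baseChange ℂ m ∈
        wt (cplx E.ρ) (a - (0, 1)) := by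
  have hn : ∀ (i : Fin 2) (z : ℂˣ), (E.nabla i).baseChange ℂ ∘ₗ cplx E.ρ z =
      ((jac z i 0 : ℝ) : ℂ) • (cplx E.ρ z ∘ₗ (E.nabla 0).baseChange ℂ) +
      ((jac z i 1 : ℝ) : ℂ) • (cplx E.ρ z ∘ₗ (E.nabla 1).baseChange ℂ) := by
    intro i z
    refine cplx_ext fun m => ?_
    simp only [LinearMap.comp_apply, LinearMap.add_apply, LinearMap.smul_apply, cplx_apply,
      baseChange_ofR, E.nabla_ρ, Fin.sum_univ_two, map_add, ofR_smul]
  have hz : ∀ z : ℂˣ, (z : ℂ)⁻¹ = (jac z 1 1 : ℂ) + Complex.I * (jac z 0 1 : ℂ) ∧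
      (starRingEnd ℂ (z : ℂ))⁻¹ = (jac z 1 1 : ℂ) - Complex.I * (jac z 0 1 : ℂ) ∧
      (jac z 0 0 : ℂ) = jac z 1 1 ∧ (jac z 1 0 : ℂ) = - jac z 0 1 := by
    intro z
    have h1 := Complex.re_add_im ((z⁻¹ : ℂˣ) : ℂ)
    have h2 := congrArg (starRingEnd ℂ) h1
    simp only [map_add, map_mul, Complex.conj_ofReal, Complex.conj_I] at h2
    refine ⟨?_, ?_, ?_, ?_⟩
    · rw [← Units.val_inv_eq_inv_val, ← h1]
      simp [jac, mul_comm]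
    · rw [← map_inv₀, ← Units.val_inv_eq_inv_val, ← h2]
      simp [jac]
      ring
    · simp [jac]
    · simp [jac]
  have hm' : ∀ (i : Fin 2) (z : ℂˣ), chi a z • (E.nabla i).baseChange ℂ m =
      ((jac z i 0 : ℝ) : ℂ) • cplx E.ρ z ((E.nabla 0).baseChange ℂ m) +
      ((jac z i 1 : ℝ) : ℂ) • cplx E.ρ z ((E.nabla 1).baseChange ℂ m) := fun i z => by
    rw [← map_smul, ← mem_wt.1 hm]
    exact LinearMap.congr_fun (hn i z) m
  constructor
  · refine mem_wt.2 fun z => ?_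
    have e1 : chi (a - (1, 0)) z = (z : ℂ) * chi a z := by
      rw [sub_eq_add_neg, chi_add, chi_neg, mul_comm]
      simp [chi_apply]
    obtain ⟨h1, _, h3, h4⟩ := hz z
    rw [e1, mul_smul, smul_add, smul_comm _ Complex.I, hm', hm', h3, h4]
    have : (z : ℂ) • ((jac z 1 1 : ℂ) + Complex.I * (jac z 0 1 : ℂ)) = 1 := by
      rw [← h1, smul_eq_mul, mul_inv_cancel₀ z.ne_zero]
    rw [map_add, map_smul]
    trans ((z : ℂ) • ((jac z 1 1 : ℂ) + Complex.I * (jac z 0 1 : ℂ))) •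
      (cplx E.ρ z ((E.nabla 1).baseChange ℂ m) +
        Complex.I • cplx E.ρ z ((E.nabla 0).baseChange ℂ m))
    · rw [this, one_smul]
    · rw [smul_assoc]
      congr 1
      have hI : (Complex.I * Complex.I) • cplx E.ρ z ((E.nabla 0).baseChange ℂ m) =
          (-1 : ℂ) • cplx E.ρ z ((E.nabla 0).baseChange ℂ m) := by rw [Complex.I_mul_I]
      linear_combination (norm := module) (jac z 0 1 : ℂ) • hI
  · refine mem_wt.2 fun z => ?_
    have e1 : chi (a - (0, 1)) z = (starRingEnd ℂ (z : ℂ)) * chi a z := by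
      rw [sub_eq_add_neg, chi_add, chi_neg, mul_comm]
      simp [chi_apply]
    obtain ⟨_, h2, h3, h4⟩ := hz z
    rw [e1, mul_smul, smul_sub, smul_comm _ Complex.I, hm', hm', h3, h4]
    have : (starRingEnd ℂ (z : ℂ)) • ((jac z 1 1 : ℂ) - Complex.I * (jac z 0 1 : ℂ)) = 1 := by
      rw [← h2, smul_eq_mul, mul_inv_cancel₀ (conj_unit_ne_zero z)]
    rw [map_sub, map_smul]
    trans ((starRingEnd ℂ (z : ℂ)) • ((jac z 1 1 : ℂ) - Complex.I * (jac z 0 1 : ℂ))) •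
      (cplx E.ρ z ((E.nabla 1).baseChange ℂ m) -
        Complex.I • cplx E.ρ z ((E.nabla 0).baseChange ℂ m))
    · rw [this, one_smul]
    · rw [smul_assoc]
      congr 1
      have hI : (Complex.I * Complex.I) • cplx E.ρ z ((E.nabla 0).baseChange ℂ m) =
          (-1 : ℂ) • cplx E.ρ z ((E.nabla 0).baseChange ℂ m) := by rw [Complex.I_mul_I]
      linear_combination (norm := module) (jac z 0 1 : ℂ) • hI

theorem connOp_mem_wtSub {a : ℤ × ℤ} {v : ℂ ⊗[ℝ] E.radial} (hv : v ∈ wt (cplx E.radialρ) a) :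
    E.connOp.baseChange ℂ v ∈ wtSub (cplx E.radialρ) {c | c.1 < a.1 ∧ c.2 < a.2} := by
  let ι : E.radial →ₗ[ℝ] E := E.radial.subtype
  have hm : ι.baseChange ℂ v ∈ wt (cplx E.ρ) a :=
    map_mem_wt (baseChange_equivariant (ρ := E.radialρ) (ρ' := E.ρ) fun z u => rfl) hv
  obtain ⟨h1, h2⟩ := nabla_mem_wt hm
  have h0 : (E.ev (pt 1)).baseChange ℂ ((E.nabla 0).baseChange ℂ (ι.baseChange ℂ v)) = 0 := by
    refine LinearMap.congr_fun (f := (E.ev (pt 1)).baseChange ℂ ∘ₗ (E.nabla 0).baseChange ℂ ∘ₗ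
      ι.baseChange ℂ) (g := 0) (cplx_ext fun u => ?_) v
    simp only [LinearMap.comp_apply, baseChange_ofR]
    rw [show ι u = (u : E) from rfl, ev_one_nabla_zero, map_zero]
    rfl
  have hb : (E.ev (pt 1)).baseChange ℂ ((E.nabla 1).baseChange ℂ (ι.baseChange ℂ v)) =
      E.connOp.baseChange ℂ v := by
    refine LinearMap.congr_fun (f := (E.ev (pt 1)).baseChange ℂ ∘ₗ (E.nabla 1).baseChange ℂ ∘ₗ
      ι.baseChange ℂ) (g := E.connOp.baseChange ℂ) (cplx_ext fun u => ?_) v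
    simp only [LinearMap.comp_apply, baseChange_ofR]
    rfl
  have k1 := ev_mem_wtSub (pt 1) h1
  have k2 := ev_mem_wtSub (pt 1) h2
  rw [map_add, map_smul, h0, hb, smul_zero, add_zero] at k1
  rw [map_sub, map_smul, h0, hb, smul_zero, sub_zero] at k2
  refine wtSub_mono ?_ (mem_wtSub_inter isDiag_radial k1 k2)
  rintro c ⟨⟨h1, h2⟩, h3, h4⟩
  simp only [Prod.fst_sub, Prod.snd_sub] at h1 h2 h3 h4
  exact ⟨by omega, by omega⟩

theorem isDiag_linHom_radial : IsDiag (Representation.linHom (cplx E.radialρ) (cplx E'.radialρ)) :=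
  isDiag_linHom isDiag_radial isDiag_radial

theorem connOp_mem_negSet : E.connOp.baseChange ℂ ∈
    wtSub (Representation.linHom (cplx E.radialρ) (cplx E.radialρ)) negSet := by
  refine mem_wtSub_linHom isDiag_linHom_radial isDiag_radial isDiag_radial fun a v hv =>
    wtSub_mono ?_ (connOp_mem_wtSub hv)
  rintro c ⟨h1, h2⟩
  exact ⟨by simp; omega, by simp; omega⟩

end connection

end EqConn

section transfer

variable {X X' : Type*} [AddCommGroup X] [Module ℂ X] [AddCommGroup X'] [Module ℂ X']
  {ρ : Representation ℂ ℂˣ X} {ρ' : Representation ℂ ℂˣ X'}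

theorem mem_wtSub_of_injective (h : IsDiag ρ) (h' : IsDiag ρ') {f : X →ₗ[ℂ] X'}
    (hf : ∀ z v, f (ρ z v) = ρ' z (f v)) (hi : Function.Injective f) {S : Set (ℤ × ℤ)} {v : X}
    (hv : f v ∈ wtSub ρ' S) : v ∈ wtSub ρ S := by
  rw [mem_wtSub_iff h] 
  apply hi
  rw [map_scale h h' hf, (mem_wtSub_iff h').1 hv]

theorem exists_mem_wtSub_of_surjective (h : IsDiag ρ) (h' : IsDiag ρ') {f : X →ₗ[ℂ] X'}
    (hf : ∀ z v, f (ρ z v) = ρ' z (f v)) (hs : Function.Surjective f) {S : Set (ℤ × ℤ)} {v : X'}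
    (hv : v ∈ wtSub ρ' S) : ∃ w ∈ wtSub ρ S, f w = v := by
  obtain ⟨w, rfl⟩ := hs v
  refine ⟨scale h (ind S) w,
    scale_mem_wtSub h (fun a _ ha => ind_of_notMem ha) (h.mem_univ w), ?_⟩
  rw [map_scale h h' hf, (mem_wtSub_iff h').1 hv]

end transfer

/-- A finite dimensional real algebraic representation of `ℂ^*` together with an operator
that strictly lowers both entries of the Hodge type. -/
structure Dat : Type 1 where
  carrier : Type
  [addCommGroup : AddCommGroup carrier]
  [module : Module ℝ carrier]
  [finite : FiniteDimensional ℝ carrier]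
  ρ : Representation ℝ ℂˣ carrier
  ρ_regular : ∀ v, IsRegularMap fun z => ρ z v
  b : carrier →ₗ[ℝ] carrier
  b_mem : b.baseChange ℂ ∈ wtSub (Representation.linHom (cplx ρ) (cplx ρ)) negSet

attribute [instance] Dat.addCommGroup Dat.module Dat.finite

instance : CoeSort Dat Type := ⟨Dat.carrier⟩

namespace Dat

theorem isDiag (D : Dat) : IsDiag (cplx D.ρ) := isDiag_cplx D.ρ_regular

theorem isDiagHom (D D' : Dat) : IsDiag (Representation.linHom (cplx D.ρ) (cplx D'.ρ)) :=
  isDiag_linHom D.isDiag D'.isDiag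

/-- Morphisms are the equivariant maps commuting with the operators. -/
@[ext]
structure Hom (D D' : Dat) : Type where
  toLin : D →ₗ[ℝ] D'
  map_ρ : ∀ z v, toLin (D.ρ z v) = D'.ρ z (toLin v)
  map_b : ∀ v, toLin (D.b v) = D'.b (toLin v)

instance : Category Dat where
  Hom := Hom
  id D := ⟨LinearMap.id, fun _ _ => rfl, fun _ => rfl⟩
  comp f g := ⟨g.toLin ∘ₗ f.toLin, fun z m => by simp [f.map_ρ, g.map_ρ],
    fun m => by simp [f.map_b, g.map_b]⟩

variable {D D' D'' : Dat}

@[ext]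
theorem hom_ext {f g : D ⟶ D'} (h : f.toLin = g.toLin) : f = g := Hom.ext h

@[simp] theorem id_toLin : Hom.toLin (𝟙 D) = LinearMap.id := rfl
@[simp] theorem comp_toLin (f : D ⟶ D') (g : D' ⟶ D'') :
    (f ≫ g).toLin = g.toLin ∘ₗ f.toLin := rfl

instance : Zero (D ⟶ D') := ⟨⟨0, by simp, by simp⟩⟩
instance : Add (D ⟶ D') := ⟨fun f g => ⟨f.toLin + g.toLin,
  by simp [f.map_ρ, g.map_ρ], by simp [f.map_b, g.map_b]⟩⟩
instance : Neg (D ⟶ D') := ⟨fun f => ⟨-f.toLin, by simp [f.map_ρ], by simp [f.map_b]⟩⟩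
instance : Sub (D ⟶ D') := ⟨fun f g => ⟨f.toLin - g.toLin,
  by simp [f.map_ρ, g.map_ρ], by simp [f.map_b, g.map_b]⟩⟩
instance : SMul ℕ (D ⟶ D') := ⟨fun n f => ⟨n • f.toLin, by simp [f.map_ρ], by simp [f.map_b]⟩⟩
instance : SMul ℤ (D ⟶ D') := ⟨fun n f => ⟨n • f.toLin, by simp [f.map_ρ], by simp [f.map_b]⟩⟩

@[simp] theorem zero_toLin : Hom.toLin (0 : D ⟶ D') = 0 := rfl
@[simp] theorem add_toLin (f g : D ⟶ D') : (f + g).toLin = f.toLin + g.toLin := rfl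

instance : AddCommGroup (D ⟶ D') :=
  Function.Injective.addCommGroup (fun f : D ⟶ D' => f.toLin) (fun _ _ h => Hom.ext h) rfl
    (fun _ _ => rfl) (fun _ => rfl) (fun _ _ => rfl) (fun _ _ => rfl) (fun _ _ => rfl)

instance : Preadditive Dat where
  add_comp _ _ _ _ _ _ := by ext; simp
  comp_add _ _ _ _ _ _ := by ext; simp

theorem sum_toLin {ι : Type*} (s : Finset ι) (f : ι → (D ⟶ D')) :
    Hom.toLin (∑ i ∈ s, f i : D ⟶ D') = ∑ i ∈ s, (f i).toLin :=
  map_sum (⟨⟨fun f : D ⟶ D' => f.toLin, rfl⟩, fun _ _ => rfl⟩ : (D ⟶ D') →+ (D →ₗ[ℝ] D')) f s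

section sub

/-- An operator commuting with an injective equivariant map into another object. -/
theorem b_mem_of_injective {V : Type} [AddCommGroup V] [Module ℝ V] [FiniteDimensional ℝ V]
    {ρ : Representation ℝ ℂˣ V} {b : V →ₗ[ℝ] V} (hr : ∀ v, IsRegularMap fun z => ρ z v)
    {i : V →ₗ[ℝ] D} (hi : Function.Injective i) (hρ : ∀ z v, i (ρ z v) = D.ρ z (i v))
    (hb : ∀ v, i (b v) = D.b (i v)) :
    b.baseChange ℂ ∈ wtSub (Representation.linHom (cplx ρ) (cplx ρ)) negSet := by
  have hd := isDiag_cplx hr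
  refine mem_wtSub_linHom (isDiag_linHom hd hd) hd hd fun a v hv => ?_
  have hiC : Function.Injective (i.baseChange ℂ) :=
    Module.Flat.lTensor_preserves_injective_linearMap i hi
  refine mem_wtSub_of_injective hd D.isDiag (baseChange_equivariant hρ) hiC ?_
  have hb' : i.baseChange ℂ (b.baseChange ℂ v) = D.b.baseChange ℂ (i.baseChange ℂ v) := by
    rw [← LinearMap.comp_apply, ← LinearMap.baseChange_comp, ← LinearMap.comp_apply,
      ← LinearMap.baseChange_comp]
    congr 2
    ext v
    exact hb v
  rw [hb']
  have h2 := map_mem_wt (baseChange_equivariant hρ) hv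
  rw [← wtSub_singleton] at h2
  exact apply_mem_wtSub (by rintro c hc _ rfl; simpa using hc) D.b_mem h2

/-- An operator commuting with a surjective equivariant map from another object. -/
theorem b_mem_of_surjective {V : Type} [AddCommGroup V] [Module ℝ V] [FiniteDimensional ℝ V]
    {ρ : Representation ℝ ℂˣ V} {b : V →ₗ[ℝ] V} (hr : ∀ v, IsRegularMap fun z => ρ z v)
    {i : D →ₗ[ℝ] V} (hi : Function.Surjective i) (hρ : ∀ z v, i (D.ρ z v) = ρ z (i v))
    (hb : ∀ v, i (D.b v) = b (i v)) :
    b.baseChange ℂ ∈ wtSub (Representation.linHom (cplx ρ) (cplx ρ)) negSet := by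
  have hd := isDiag_cplx hr
  refine mem_wtSub_linHom (isDiag_linHom hd hd) hd hd fun a v hv => ?_
  have hiC : Function.Surjective (i.baseChange ℂ) := LinearMap.lTensor_surjective ℂ hi
  rw [← wtSub_singleton] at hv
  obtain ⟨w, hw, rfl⟩ := exists_mem_wtSub_of_surjective D.isDiag hd
    (baseChange_equivariant hρ) hiC hv
  have hb' : i.baseChange ℂ (D.b.baseChange ℂ w) = b.baseChange ℂ (i.baseChange ℂ w) := by
    rw [← LinearMap.comp_apply, ← LinearMap.baseChange_comp, ← LinearMap.comp_apply,
      ← LinearMap.baseChange_comp]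
    congr 2
    ext v
    exact hb v
  rw [← hb']
  refine map_mem_wtSub (baseChange_equivariant hρ) ?_
  exact apply_mem_wtSub (by rintro c hc _ rfl; simpa using hc) D.b_mem hw

/-- The object structure on an invariant subspace. -/
def sub (D : Dat) (K : Submodule ℝ D) (hρ : ∀ z, ∀ v ∈ K, D.ρ z v ∈ K)
    (hb : ∀ v ∈ K, D.b v ∈ K) : Dat :=
  let ρ : Representation ℝ ℂˣ K :=
    { toFun := fun z => (D.ρ z).restrict (hρ z)
      map_one' := by ext v; simp
      map_mul' := fun z w => by ext v; simp }
  have hr : ∀ v, IsRegularMap fun z => ρ z v := fun v => by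
    obtain ⟨L, hL⟩ := K.subtype.exists_leftInverse_of_injective K.ker_subtype
    have h := (D.ρ_regular v).map L
    refine (congrArg IsRegularMap ?_).mp h
    funext z
    exact LinearMap.congr_fun hL (ρ z v)
  { carrier := K
    ρ := ρ
    ρ_regular := hr
    b := D.b.restrict hb
    b_mem := b_mem_of_injective hr (i := K.subtype) K.subtype_injective (fun _ _ => rfl)
      (fun _ => rfl) }

/-- The inclusion of an invariant subspace. -/
def subι (K : Submodule ℝ D) (hρ : ∀ z, ∀ v ∈ K, D.ρ z v ∈ K)
    (hb : ∀ v ∈ K, D.b v ∈ K) : D.sub K hρ hb ⟶ D where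
  toLin := K.subtype
  map_ρ _ _ := rfl
  map_b _ := rfl

/-- The object structure on the quotient by an invariant subspace. -/
def quot (D : Dat) (K : Submodule ℝ D) (hρ : ∀ z, ∀ v ∈ K, D.ρ z v ∈ K)
    (hb : ∀ v ∈ K, D.b v ∈ K) : Dat :=
  let ρ : Representation ℝ ℂˣ (D ⧸ K) :=
    { toFun := fun z => K.mapQ K (D.ρ z) (hρ z)
      map_one' := by ext v; simp
      map_mul' := fun z w => by ext v; simp }
  have hr : ∀ v, IsRegularMap fun z => ρ z v := fun v => by
    obtain ⟨v, rfl⟩ := K.mkQ_surjective v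
    exact (D.ρ_regular v).map K.mkQ
  { carrier := D ⧸ K
    ρ := ρ
    ρ_regular := hr
    b := K.mapQ K D.b hb
    b_mem := b_mem_of_surjective hr (i := K.mkQ) K.mkQ_surjective (fun _ _ => rfl)
      (fun _ => rfl) }

/-- The projection to the quotient by an invariant subspace. -/
def quotπ (K : Submodule ℝ D) (hρ : ∀ z, ∀ v ∈ K, D.ρ z v ∈ K)
    (hb : ∀ v ∈ K, D.b v ∈ K) : D ⟶ D.quot K hρ hb where
  toLin := K.mkQ
  map_ρ _ _ := rfl
  map_b _ := rfl

/-- Lifting a morphism through an injective one. -/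
def liftOfInjective (i : D' ⟶ D) (hi : Function.Injective i.toLin) (f : D'' ⟶ D)
    (h : ∀ v, f.toLin v ∈ LinearMap.range i.toLin) : D'' ⟶ D' :=
  let e := LinearEquiv.ofInjective i.toLin hi
  let L : D'' →ₗ[ℝ] D' := e.symm.toLinearMap ∘ₗ f.toLin.codRestrict _ h
  have hL : ∀ v, i.toLin (L v) = f.toLin v := fun v =>
    congrArg Subtype.val (e.apply_symm_apply ⟨f.toLin v, h v⟩)
  { toLin := L
    map_ρ := fun z v => hi (by rw [hL, f.map_ρ, i.map_ρ, hL])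
    map_b := fun v => hi (by rw [hL, f.map_b, i.map_b, hL]) }

theorem liftOfInjective_comp (i : D' ⟶ D) (hi : Function.Injective i.toLin) (f : D'' ⟶ D)
    (h : ∀ v, f.toLin v ∈ LinearMap.range i.toLin) : liftOfInjective i hi f h ≫ i = f := by
  ext v
  exact congrArg Subtype.val
    ((LinearEquiv.ofInjective i.toLin hi).apply_symm_apply ⟨f.toLin v, h v⟩)

/-- Descending a morphism along a surjective one. -/
def descOfSurjective (p : D ⟶ D') (hp : Function.Surjective p.toLin) (f : D ⟶ D'')
    (h : LinearMap.ker p.toLin ≤ LinearMap.ker f.toLin) : D' ⟶ D'' :=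
  let e := p.toLin.quotKerEquivOfSurjective hp
  let L : D' →ₗ[ℝ] D'' := (LinearMap.ker p.toLin).liftQ f.toLin h ∘ₗ e.symm.toLinearMap
  have hL : ∀ v, L (p.toLin v) = f.toLin v := fun v => by
    have : e.symm (p.toLin v) = (LinearMap.ker p.toLin).mkQ v :=
      (LinearEquiv.symm_apply_eq e).2 rfl
    simp only [L, LinearMap.comp_apply, LinearEquiv.coe_coe, this]
    exact Submodule.liftQ_apply _ _ _
  { toLin := L
    map_ρ := fun z v => by
      obtain ⟨v, rfl⟩ := hp v
      rw [← p.map_ρ, hL, hL, f.map_ρ]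
    map_b := fun v => by
      obtain ⟨v, rfl⟩ := hp v
      rw [← p.map_b, hL, hL, f.map_b] }

theorem comp_descOfSurjective (p : D ⟶ D') (hp : Function.Surjective p.toLin) (f : D ⟶ D'')
    (h : LinearMap.ker p.toLin ≤ LinearMap.ker f.toLin) : p ≫ descOfSurjective p hp f h = f := by
  ext v
  have : (p.toLin.quotKerEquivOfSurjective hp).symm (p.toLin v) =
      (LinearMap.ker p.toLin).mkQ v := (LinearEquiv.symm_apply_eq _).2 rfl
  change (LinearMap.ker p.toLin).liftQ f.toLin h
    ((p.toLin.quotKerEquivOfSurjective hp).symm (p.toLin v)) = _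
  rw [this]
  exact Submodule.liftQ_apply _ _ _

end sub

section limits

open Limits

/-- The kernel of a morphism. -/
def ker (f : D ⟶ D') : Dat := D.sub (LinearMap.ker f.toLin)
  (fun z v hv => by rw [LinearMap.mem_ker] at hv ⊢; rw [f.map_ρ, hv, map_zero])
  (fun v hv => by rw [LinearMap.mem_ker] at hv ⊢; rw [f.map_b, hv, map_zero])

/-- The inclusion of the kernel. -/
def kerι (f : D ⟶ D') : ker f ⟶ D := subι _ _ _

theorem kerι_injective (f : D ⟶ D') : Function.Injective (kerι f).toLin :=
  Submodule.subtype_injective _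

theorem range_kerι (f : D ⟶ D') : LinearMap.range (kerι f).toLin = LinearMap.ker f.toLin :=
  Submodule.range_subtype _

theorem kerι_comp (f : D ⟶ D') : kerι f ≫ f = 0 := by
  ext v
  exact v.2

/-- The cokernel of a morphism. -/
def coker (f : D ⟶ D') : Dat := D'.quot (LinearMap.range f.toLin)
  (by rintro z _ ⟨v, rfl⟩; exact ⟨_, f.map_ρ z v⟩) (by rintro _ ⟨v, rfl⟩; exact ⟨_, f.map_b v⟩)

/-- The projection to the cokernel. -/
def cokerπ (f : D ⟶ D') : D' ⟶ coker f := quotπ _ _ _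

theorem cokerπ_surjective (f : D ⟶ D') : Function.Surjective (cokerπ f).toLin :=
  Submodule.mkQ_surjective _

theorem ker_cokerπ (f : D ⟶ D') : LinearMap.ker (cokerπ f).toLin = LinearMap.range f.toLin :=
  Submodule.ker_mkQ _

theorem comp_cokerπ (f : D ⟶ D') : f ≫ cokerπ f = 0 := by
  ext v
  exact (Submodule.Quotient.mk_eq_zero _).2 ⟨v, rfl⟩

theorem mono_of_injective (i : D ⟶ D') (hi : Function.Injective i.toLin) : Mono i :=
  ⟨fun g h hgh => by
    ext v
    exact hi (LinearMap.congr_fun (congrArg Hom.toLin hgh) v)⟩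

theorem epi_of_surjective (i : D ⟶ D') (hi : Function.Surjective i.toLin) : Epi i :=
  ⟨fun g h hgh => by
    ext v
    obtain ⟨v, rfl⟩ := hi v
    exact LinearMap.congr_fun (congrArg Hom.toLin hgh) v⟩

theorem injective_of_mono (i : D ⟶ D') [Mono i] : Function.Injective i.toLin := by
  have h : kerι i = 0 := by rw [← cancel_mono i, kerι_comp, zero_comp]
  refine LinearMap.ker_eq_bot.1 ((Submodule.eq_bot_iff _).2 fun v hv => ?_)
  exact LinearMap.congr_fun (congrArg Hom.toLin h) ⟨v, hv⟩

theorem surjective_of_epi (i : D ⟶ D') [Epi i] : Function.Surjective i.toLin := by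
  have h : cokerπ i = 0 := by rw [← cancel_epi i, comp_cokerπ, comp_zero]
  refine LinearMap.range_eq_top.1 ?_
  rw [← ker_cokerπ, h]
  exact LinearMap.ker_zero

/-- An injective morphism is a kernel of any morphism whose kernel is its range. -/
def isKernel (i : D ⟶ D') (g : D' ⟶ D'') (hi : Function.Injective i.toLin)
    (h : LinearMap.ker g.toLin = LinearMap.range i.toLin) (w : i ≫ g = 0) :
    IsLimit (KernelFork.ofι i w) :=
  KernelFork.IsLimit.ofι i w
    (fun f hf => liftOfInjective i hi f fun v => by
      rw [← h]
      exact LinearMap.congr_fun (congrArg Hom.toLin hf) v)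
    (fun f hf => liftOfInjective_comp i hi f _)
    (fun f hf m hm => by
      have := mono_of_injective i hi
      rw [← cancel_mono i, hm, liftOfInjective_comp])

/-- A surjective morphism is a cokernel of any morphism whose range is its kernel. -/
def isCokernel (g : D ⟶ D') (p : D' ⟶ D'') (hp : Function.Surjective p.toLin)
    (h : LinearMap.ker p.toLin = LinearMap.range g.toLin) (w : g ≫ p = 0) :
    IsColimit (CokernelCofork.ofπ p w) :=
  CokernelCofork.IsColimit.ofπ p w
    (fun f hf => descOfSurjective p hp f (by
      rw [h]
      rintro _ ⟨v, rfl⟩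
      exact LinearMap.congr_fun (congrArg Hom.toLin hf) v))
    (fun f hf => comp_descOfSurjective p hp f _)
    (fun f hf m hm => by
      have := epi_of_surjective p hp
      rw [← cancel_epi p, hm, comp_descOfSurjective])

instance : HasKernels Dat :=
  ⟨fun {_ _} f => ⟨⟨⟨_, isKernel (kerι f) f (kerι_injective f) (range_kerι f).symm (kerι_comp f)⟩⟩⟩⟩

instance : HasCokernels Dat :=
  ⟨fun {_ _} f => ⟨⟨⟨_, isCokernel f (cokerπ f) (cokerπ_surjective f) (ker_cokerπ f)
    (comp_cokerπ f)⟩⟩⟩⟩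

instance : IsNormalMonoCategory Dat :=
  ⟨fun {_ _} f _ => ⟨⟨coker f, cokerπ f, comp_cokerπ f,
    isKernel f (cokerπ f) (injective_of_mono f) (ker_cokerπ f) _⟩⟩⟩

instance : IsNormalEpiCategory Dat :=
  ⟨fun {_ _} f _ => ⟨⟨ker f, kerι f, kerι_comp f,
    isCokernel (kerι f) f (surjective_of_epi f) (range_kerι f).symm _⟩⟩⟩

/-- The product representation. -/
def piρ {n : ℕ} (D : Fin n → Dat) : Representation ℝ ℂˣ (∀ i, D i) where
  toFun z := LinearMap.pi fun i => (D i).ρ z ∘ₗ LinearMap.proj i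
  map_one' := by ext v; simp
  map_mul' z w := by ext v; simp

theorem piρ_regular {n : ℕ} (D : Fin n → Dat) (v : ∀ i, D i) :
    IsRegularMap fun z => piρ D z v := by
  classical
  have h : ∀ s : Finset (Fin n), IsRegularMap fun z => ∑ i ∈ s,
      LinearMap.single ℝ (fun i => (D i : Type)) i ((D i).ρ z (v i)) := by
    intro s
    induction s using Finset.induction_on with
    | empty => simpa using isRegularMap_zero
    | insert i s hi ih =>
      simp only [Finset.sum_insert hi]
      exact (((D i).ρ_regular (v i)).map _).add ih
  refine (congrArg IsRegularMap ?_).mp (h Finset.univ)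
  funext z
  exact LinearMap.sum_single_apply _ _

theorem single_piρ {n : ℕ} (D : Fin n → Dat) (i : Fin n) (z : ℂˣ) (v : D i) :
    LinearMap.single ℝ (fun i => (D i : Type)) i ((D i).ρ z v) =
      piρ D z (LinearMap.single ℝ (fun i => (D i : Type)) i v) := by
  ext j
  by_cases hij : j = i
  · subst hij; simp [piρ]
  · simp [piρ, hij]

/-- The product operator. -/
def piB {n : ℕ} (D : Fin n → Dat) : (∀ i, D i) →ₗ[ℝ] (∀ i, D i) :=
  LinearMap.pi fun i => (D i).b ∘ₗ LinearMap.proj i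

theorem piB_baseChange {n : ℕ} (D : Fin n → Dat) : (piB D).baseChange ℂ =
    ∑ i, (LinearMap.single ℝ (fun i => (D i : Type)) i).baseChange ℂ ∘ₗ
      (D i).b.baseChange ℂ ∘ₗ (LinearMap.proj (φ := fun i => (D i : Type)) i).baseChange ℂ := by
  refine cplx_ext fun v => ?_
  rw [LinearMap.sum_apply]
  simp only [LinearMap.comp_apply, baseChange_ofR]
  rw [← map_sum]
  exact congrArg _ (LinearMap.sum_single_apply (fun i => (D i : Type)) (piB D v)).symm

theorem piB_mem {n : ℕ} (D : Fin n → Dat) :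
    (piB D).baseChange ℂ ∈ wtSub (Representation.linHom (cplx (piρ D)) (cplx (piρ D))) negSet := by
  have hd := isDiag_cplx (piρ_regular D)
  rw [piB_baseChange]
  refine Submodule.sum_mem _ fun i _ => ?_
  refine mem_wtSub_linHom (isDiag_linHom hd hd) hd hd fun a v hv => ?_
  have h2 : (LinearMap.proj (φ := fun i => (D i : Type)) i).baseChange ℂ v ∈
      wt (cplx (D i).ρ) a := map_mem_wt (ρ := cplx (piρ D)) (ρ' := cplx (D i).ρ)
        (baseChange_equivariant (ρ := piρ D) (ρ' := (D i).ρ) fun z v => rfl) hv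
  rw [← wtSub_singleton] at h2
  have h3 := apply_mem_wtSub (T := {c | c - a ∈ negSet})
    (by rintro c hc _ rfl; simpa using hc) (D i).b_mem h2
  exact map_mem_wtSub (ρ := cplx (D i).ρ) (ρ' := cplx (piρ D))
    (baseChange_equivariant (single_piρ D i)) h3

/-- The direct sum of a finite family of objects. -/
def pi {n : ℕ} (D : Fin n → Dat) : Dat where
  carrier := ∀ i, D i
  ρ := piρ D
  ρ_regular := piρ_regular D
  b := piB D
  b_mem := piB_mem D

/-- The projections of a direct sum. -/
def piProj {n : ℕ} (D : Fin n → Dat) (i : Fin n) : pi D ⟶ D i where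
  toLin := LinearMap.proj i
  map_ρ _ _ := rfl
  map_b _ := rfl

/-- The morphism to a direct sum with given components. -/
def piLift {n : ℕ} {D : Fin n → Dat} (f : ∀ i, D' ⟶ D i) : D' ⟶ pi D where
  toLin := LinearMap.pi fun i => (f i).toLin
  map_ρ z v := by
    funext i
    exact (f i).map_ρ z v
  map_b v := by
    funext i
    exact (f i).map_b v

instance : HasFiniteProducts Dat :=
  ⟨fun n => by
    have h : ∀ D : Fin n → Dat, HasProduct D := fun D =>
      ⟨⟨⟨Fan.mk (pi D) (piProj D), Fan.IsLimit.mk _ (fun s => piLift s.proj)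
        (fun s i => rfl) (fun s m hm => by
          ext v
          funext i
          exact LinearMap.congr_fun (congrArg Hom.toLin (hm i)) v)⟩⟩⟩
    exact ⟨fun K => hasLimit_of_iso (Discrete.natIsoFunctor (F := K)).symm⟩⟩

instance : Abelian Dat where

end limits

end Dat

namespace EqConn

section free

variable {V : Type} [AddCommGroup V] [Module ℝ V]

/-- The action on functions with values in a representation. -/
def freeρ (ρ : Representation ℝ ℂˣ V) : Representation ℝ ℂˣ (Poly ⊗[ℝ] V) where
  toFun z := TensorProduct.map (act z).toLinearMap (ρ z)
  map_one' := by
    refine TensorProduct.ext' fun f v => ?_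
    simp [act_one]
  map_mul' z w := by
    refine TensorProduct.ext' fun f v => ?_
    simp [act_mul]

theorem freeρ_tmul (ρ : Representation ℝ ℂˣ V) (z : ℂˣ) (f : Poly) (v : V) :
    freeρ ρ z (f ⊗ₜ v) = act z f ⊗ₜ ρ z v := rfl

/-- Partial derivatives of functions with values in a vector space. -/
def freeNabla (V : Type) [AddCommGroup V] [Module ℝ V] (i : Fin 2) :
    (Poly ⊗[ℝ] V) →ₗ[ℝ] (Poly ⊗[ℝ] V) :=
  LinearMap.rTensor V (MvPolynomial.pderiv i).toLinearMap

theorem freeNabla_tmul (i : Fin 2) (f : Poly) (v : V) :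
    freeNabla V i (f ⊗ₜ v) = MvPolynomial.pderiv i f ⊗ₜ v := rfl

/-- The trivial bundle attached to a representation, with the trivial connection. -/
def free (ρ : Representation ℝ ℂˣ V) (hρ : ∀ v, IsRegularMap fun z => ρ z v) : EqConn where
  carrier := Poly ⊗[ℝ] V
  ρ := freeρ ρ
  ρ_smul z f m := by
    induction m with
    | zero => simp
    | add x y hx hy => simp only [smul_add, map_add, hx, hy]
    | tmul g v => simp [freeρ_tmul, TensorProduct.smul_tmul']
  ρ_regular m := by
    induction m with
    | zero => simpa using isRegularMap_zero
    | add x y hx hy => simpa using hx.add hy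
    | tmul g v => exact (act_regular g).bilin (hρ v) (TensorProduct.mk ℝ Poly V)
  nabla := freeNabla V
  leibniz i f m := by
    induction m with
    | zero => simp
    | add x y hx hy =>
      simp only [smul_add, map_add, hx, hy]
      abel
    | tmul g v =>
      simp only [TensorProduct.smul_tmul', freeNabla_tmul, Derivation.leibniz, smul_eq_mul,
        TensorProduct.add_tmul]
      rw [add_comm, mul_comm g]
  invariant z m := by
    funext i
    simp only [formAct, LinearMap.pi_apply, LinearMap.sum_apply, LinearMap.smul_apply,
      LinearMap.comp_apply, LinearMap.proj_apply]
    induction m with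
    | zero => simp
    | add x y hx hy => simp only [map_add, hx, hy, smul_add, Finset.sum_add_distrib]
    | tmul g v =>
      simp only [freeρ_tmul, freeNabla_tmul, pderiv_act, TensorProduct.sum_tmul,
        TensorProduct.smul_tmul']

end free

section withConn

/-- The functions `-y`, `x`. -/
def rot : Fin 2 → Poly := ![-MvPolynomial.X 1, MvPolynomial.X 0]

theorem sum_jac_act_rot (z : ℂˣ) (i : Fin 2) :
    ∑ j, jac z i j • act z (rot j) = Complex.normSq ((z⁻¹ : ℂˣ) : ℂ) • rot i := by
  have h : (Complex.normSq ((z⁻¹ : ℂˣ) : ℂ)) = ((z⁻¹ : ℂˣ) : ℂ).re * ((z⁻¹ : ℂˣ) : ℂ).re +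
    ((z⁻¹ : ℂˣ) : ℂ).im * ((z⁻¹ : ℂˣ) : ℂ).im := Complex.normSq_apply _
  rw [h, show jac z = !![((z⁻¹ : ℂˣ) : ℂ).re, ((z⁻¹ : ℂˣ) : ℂ).im;
    -((z⁻¹ : ℂˣ) : ℂ).im, ((z⁻¹ : ℂˣ) : ℂ).re] from rfl]
  have h0 : act z (rot 0) = -(MvPolynomial.C ((z⁻¹ : ℂˣ) : ℂ).im * MvPolynomial.X 0 +
      MvPolynomial.C ((z⁻¹ : ℂˣ) : ℂ).re * MvPolynomial.X 1) := by
    simp only [rot, Matrix.cons_val_zero, map_neg, act_X, Fin.sum_univ_two]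
    rfl
  have h1 : act z (rot 1) = MvPolynomial.C ((z⁻¹ : ℂˣ) : ℂ).re * MvPolynomial.X 0 +
      MvPolynomial.C (-((z⁻¹ : ℂˣ) : ℂ).im) * MvPolynomial.X 1 := by
    simp only [rot, Matrix.cons_val_one, Matrix.cons_val_fin_one, act_X, Fin.sum_univ_two]
    rfl
  rw [Fin.sum_univ_two, h0, h1]
  generalize ((z⁻¹ : ℂˣ) : ℂ).re = r
  generalize ((z⁻¹ : ℂˣ) : ℂ).im = s
  fin_cases i <;> simp [rot, MvPolynomial.smul_eq_C_mul] <;> ring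

/-- Adding the form `B · (x dy - y dx)` to a connection. -/
def withConn (E : EqConn) (B : E →ₗ[Poly] E)
    (hB : ∀ z m, B (E.ρ z m) = Complex.normSq ((z⁻¹ : ℂˣ) : ℂ) • E.ρ z (B m)) : EqConn where
  carrier := E
  ρ := E.ρ
  ρ_smul := E.ρ_smul
  ρ_regular := E.ρ_regular
  nabla i := E.nabla i + E.smulBil (fn (rot i)) ∘ₗ B.restrictScalars ℝ
  leibniz i f m := by
    simp only [LinearMap.add_apply, E.leibniz, LinearMap.comp_apply,
      LinearMap.restrictScalars_apply, map_smul, smulBil_fn, smul_add, smul_comm (rot i) f]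
    abel
  invariant z m := by
    funext i
    have h1 := E.nabla_ρ i z m
    have h2 : ∑ j, jac z i j • act z (rot j) • E.ρ z (B m) = rot i • B (E.ρ z m) := by
      rw [hB, smul_comm (rot i), ← smul_assoc, ← sum_jac_act_rot, Finset.sum_smul]
      simp only [smul_assoc]
    simp only [formAct, LinearMap.pi_apply, LinearMap.sum_apply, LinearMap.smul_apply,
      LinearMap.comp_apply, LinearMap.proj_apply, LinearMap.add_apply, map_add, smul_add,
      Finset.sum_add_distrib, smulBil_fn, LinearMap.restrictScalars_apply, E.ρ_smul]
    rw [h1, h2]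

theorem withConn_euler (E : EqConn) (B : E →ₗ[Poly] E)
    (hB : ∀ z m, B (E.ρ z m) = Complex.normSq ((z⁻¹ : ℂˣ) : ℂ) • E.ρ z (B m)) (m : E) :
    (E.withConn B hB).euler m = E.euler m := by
  change (MvPolynomial.X 0 : Poly) • (E.nabla 0 m + rot 0 • B m) +
    (MvPolynomial.X 1 : Poly) • (E.nabla 1 m + rot 1 • B m) = _
  rw [euler_apply]
  simp only [rot, Matrix.cons_val_zero, Matrix.cons_val_one, smul_add, neg_smul, smul_neg,
    smul_smul, mul_comm (MvPolynomial.X 1 : Poly)]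
  abel

end withConn

section symbol

/-- Evaluation of complex functions at the point `1`. -/
def evalOne : (ℂ ⊗[ℝ] unit) →ₗ[ℂ] ℂ :=
  LinearMap.liftBaseChange ℂ (Complex.ofRealCLM.toLinearMap ∘ₗ
    (MvPolynomial.aeval (R := ℝ) (pt 1)).toLinearMap : unit →ₗ[ℝ] ℂ)

theorem evalOne_ofR (f : Poly) : evalOne (ofR unit (fn f)) = (MvPolynomial.eval (pt 1) f : ℝ) := by
  rw [evalOne, ofR_apply, LinearMap.liftBaseChange_tmul, one_smul]
  rfl

theorem evalOne_mul (f g : ℂ ⊗[ℝ] unit) :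
    evalOne (cbil unit.smulBil f g) = evalOne f * evalOne g := by
  refine LinearMap.congr_fun₂ (f := (cbil unit.smulBil).compr₂ evalOne)
    (g := (LinearMap.mul ℂ ℂ).compl₁₂ evalOne evalOne) (cplx_ext₂ fun f g => ?_) f g
  change evalOne (cbil unit.smulBil (ofR unit f) (ofR unit g)) =
    evalOne (ofR unit f) * evalOne (ofR unit g)
  rw [cbil_ofR]
  refine (evalOne_ofR ((show Poly from f) * (show Poly from g))).trans ?_
  rw [map_mul, Complex.ofReal_mul]
  exact congrArg₂ _ (evalOne_ofR f).symm (evalOne_ofR g).symm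

theorem exists_evalOne (k l : ℕ) : ∃ w ∈ wt (cplx unit.ρ) ((k : ℤ), (l : ℤ)), evalOne w = 1 := by
  have ht : evalOne tau = 1 := by
    rw [tau, map_add, map_smul, evalOne_ofR, evalOne_ofR]
    simp [pt]
  have ht' : evalOne (FiltSpace.conj unit tau) = 1 := by
    rw [conj_eq, reC_tau, imC_tau, map_sub, map_smul, evalOne_ofR, evalOne_ofR]
    simp [pt]
  have hstep : ∀ {a b : ℤ × ℤ} {v w : ℂ ⊗[ℝ] unit}, v ∈ wt (cplx unit.ρ) a →
      w ∈ wt (cplx unit.ρ) b → cbil unit.smulBil v w ∈ wt (cplx unit.ρ) (a + b) :=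
    fun hv hw => bilin_mem_wt (cbil_equivariant (smulBil_equivariant unit)) hv hw
  induction k with
  | zero =>
    induction l with
    | zero =>
      refine ⟨ofR unit (fn 1), mem_wt.2 fun z => ?_, by simp [evalOne_ofR]⟩
      rw [cplx_apply, baseChange_ofR, unit_ρ_fn, map_one]
      simp [chi_apply]
    | succ l ih =>
      obtain ⟨w, hw, hw'⟩ := ih
      refine ⟨_, ?_, (evalOne_mul w (FiltSpace.conj unit tau)).trans (by rw [hw', ht', one_mul])⟩
      simpa using hstep hw conj_tau_mem_wt
  | succ k ih =>
    obtain ⟨w, hw, hw'⟩ := ih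
    refine ⟨_, ?_, (evalOne_mul w tau).trans (by rw [hw', ht, one_mul])⟩
    simpa using hstep hw tau_mem_wt

variable {V : Type} [AddCommGroup V] [Module ℝ V] [FiniteDimensional ℝ V]
  (ρ : Representation ℝ ℂˣ V) (hρ : ∀ v, IsRegularMap fun z => ρ z v)

/-- The product of a function and a vector. -/
def freeMk : unit →ₗ[ℝ] V →ₗ[ℝ] free ρ hρ := TensorProduct.mk ℝ Poly V

/-- Evaluation at `1`. -/
def freeEv : free ρ hρ →ₗ[ℝ] V := evT V (pt 1)

theorem freeEv_cbil (w : ℂ ⊗[ℝ] unit) (v : ℂ ⊗[ℝ] V) :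
    (freeEv ρ hρ).baseChange ℂ (cbil (freeMk ρ hρ) w v) = evalOne w • v := by
  refine LinearMap.congr_fun₂ (f := (cbil (freeMk ρ hρ)).compr₂ ((freeEv ρ hρ).baseChange ℂ))
    (g := LinearMap.lsmul ℂ (ℂ ⊗[ℝ] V) ∘ₗ evalOne) (cplx_ext₂ fun f v => ?_) w v
  change (freeEv ρ hρ).baseChange ℂ (cbil (freeMk ρ hρ) (ofR unit f) (ofR V v)) =
    evalOne (ofR unit f) • ofR V v
  have h : evalOne (ofR unit f) = ((MvPolynomial.eval (pt 1) (show Poly from f) : ℝ) : ℂ) :=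
    evalOne_ofR f
  rw [cbil_ofR, baseChange_ofR, h, ← ofR_smul]
  exact congrArg _ (evT_tmul (pt 1) f v)

/-- The complex operators that are values at `1` of operators of type `(-1, -1)`. -/
def symbols : Submodule ℂ ((ℂ ⊗[ℝ] V) →ₗ[ℂ] (ℂ ⊗[ℝ] V)) where
  carrier := {N | ∃ β : (ℂ ⊗[ℝ] V) →ₗ[ℂ] (ℂ ⊗[ℝ] (free ρ hρ)),
    (∀ z v, β (cplx ρ z v) = (Complex.normSq ((z⁻¹ : ℂˣ) : ℂ) : ℂ) • cplx (free ρ hρ).ρ z (β v)) ∧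
      (freeEv ρ hρ).baseChange ℂ ∘ₗ β = N}
  zero_mem' := ⟨0, by simp, by simp⟩
  add_mem' := by
    rintro _ _ ⟨β, h, rfl⟩ ⟨β', h', rfl⟩
    refine ⟨β + β', fun z v => ?_, by rw [LinearMap.comp_add]⟩
    simp only [LinearMap.add_apply, h, h', map_add, smul_add]
  smul_mem' := by
    rintro c _ ⟨β, h, rfl⟩
    refine ⟨c • β, fun z v => ?_, by rw [LinearMap.comp_smul]⟩
    simp only [LinearMap.smul_apply, h, map_smul]
    rw [smul_comm]

theorem wtSub_negSet_le_symbols :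
    wtSub (Representation.linHom (cplx ρ) (cplx ρ)) negSet ≤ symbols ρ hρ := by
  refine wtSub_le fun c hc N hN => ?_
  obtain ⟨w, hw, hw1⟩ := exists_evalOne (-c.1 - 1).toNat (-c.2 - 1).toNat
  refine ⟨cbil (freeMk ρ hρ) w ∘ₗ N, fun z v => ?_, ?_⟩
  · have h1 : cplx ρ z (N v) = chi c z • N (cplx ρ z v) := by
      rw [← linHom_apply_apply, mem_wt.1 hN]
      rfl
    have h2 := cbil_equivariant (ρ := unit.ρ) (ρ' := ρ) (ρ'' := (free ρ hρ).ρ)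
      (β := freeMk ρ hρ) (fun z f v => rfl) z w (N v)
    rw [mem_wt.1 hw, h1, map_smul, map_smul, LinearMap.smul_apply, smul_smul] at h2
    rw [LinearMap.comp_apply, LinearMap.comp_apply, ← h2, smul_smul]
    have h3 : (Complex.normSq ((z⁻¹ : ℂˣ) : ℂ) : ℂ) = chi (1, 1) z := by
      rw [Complex.normSq_eq_conj_mul_self, mul_comm]
      simp [chi_apply]
    obtain ⟨hc1, hc2⟩ := hc
    rw [h3, ← chi_add, ← chi_add, Int.toNat_of_nonneg (by omega), Int.toNat_of_nonneg (by omega)]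
    have : ((1, 1) + (c + (-c.1 - 1, -c.2 - 1)) : ℤ × ℤ) = 0 := by
      ext <;> simp <;> omega
    rw [this]
    simp [chi_apply]
  · refine LinearMap.ext fun v => ?_
    rw [LinearMap.comp_apply, LinearMap.comp_apply, freeEv_cbil, hw1, one_smul]

theorem exists_symbol (b : V →ₗ[ℝ] V)
    (hb : b.baseChange ℂ ∈ wtSub (Representation.linHom (cplx ρ) (cplx ρ)) negSet) :
    ∃ B : free ρ hρ →ₗ[Poly] free ρ hρ,
      (∀ z m, B ((free ρ hρ).ρ z m) = Complex.normSq ((z⁻¹ : ℂˣ) : ℂ) • (free ρ hρ).ρ z (B m)) ∧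
      ∀ v, freeEv ρ hρ (B ((1 : Poly) ⊗ₜ[ℝ] v)) = b v := by
  obtain ⟨β', h1, h2⟩ := wtSub_negSet_le_symbols ρ hρ hb
  let β : V →ₗ[ℝ] free ρ hρ := reC (free ρ hρ) ∘ₗ β'.restrictScalars ℝ ∘ₗ ofR V
  have hβ : ∀ z v, β (ρ z v) = Complex.normSq ((z⁻¹ : ℂˣ) : ℂ) • (free ρ hρ).ρ z (β v) := by
    intro z v
    change reC _ (β' (ofR V (ρ z v))) = Complex.normSq ((z⁻¹ : ℂˣ) : ℂ) • (free ρ hρ).ρ z (reC _ (β' (ofR V v)))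
    rw [← reC_baseChange, ← cplx_apply, ← map_smul, ← baseChange_ofR, ← cplx_apply, h1]
    congr 1
  let B : free ρ hρ →ₗ[Poly] free ρ hρ := LinearMap.liftBaseChange Poly β
  have hB : ∀ (f : Poly) (v : V), B (f ⊗ₜ[ℝ] v) = f • β v := fun f v =>
    LinearMap.liftBaseChange_tmul ..
  refine ⟨B, fun z m => ?_, fun v => ?_⟩
  · refine LinearMap.congr_fun (f := B.restrictScalars ℝ ∘ₗ (free ρ hρ).ρ z)
      (g := Complex.normSq ((z⁻¹ : ℂˣ) : ℂ) • ((free ρ hρ).ρ z ∘ₗ B.restrictScalars ℝ))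
      (TensorProduct.ext' fun f v => ?_) m
    change B (act z f ⊗ₜ[ℝ] ρ z v) = Complex.normSq ((z⁻¹ : ℂˣ) : ℂ) • (free ρ hρ).ρ z (B (f ⊗ₜ[ℝ] v))
    rw [hB, hB, hβ, (free ρ hρ).ρ_smul, smul_comm]
  · rw [hB, one_smul]
    change freeEv ρ hρ (reC _ (β' (ofR V v))) = b v
    rw [← reC_baseChange, ← LinearMap.comp_apply, h2, baseChange_ofR]
    simp [ofR_apply]

end symbol

end EqConn

namespace EqConn

section toDat

variable {E E' E'' : EqConn} [Module.Finite Poly E] [Module.Projective Poly E]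
  [Module.Finite Poly E'] [Module.Projective Poly E']
  [Module.Finite Poly E''] [Module.Projective Poly E'']

theorem radialρ_regular (u : E.radial) : IsRegularMap fun z => E.radialρ z u := by
  obtain ⟨L, hL⟩ := E.radial.subtype.exists_leftInverse_of_injective E.radial.ker_subtype
  have h := (E.ρ_regular u).map L
  refine (congrArg IsRegularMap ?_).mp h
  funext z
  exact LinearMap.congr_fun hL (E.radialρ z u)

/-- The linear data attached to a bundle: radially constant sections, with the value
of the connection form at the point `1`. -/
def toDat (E : EqConn) [Module.Finite Poly E] [Module.Projective Poly E] : Dat where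
  carrier := E.radial
  ρ := E.radialρ
  ρ_regular := radialρ_regular
  b := E.connOp
  b_mem := connOp_mem_negSet

/-- The map induced by a morphism on radially constant sections. -/
def Hom.mapRadial {E E' : EqConn} (f : Hom E E') : E.radial →ₗ[ℝ] E'.radial :=
  f.toReal.restrict fun u hu => by
    rw [mem_radial] at hu ⊢
    rw [Hom.toReal_apply, ← f.map_euler, hu, map_zero]

theorem Hom.coe_mapRadial (f : Hom E E') (u : E.radial) :
    (f.mapRadial u : E') = f.toLin (u : E) := rfl

theorem Hom.ev_toLin (f : Hom E E') (a : Fin 2 → ℝ) (m : E) :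
    E'.ev a (f.toLin m) = f.mapRadial (E.ev a m) := by
  refine LinearMap.congr_fun (f := E'.ev a ∘ₗ f.toReal) (g := f.mapRadial ∘ₗ E.ev a)
    (frame_ext fun g u => ?_) m
  rw [LinearMap.comp_apply, LinearMap.comp_apply, Hom.toReal_apply, map_smul, ev_smul, ev_smul,
    ev_coe, ← f.coe_mapRadial, ev_coe, map_smul]

theorem Hom.mapRadial_connOp (f : Hom E E') (u : E.radial) :
    f.mapRadial (E.connOp u) = E'.connOp (f.mapRadial u) := by
  rw [connOp_apply, connOp_apply, ← Hom.ev_toLin, f.map_nabla, f.coe_mapRadial]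

/-- The map induced by a morphism on linear data. -/
def toDatMap (f : E ⟶ E') : E.toDat ⟶ E'.toDat where
  toLin := Hom.mapRadial f
  map_ρ z u := Subtype.ext (f.map_ρ z (u : E.radial).1)
  map_b u := Hom.mapRadial_connOp f u

theorem toDatMap_injective : Function.Injective (toDatMap (E := E) (E' := E')) := by
  intro f g h
  ext m
  refine LinearMap.congr_fun (f := f.toReal) (g := g.toReal) (frame_ext fun p u => ?_) m
  have hu : f.toLin (u : E) = g.toLin (u : E) :=
    congrArg Subtype.val (LinearMap.congr_fun (congrArg Dat.Hom.toLin h) u)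
  rw [Hom.toReal_apply, Hom.toReal_apply, map_smul, map_smul, hu]

/-- A morphism of linear data extends to a morphism of bundles. -/
def ofDatMap (T : E.toDat ⟶ E'.toDat) : E ⟶ E' :=
  let T' : E.radial →ₗ[ℝ] E'.radial := T.toLin
  have hρ : ∀ z (u : E.radial), T' (E.radialρ z u) = E'.radialρ z (T' u) := T.map_ρ
  have hb : ∀ (u : E.radial), T' (E.connOp u) = E'.connOp (T' u) := T.map_b
  { toLin := extend T'
    map_ρ := fun z m => by
      refine LinearMap.congr_fun (f := (extend T').restrictScalars ℝ ∘ₗ E.ρ z)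
        (g := E'.ρ z ∘ₗ (extend T').restrictScalars ℝ) (frame_ext fun p u => ?_) m
      simp only [LinearMap.comp_apply, LinearMap.restrictScalars_apply]
      rw [E.ρ_smul, extend_smul_coe, E'.ρ_smul, ← coe_radialρ, extend_smul_coe, hρ, coe_radialρ]
    map_nabla := fun i m => by
      refine LinearMap.congr_fun (f := (extend T').restrictScalars ℝ ∘ₗ E.nabla i)
        (g := E'.nabla i ∘ₗ (extend T').restrictScalars ℝ) (frame_ext fun p u => ?_) m
      simp only [LinearMap.comp_apply, LinearMap.restrictScalars_apply]
      rw [E.leibniz, extend_smul_coe, E'.leibniz, map_add, map_smul (extend T') p,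
        extend_smul_coe]
      congr 2
      refine eq_of_ev fun a ha => ?_
      obtain ⟨z, rfl⟩ := exists_pt ha
      rw [ev_extend, ev_nabla, ev_nabla, map_smul, hρ, hb, hρ] }

theorem toDatMap_ofDatMap (T : E.toDat ⟶ E'.toDat) : toDatMap (ofDatMap T) = T := by
  ext u
  exact Subtype.ext (extend_coe _ u)

end toDat

end EqConn

instance (E : Bun) : Module.Finite Poly E.obj := E.property.1
instance (E : Bun) : Module.Projective Poly E.obj := E.property.2

/-- The functor sending a bundle to its linear data. -/
def bunToDat : Bun ⥤ Dat where
  obj E := E.obj.toDat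
  map f := EqConn.toDatMap f.hom
  map_id _ := rfl
  map_comp _ _ := rfl

instance : bunToDat.Faithful where
  map_injective h := ObjectProperty.hom_ext _ (EqConn.toDatMap_injective h)

instance : bunToDat.Full where
  map_surjective T := ⟨ObjectProperty.homMk (EqConn.ofDatMap T), EqConn.toDatMap_ofDatMap T⟩

instance : bunToDat.Additive where
  map_add := rfl

/-- Constructor for isomorphisms. -/
def Dat.mkIso {D D' : Dat} (e : D ≃ₗ[ℝ] D') (h₁ : ∀ z v, e (D.ρ z v) = D'.ρ z (e v))
    (h₂ : ∀ v, e (D.b v) = D'.b (e v)) : D ≅ D' where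
  hom := ⟨e, h₁, h₂⟩
  inv := ⟨e.symm, fun z m => by apply e.injective; simp [h₁],
    fun m => by apply e.injective; simp [h₂]⟩
  hom_inv_id := by ext; simp
  inv_hom_id := by ext; simp

section essSurj

variable {V : Type} [AddCommGroup V] [Module ℝ V] [FiniteDimensional ℝ V]
  {ρ : Representation ℝ ℂˣ V} {hρ : ∀ v, IsRegularMap fun z => ρ z v}
  {B : EqConn.free ρ hρ →ₗ[Poly] EqConn.free ρ hρ}
  {hB : ∀ z m, B ((EqConn.free ρ hρ).ρ z m) =
    Complex.normSq ((z⁻¹ : ℂˣ) : ℂ) • (EqConn.free ρ hρ).ρ z (B m)}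

instance : Module.Finite Poly ((EqConn.free ρ hρ).withConn B hB) :=
  inferInstanceAs (Module.Finite Poly (Poly ⊗[ℝ] V))

instance : Module.Projective Poly ((EqConn.free ρ hρ).withConn B hB) :=
  inferInstanceAs (Module.Projective Poly (Poly ⊗[ℝ] V))

/-- Constant sections are radially constant. -/
def constSection : V →ₗ[ℝ] ((EqConn.free ρ hρ).withConn B hB).radial :=
  (TensorProduct.mk ℝ Poly V 1).codRestrict _ fun v => by
    have h : ∀ i, (EqConn.free ρ hρ).nabla i ((TensorProduct.mk ℝ Poly V 1) v) =
        (0 : EqConn.free ρ hρ) := fun i => by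
      change MvPolynomial.pderiv i (1 : Poly) ⊗ₜ[ℝ] v = 0
      rw [MvPolynomial.pderiv_one, TensorProduct.zero_tmul]
    refine EqConn.mem_radial.2 ((EqConn.withConn_euler _ B hB _).trans
      ((EqConn.euler_apply _ _).trans ?_))
    refine (congrArg₂ (fun a b : EqConn.free ρ hρ => (MvPolynomial.X 0 : Poly) • a +
      (MvPolynomial.X 1 : Poly) • b) (h 0) (h 1)).trans ?_
    simp only [smul_zero, add_zero]
    rfl

theorem coe_constSection (v : V) :
    ((constSection (B := B) (hB := hB) v).1 : Poly ⊗[ℝ] V) = (1 : Poly) ⊗ₜ v := rfl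

theorem constSection_bijective : Function.Bijective (constSection (B := B) (hB := hB)) := by
  constructor
  · intro v w h
    have h1 := congrArg (fun u => EqConn.evT V 0 (u.1 : Poly ⊗[ℝ] V)) h
    simpa [coe_constSection] using h1
  · intro u
    have key : ∀ m : (EqConn.free ρ hρ).withConn B hB,
        ((EqConn.free ρ hρ).withConn B hB).radialPart m ∈
          LinearMap.range (constSection (B := B) (hB := hB)) := by
      intro m
      refine TensorProduct.induction_on (motive := fun m =>
        ((EqConn.free ρ hρ).withConn B hB).radialPart m ∈ _) m ?_ (fun f v => ?_) ?_
      · exact (map_zero (((EqConn.free ρ hρ).withConn B hB).radialPart)) ▸ Submodule.zero_mem _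
      · have h : ((f ⊗ₜ[ℝ] v : Poly ⊗[ℝ] V) : (EqConn.free ρ hρ).withConn B hB) =
            f • ((constSection (B := B) (hB := hB) v).1) := by
          rw [coe_constSection]
          change (f ⊗ₜ[ℝ] v : Poly ⊗[ℝ] V) = f • ((1 : Poly) ⊗ₜ[ℝ] v)
          rw [TensorProduct.smul_tmul', smul_eq_mul, mul_one]
        rw [h, EqConn.radialPart_smul, EqConn.radialPart_coe]
        exact Submodule.smul_mem _ _ ⟨v, rfl⟩
      · intro x y hx hy
        exact (map_add (((EqConn.free ρ hρ).withConn B hB).radialPart) x y) ▸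
          Submodule.add_mem _ hx hy
    have := key u
    rwa [EqConn.radialPart_coe] at this

theorem ev_constSection (a : Fin 2 → ℝ) (m : (EqConn.free ρ hρ).withConn B hB) :
    ((EqConn.free ρ hρ).withConn B hB).ev a m = constSection (EqConn.evT V a m) := by
  refine LinearMap.congr_fun (f := ((EqConn.free ρ hρ).withConn B hB).ev a)
    (g := constSection ∘ₗ EqConn.evT V a) (EqConn.frame_ext fun f u => ?_) m
  obtain ⟨v, rfl⟩ := constSection_bijective.2 u
  rw [EqConn.ev_smul, EqConn.ev_coe]
  have : EqConn.evT V a (f • ((1 : Poly) ⊗ₜ[ℝ] v)) = MvPolynomial.eval a f • v := by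
    rw [EqConn.evT_smul, EqConn.evT_tmul, map_one, one_smul]
  exact ((congrArg constSection this).trans (map_smul _ _ _)).symm

end essSurj

instance : bunToDat.EssSurj where
  mem_essImage D := by
    obtain ⟨B, hB, hb⟩ := EqConn.exists_symbol D.ρ D.ρ_regular D.b D.b_mem
    refine ⟨⟨(EqConn.free D.ρ D.ρ_regular).withConn B hB, inferInstance, inferInstance⟩, ⟨?_⟩⟩
    refine Iso.symm (Dat.mkIso (LinearEquiv.ofBijective (constSection (B := B) (hB := hB))
      constSection_bijective) (fun z v => ?_) fun v => ?_)
    · refine Subtype.ext ?_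
      change (1 : Poly) ⊗ₜ[ℝ] D.ρ z v = act z 1 ⊗ₜ[ℝ] D.ρ z v
      rw [map_one]
    · change constSection (D.b v) = EqConn.connOp _ (constSection v)
      rw [EqConn.connOp_apply, ev_constSection, ← hb]
      let c : EqConn.free D.ρ D.ρ_regular := (1 : Poly) ⊗ₜ[ℝ] v
      have h1 : (EqConn.free D.ρ D.ρ_regular).nabla 1 c = 0 := by
        change MvPolynomial.pderiv 1 (1 : Poly) ⊗ₜ[ℝ] v = 0
        rw [MvPolynomial.pderiv_one, TensorProduct.zero_tmul]
      have h2 : EqConn.freeEv D.ρ D.ρ_regular (EqConn.rot 1 • B c) =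
          MvPolynomial.eval (EqConn.pt 1) (EqConn.rot 1) • EqConn.freeEv D.ρ D.ρ_regular (B c) :=
        EqConn.evT_smul (EqConn.pt 1) (EqConn.rot 1) _
      refine congrArg constSection (?_ : EqConn.freeEv D.ρ D.ρ_regular (B c) =
        EqConn.freeEv D.ρ D.ρ_regular ((EqConn.free D.ρ D.ρ_regular).nabla 1 c +
          EqConn.rot 1 • B c))
      rw [h1, zero_add, h2]
      simp [EqConn.rot, EqConn.pt]

instance : bunToDat.IsEquivalence where

section lowering

variable {V V' V'' : Type} [AddCommGroup V] [Module ℝ V] [AddCommGroup V'] [Module ℝ V']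
  [AddCommGroup V''] [Module ℝ V'']

/-- The complex linear maps that lower the weight filtration by `-k`. -/
def lo (ρ : Representation ℝ ℂˣ V) (ρ' : Representation ℝ ℂˣ V') (k : ℤ) :
    Submodule ℂ ((ℂ ⊗[ℝ] V) →ₗ[ℂ] (ℂ ⊗[ℝ] V')) :=
  wtSub (Representation.linHom (cplx ρ) (cplx ρ')) (le k)

variable {ρ : Representation ℝ ℂˣ V} {ρ' : Representation ℝ ℂˣ V'} {ρ'' : Representation ℝ ℂˣ V''}

theorem lo_mono {k l : ℤ} (h : k ≤ l) : lo ρ ρ' k ≤ lo ρ ρ' l := wtSub_mono (le_mono h)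

theorem comp_mem_lo {k l m : ℤ} (h : k + l ≤ m) {N' : (ℂ ⊗[ℝ] V') →ₗ[ℂ] (ℂ ⊗[ℝ] V'')}
    {N : (ℂ ⊗[ℝ] V) →ₗ[ℂ] (ℂ ⊗[ℝ] V')} (hN' : N' ∈ lo ρ' ρ'' k) (hN : N ∈ lo ρ ρ' l) :
    N' ∘ₗ N ∈ lo ρ ρ'' m :=
  comp_mem_wtSub (fun a ha b hb => by
    rw [mem_le] at ha hb ⊢
    simp only [Prod.fst_add, Prod.snd_add]
    omega) hN' hN

theorem equivariant_mem_lo {N : (ℂ ⊗[ℝ] V) →ₗ[ℂ] (ℂ ⊗[ℝ] V')}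
    (hN : ∀ z v, N (cplx ρ z v) = cplx ρ' z (N v)) : N ∈ lo ρ ρ' 0 := by
  have h : N ∈ wt (Representation.linHom (cplx ρ) (cplx ρ')) 0 := mem_wt.2 fun z => by
    refine LinearMap.ext fun v => ?_
    obtain ⟨w, rfl⟩ : ∃ w, cplx ρ z w = v := ⟨cplx ρ z⁻¹ v, by
      rw [← Module.End.mul_apply, ← map_mul, mul_inv_cancel, map_one]; rfl⟩
    rw [linHom_apply_apply, LinearMap.smul_apply, hN]
    simp [chi_apply]
  exact wt_le_wtSub (by simp [mem_le]) h

theorem one_mem_lo : (1 : Module.End ℂ (ℂ ⊗[ℝ] V)) ∈ lo ρ ρ 0 :=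
  equivariant_mem_lo fun _ _ => rfl

theorem negSet_subset_le : negSet ⊆ le (-2) := fun a ha => by
  obtain ⟨h1, h2⟩ := ha
  rw [mem_le]
  omega

theorem pow_mem_lo {a : Module.End ℂ (ℂ ⊗[ℝ] V)} (ha : a ∈ lo ρ ρ (-2)) (n : ℕ) :
    a ^ n ∈ lo ρ ρ 0 := by
  induction n with
  | zero => exact one_mem_lo
  | succ n ih =>
    rw [pow_succ]
    exact comp_mem_lo (by norm_num) ih ha

theorem apply_mem_of_mem_lo {k l m : ℤ} (h : k + l ≤ m) {N : (ℂ ⊗[ℝ] V) →ₗ[ℂ] (ℂ ⊗[ℝ] V')}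
    (hN : N ∈ lo ρ ρ' k) {v : ℂ ⊗[ℝ] V} (hv : v ∈ wtSub (cplx ρ) (le l)) :
    N v ∈ wtSub (cplx ρ') (le m) :=
  apply_mem_wtSub (fun a ha b hb => by
    rw [mem_le] at ha hb ⊢
    simp only [Prod.fst_add, Prod.snd_add]
    omega) hN hv

/-- Exponentials of intertwined operators are intertwined. -/
theorem comp_exp {X X' : Type*} [AddCommGroup X] [Module ℂ X] [Module ℚ X] [SMulCommClass ℂ ℚ X]
    [AddCommGroup X'] [Module ℂ X'] [Module ℚ X'] [SMulCommClass ℂ ℚ X']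
    {a : Module.End ℂ X} {a' : Module.End ℂ X'} (ha : IsNilpotent a) (ha' : IsNilpotent a')
    {f : X →ₗ[ℂ] X'} (hf : ∀ v, f (a v) = a' (f v)) (v : X) :
    f (IsNilpotent.exp a v) = IsNilpotent.exp a' (f v) := by
  obtain ⟨k, hk⟩ := ha
  obtain ⟨k', hk'⟩ := ha'
  have h1 : a ^ (k + k') = 0 := by rw [pow_add, hk, zero_mul]
  have h2 : a' ^ (k + k') = 0 := by rw [pow_add, hk', mul_zero]
  rw [IsNilpotent.exp_eq_sum h1, IsNilpotent.exp_eq_sum h2, LinearMap.sum_apply,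
    LinearMap.sum_apply, map_sum]
  refine Finset.sum_congr rfl fun n _ => ?_
  have h : ∀ n : ℕ, f ((a ^ n) v) = (a' ^ n) (f v) := by
    intro n
    induction n with
    | zero => rfl
    | succ n ih =>
      rw [pow_succ', pow_succ', Module.End.mul_apply, Module.End.mul_apply, hf, ih]
  rw [LinearMap.smul_apply, LinearMap.smul_apply, map_rat_smul, h]

/-- The exponentials of two operators that are intertwined up to `δ` are intertwined
up to `δ` and lower order terms. -/
theorem comp_exp_sub_mem {a : Module.End ℂ (ℂ ⊗[ℝ] V)} {a' : Module.End ℂ (ℂ ⊗[ℝ] V')}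
    (ha : IsNilpotent a) (ha' : IsNilpotent a') (hal : a ∈ lo ρ ρ (-2)) (hal' : a' ∈ lo ρ' ρ' (-2))
    {f : (ℂ ⊗[ℝ] V) →ₗ[ℂ] (ℂ ⊗[ℝ] V')} {m : ℤ} (hδ : f ∘ₗ a - a' ∘ₗ f ∈ lo ρ ρ' (-m)) :
    f ∘ₗ IsNilpotent.exp a - IsNilpotent.exp a' ∘ₗ f - (f ∘ₗ a - a' ∘ₗ f) ∈
      lo ρ ρ' (-m - 1) := by
  obtain ⟨k, hk⟩ := ha
  obtain ⟨k', hk'⟩ := ha'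
  have h1 : a ^ (k + k' + 2) = 0 := by rw [add_assoc, pow_add, hk, zero_mul]
  have h2 : a' ^ (k + k' + 2) = 0 := by rw [add_comm k, add_assoc, pow_add, hk', zero_mul]
  let T : ℕ → ((ℂ ⊗[ℝ] V) →ₗ[ℂ] (ℂ ⊗[ℝ] V')) := fun n =>
    f ∘ₗ (a ^ n : Module.End ℂ (ℂ ⊗[ℝ] V)) - (a' ^ n : Module.End ℂ (ℂ ⊗[ℝ] V')) ∘ₗ f
  have hT : ∀ n, T (n + 1) = T n ∘ₗ a +
      (a' ^ n : Module.End ℂ (ℂ ⊗[ℝ] V')) ∘ₗ (f ∘ₗ a - a' ∘ₗ f) := by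
    intro n
    refine LinearMap.ext fun v => ?_
    simp only [T, LinearMap.sub_apply, LinearMap.comp_apply, LinearMap.add_apply, map_sub,
      pow_succ, Module.End.mul_apply]
    abel
  have hT0 : T 0 = 0 := sub_self _
  have hT1 : T 1 = f ∘ₗ a - a' ∘ₗ f := by rw [hT 0, hT0, LinearMap.zero_comp, zero_add]; rfl
  have hTm : ∀ n, T n ∈ lo ρ ρ' (-m) := by
    intro n
    induction n with
    | zero => rw [hT0]; exact Submodule.zero_mem _
    | succ n ih =>
      rw [hT]
      exact add_mem (comp_mem_lo (by omega) ih hal)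
        (comp_mem_lo (by omega) (pow_mem_lo hal' n) hδ)
  have hT2 : ∀ n, T (n + 2) ∈ lo ρ ρ' (-m - 1) := by
    intro n
    rw [hT, pow_succ]
    refine add_mem (comp_mem_lo (by omega) (hTm _) hal) ?_
    exact comp_mem_lo (k := -2) (l := -m) (by omega)
      (comp_mem_lo (by norm_num) (pow_mem_lo hal' n) hal') hδ
  have hsum : f ∘ₗ IsNilpotent.exp a - IsNilpotent.exp a' ∘ₗ f =
      ∑ n ∈ Finset.range (k + k' + 2), (n.factorial : ℚ)⁻¹ • T n := by
    refine LinearMap.ext fun v => ?_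
    rw [IsNilpotent.exp_eq_sum h1, IsNilpotent.exp_eq_sum h2, LinearMap.sub_apply,
      LinearMap.comp_apply, LinearMap.comp_apply, LinearMap.sum_apply, LinearMap.sum_apply,
      LinearMap.sum_apply, map_sum, ← Finset.sum_sub_distrib]
    refine Finset.sum_congr rfl fun n _ => ?_
    rw [LinearMap.smul_apply, LinearMap.smul_apply, LinearMap.smul_apply, map_rat_smul,
      ← smul_sub]
    rfl
  rw [hsum, Finset.sum_range_succ', Finset.sum_range_succ', hT0, ← hT1]
  simp only [zero_add, Nat.factorial_one, Nat.cast_one, inv_one, one_smul, smul_zero, add_zero,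
    add_sub_cancel_right]
  refine Submodule.sum_mem _ fun n _ => ?_
  exact Submodule.smul_of_tower_mem _ _ (hT2 n)

end lowering

section realStructure

variable {X : Type*} [AddCommGroup X] [Module ℂ X] {σ : Representation ℂ ℂˣ X}

/-- The types that do not lower the Hodge filtration. -/
def fSet : Set (ℤ × ℤ) := {a | 0 ≤ a.1}

/-- The types that do not lower the conjugate Hodge filtration. -/
def fbarSet : Set (ℤ × ℤ) := {a | 0 ≤ a.2}

variable (h : IsDiag σ) {c : X →ₛₗ[starRingEnd ℂ] X}

theorem conj_scale_ind (hc : ∀ z v, c (σ z v) = σ z (c v)) {S T : Set (ℤ × ℤ)} (hS : ∀ a, a ∈ T ↔ a.swap ∈ S) (v : X) :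
    c (scale h (ind S) v) = scale h (ind T) (c v) := by
  rw [semi_scale h h hc]
  congr 2
  funext a
  by_cases ha : a ∈ T
  · rw [ind_of_mem ha, ind_of_mem ((hS a).1 ha), map_one]
  · rw [ind_of_notMem ha, ind_of_notMem (mt (hS a).2 ha), map_zero]

theorem scale_add_scale (S : Set (ℤ × ℤ)) (v : X) :
    scale h (ind S) v + scale h (ind Sᶜ) v = v := by
  rw [← LinearMap.add_apply, ← scale_add]
  have : ind S + ind Sᶜ = 1 := by
    funext a
    by_cases ha : a ∈ S
    · simp [ind_of_mem ha, ind_of_notMem (Set.notMem_compl_iff.2 ha)]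
    · simp [ind_of_notMem ha, ind_of_mem (Set.mem_compl ha)]
  rw [this, scale_one]
  rfl

theorem scale_ind_mem {S : Set (ℤ × ℤ)} (v : X) : scale h (ind S) v ∈ wtSub σ S :=
  scale_mem_wtSub h (fun _ _ ha => ind_of_notMem ha) (h.mem_univ v)

theorem scale_ind_mem_of_mem {S T : Set (ℤ × ℤ)} {v : X} (hv : v ∈ wtSub σ T) :
    scale h (ind S) v ∈ wtSub σ (T ∩ S) :=
  scale_mem_wtSub h (fun _ haT ha => ind_of_notMem fun haS => ha (Set.mem_inter haT haS)) hv

/-- Decomposition of an operator into a real one, `I` times a real one that lowers both filtrations,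
and one preserving the Hodge filtration. -/
theorem exists_real_decomposition (h : IsDiag σ) (hc : ∀ z v, c (σ z v) = σ z (c v))
    (hcc : ∀ v, c (c v) = v) {m : ℤ} {N : X} (hN : N ∈ wtSub σ (le (-m))) :
    ∃ R β ε, c R = R ∧ c β = β ∧ R ∈ wtSub σ (le (-m)) ∧ β ∈ wtSub σ (le (-m)) ∧
      ε ∈ wtSub σ (le (-m)) ∧ β ∈ wtSub σ negSet ∧ ε ∈ wtSub σ fSet ∧
      N = R + Complex.I • β + ε := by
  have hcle : ∀ {v}, v ∈ wtSub σ (le (-m)) → c v ∈ wtSub σ (le (-m)) := fun hv =>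
    semi_mem_wtSub hc (fun a ha => swap_mem_le a ha) hv
  have hsle : ∀ {v} S, v ∈ wtSub σ (le (-m)) → scale h (ind S) v ∈ wtSub σ (le (-m)) :=
    fun S hv => wtSub_mono Set.inter_subset_left (scale_ind_mem_of_mem h hv)
  let P := scale h (ind fSet) N
  let N' := scale h (ind fSetᶜ) N
  let Q := scale h (ind fbarSet) N'
  let L := scale h (ind fbarSetᶜ) N'
  have hPm : P ∈ wtSub σ (le (-m)) := hsle _ hN
  have hQm : Q ∈ wtSub σ (le (-m)) := hsle _ (hsle _ hN)
  have hLm : L ∈ wtSub σ (le (-m)) := hsle _ (hsle _ hN)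
  have hL : L ∈ wtSub σ negSet := by
    refine wtSub_mono ?_ (scale_ind_mem_of_mem h (scale_ind_mem h N))
    rintro a ⟨h1, h2⟩
    simp only [Set.mem_compl_iff, fSet, fbarSet, Set.mem_ofPred_eq, not_le] at h1 h2
    exact ⟨h1, h2⟩
  have hcL : c L ∈ wtSub σ negSet := semi_mem_wtSub hc (fun a ha => (⟨ha.2, ha.1⟩ : a.swap.1 < 0 ∧ a.swap.2 < 0)) hL
  have hcQ : c Q ∈ wtSub σ fSet := semi_mem_wtSub hc (fun a (ha : a ∈ fbarSet) => ha)
    (scale_ind_mem h N')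
  have h2 : starRingEnd ℂ 2 = 2 := map_ofNat _ 2
  have hc2 : ∀ x : X, c ((1 / 2 : ℂ) • x) = (1 / 2 : ℂ) • c x := fun x => by
    rw [LinearMap.map_smulₛₗ]; simp [h2]
  have hcI : ∀ x : X, c ((-Complex.I / 2 : ℂ) • x) = (Complex.I / 2 : ℂ) • c x := fun x => by
    rw [LinearMap.map_smulₛₗ]; simp [h2]
  refine ⟨Q + c Q + (1 / 2 : ℂ) • (L + c L), (-Complex.I / 2 : ℂ) • (L - c L), P - c Q,
    ?_, ?_, ?_, ?_, ?_, ?_, ?_, ?_⟩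
  · rw [map_add, map_add, hc2, map_add, hcc, hcc, add_comm (c Q), add_comm (c L)]
  · rw [hcI, map_sub, hcc]
    module
  · exact add_mem (add_mem hQm (hcle hQm)) (Submodule.smul_mem _ _ (add_mem hLm (hcle hLm)))
  · exact Submodule.smul_mem _ _ (sub_mem hLm (hcle hLm))
  · exact sub_mem hPm (hcle hQm)
  · exact Submodule.smul_mem _ _ (sub_mem hL hcL)
  · exact sub_mem (scale_ind_mem h N) hcQ
  · have h1 : P + N' = N := scale_add_scale h fSet N
    have h2 : Q + L = N' := scale_add_scale h fbarSet N'
    rw [smul_smul, show Complex.I * (-Complex.I / 2) = 1 / 2 by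
      rw [mul_div_assoc', mul_neg, Complex.I_mul_I, neg_neg], ← h1, ← h2]
    module

/-- The decomposition is unique up to lower order terms. -/
theorem real_decomposition_unique (h : IsDiag σ) (hc : ∀ z v, c (σ z v) = σ z (c v)) {m : ℤ} (hm : 1 ≤ m) {R β ε : X} (hR : c R = R) (hβ : c β = β)
    (hRm : R ∈ wtSub σ (le (-m))) (hβm : β ∈ wtSub σ (le (-m))) (hεm : ε ∈ wtSub σ (le (-m)))
    (hβL : β ∈ wtSub σ negSet) (hεF : ε ∈ wtSub σ fSet)
    (hsum : R + Complex.I • β + ε ∈ wtSub σ (le (-m - 1))) :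
    R ∈ wtSub σ (le (-m - 1)) ∧ β ∈ wtSub σ (le (-m - 1)) ∧ ε ∈ wtSub σ (le (-m - 1)) := by
  let T : Set (ℤ × ℤ) := (le (-m - 1))ᶜ
  have hT : ∀ {v}, scale h (ind T) v = 0 → v ∈ wtSub σ (le (-m - 1)) := fun {v} hv => by
    rw [← scale_add_scale h (le (-m - 1)) v]
    change _ + scale h (ind T) v ∈ _
    rw [hv, add_zero]
    exact scale_ind_mem h v
  have hTz : ∀ {v}, v ∈ wtSub σ (le (-m - 1)) → scale h (ind T) v = 0 := fun hv =>
    scale_eq_zero h (fun a ha => ind_of_notMem (Set.notMem_compl_iff.2 ha)) hv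
  have hTm : ∀ {v S}, v ∈ wtSub σ (le (-m)) → v ∈ wtSub σ S →
      scale h (ind T) v ∈ wtSub σ ({a | a.1 + a.2 = -m} ∩ S) := fun {v S} hv hvS => by
    refine wtSub_mono ?_ (scale_ind_mem_of_mem h (mem_wtSub_inter h hv hvS))
    rintro a ⟨⟨h1, h2⟩, h3⟩
    simp only [T, Set.mem_compl_iff, mem_le] at h1 h3
    refine ⟨?_, h2⟩
    simp only [Set.mem_ofPred_eq]
    omega
  have hswap : ∀ a, a ∈ T ↔ a.swap ∈ T := fun a => by
    simp only [T, Set.mem_compl_iff, mem_le, Prod.fst_swap, Prod.snd_swap]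
    rw [add_comm]
  let R' := scale h (ind T) R
  let β' := scale h (ind T) β
  let ε' := scale h (ind T) ε
  have hR' : c R' = R' := by rw [conj_scale_ind h hc hswap, hR]
  have hβ' : c β' = β' := by rw [conj_scale_ind h hc hswap, hβ]
  have hβs := hTm hβm hβL
  have hεs := hTm hεm hεF
  have hRs := hTm hRm (h.mem_univ R)
  have hsum' : R' + Complex.I • β' + ε' = 0 := by
    have := hTz hsum
    rwa [map_add, map_add, map_smul] at this
  have hsumL : scale h (ind negSet) R' + Complex.I • β' = 0 := by
    have h1 := congrArg (scale h (ind negSet)) hsum'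
    rw [map_add, map_add, map_smul, map_zero] at h1
    rwa [(mem_wtSub_iff h).1 (wtSub_mono Set.inter_subset_right hβs),
      scale_eq_zero h (fun a ha => ind_of_notMem fun haL => ?_) hεs, add_zero] at h1
    exact absurd haL.1 (not_lt.2 ha.2)
  have hcL : c (scale h (ind negSet) R') = scale h (ind negSet) R' := by
    rw [conj_scale_ind h hc (S := negSet) (T := negSet) (fun a => and_comm), hR']
  have hβ0 : β' = 0 := by
    have h1 := congrArg c hsumL
    rw [map_add, hcL, LinearMap.map_smulₛₗ, hβ', map_zero, Complex.conj_I, neg_smul] at h1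
    have h2 : Complex.I • β' = 0 := by
      have : (2 : ℂ) • Complex.I • β' = 0 := by
        rw [two_smul]
        calc Complex.I • β' + Complex.I • β' = (scale h (ind negSet) R' + Complex.I • β') -
          (scale h (ind negSet) R' + -(Complex.I • β')) := by abel
          _ = 0 := by rw [hsumL, h1, sub_zero]
      exact (smul_eq_zero.1 this).resolve_left two_ne_zero
    exact (smul_eq_zero.1 h2).resolve_left Complex.I_ne_zero
  rw [hβ0, smul_zero, add_zero] at hsumL hsum'
  have hRF : R' ∈ wtSub σ ({a | a.1 + a.2 = -m} ∩ fSet) := by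
    rw [eq_neg_of_add_eq_zero_left hsum']
    exact neg_mem hεs
  have hR0 : R' = 0 := by
    have h1 : R' ∈ wtSub σ fbarSet := by
      rw [← hR']
      exact semi_mem_wtSub hc (fun a ha => ha.2) hRF
    have h2 := mem_wtSub_inter h hRF h1
    have h3 : ({a : ℤ × ℤ | a.1 + a.2 = -m} ∩ fSet) ∩ fbarSet = ∅ := by
      ext a
      simp only [fSet, fbarSet, Set.mem_inter_iff, Set.mem_ofPred_eq, Set.mem_empty_iff_false,
        iff_false]
      omega
    rw [h3, wtSub_empty] at h2
    exact (Submodule.mem_bot ℂ).1 h2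
  refine ⟨hT hR0, hT hβ0, hT ?_⟩
  rw [hR0, zero_add] at hsum'
  exact hsum'

end realStructure

namespace FiltSpace

section opposed

variable {K X : Type} [Field K] [AddCommGroup X] [Module K X]

theorem mkQ_mem_induced {A B G : Submodule K X} (x : A) :
    (B.submoduleOf A).mkQ x ∈ induced A B G ↔ (x : X) ∈ (G ⊓ A) ⊔ B := by
  constructor
  · rintro ⟨g, hg, hgx⟩
    have h : (x - g : A) ∈ B.submoduleOf A := (Submodule.Quotient.eq _).1 hgx.symm
    refine Submodule.mem_sup.2 ⟨g, ⟨hg, g.2⟩, _, h, ?_⟩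
    simp
  · intro h
    obtain ⟨g, ⟨hg, hgA⟩, b, hb, hgb⟩ := Submodule.mem_sup.1 h
    refine ⟨⟨g, hgA⟩, hg, (Submodule.Quotient.eq _).2 ?_⟩
    change g - (x : X) ∈ B
    rw [← hgb, sub_add_cancel_left]
    exact neg_mem hb

theorem subsingleton_gr_iff {A B : Submodule K X} : Subsingleton (Gr A B) ↔ A ≤ B := by
  rw [Submodule.Quotient.subsingleton_iff]
  exact Submodule.comap_subtype_eq_top

theorem subsingleton_gr_induced {C C' f f' : Submodule K X} :
    Subsingleton (Gr (induced C C' f) (induced C C' f')) ↔ f ⊓ C ≤ (f' ⊓ C) ⊔ C' := by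
  rw [subsingleton_gr_iff]
  constructor
  · intro h x hx
    exact (mkQ_mem_induced ⟨x, hx.2⟩).1 (h ((mkQ_mem_induced ⟨x, hx.2⟩).2
      (Submodule.mem_sup_left hx)))
  · intro h x hx
    obtain ⟨x, rfl⟩ := Submodule.mkQ_surjective _ x
    refine (mkQ_mem_induced x).2 ?_
    exact (sup_le h le_sup_right) ((mkQ_mem_induced x).1 hx)

theorem induced_inf_le_iff {T S F F' G G' : Submodule K X} (hS : S ≤ T) :
    induced T S F ⊓ induced T S G ≤ (induced T S F' ⊓ induced T S G) ⊔ induced T S G' ↔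
      ((F ⊓ T) ⊔ S) ⊓ ((G ⊓ T) ⊔ S) ≤
        (((F' ⊓ T) ⊔ S) ⊓ ((G ⊓ T) ⊔ S)) ⊔ ((G' ⊓ T) ⊔ S) := by
  have hle : ∀ F : Submodule K X, (F ⊓ T) ⊔ S ≤ T := fun F => sup_le inf_le_right hS
  constructor
  · intro h x hx
    have hxT : x ∈ T := hle F hx.1
    obtain ⟨y, hy, z, hz, hyz⟩ := Submodule.mem_sup.1 (h (x := (S.submoduleOf T).mkQ ⟨x, hxT⟩)
      ⟨(mkQ_mem_induced _).2 hx.1, (mkQ_mem_induced _).2 hx.2⟩)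
    obtain ⟨y, rfl⟩ := Submodule.mkQ_surjective _ y
    obtain ⟨z, rfl⟩ := Submodule.mkQ_surjective _ z
    rw [← map_add] at hyz
    have h1 : ((y + z - ⟨x, hxT⟩ : T) : X) ∈ S :=
      (Submodule.Quotient.eq (S.submoduleOf T)).1 hyz
    have hz' := (mkQ_mem_induced _).1 hz
    refine Submodule.mem_sup.2 ⟨y, ⟨(mkQ_mem_induced _).1 hy.1, (mkQ_mem_induced _).1 hy.2⟩,
      z - (y + z - x), sub_mem hz' (Submodule.mem_sup_right h1), by abel⟩
  · intro h x hx
    obtain ⟨x, rfl⟩ := Submodule.mkQ_surjective _ x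
    obtain ⟨y, hy, z, hz, hyz⟩ := Submodule.mem_sup.1 (h (x := (x : X))
      ⟨(mkQ_mem_induced _).1 hx.1, (mkQ_mem_induced _).1 hx.2⟩)
    have e : x = ⟨y, hle F' hy.1⟩ + ⟨z, hle G' hz⟩ := Subtype.ext hyz.symm
    rw [e, map_add]
    exact Submodule.add_mem_sup
      ⟨(mkQ_mem_induced _).2 hy.1, (mkQ_mem_induced _).2 hy.2⟩ ((mkQ_mem_induced _).2 hz)

end opposed

variable (V : FiltSpace)

/-- The inverse image in `W_n` of the subspace induced on `gr_n^W`. -/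
def onGr (G : Submodule ℂ (ℂ ⊗[ℝ] V)) (n : ℤ) : Submodule ℂ (ℂ ⊗[ℝ] V) :=
  (G ⊓ V.Wc n) ⊔ V.Wc (n - 1)

theorem Wc_mono : Monotone V.Wc := fun _ _ h => baseChange_le fun _ hv =>
  ofR_mem_baseChange (V.W_mono h hv)

theorem Fbar_anti : Antitone V.Fbar := fun _ _ h => Submodule.map_mono (V.F_anti h)

theorem subsingleton_grGrGr_iff (p q n : ℤ) : Subsingleton (V.GrGrGr p q n) ↔
    V.onGr (V.F p) n ⊓ V.onGr (V.Fbar q) n ≤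
      (V.onGr (V.F (p + 1)) n ⊓ V.onGr (V.Fbar q) n) ⊔ V.onGr (V.Fbar (q + 1)) n := by
  exact subsingleton_gr_induced.trans (induced_inf_le_iff (V.Wc_mono (by omega)))

theorem mem_Fbar {q : ℤ} {x : ℂ ⊗[ℝ] V} : x ∈ V.Fbar q ↔ conj V x ∈ V.F q := by
  constructor
  · rintro ⟨y, hy, rfl⟩
    rwa [conj_conj]
  · intro h
    exact ⟨_, h, conj_conj x⟩

theorem mem_onGr_Fbar {q n : ℤ} {x : ℂ ⊗[ℝ] V} :
    x ∈ V.onGr (V.Fbar q) n ↔ conj V x ∈ V.onGr (V.F q) n := by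
  constructor
  · intro h
    obtain ⟨y, ⟨hy, hyW⟩, z, hz, rfl⟩ := Submodule.mem_sup.1 h
    rw [map_add]
    exact Submodule.add_mem_sup ⟨V.mem_Fbar.1 hy, conj_mem_baseChange hyW⟩
      (conj_mem_baseChange hz)
  · intro h
    obtain ⟨y, ⟨hy, hyW⟩, z, hz, e⟩ := Submodule.mem_sup.1 h
    rw [← conj_conj x, ← e, map_add]
    exact Submodule.add_mem_sup ⟨V.mem_Fbar.2 (by rwa [conj_conj]), conj_mem_baseChange hyW⟩
      (conj_mem_baseChange hz)

end FiltSpace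

namespace Dat

variable (D : Dat) {D' : Dat}

/-- The complexified operator times `I`. -/
def ib : Module.End ℂ (ℂ ⊗[ℝ] D) := Complex.I • D.b.baseChange ℂ

theorem ib_mem : D.ib ∈ lo D.ρ D.ρ (-2) :=
  Submodule.smul_mem _ _ (wtSub_mono negSet_subset_le D.b_mem)

theorem isNilpotent_ib : IsNilpotent D.ib :=
  isNilpotent_of_mem_wtSub D.isDiag (lo_mono (by norm_num) D.ib_mem)

/-- The exponential of `i b`. -/
def G : Module.End ℂ (ℂ ⊗[ℝ] D) := IsNilpotent.exp D.ib

/-- The exponential of `- i b`. -/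
def Ginv : Module.End ℂ (ℂ ⊗[ℝ] D) := IsNilpotent.exp (-D.ib)

theorem G_Ginv (v : ℂ ⊗[ℝ] D) : D.G (D.Ginv v) = v :=
  LinearMap.congr_fun (IsNilpotent.exp_mul_exp_neg_self D.isNilpotent_ib) v

theorem Ginv_G (v : ℂ ⊗[ℝ] D) : D.Ginv (D.G v) = v :=
  LinearMap.congr_fun (IsNilpotent.exp_neg_mul_exp_self D.isNilpotent_ib) v

theorem exp_sub_one_mem {V : Type} [AddCommGroup V] [Module ℝ V] {ρ : Representation ℝ ℂˣ V}
    {a : Module.End ℂ (ℂ ⊗[ℝ] V)} (ha : IsNilpotent a) (hal : a ∈ lo ρ ρ (-2)) :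
    IsNilpotent.exp a - 1 ∈ lo ρ ρ (-1) := by
  have h := comp_exp_sub_mem (ρ := ρ) (ρ' := ρ) (f := 1) (m := 1) ha IsNilpotent.zero hal
    (Submodule.zero_mem _) (by
      rw [LinearMap.zero_comp, sub_zero]
      exact lo_mono (by norm_num) hal)
  have h2 : IsNilpotent.exp a - 1 = ((1 : Module.End ℂ (ℂ ⊗[ℝ] V)) ∘ₗ IsNilpotent.exp a -
      IsNilpotent.exp (0 : Module.End ℂ (ℂ ⊗[ℝ] V)) ∘ₗ 1 -
      ((1 : Module.End ℂ (ℂ ⊗[ℝ] V)) ∘ₗ a - (0 : Module.End ℂ (ℂ ⊗[ℝ] V)) ∘ₗ 1)) + a := by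
    rw [IsNilpotent.exp_zero, LinearMap.zero_comp, sub_zero]
    change _ = (1 * IsNilpotent.exp a - 1 * 1 - 1 * a) + a
    rw [one_mul, one_mul, one_mul, sub_add_cancel]
  rw [h2]
  exact add_mem (lo_mono (by norm_num) h) (lo_mono (by norm_num) hal)

theorem G_sub_one_mem : D.G - 1 ∈ lo D.ρ D.ρ (-1) := exp_sub_one_mem D.isNilpotent_ib D.ib_mem

theorem Ginv_sub_one_mem : D.Ginv - 1 ∈ lo D.ρ D.ρ (-1) :=
  exp_sub_one_mem D.isNilpotent_ib.neg (neg_mem D.ib_mem)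

theorem mem_lo_of_sub_one {V : Type} [AddCommGroup V] [Module ℝ V] {ρ : Representation ℝ ℂˣ V}
    {g : Module.End ℂ (ℂ ⊗[ℝ] V)} (hg : g - 1 ∈ lo ρ ρ (-1)) : g ∈ lo ρ ρ 0 := by
  rw [← sub_add_cancel g 1]
  exact add_mem (lo_mono (by norm_num) hg) one_mem_lo

/-- The filtered space attached to linear data: the Hodge filtration is the one defined
by the Hodge types, moved by `exp (i b)`. -/
def toFilt : FiltSpace where
  carrier := D
  W := wtW D.ρ
  F p := (wtSub (cplx D.ρ) {a | p ≤ a.1}).comap D.Ginv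
  W_mono := wtW_mono
  F_anti _ _ h := Submodule.comap_mono (wtSub_mono fun _ ha => le_trans h ha)

/-- The Hodge filtration. -/
def hodge (p : ℤ) : Submodule ℂ (ℂ ⊗[ℝ] D) := (wtSub (cplx D.ρ) {a | p ≤ a.1}).comap D.Ginv

theorem mem_hodge {p : ℤ} {v : ℂ ⊗[ℝ] D} :
    v ∈ D.hodge p ↔ D.Ginv v ∈ wtSub (cplx D.ρ) {a | p ≤ a.1} := Iff.rfl

theorem toFilt_Wc (n : ℤ) : D.toFilt.Wc n = wtSub (cplx D.ρ) (le n) := baseChange_wtW n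

theorem hodge_onGr (p n : ℤ) :
    (D.hodge p ⊓ wtSub (cplx D.ρ) (le n)) ⊔ wtSub (cplx D.ρ) (le (n - 1)) =
    wtSub (cplx D.ρ) (({a | p ≤ a.1} ∩ le n) ∪ le (n - 1)) := by
  apply le_antisymm
  · refine sup_le ?_ (wtSub_mono Set.subset_union_right)
    rintro x ⟨hx, hxW⟩
    have h1 : D.Ginv x ∈ wtSub (cplx D.ρ) (le n) :=
      apply_mem_of_mem_lo (by omega) (mem_lo_of_sub_one D.Ginv_sub_one_mem) hxW
    have h2 : D.Ginv x - x ∈ wtSub (cplx D.ρ) (le (n - 1)) :=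
      apply_mem_of_mem_lo (k := -1) (l := n) (by omega) D.Ginv_sub_one_mem hxW
    rw [show x = D.Ginv x - (D.Ginv x - x) by abel]
    exact sub_mem (wtSub_mono Set.subset_union_left (mem_wtSub_inter D.isDiag hx h1))
      (wtSub_mono Set.subset_union_right h2)
  · intro x hx
    obtain ⟨y, hy, z, hz, rfl⟩ := mem_wtSub_union D.isDiag hx
    have hyF : y ∈ wtSub (cplx D.ρ) {a | p ≤ a.1} := wtSub_mono Set.inter_subset_left hy
    have hyW : y ∈ wtSub (cplx D.ρ) (le n) := wtSub_mono Set.inter_subset_right hy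
    have h2 : D.G y - y ∈ wtSub (cplx D.ρ) (le (n - 1)) :=
      apply_mem_of_mem_lo (k := -1) (l := n) (by omega) D.G_sub_one_mem hyW
    have h3 : D.G y ∈ wtSub (cplx D.ρ) (le n) :=
      apply_mem_of_mem_lo (by omega) (mem_lo_of_sub_one D.G_sub_one_mem) hyW
    rw [show y + z = D.G y + (z - (D.G y - y)) by abel]
    refine Submodule.add_mem_sup ⟨?_, h3⟩ (sub_mem hz h2)
    rw [SetLike.mem_coe, mem_hodge, Ginv_G]
    exact hyF

theorem toFilt_onGr (p n : ℤ) : D.toFilt.onGr (D.toFilt.F p) n =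
    wtSub (cplx D.ρ) (({a | p ≤ a.1} ∩ le n) ∪ le (n - 1)) :=
  (congrArg₂ (fun A B : Submodule ℂ (ℂ ⊗[ℝ] D) => (D.hodge p ⊓ A) ⊔ B)
    (D.toFilt_Wc n) (D.toFilt_Wc (n - 1))).trans (D.hodge_onGr p n)

theorem toFilt_onGr_Fbar (q n : ℤ) : D.toFilt.onGr (D.toFilt.Fbar q) n =
    wtSub (cplx D.ρ) (({a | q ≤ a.2} ∩ le n) ∪ le (n - 1)) := by
  have key : ∀ (S T : Set (ℤ × ℤ)), (∀ a, a ∈ T ↔ a.swap ∈ S) → ∀ x : ℂ ⊗[ℝ] D,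
      FiltSpace.conj D x ∈ wtSub (cplx D.ρ) S ↔ x ∈ wtSub (cplx D.ρ) T := by
    intro S T h x
    constructor
    · intro hx
      have := conj_mem_wtSub (ρ := D.ρ) (T := T) (fun a ha => (h _).2 (by simpa using ha)) hx
      rwa [conj_conj] at this
    · intro hx
      exact conj_mem_wtSub (fun a ha => (h a).1 ha) hx
  refine Submodule.ext fun x => (FiltSpace.mem_onGr_Fbar _).trans ?_
  refine (show FiltSpace.conj D x ∈ D.toFilt.onGr (D.toFilt.F q) n ↔ FiltSpace.conj D x ∈
    wtSub (cplx D.ρ) (({a | q ≤ a.1} ∩ le n) ∪ le (n - 1)) from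
      Iff.of_eq (congrArg (fun S : Submodule ℂ (ℂ ⊗[ℝ] D) => FiltSpace.conj D x ∈ S)
        (D.toFilt_onGr q n))).trans (key _ _ (fun a => ?_) x)
  simp only [Set.mem_union, Set.mem_inter_iff, Set.mem_ofPred_eq, mem_le, Prod.fst_swap,
    Prod.snd_swap, add_comm]

theorem exists_hodge_bot : ∃ p, D.hodge p = ⊥ := by
  obtain ⟨s, hs⟩ := D.isDiag.exists_finset_of_finite
  obtain ⟨N, hN⟩ := (s.image fun a => a.1).bddAbove
  refine ⟨N + 1, (Submodule.eq_bot_iff _).2 fun v hv => ?_⟩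
  have h1 := mem_wtSub_inter D.isDiag hv
    (show D.Ginv v ∈ wtSub (cplx D.ρ) (s : Set (ℤ × ℤ)) by rw [hs]; trivial)
  have h2 : ({a : ℤ × ℤ | N + 1 ≤ a.1} ∩ (s : Set (ℤ × ℤ))) = ∅ := by
    refine Set.eq_empty_iff_forall_notMem.2 fun a ha => ?_
    have h3 : N + 1 ≤ a.1 := ha.1
    have h4 := hN (Finset.mem_coe.2 (Finset.mem_image_of_mem (fun a => a.1) (Finset.mem_coe.1 ha.2)))
    omega
  rw [h2, wtSub_empty, Submodule.mem_bot] at h1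
  rw [← D.G_Ginv v, h1, map_zero]

theorem exists_hodge_top : ∃ p, D.hodge p = ⊤ := by
  obtain ⟨s, hs⟩ := D.isDiag.exists_finset_of_finite
  obtain ⟨N, hN⟩ := (s.image fun a => a.1).bddBelow
  refine ⟨N, top_le_iff.1 fun v _ => ?_⟩
  refine wtSub_mono (fun a ha => ?_)
    (show D.Ginv v ∈ wtSub (cplx D.ρ) (s : Set (ℤ × ℤ)) by rw [hs]; trivial)
  exact hN (Finset.mem_coe.2 (Finset.mem_image_of_mem (fun a => a.1) (Finset.mem_coe.1 ha)))

theorem opposed {p q n : ℤ} (hn : n ≠ p + q) :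
    wtSub (cplx D.ρ) (({a | p ≤ a.1} ∩ le n) ∪ le (n - 1)) ⊓
        wtSub (cplx D.ρ) (({a | q ≤ a.2} ∩ le n) ∪ le (n - 1)) ≤
      (wtSub (cplx D.ρ) (({a | p + 1 ≤ a.1} ∩ le n) ∪ le (n - 1)) ⊓
        wtSub (cplx D.ρ) (({a | q ≤ a.2} ∩ le n) ∪ le (n - 1))) ⊔
      wtSub (cplx D.ρ) (({a | q + 1 ≤ a.2} ∩ le n) ∪ le (n - 1)) := by
  rintro x ⟨hx1, hx2⟩
  have hx := mem_wtSub_inter D.isDiag hx1 hx2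
  have hsub : (({a : ℤ × ℤ | p ≤ a.1} ∩ le n) ∪ le (n - 1)) ∩
      (({a : ℤ × ℤ | q ≤ a.2} ∩ le n) ∪ le (n - 1)) ⊆
      ((({a : ℤ × ℤ | p + 1 ≤ a.1} ∩ le n) ∪ le (n - 1)) ∩
        (({a : ℤ × ℤ | q ≤ a.2} ∩ le n) ∪ le (n - 1))) ∪
      (({a : ℤ × ℤ | q + 1 ≤ a.2} ∩ le n) ∪ le (n - 1)) := by
    intro a
    simp only [Set.mem_union, Set.mem_inter_iff, Set.mem_ofPred_eq, mem_le]
    omega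
  obtain ⟨y, hy, z, hz, rfl⟩ := mem_wtSub_union D.isDiag (wtSub_mono hsub hx)
  exact Submodule.add_mem_sup ⟨wtSub_mono Set.inter_subset_left hy,
    wtSub_mono Set.inter_subset_right hy⟩ hz

theorem isMHS_toFilt : IsMHS D.toFilt where
  finite := inferInstanceAs (FiniteDimensional ℝ D)
  W_bot := exists_wtW_bot D.isDiag
  W_top := exists_wtW_top D.isDiag
  F_bot := D.exists_hodge_bot
  F_top := D.exists_hodge_top
  opposed p q n hn := (FiltSpace.subsingleton_grGrGr_iff _ p q n).2 (by
    rw [toFilt_onGr, toFilt_onGr_Fbar, toFilt_onGr, toFilt_onGr_Fbar]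
    exact D.opposed hn)

variable {D}

theorem Hom.baseChange_ib (f : Hom D D') (v : ℂ ⊗[ℝ] D) :
    f.toLin.baseChange ℂ (D.ib v) = D'.ib (f.toLin.baseChange ℂ v) := by
  have : f.toLin.baseChange ℂ ∘ₗ D.b.baseChange ℂ = D'.b.baseChange ℂ ∘ₗ f.toLin.baseChange ℂ :=
    cplx_ext fun v => by
      simp only [LinearMap.comp_apply, baseChange_ofR, f.map_b]
  rw [ib, ib, LinearMap.smul_apply, LinearMap.smul_apply, map_smul]
  exact congrArg _ (LinearMap.congr_fun this v)

theorem Hom.baseChange_Ginv (f : Hom D D') (v : ℂ ⊗[ℝ] D) :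
    f.toLin.baseChange ℂ (D.Ginv v) = D'.Ginv (f.toLin.baseChange ℂ v) :=
  comp_exp D.isNilpotent_ib.neg D'.isNilpotent_ib.neg (fun v => by
    rw [LinearMap.neg_apply, LinearMap.neg_apply, map_neg, f.baseChange_ib]) v

/-- A morphism of linear data is a morphism of filtered spaces. -/
def toFiltMap (f : D ⟶ D') : D.toFilt ⟶ D'.toFilt where
  toLin := f.toLin
  map_W _ _ hv := map_mem_wtW f.map_ρ hv
  map_F p v hv := by
    have hv' : D.Ginv v ∈ wtSub (cplx D.ρ) {a | p ≤ a.1} := hv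
    have h := map_mem_wtSub (baseChange_equivariant f.map_ρ) hv'
    exact FiltSpace.mem_of_eq (S := wtSub (cplx D'.ρ) {a | p ≤ a.1})
      (Hom.baseChange_Ginv f v).symm h

end Dat

/-- The functor from linear data to mixed Hodge structures. -/
def datToMHS : Dat ⥤ MHS where
  obj D := ⟨D.toFilt, D.isMHS_toFilt⟩
  map f := ObjectProperty.homMk (Dat.toFiltMap f)
  map_id _ := rfl
  map_comp _ _ := rfl

instance : datToMHS.Additive where
  map_add := rfl

instance : datToMHS.Faithful where
  map_injective h := Dat.hom_ext
    (congrArg (fun f : (_ : MHS) ⟶ (_ : MHS) => FiltSpace.Hom.toLin f.hom) h)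

theorem exists_wtSub_le_eq_bot {X : Type*} [AddCommGroup X] [Module ℂ X] [FiniteDimensional ℂ X]
    {σ : Representation ℂ ℂˣ X} (h : IsDiag σ) :
    ∃ m : ℕ, 1 ≤ m ∧ wtSub σ (le (-m)) = ⊥ := by
  obtain ⟨s, hs⟩ := h.exists_finset_of_finite
  obtain ⟨N, hN⟩ := (s.image fun a => -(a.1 + a.2)).bddAbove
  refine ⟨N.toNat + 1, by omega, (Submodule.eq_bot_iff _).2 fun v hv => ?_⟩
  have h1 := mem_wtSub_inter h hv (show v ∈ wtSub σ (s : Set (ℤ × ℤ)) by rw [hs]; trivial)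
  have h2 : le (-(N.toNat + 1 : ℕ)) ∩ (s : Set (ℤ × ℤ)) = ∅ := by
    refine Set.eq_empty_iff_forall_notMem.2 fun a ha => ?_
    have h3 := mem_le.1 ha.1
    have h4 : -(a.1 + a.2) ≤ N :=
      hN (Finset.mem_coe.2 (Finset.mem_image_of_mem _ (Finset.mem_coe.1 ha.2)))
    omega
  rwa [h2, wtSub_empty, Submodule.mem_bot] at h1

namespace Dat

section full

variable {D D' : Dat} {L : D →ₗ[ℝ] D'}

theorem conjHom_comp_baseChange {V V' V'' : Type} [AddCommGroup V] [Module ℝ V]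
    [AddCommGroup V'] [Module ℝ V'] [AddCommGroup V''] [Module ℝ V'']
    (N' : (ℂ ⊗[ℝ] V') →ₗ[ℂ] (ℂ ⊗[ℝ] V'')) (N : (ℂ ⊗[ℝ] V) →ₗ[ℂ] (ℂ ⊗[ℝ] V')) :
    conjHom V V'' (N' ∘ₗ N) = conjHom V' V'' N' ∘ₗ conjHom V V' N := by
  ext v
  simp [conjHom_apply, conj_conj]

/-- The linear map moved to the split mixed Hodge structures. -/
def twist (L : D →ₗ[ℝ] D') : (ℂ ⊗[ℝ] D) →ₗ[ℂ] (ℂ ⊗[ℝ] D') := D'.Ginv ∘ₗ L.baseChange ℂ ∘ₗ D.G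

theorem twist_sub_mem (hL : L.baseChange ℂ ∈ lo D.ρ D'.ρ 0) :
    twist L - L.baseChange ℂ ∈ lo D.ρ D'.ρ (-1) := by
  have e : twist L - L.baseChange ℂ = (D'.Ginv - 1) ∘ₗ (L.baseChange ℂ ∘ₗ D.G) +
      L.baseChange ℂ ∘ₗ (D.G - 1) := by
    ext v
    simp [twist]
  rw [e]
  exact add_mem (comp_mem_lo (by norm_num) D'.Ginv_sub_one_mem
    (comp_mem_lo (m := 0) (by norm_num) hL (mem_lo_of_sub_one D.G_sub_one_mem)))
    (comp_mem_lo (by norm_num) hL D.G_sub_one_mem)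

theorem twist_mem_fSet (hF : ∀ p, ∀ v ∈ D.hodge p, L.baseChange ℂ v ∈ D'.hodge p) :
    twist L ∈ wtSub (Representation.linHom (cplx D.ρ) (cplx D'.ρ)) fSet := by
  refine mem_wtSub_linHom (isDiagHom D D') D.isDiag D'.isDiag fun a v hv => ?_
  have h1 : D.G v ∈ D.hodge a.1 := by
    rw [mem_hodge, Ginv_G]
    exact wt_le_wtSub (le_refl a.1) hv
  refine wtSub_mono (fun b hb => ?_) (D'.mem_hodge.1 (hF _ _ h1))
  have hb' : a.1 ≤ b.1 := hb
  show 0 ≤ b.1 - a.1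
  omega

theorem exists_equivariant_part (hL : L.baseChange ℂ ∈ lo D.ρ D'.ρ 0)
    (hF : ∀ p, ∀ v ∈ D.hodge p, L.baseChange ℂ v ∈ D'.hodge p) :
    ∃ L₀ ∈ wt (Representation.linHom (cplx D.ρ) (cplx D'.ρ)) 0, conjHom D D' L₀ = L₀ ∧
      L.baseChange ℂ - L₀ ∈ lo D.ρ D'.ρ (-1) := by
  have hH := isDiagHom D D'
  have hc := conjHom_linHom D.ρ D'.ρ
  refine ⟨scale hH (ind (le (-1))ᶜ) (L.baseChange ℂ), ?_, ?_, ?_⟩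
  rotate_left
  · rw [conj_scale_ind hH hc (T := (le (-1))ᶜ), conjHom_baseChange]
    intro a
    simp only [Set.mem_compl_iff, mem_le, Prod.fst_swap, Prod.snd_swap, add_comm]
  · rw [sub_eq_of_eq_add (scale_add_scale hH (le (-1)) (L.baseChange ℂ)).symm]
    exact scale_ind_mem hH _
  · have h1 := scale_ind_mem_of_mem (S := (le (-1))ᶜ) hH hL
    have h2 : scale hH (ind (le (-1))ᶜ) (L.baseChange ℂ) =
        scale hH (ind (le (-1))ᶜ) (twist L) := by
      have h3 : scale hH (ind (le (-1))ᶜ) (twist L - L.baseChange ℂ) = 0 :=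
        scale_eq_zero hH (fun a ha => ind_of_notMem (not_not.2 ha)) (twist_sub_mem hL)
      rw [map_sub, sub_eq_zero] at h3
      exact h3.symm
    have h3 := wtSub_mono Set.inter_subset_left
      (scale_ind_mem_of_mem (S := (le (-1))ᶜ) hH (twist_mem_fSet hF))
    rw [← h2] at h3
    have h4 : scale hH (ind (le (-1))ᶜ) (L.baseChange ℂ) ∈
        wtSub (Representation.linHom (cplx D.ρ) (cplx D'.ρ)) fbarSet := by
      have h5 : conjHom D D' (scale hH (ind (le (-1))ᶜ) (L.baseChange ℂ)) =
          scale hH (ind (le (-1))ᶜ) (L.baseChange ℂ) := by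
        rw [conj_scale_ind hH hc (T := (le (-1))ᶜ), conjHom_baseChange]
        intro a
        simp only [Set.mem_compl_iff, mem_le, Prod.fst_swap, Prod.snd_swap, add_comm]
      rw [← h5]
      exact semi_mem_wtSub hc (fun a ha => ha) h3
    rw [← wtSub_singleton]
    refine wtSub_mono (fun a ha => ?_) (mem_wtSub_inter hH h1 (mem_wtSub_inter hH h3 h4))
    obtain ⟨⟨h5, h6⟩, h7, h8⟩ := ha
    simp only [Set.mem_compl_iff, mem_le] at h5 h6
    change 0 ≤ a.1 at h7
    change 0 ≤ a.2 at h8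
    exact Prod.ext (by simp; omega) (by simp; omega)

theorem approx_step {L₀ : (ℂ ⊗[ℝ] D) →ₗ[ℂ] (ℂ ⊗[ℝ] D')} {m : ℤ}
    (hL : L.baseChange ℂ - L₀ ∈ lo D.ρ D'.ρ (-m)) (ht : twist L - L₀ ∈ lo D.ρ D'.ρ (-m))
    (hδ : L₀ ∘ₗ D.b.baseChange ℂ - D'.b.baseChange ℂ ∘ₗ L₀ ∈ lo D.ρ D'.ρ (-m)) :
    (L.baseChange ℂ - L₀) + Complex.I • (L₀ ∘ₗ D.b.baseChange ℂ - D'.b.baseChange ℂ ∘ₗ L₀) +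
      (L₀ - twist L) ∈ lo D.ρ D'.ρ (-m - 1) := by
  have e1 : L₀ ∘ₗ D.ib - D'.ib ∘ₗ L₀ =
      Complex.I • (L₀ ∘ₗ D.b.baseChange ℂ - D'.b.baseChange ℂ ∘ₗ L₀) := by
    rw [ib, ib, LinearMap.comp_smul, LinearMap.smul_comp, smul_sub]
  have h1 := comp_exp_sub_mem (f := L₀) (m := m) D.isNilpotent_ib D'.isNilpotent_ib D.ib_mem
    D'.ib_mem (by rw [e1]; exact Submodule.smul_mem _ _ hδ)
  rw [e1] at h1
  have e2 : (L.baseChange ℂ - L₀) +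
      Complex.I • (L₀ ∘ₗ D.b.baseChange ℂ - D'.b.baseChange ℂ ∘ₗ L₀) + (L₀ - twist L) =
      -(L₀ ∘ₗ D.G - D'.G ∘ₗ L₀ -
        Complex.I • (L₀ ∘ₗ D.b.baseChange ℂ - D'.b.baseChange ℂ ∘ₗ L₀)) -
      (L.baseChange ℂ - L₀) ∘ₗ (D.G - 1) + (D'.G - 1) ∘ₗ (twist L - L₀) := by
    refine LinearMap.ext fun v => ?_
    have h3 : D'.G (twist L v) = L.baseChange ℂ (D.G v) := D'.G_Ginv _
    simp only [LinearMap.add_apply, LinearMap.sub_apply, LinearMap.neg_apply, LinearMap.comp_apply,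
      Module.End.one_apply, map_sub, LinearMap.smul_apply, h3]
    module
  rw [e2]
  exact add_mem (sub_mem (neg_mem h1) (comp_mem_lo (by omega) hL D.G_sub_one_mem))
    (comp_mem_lo (by omega) D'.G_sub_one_mem ht)

theorem map_of_filtered (hW : ∀ k, ∀ v ∈ wtW D.ρ k, L v ∈ wtW D'.ρ k)
    (hF : ∀ p, ∀ v ∈ D.hodge p, L.baseChange ℂ v ∈ D'.hodge p) :
    (∀ z v, L (D.ρ z v) = D'.ρ z (L v)) ∧ ∀ v, L (D.b v) = D'.b (L v) := by
  have hH := isDiagHom D D'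
  have hc := conjHom_linHom D.ρ D'.ρ
  have hL : L.baseChange ℂ ∈ lo D.ρ D'.ρ 0 := by
    have := baseChange_mem_wtSub_linHom (m := 0) (isDiagHom D D') D.isDiag D'.isDiag
      (f := L) (fun k v hv => by rw [sub_zero]; exact hW k v hv)
    rwa [neg_zero] at this
  obtain ⟨L₀, hL₀, hreal, h1⟩ := exists_equivariant_part hL hF
  set δ := L₀ ∘ₗ D.b.baseChange ℂ - D'.b.baseChange ℂ ∘ₗ L₀ with hδ
  have hL₀' : L₀ ∈ wtSub (Representation.linHom (cplx D.ρ) (cplx D'.ρ)) {0} := by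
    rwa [wtSub_singleton]
  have hδn : δ ∈ wtSub (Representation.linHom (cplx D.ρ) (cplx D'.ρ)) negSet := by
    refine sub_mem (comp_mem_wtSub ?_ hL₀' D.b_mem) (comp_mem_wtSub ?_ D'.b_mem hL₀')
    · rintro a rfl b hb
      rwa [zero_add]
    · rintro b hb a rfl
      rwa [add_zero]
  have hδr : conjHom D D' δ = δ := by
    rw [hδ, map_sub, conjHom_comp_baseChange, conjHom_comp_baseChange, conjHom_baseChange,
      conjHom_baseChange, hreal]
  have hε : L₀ - twist L ∈ wtSub (Representation.linHom (cplx D.ρ) (cplx D'.ρ)) fSet := by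
    refine sub_mem (wtSub_mono ?_ hL₀') (twist_mem_fSet hF)
    rintro a rfl
    exact le_refl (0 : ℤ)
  have key : ∀ m : ℕ, L.baseChange ℂ - L₀ ∈ lo D.ρ D'.ρ (-(m + 1 : ℤ)) ∧
      δ ∈ lo D.ρ D'.ρ (-(m + 1 : ℤ)) ∧ L₀ - twist L ∈ lo D.ρ D'.ρ (-(m + 1 : ℤ)) := by
    intro m
    induction m with
    | zero =>
      refine ⟨lo_mono (by norm_num) h1, wtSub_mono (negSet_subset_le.trans (le_mono (by norm_num)))
        hδn, ?_⟩
      have := neg_mem (add_mem (twist_sub_mem hL) h1)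
      rw [sub_add_sub_cancel, neg_sub] at this
      exact lo_mono (by norm_num) this
    | succ m ih =>
      obtain ⟨i1, i2, i3⟩ := ih
      have h2 := approx_step i1 (by rw [← neg_sub]; exact neg_mem i3) i2
      obtain ⟨j1, j2, j3⟩ := real_decomposition_unique hH hc (by omega)
        (by rw [map_sub, conjHom_baseChange, hreal]) hδr i1 i2 i3 hδn hε h2
      exact ⟨lo_mono (by push_cast; omega) j1, lo_mono (by push_cast; omega) j2,
        lo_mono (by push_cast; omega) j3⟩
  obtain ⟨m, -, hm⟩ := exists_wtSub_le_eq_bot hH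
  have hbot : ∀ {N}, N ∈ lo D.ρ D'.ρ (-(m + 1 : ℤ)) → N = 0 := fun {N} hN => by
    have := lo_mono (show -(m + 1 : ℤ) ≤ -m by omega) hN
    rw [lo, hm] at this
    exact (Submodule.mem_bot ℂ).1 this
  have e1 : L.baseChange ℂ = L₀ := sub_eq_zero.1 (hbot (key m).1)
  have e2 := sub_eq_zero.1 (hbot (key m).2.1)
  rw [← e1] at e2 hL₀
  constructor
  · intro z v
    have h3 := linHom_apply_apply (ρ := cplx D.ρ) (ρ' := cplx D'.ρ) z (L.baseChange ℂ) (ofR D v)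
    rw [mem_wt.1 hL₀ z] at h3
    have h4 : chi (0 : ℤ × ℤ) z = 1 := by simp [chi_apply]
    rw [h4, one_smul, cplx_apply, cplx_apply, baseChange_ofR, baseChange_ofR, baseChange_ofR,
      baseChange_ofR] at h3
    exact ofR_injective h3
  · intro v
    have h3 := LinearMap.congr_fun e2 (ofR D v)
    rw [LinearMap.comp_apply, LinearMap.comp_apply, baseChange_ofR, baseChange_ofR, baseChange_ofR,
      baseChange_ofR] at h3
    exact ofR_injective h3

end full

end Dat

instance : datToMHS.Full where
  map_surjective {D D'} f := by
    have h := Dat.map_of_filtered (D := D) (D' := D') (L := FiltSpace.Hom.toLin f.hom)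
      f.hom.map_W f.hom.map_F
    exact ⟨⟨FiltSpace.Hom.toLin f.hom, h.1, h.2⟩, rfl⟩

section opposedFiltrations

variable {K X : Type*} [Field K] [AddCommGroup X] [Module K X] {A B : ℤ → Submodule K X}
  {S : Submodule K X} {n : ℤ}

theorem inf_le_of_opposed (hA : Antitone A) (hB : Antitone B) {P Q : ℤ} (hP : A P ≤ S)
    (hQ : B Q ≤ S) (h : ∀ p q, n ≠ p + q → A p ⊓ B q ≤ (A (p + 1) ⊓ B q) ⊔ B (q + 1)) {p q : ℤ}
    (hpq : n < p + q) : A p ⊓ B q ≤ S := by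
  have key : ∀ k : ℕ, ∀ p q : ℤ, n < p + q → P + Q - k ≤ p + q → A p ⊓ B q ≤ S := by
    intro k
    induction k with
    | zero =>
      intro p q _ h2
      rcases le_or_gt P p with hp | hp
      · exact inf_le_left.trans ((hA hp).trans hP)
      · exact inf_le_right.trans ((hB (show Q ≤ q by push_cast at h2; omega)).trans hQ)
    | succ k ih =>
      rintro p q h1 h2 x ⟨hxA, hxB⟩
      obtain ⟨y, hy, z, hz, rfl⟩ := Submodule.mem_sup.1 (h p q (by omega) ⟨hxA, hxB⟩)
      refine add_mem (ih (p + 1) q (by omega) (by push_cast at h2; omega) hy)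
        (ih p (q + 1) (by omega) (by push_cast at h2; omega) ⟨?_, hz⟩)
      have := sub_mem hxA (hA (by omega) hy.1)
      rwa [add_sub_cancel_left] at this
  exact key (P + Q - (p + q)).toNat p q hpq (by omega)

theorem le_sup_of_opposed (hA : Antitone A) (hB : Antitone B) {p Q : ℤ} (hQ : A p ≤ B Q)
    (h : ∀ p q, n ≠ p + q → A p ⊓ B q ≤ (A (p + 1) ⊓ B q) ⊔ B (q + 1)) :
    A p ≤ A (p + 1) ⊔ (A p ⊓ B (n - p)) := by
  have key : ∀ k : ℕ, Q + k ≤ n - p → A p ≤ A (p + 1) ⊔ (A p ⊓ B (Q + k)) := by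
    intro k
    induction k with
    | zero =>
      intro _
      rw [Nat.cast_zero, add_zero]
      exact le_sup_of_le_right (le_inf le_rfl hQ)
    | succ k ih =>
      intro hk x hx
      obtain ⟨y, hy, z, ⟨hzA, hzB⟩, rfl⟩ := Submodule.mem_sup.1 (ih (by push_cast at hk; omega) hx)
      obtain ⟨y', ⟨hy', -⟩, z', hz', rfl⟩ := Submodule.mem_sup.1
        (h p (Q + k) (by push_cast at hk; omega) ⟨hzA, hzB⟩)
      rw [← add_assoc]
      refine Submodule.add_mem_sup (add_mem hy hy') ⟨?_, ?_⟩
      · have := sub_mem hzA (hA (by omega) hy')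
        rwa [add_sub_cancel_left] at this
      · rw [Nat.cast_succ, ← add_assoc]
        exact hz'
  rcases le_or_gt Q (n - p) with hp | hp
  · have := key (n - p - Q).toNat (by omega)
    rwa [show Q + ((n - p - Q).toNat : ℤ) = n - p by omega] at this
  · exact le_sup_of_le_right (le_inf le_rfl (hQ.trans (hB hp.le)))

end opposedFiltrations

theorem imC_mem_of_mem_baseChange {V : Type} [AddCommGroup V] [Module ℝ V] {S : Submodule ℝ V}
    {v : ℂ ⊗[ℝ] V} (hv : v ∈ S.baseChange ℂ) : imC V v ∈ S := by
  have h : imC V v = reC V ((-Complex.I) • v) := by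
    apply ofR_injective
    rw [ofR_imC, ofR_reC, LinearMap.map_smulₛₗ, map_neg, Complex.conj_I]
    module
  rw [h]
  exact reC_mem_of_mem_baseChange (Submodule.smul_mem _ _ hv)

namespace FiltSpace

variable {V : FiltSpace}

theorem exists_weight_complement (V : FiltSpace) (n : ℤ) :
    ∃ U : Submodule ℝ V, V.W n = U ⊔ V.W (n - 1) ∧ U ⊓ V.W (n - 1) = ⊥ := by
  obtain ⟨C, hC⟩ := exists_isCompl (V.W (n - 1))
  refine ⟨C ⊓ V.W n, ?_, ?_⟩
  · rw [sup_comm, ← sup_inf_assoc_of_le C (V.W_mono (by omega)), hC.sup_eq_top, top_inf_eq]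
  · rw [inf_right_comm, inf_comm C, hC.inf_eq_bot, bot_inf_eq]

theorem Wc_eq_sup {n : ℤ} {U : Submodule ℝ V} (hU : V.W n = U ⊔ V.W (n - 1)) :
    V.Wc n = U.baseChange ℂ ⊔ V.Wc (n - 1) := by
  apply le_antisymm
  · refine baseChange_le fun v hv => ?_
    rw [hU] at hv
    obtain ⟨u, hu, w, hw, rfl⟩ := Submodule.mem_sup.1 hv
    rw [map_add]
    exact Submodule.add_mem_sup (ofR_mem_baseChange hu) (ofR_mem_baseChange hw)
  · refine sup_le (baseChange_le fun v hv => ofR_mem_baseChange ?_) (V.Wc_mono (by omega))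
    rw [hU]
    exact Submodule.mem_sup_left hv

theorem baseChange_inf_Wc {n : ℤ} {U : Submodule ℝ V} (hU : U ⊓ V.W (n - 1) = ⊥) :
    U.baseChange ℂ ⊓ V.Wc (n - 1) = ⊥ := by
  refine (Submodule.eq_bot_iff _).2 fun x hx => ?_
  have h1 : reC V x ∈ U ⊓ V.W (n - 1) :=
    ⟨reC_mem_of_mem_baseChange hx.1, reC_mem_of_mem_baseChange hx.2⟩
  have h2 : imC V x ∈ U ⊓ V.W (n - 1) :=
    ⟨imC_mem_of_mem_baseChange hx.1, imC_mem_of_mem_baseChange hx.2⟩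
  rw [hU, Submodule.mem_bot] at h1 h2
  rw [← reC_add_imC x, h1, h2, map_zero, smul_zero, add_zero]

theorem onGr_mono {G G' : Submodule ℂ (ℂ ⊗[ℝ] V)} (h : G ≤ G') (n : ℤ) :
    V.onGr G n ≤ V.onGr G' n := sup_le_sup_right (inf_le_inf_right _ h) _

theorem Wc_le_onGr (G : Submodule ℂ (ℂ ⊗[ℝ] V)) (n : ℤ) : V.Wc (n - 1) ≤ V.onGr G n :=
  le_sup_right

theorem onGr_le_Wc (G : Submodule ℂ (ℂ ⊗[ℝ] V)) (n : ℤ) : V.onGr G n ≤ V.Wc n :=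
  sup_le inf_le_right (V.Wc_mono (by omega))

theorem onGr_bot (n : ℤ) : V.onGr ⊥ n = V.Wc (n - 1) := by
  rw [onGr, bot_inf_eq, bot_sup_eq]

theorem onGr_top (n : ℤ) : V.onGr ⊤ n = V.Wc n := by
  rw [onGr, top_inf_eq]
  exact sup_eq_left.2 (V.Wc_mono (by omega))

/-- The spaces of Hodge type, realized inside complements of the steps of the weight
filtration. -/
def hodgePiece (U : ℤ → Submodule ℝ V) (a : ℤ × ℤ) : Submodule ℂ (ℂ ⊗[ℝ] V) :=
  V.onGr (V.F a.1) (a.1 + a.2) ⊓ V.onGr (V.Fbar a.2) (a.1 + a.2) ⊓ (U (a.1 + a.2)).baseChange ℂ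

theorem conj_mem_hodgePiece {U : ℤ → Submodule ℝ V} {a : ℤ × ℤ} {v : ℂ ⊗[ℝ] V}
    (hv : v ∈ hodgePiece U a) : conj V v ∈ hodgePiece U a.swap := by
  obtain ⟨⟨h1, h2⟩, h3⟩ := hv
  rw [hodgePiece, Prod.fst_swap, Prod.snd_swap, add_comm a.2]
  exact ⟨⟨V.mem_onGr_Fbar.1 h2, V.mem_onGr_Fbar.2 (by rwa [conj_conj])⟩, conj_mem_baseChange h3⟩

theorem Fbar_eq_bot {p : ℤ} (hp : V.F p = ⊥) : V.Fbar p = ⊥ := by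
  refine (Submodule.eq_bot_iff _).2 fun x hx => ?_
  rw [mem_Fbar, hp, Submodule.mem_bot] at hx
  rw [← conj_conj x, hx, map_zero]

theorem Fbar_eq_top {p : ℤ} (hp : V.F p = ⊤) : V.Fbar p = ⊤ :=
  top_le_iff.1 fun x _ => by
    rw [mem_Fbar, hp]
    trivial

theorem _root_.HodgeConn.IsMHS.inf_onGr_le (hV : IsMHS V) {p q n : ℤ} (hpq : n < p + q) :
    V.onGr (V.F p) n ⊓ V.onGr (V.Fbar q) n ≤ V.Wc (n - 1) := by
  obtain ⟨P, hP⟩ := hV.F_bot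
  refine inf_le_of_opposed (A := fun p => V.onGr (V.F p) n) (B := fun q => V.onGr (V.Fbar q) n)
    (P := P) (Q := P) (fun _ _ h => onGr_mono (V.F_anti h) n)
    (fun _ _ h => onGr_mono (V.Fbar_anti h) n) ?_ ?_
    (fun p q h => (V.subsingleton_grGrGr_iff p q n).1 (hV.opposed p q n h)) hpq
  · exact (hP ▸ onGr_bot n).le
  · exact (Fbar_eq_bot hP ▸ onGr_bot n).le

theorem _root_.HodgeConn.IsMHS.onGr_le (hV : IsMHS V) (p n : ℤ) :
    V.onGr (V.F p) n ≤ V.onGr (V.F (p + 1)) n ⊔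
      (V.onGr (V.F p) n ⊓ V.onGr (V.Fbar (n - p)) n) := by
  obtain ⟨P, hP⟩ := hV.F_top
  refine le_sup_of_opposed (A := fun p => V.onGr (V.F p) n) (B := fun q => V.onGr (V.Fbar q) n)
    (Q := P) (fun _ _ h => onGr_mono (V.F_anti h) n) (fun _ _ h => onGr_mono (V.Fbar_anti h) n) ?_
    (fun p q h => (V.subsingleton_grGrGr_iff p q n).1 (hV.opposed p q n h))
  simp only [Fbar_eq_top hP, onGr_top]
  exact onGr_le_Wc _ n

variable {U : ℤ → Submodule ℝ V}

theorem hodgePiece_le_onGr {a : ℤ × ℤ} {p n : ℤ} (hp : p ≤ a.1) (hn : a.1 + a.2 = n) :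
    hodgePiece U a ≤ V.onGr (V.F p) n := by
  subst hn
  exact inf_le_left.trans (inf_le_left.trans (onGr_mono (V.F_anti hp) _))

theorem onGr_eq_iSup (hV : IsMHS V) (hU : ∀ n, V.W n = U n ⊔ V.W (n - 1)) (p n : ℤ) :
    V.onGr (V.F p) n =
      (⨆ a ∈ {a : ℤ × ℤ | p ≤ a.1 ∧ a.1 + a.2 = n}, hodgePiece U a) ⊔ V.Wc (n - 1) := by
  apply le_antisymm
  · obtain ⟨P, hP⟩ := hV.F_bot
    have key : ∀ k : ℕ, ∀ p, P - k ≤ p → V.onGr (V.F p) n ≤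
        (⨆ a ∈ {a : ℤ × ℤ | p ≤ a.1 ∧ a.1 + a.2 = n}, hodgePiece U a) ⊔ V.Wc (n - 1) := by
      intro k
      induction k with
      | zero =>
        intro p hp
        have h1 : V.F p = ⊥ := le_bot_iff.1 (hP ▸ V.F_anti (by simpa using hp))
        rw [h1, onGr_bot]
        exact le_sup_right
      | succ k ih =>
        intro p hp x hx
        obtain ⟨y, hy, z, ⟨hz1, hz2⟩, rfl⟩ := Submodule.mem_sup.1 (hV.onGr_le p n hx)
        refine add_mem ?_ ?_
        · have hle : (⨆ a ∈ {a : ℤ × ℤ | p + 1 ≤ a.1 ∧ a.1 + a.2 = n}, hodgePiece U a) ⊔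
              V.Wc (n - 1) ≤ (⨆ a ∈ {a : ℤ × ℤ | p ≤ a.1 ∧ a.1 + a.2 = n}, hodgePiece U a) ⊔
              V.Wc (n - 1) :=
            sup_le_sup_right (biSup_mono fun a ha => ⟨(by omega : p ≤ p + 1).trans ha.1, ha.2⟩) _
          exact hle (ih (p + 1) (by push_cast at hp; omega) hy)
        · have hzW : z ∈ V.Wc n := onGr_le_Wc _ _ hz1
          rw [Wc_eq_sup (hU n)] at hzW
          obtain ⟨u, hu, w, hw, rfl⟩ := Submodule.mem_sup.1 hzW
          refine Submodule.add_mem_sup ?_ hw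
          refine Submodule.mem_iSup_of_mem (p, n - p)
            (Submodule.mem_iSup_of_mem ⟨le_rfl, by simp⟩ ?_)
          rw [hodgePiece, add_sub_cancel]
          refine ⟨⟨?_, ?_⟩, hu⟩
          · have := sub_mem hz1 (Wc_le_onGr (V.F p) n hw)
            rwa [add_sub_cancel_right] at this
          · have := sub_mem hz2 (Wc_le_onGr (V.Fbar (n - p)) n hw)
            rwa [add_sub_cancel_right] at this
    exact key (P - p).toNat p (by omega)
  · exact sup_le (iSup₂_le fun a ha => hodgePiece_le_onGr ha.1 ha.2) (Wc_le_onGr _ _)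

theorem hodgePiece_le_Wc {a : ℤ × ℤ} {n : ℤ} (hn : a.1 + a.2 ≤ n) :
    hodgePiece U a ≤ V.Wc n :=
  (hodgePiece_le_onGr le_rfl rfl).trans ((onGr_le_Wc _ _).trans (V.Wc_mono hn))

theorem iSupIndep_hodgePiece (hV : IsMHS V) (hU : ∀ n, U n ⊓ V.W (n - 1) = ⊥) :
    iSupIndep (hodgePiece U) := by
  classical
  refine iSupIndep_of_dfinsupp_lsum_injective _ ?_
  rw [injective_iff_map_eq_zero]
  intro x hx
  by_contra hne
  obtain ⟨a, ha, hmin⟩ := Finset.exists_min_image x.support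
    (fun a => toLex (-(a.1 + a.2), a.1)) (Finset.nonempty_iff_ne_empty.2 fun h => hne
      (DFinsupp.support_eq_empty.1 h))
  rw [DFinsupp.lsum_apply_apply, DFinsupp.sumAddHom_apply, DFinsupp.sum,
    ← Finset.add_sum_erase _ _ ha] at hx
  have h1 : ((x a : hodgePiece U a) : ℂ ⊗[ℝ] V) ∈ V.onGr (V.F (a.1 + 1)) (a.1 + a.2) := by
    refine (Submodule.neg_mem_iff _).1
      (mem_of_eq (eq_neg_of_add_eq_zero_right hx).symm (Submodule.sum_mem _ fun b hb => ?_))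
    obtain ⟨hba, hb⟩ := Finset.mem_erase.1 hb
    rcases (Prod.Lex.le_iff.1 (hmin b hb)) with h | ⟨h, h'⟩
    · change -(a.1 + a.2) < -(b.1 + b.2) at h
      exact Wc_le_onGr _ _ (hodgePiece_le_Wc (by omega) (x b).2)
    · change -(a.1 + a.2) = -(b.1 + b.2) at h
      change a.1 ≤ b.1 at h'
      have : a.1 ≠ b.1 := fun e => hba (Prod.ext e.symm (by omega))
      exact hodgePiece_le_onGr (by omega) (by omega) (x b).2
  have h2 := hV.inf_onGr_le (by omega) ⟨h1, (x a).2.1.2⟩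
  have h3 := (Submodule.eq_bot_iff _).1 (baseChange_inf_Wc (hU _)) _ ⟨(x a).2.2, h2⟩
  exact DFinsupp.mem_support_iff.1 ha (Subtype.ext h3)

end FiltSpace

section grading

variable {X X' : Type*} [AddCommGroup X] [Module ℂ X] [AddCommGroup X'] [Module ℂ X']
  {H : ℤ × ℤ → Submodule ℂ X}

theorem exists_linearMap_of_internal (hi : DirectSum.IsInternal H) (f : ∀ a, H a →ₗ[ℂ] X') :
    ∃ g : X →ₗ[ℂ] X', ∀ a (v : H a), g v = f a v := by
  refine ⟨DirectSum.toModule ℂ (ℤ × ℤ) X' f ∘ₗ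
    (LinearEquiv.ofBijective (DirectSum.coeLinearMap H) hi).symm.toLinearMap, fun a v => ?_⟩
  have h : (LinearEquiv.ofBijective (DirectSum.coeLinearMap H) hi).symm (v : X) =
      DirectSum.lof ℂ (ℤ × ℤ) (fun a => H a) a v := by
    exact (LinearEquiv.symm_apply_eq _).2 (DirectSum.coeLinearMap_lof H a v).symm
  rw [LinearMap.comp_apply, LinearEquiv.coe_coe, h, DirectSum.toModule_lof]

theorem linearMap_ext_of_iSup_eq_top (ht : ⨆ a, H a = ⊤) {f g : X →ₗ[ℂ] X'}
    (hfg : ∀ a, ∀ v ∈ H a, f v = g v) : f = g := by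
  have h : ⨆ a, H a ≤ LinearMap.eqLocus f g := iSup_le hfg
  rw [ht] at h
  exact LinearMap.ext fun v => h (x := v) trivial

theorem exists_rep_of_grading (hi : iSupIndep H) (ht : ⨆ a, H a = ⊤) :
    ∃ σ : Representation ℂ ℂˣ X, ∀ a, H a ≤ wt σ a := by
  have hI := DirectSum.isInternal_submodule_of_iSupIndep_of_iSup_eq_top hi ht
  choose T hT using fun z : ℂˣ => exists_linearMap_of_internal hI
    (fun a => chi a z • (H a).subtype)
  have hT' : ∀ z a, ∀ v ∈ H a, T z v = chi a z • v := fun z a v hv => hT z a ⟨v, hv⟩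
  refine ⟨⟨⟨T, linearMap_ext_of_iSup_eq_top ht fun a v hv => ?_⟩, fun z w =>
    linearMap_ext_of_iSup_eq_top ht fun a v hv => ?_⟩, fun a v hv => mem_wt.2 fun z => hT' z a v hv⟩
  · rw [hT' _ _ _ hv, map_one, one_smul, Module.End.one_apply]
  · change T (z * w) v = T z (T w v)
    rw [hT' _ _ _ hv, hT' _ _ _ hv, map_smul, hT' _ _ _ hv, map_mul, smul_smul, mul_comm]

theorem wt_eq_of_grading {σ : Representation ℂ ℂˣ X} (h : IsDiag σ) (hσ : ∀ a, H a ≤ wt σ a)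
    (ht : ⨆ a, H a = ⊤) (a : ℤ × ℤ) : wt σ a = H a := by
  refine le_antisymm (fun v hv => ?_) (hσ a)
  have h1 : ⨆ b, H b ≤ (H a).comap (scale h (ind {a})) := iSup_le fun b w hw => by
    rw [Submodule.mem_comap, scale_of_mem h _ (hσ b hw)]
    by_cases hb : b = a
    · subst hb
      exact Submodule.smul_mem _ _ hw
    · rw [ind_of_notMem (S := {a}) hb, zero_smul]
      exact Submodule.zero_mem _
  rw [ht] at h1
  have h2 : scale h (ind {a}) v ∈ H a := h1 (x := v) trivial
  rwa [scale_of_mem h _ hv, ind_of_mem (Set.mem_singleton a), one_smul] at h2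

theorem exists_lift {σ : Representation ℂ ℂˣ X} (h : IsDiag σ) {P Q : ℤ × ℤ → Submodule ℂ X}
    (hPQ : ∀ a, wt σ a ≤ P a ⊔ Q a) :
    ∃ g : X →ₗ[ℂ] X, ∀ a, ∀ v ∈ wt σ a, g v ∈ P a ∧ g v - v ∈ Q a := by
  have key : ∀ a, ∃ f : wt σ a →ₗ[ℂ] X, ∀ v, f v ∈ P a ∧ f v - v ∈ Q a := by
    intro a
    let c : (P a × Q a) →ₗ[ℂ] X := (P a).subtype.coprod (Q a).subtype
    have hr : ∀ v : wt σ a, (wt σ a).subtype v ∈ LinearMap.range c := fun v => by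
      obtain ⟨x, hx, y, hy, hxy⟩ := Submodule.mem_sup.1 (hPQ a v.2)
      exact ⟨(⟨x, hx⟩, ⟨y, hy⟩), hxy⟩
    obtain ⟨l, hl⟩ := Module.projective_lifting_property c.rangeRestrict
      ((wt σ a).subtype.codRestrict _ hr) c.surjective_rangeRestrict
    refine ⟨(P a).subtype ∘ₗ LinearMap.fst ℂ _ _ ∘ₗ l, fun v => ⟨(l v).1.2, ?_⟩⟩
    have h1 : ((l v).1 : X) + ((l v).2 : X) = v := congrArg Subtype.val (LinearMap.congr_fun hl v)
    change ((l v).1 : X) - v ∈ Q a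
    rw [← h1, sub_add_cancel_left]
    exact neg_mem (l v).2.2
  choose f hf using key
  obtain ⟨g, hg⟩ := exists_linearMap_of_internal h.isInternal f
  exact ⟨g, fun a v hv => by rw [hg a ⟨v, hv⟩]; exact hf a ⟨v, hv⟩⟩

end grading

section regularity

theorem re_im_regular_mul {f g : ℂˣ → ℂ}
    (hf : (fun z => (f z).re) ∈ regularFunctions ∧ (fun z => (f z).im) ∈ regularFunctions)
    (hg : (fun z => (g z).re) ∈ regularFunctions ∧ (fun z => (g z).im) ∈ regularFunctions) :
    (fun z => (f z * g z).re) ∈ regularFunctions ∧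
      (fun z => (f z * g z).im) ∈ regularFunctions := by
  simp only [Complex.mul_re, Complex.mul_im]
  exact ⟨sub_mem (mul_mem hf.1 hg.1) (mul_mem hf.2 hg.2),
    add_mem (mul_mem hf.1 hg.2) (mul_mem hf.2 hg.1)⟩

theorem re_im_regular_pow {f : ℂˣ → ℂ}
    (hf : (fun z => (f z).re) ∈ regularFunctions ∧ (fun z => (f z).im) ∈ regularFunctions)
    (n : ℕ) : (fun z => (f z ^ n).re) ∈ regularFunctions ∧
      (fun z => (f z ^ n).im) ∈ regularFunctions := by
  induction n with
  | zero =>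
    simp only [pow_zero, Complex.one_re, Complex.one_im]
    exact ⟨one_mem _, zero_mem _⟩
  | succ n ih =>
    simp only [pow_succ]
    exact re_im_regular_mul ih hf

theorem re_im_regular_zpow (n : ℤ) : (fun z : ℂˣ => ((z : ℂ) ^ n).re) ∈ regularFunctions ∧
    (fun z : ℂˣ => ((z : ℂ) ^ n).im) ∈ regularFunctions := by
  rcases n with n | n
  · simp only [Int.ofNat_eq_natCast, zpow_natCast]
    exact re_im_regular_pow (f := fun z : ℂˣ => (z : ℂ))
      ⟨Algebra.subset_adjoin (by simp), Algebra.subset_adjoin (by simp)⟩ n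
  · have h1 := jac_regular 0 0
    have h2 := jac_regular 0 1
    simp only [jac, Matrix.of_apply, Matrix.cons_val_zero, Matrix.cons_val_one] at h1 h2
    have := re_im_regular_pow (f := fun z : ℂˣ => ((z⁻¹ : ℂˣ) : ℂ)) ⟨h1, h2⟩ (n + 1)
    simpa only [zpow_negSucc, Units.val_inv_eq_inv_val, inv_pow] using this

theorem re_im_regular_chi (a : ℤ × ℤ) : (fun z => (chi a z).re) ∈ regularFunctions ∧
    (fun z => (chi a z).im) ∈ regularFunctions := by
  simp only [chi_apply]
  refine re_im_regular_mul (re_im_regular_zpow _) ?_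
  simp only [← map_zpow₀, Complex.conj_re, Complex.conj_im]
  exact ⟨(re_im_regular_zpow _).1, neg_mem (re_im_regular_zpow (-a.2)).2⟩

variable {V : Type} [AddCommGroup V] [Module ℝ V]

theorem reC_smul (c : ℂ) (x : ℂ ⊗[ℝ] V) :
    reC V (c • x) = c.re • reC V x - c.im • imC V x := by
  apply ofR_injective
  rw [map_sub, ofR_smul, ofR_smul, ofR_reC, ofR_reC, ofR_imC, LinearMap.map_smulₛₗ]
  have h1 : (starRingEnd ℂ) c = c.re - c.im * Complex.I := by
    apply Complex.ext <;> simp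
  rw [h1]
  nth_rewrite 1 [← Complex.re_add_im c]
  module

theorem isRegularMap_of_isDiag {ρ : Representation ℝ ℂˣ V} (h : IsDiag (cplx ρ)) (v : V) :
    IsRegularMap fun z => ρ z v := by
  have key : ∀ x : ℂ ⊗[ℝ] V, IsRegularMap fun z => reC V (cplx ρ z x) := by
    intro x
    have hx := h.mem_univ x
    refine Submodule.iSup_induction' (fun a => ⨆ _ : a ∈ (Set.univ : Set (ℤ × ℤ)), wt (cplx ρ) a)
      (motive := fun x _ => IsRegularMap fun z => reC V (cplx ρ z x)) ?_ ?_ ?_ hx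
    · intro a x hx
      have hx' : x ∈ wt (cplx ρ) a := by simpa using hx
      simp only [mem_wt.1 hx', reC_smul, sub_eq_add_neg, ← smul_neg]
      exact (isRegularMap_smul (re_im_regular_chi a).1 _).add
        (isRegularMap_smul (re_im_regular_chi a).2 _)
    · simp only [map_zero]
      exact isRegularMap_zero
    · intro x y _ _ hx hy
      simp only [map_add]
      exact hx.add hy
  have h1 := key (ofR V v)
  simp only [cplx_apply, reC_baseChange] at h1
  have h2 : reC V (ofR V v) = v := ofR_injective (ofR_reC_of_conj (conj_ofR v))
  rwa [h2] at h1

theorem exists_real_rep {H : ℤ × ℤ → Submodule ℂ (ℂ ⊗[ℝ] V)} (hi : iSupIndep H)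
    (ht : ⨆ a, H a = ⊤) (hc : ∀ a, ∀ v ∈ H a, FiltSpace.conj V v ∈ H a.swap) :
    ∃ ρ : Representation ℝ ℂˣ V, IsDiag (cplx ρ) ∧ ∀ a, wt (cplx ρ) a = H a := by
  obtain ⟨σ, hσ⟩ := exists_rep_of_grading hi ht
  have hd : IsDiag σ := top_le_iff.1 (by
    rw [← ht]
    exact iSup_le fun a => (hσ a).trans (wt_le_wtSub trivial))
  have hcomm : ∀ z v, FiltSpace.conj V (σ z v) = σ z (FiltSpace.conj V v) := by
    intro z
    have h1 : (FiltSpace.conj V).comp (σ z) = (σ z).comp (FiltSpace.conj V) :=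
      hd.ext_semi fun a v hv => by
        rw [LinearMap.comp_apply, LinearMap.comp_apply, mem_wt.1 hv, LinearMap.map_smulₛₗ,
          conj_chi]
        rw [wt_eq_of_grading hd hσ ht] at hv
        exact (mem_wt.1 (hσ _ (hc a v hv)) z).symm
    exact fun v => LinearMap.congr_fun h1 v
  have hb : ∀ z, (descend (σ z)).baseChange ℂ = σ z := fun z => descend_baseChange (hcomm z)
  let ρ : Representation ℝ ℂˣ V :=
    { toFun := fun z => descend (σ z)
      map_one' := baseChange_injective (by
        rw [hb, map_one]
        exact (LinearMap.baseChange_id).symm)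
      map_mul' := fun z w => baseChange_injective (by
        rw [hb, map_mul]
        change _ = (descend (σ z) ∘ₗ descend (σ w)).baseChange ℂ
        rw [LinearMap.baseChange_comp, hb, hb]
        rfl) }
  have hρ : cplx ρ = σ := MonoidHom.ext hb
  exact ⟨ρ, hρ ▸ hd, fun a => hρ ▸ wt_eq_of_grading hd hσ ht a⟩

end regularity

namespace FiltSpace

/-- A representation of `ℂ^*` on a filtered space which splits the filtrations induced on the
graded pieces of the weight filtration. -/
structure IsSplitting (V : FiltSpace) (ρ : Representation ℝ ℂˣ V) : Prop where
  isDiag : IsDiag (cplx ρ)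
  Wc_eq : ∀ n, V.Wc n = wtSub (cplx ρ) (le n)
  onGr_eq : ∀ p n, V.onGr (V.F p) n = wtSub (cplx ρ) (({a | p ≤ a.1} ∩ le n) ∪ le (n - 1))

theorem exists_splitting {V : FiltSpace} (hV : IsMHS V) : ∃ ρ, IsSplitting V ρ := by
  choose U hU hU' using V.exists_weight_complement
  have hgr := fun p n => onGr_eq_iSup hV hU p n
  obtain ⟨P, hP⟩ := hV.F_top
  obtain ⟨M, hM⟩ := hV.W_bot
  obtain ⟨M', hM'⟩ := hV.W_top
  have hWbot : ∀ n ≤ M, V.Wc n = ⊥ := fun n hn => le_bot_iff.1 (baseChange_le fun v hv => by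
    have h1 := V.W_mono hn hv
    rw [hM, Submodule.mem_bot] at h1
    rw [h1, map_zero]
    exact Submodule.zero_mem _)
  have hWle : ∀ n, V.Wc n ≤ ⨆ a ∈ le n, hodgePiece U a := by
    have key : ∀ k : ℕ, ∀ n ≤ M + k, V.Wc n ≤ ⨆ a ∈ le n, hodgePiece U a := by
      intro k
      induction k with
      | zero =>
        intro n hn
        rw [hWbot n (by simpa using hn)]
        exact bot_le
      | succ k ih =>
        intro n hn
        rw [← onGr_top n, ← hP, hgr]
        refine sup_le (biSup_mono fun a ha => mem_le.2 ha.2.le) ?_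
        exact (ih (n - 1) (by push_cast at hn; omega)).trans
          (biSup_mono fun a ha => le_mono (by omega) ha)
    exact fun n => key (n - M).toNat n (by omega)
  have ht : ⨆ a, hodgePiece U a = ⊤ := by
    refine top_le_iff.1 fun x _ => ?_
    have hx : x ∈ V.Wc M' := by
      rw [Wc, hM']
      exact (Submodule.baseChange_top (R := ℝ) (A := ℂ) (M := V)) ▸ trivial
    exact (iSup₂_le fun a _ => le_iSup (hodgePiece U) a : _ ≤ _) (hWle M' hx)
  obtain ⟨ρ, hd, hρ⟩ := exists_real_rep (iSupIndep_hodgePiece hV hU') ht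
    fun a v hv => conj_mem_hodgePiece hv
  have hS : ∀ S : Set (ℤ × ℤ), wtSub (cplx ρ) S = ⨆ a ∈ S, hodgePiece U a := fun S => by
    simp only [wtSub, hρ]
  have hWc : ∀ n, V.Wc n = wtSub (cplx ρ) (le n) := fun n => by
    rw [hS]
    exact le_antisymm (hWle n) (iSup₂_le fun a ha => hodgePiece_le_Wc ha)
  refine ⟨ρ, hd, hWc, fun p n => ?_⟩
  rw [hgr, hWc, ← hS]
  apply le_antisymm
  · refine sup_le (wtSub_mono fun a ha => Or.inl ⟨ha.1, ha.2.le⟩) (wtSub_mono fun a ha => Or.inr ha)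
  · intro x hx
    have hx' : x ∈ wtSub (cplx ρ) ({a | p ≤ a.1 ∧ a.1 + a.2 = n} ∪ le (n - 1)) := by
      refine wtSub_mono (fun a ha => ?_) hx
      simp only [Set.mem_union, Set.mem_inter_iff, Set.mem_ofPred_eq, mem_le] at ha ⊢
      omega
    obtain ⟨y, hy, z, hz, rfl⟩ := mem_wtSub_union hd hx'
    exact Submodule.add_mem_sup hy hz

variable {V : FiltSpace} {ρ : Representation ℝ ℂˣ V}

theorem IsSplitting.exists_lift (hρ : IsSplitting V ρ)
    (hH : IsDiag (Representation.linHom (cplx ρ) (cplx ρ))) (hbot : ∃ n, V.W n = ⊥)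
    (htop : ∃ n, V.W n = ⊤) :
    ∃ g : Module.End ℂ (ℂ ⊗[ℝ] V), g - 1 ∈ lo ρ ρ (-1) ∧
      ∀ p, V.F p = (wtSub (cplx ρ) {a | p ≤ a.1}).map g := by
  obtain ⟨g, hg⟩ := HodgeConn.exists_lift hρ.isDiag (P := fun a => V.F a.1)
    (Q := fun a => V.Wc (a.1 + a.2 - 1)) (fun a v hv => by
      have h1 : v ∈ V.onGr (V.F a.1) (a.1 + a.2) := by
        rw [hρ.onGr_eq]
        exact wt_le_wtSub (Or.inl ⟨le_refl a.1, le_refl (a.1 + a.2)⟩) hv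
      obtain ⟨y, hy, z, hz, e⟩ := Submodule.mem_sup.1 h1
      exact Submodule.mem_sup.2 ⟨y, hy.1, z, hz, e⟩)
  have hg1 : g - 1 ∈ lo ρ ρ (-1) :=
    mem_wtSub_linHom hH hρ.isDiag hρ.isDiag fun a v hv => by
      have h1 := (hg a v hv).2
      rw [hρ.Wc_eq] at h1
      refine wtSub_mono (fun b hb => ?_) h1
      have hb' := mem_le.1 hb
      show (b - a).1 + (b - a).2 ≤ -1
      rw [Prod.fst_sub, Prod.snd_sub]
      omega
  have hle : ∀ p, (wtSub (cplx ρ) {a | p ≤ a.1}).map g ≤ V.F p := fun p =>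
    Submodule.map_le_iff_le_comap.2 (wtSub_le fun a ha v hv => V.F_anti ha (hg a v hv).1)
  refine ⟨g, hg1, fun p => le_antisymm ?_ (hle p)⟩
  obtain ⟨M, hM⟩ := hbot
  obtain ⟨M', hM'⟩ := htop
  have key : ∀ k : ℕ, ∀ x ∈ V.F p, x ∈ V.Wc (M + k) →
      x ∈ (wtSub (cplx ρ) {a | p ≤ a.1}).map g := by
    intro k
    induction k with
    | zero =>
      intro x _ hxW
      rw [Nat.cast_zero, add_zero, Wc, hM, Submodule.baseChange_bot, Submodule.mem_bot] at hxW
      rw [hxW]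
      exact Submodule.zero_mem _
    | succ k ih =>
      intro x hx hxW
      have h1 : x ∈ V.onGr (V.F p) (M + (k + 1 : ℕ)) := Submodule.mem_sup_left ⟨hx, hxW⟩
      rw [hρ.onGr_eq] at h1
      obtain ⟨y, hy, z, hz, rfl⟩ := mem_wtSub_union hρ.isDiag h1
      have hy1 : y ∈ wtSub (cplx ρ) {a | p ≤ a.1} := wtSub_mono Set.inter_subset_left hy
      have hy2 : y ∈ wtSub (cplx ρ) (le (M + (k + 1 : ℕ))) := wtSub_mono Set.inter_subset_right hy
      have hgy : g y ∈ (wtSub (cplx ρ) {a | p ≤ a.1}).map g := Submodule.mem_map_of_mem hy1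
      have h2 : g y - y ∈ wtSub (cplx ρ) (le (M + (k + 1 : ℕ) - 1)) :=
        apply_mem_of_mem_lo (k := -1) (by omega) hg1 hy2
      have h3 := ih (y + z - g y) (sub_mem hx (hle p hgy)) (by
        rw [hρ.Wc_eq, show y + z - g y = z - (g y - y) by abel]
        refine wtSub_mono (le_mono ?_) (sub_mem hz h2)
        push_cast
        omega)
      have := add_mem h3 hgy
      rwa [sub_add_cancel] at this
  intro x hx
  refine key (M' - M).toNat x hx ?_
  have hx : x ∈ V.Wc M' := by
    rw [Wc, hM']
    exact (Submodule.baseChange_top (R := ℝ) (A := ℂ) (M := V)) ▸ trivial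
  exact V.Wc_mono (by omega) hx

end FiltSpace

section approximation

variable {V : Type} [AddCommGroup V] [Module ℝ V] [FiniteDimensional ℝ V]
  {ρ : Representation ℝ ℂˣ V}

theorem exists_exp_factorization (hd : IsDiag (cplx ρ)) {g : Module.End ℂ (ℂ ⊗[ℝ] V)}
    (hg : g - 1 ∈ lo ρ ρ (-1)) :
    ∃ r b e : Module.End ℂ (ℂ ⊗[ℝ] V), conjHom V V r = r ∧ conjHom V V b = b ∧
      r - 1 ∈ lo ρ ρ (-1) ∧ e - 1 ∈ lo ρ ρ (-1) ∧
      b ∈ wtSub (Representation.linHom (cplx ρ) (cplx ρ)) negSet ∧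
      e ∈ wtSub (Representation.linHom (cplx ρ) (cplx ρ)) fSet ∧
      r ∘ₗ g = IsNilpotent.exp (Complex.I • b) ∘ₗ e := by
  have hH : IsDiag (Representation.linHom (cplx ρ) (cplx ρ)) := isDiag_linHom hd hd
  have hc := conjHom_linHom ρ ρ
  have hlo : ∀ {b}, b ∈ wtSub (Representation.linHom (cplx ρ) (cplx ρ)) negSet →
      Complex.I • b ∈ lo ρ ρ (-2) := fun hb =>
    Submodule.smul_mem _ _ (wtSub_mono negSet_subset_le hb)
  have hnil : ∀ {b}, b ∈ wtSub (Representation.linHom (cplx ρ) (cplx ρ)) negSet →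
      IsNilpotent (Complex.I • b) := fun hb =>
    isNilpotent_of_mem_wtSub hd (lo_mono (by norm_num) (hlo hb))
  have h1e : conjHom V V (1 : Module.End ℂ (ℂ ⊗[ℝ] V)) = 1 :=
    LinearMap.ext fun v => by rw [conjHom_apply, Module.End.one_apply, conj_conj]; rfl
  have key : ∀ m : ℕ, ∃ r b e : Module.End ℂ (ℂ ⊗[ℝ] V), conjHom V V r = r ∧ conjHom V V b = b ∧
      r - 1 ∈ lo ρ ρ (-1) ∧ e - 1 ∈ lo ρ ρ (-1) ∧
      b ∈ wtSub (Representation.linHom (cplx ρ) (cplx ρ)) negSet ∧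
      e ∈ wtSub (Representation.linHom (cplx ρ) (cplx ρ)) fSet ∧
      r ∘ₗ g - IsNilpotent.exp (Complex.I • b) ∘ₗ e ∈ lo ρ ρ (-(m + 1 : ℤ)) := by
    intro m
    induction m with
    | zero =>
      refine ⟨1, 0, 1, h1e, map_zero _, ?_, ?_, Submodule.zero_mem _, ?_, ?_⟩
      · rw [sub_self]; exact Submodule.zero_mem _
      · rw [sub_self]; exact Submodule.zero_mem _
      · refine wtSub_mono (S := {0}) ?_ ?_
        · rintro a rfl
          exact le_refl (0 : ℤ)
        · rw [wtSub_singleton]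
          refine mem_wt_linHom hd fun a v hv => ?_
          rwa [zero_add]
      · rw [smul_zero, IsNilpotent.exp_zero]
        exact lo_mono (by norm_num) hg
    | succ m ih =>
      obtain ⟨r, b, e, hr, hb, hr1, he1, hbn, hef, hX⟩ := ih
      obtain ⟨R, β, ε, hR, hβ, hRm, hβm, hεm, hβn, hεf, hsum⟩ :=
        exists_real_decomposition hH hc conjHom_conjHom hX
      refine ⟨r - R, b + β, e + ε, by rw [map_sub, hr, hR], by rw [map_add, hb, hβ], ?_, ?_,
        add_mem hbn hβn, add_mem hef hεf, ?_⟩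
      · rw [sub_right_comm]
        exact sub_mem hr1 (lo_mono (by omega) hRm)
      · rw [add_sub_right_comm]
        exact add_mem he1 (lo_mono (by omega) hεm)
      · have hE := comp_exp_sub_mem (ρ := ρ) (ρ' := ρ) (f := 1) (m := m + 1)
          (hnil (add_mem hbn hβn)) (hnil hbn) (hlo (add_mem hbn hβn)) (hlo hbn) (by
            have : (1 : Module.End ℂ (ℂ ⊗[ℝ] V)) ∘ₗ (Complex.I • (b + β)) -
                (Complex.I • b) ∘ₗ 1 = Complex.I • β := by
              rw [Module.End.one_eq_id, LinearMap.id_comp, LinearMap.comp_id, smul_add,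
                add_sub_cancel_left]
            rw [this]
            exact Submodule.smul_mem _ _ hβm)
        have hG1 : IsNilpotent.exp (Complex.I • (b + β)) - 1 ∈ lo ρ ρ (-1) :=
          Dat.exp_sub_one_mem (hnil (add_mem hbn hβn)) (hlo (add_mem hbn hβn))
        have he0 := Dat.mem_lo_of_sub_one he1
        have hEe := comp_mem_lo (k := -(m + 1 : ℤ) - 1) (l := 0) (m := -(m + 1 : ℤ) - 1)
          (by omega) hE he0
        have hRg := comp_mem_lo (k := -(m + 1 : ℤ)) (l := -1) (m := -(m + 1 : ℤ) - 1)
          (by omega) hRm hg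
        have hβe := comp_mem_lo (k := -(m + 1 : ℤ)) (l := -1) (m := -(m + 1 : ℤ) - 1)
          (by omega) (Submodule.smul_mem _ Complex.I hβm) he1
        have hGε := comp_mem_lo (k := -1) (l := -(m + 1 : ℤ)) (m := -(m + 1 : ℤ) - 1)
          (by omega) hG1 hεm
        have e1 : (r - R) ∘ₗ g - IsNilpotent.exp (Complex.I • (b + β)) ∘ₗ (e + ε) =
            (r ∘ₗ g - IsNilpotent.exp (Complex.I • b) ∘ₗ e - (R + Complex.I • β + ε)) -
            ((1 ∘ₗ IsNilpotent.exp (Complex.I • (b + β)) - IsNilpotent.exp (Complex.I • b) ∘ₗ 1 -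
              (1 ∘ₗ (Complex.I • (b + β)) - (Complex.I • b) ∘ₗ 1)) ∘ₗ e) - R ∘ₗ (g - 1) -
            (Complex.I • β) ∘ₗ (e - 1) -
            (IsNilpotent.exp (Complex.I • (b + β)) - 1) ∘ₗ ε := by
          refine LinearMap.ext fun v => ?_
          simp only [LinearMap.add_apply, LinearMap.sub_apply, LinearMap.comp_apply,
            Module.End.one_apply, map_sub, map_add, LinearMap.smul_apply, smul_add]
          abel
        rw [e1, hsum, sub_self, zero_sub]
        refine lo_mono (by push_cast; omega)
          (sub_mem (sub_mem (sub_mem (neg_mem hEe) hRg) hβe) hGε)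
  obtain ⟨m, -, hm⟩ := exists_wtSub_le_eq_bot hH
  obtain ⟨r, b, e, hr, hb, hr1, he1, hbn, hef, hX⟩ := key m
  refine ⟨r, b, e, hr, hb, hr1, he1, hbn, hef, sub_eq_zero.1 ?_⟩
  have := lo_mono (show -(m + 1 : ℤ) ≤ -m by omega) hX
  rw [lo, hm] at this
  exact (Submodule.mem_bot ℂ).1 this

theorem injective_of_sub_one_mem {X : Type*} [AddCommGroup X] [Module ℂ X]
    [FiniteDimensional ℂ X] {σ : Representation ℂ ℂˣ X} (h : IsDiag σ) {r : Module.End ℂ X}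
    (hr : r - 1 ∈ wtSub (Representation.linHom σ σ) (le (-1))) : Function.Injective r := by
  have h1 : IsUnit r := by
    have := (isNilpotent_of_mem_wtSub h hr).isUnit_add_one
    rwa [sub_add_cancel] at this
  exact ((Module.End.isUnit_iff r).1 h1).injective

theorem mem_of_apply_mem {K X : Type*} [Field K] [AddCommGroup X] [Module K X]
    [FiniteDimensional K X] {f : X →ₗ[K] X} (hf : Function.Injective f) {S : Submodule K X}
    (hS : ∀ v ∈ S, f v ∈ S) {v : X} (hv : f v ∈ S) : v ∈ S := by
  have h : S.map f = S := Submodule.eq_of_le_of_finrank_eq (Submodule.map_le_iff_le_comap.2 hS)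
    (Submodule.equivMapOfInjective f hf S).finrank_eq.symm
  rw [← h] at hv
  obtain ⟨w, hw, e⟩ := hv
  exact hf e ▸ hw

end approximation

theorem exists_toFilt_iso {V : FiltSpace} (hV : IsMHS V) :
    ∃ D : Dat, Nonempty (D.toFilt ≅ V) := by
  have := hV.finite
  obtain ⟨ρ, hρ⟩ := FiltSpace.exists_splitting hV
  have hd := hρ.isDiag
  obtain ⟨g, hg1, hgF⟩ := hρ.exists_lift (isDiag_linHom hd hd) hV.W_bot hV.W_top
  obtain ⟨r, b, e, hr, hb, hr1, he1, hbn, hef, hfac⟩ := exists_exp_factorization hd hg1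
  obtain ⟨r, rfl⟩ := exists_baseChange_of_conjHom hr
  obtain ⟨b, rfl⟩ := exists_baseChange_of_conjHom hb
  let D : Dat := ⟨V, ρ, isRegularMap_of_isDiag hd, b, hbn⟩
  have hfac' : ∀ y : ℂ ⊗[ℝ] V, r.baseChange ℂ (g y) = D.G (e y) := LinearMap.congr_fun hfac
  have hinj : Function.Injective r := fun v w h => by
    refine ofR_injective (injective_of_sub_one_mem hd hr1 ?_)
    rw [baseChange_ofR, baseChange_ofR, h]
  have hW : ∀ n, V.W n = wtW ρ n := fun n => Submodule.ext fun v => by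
    rw [← ofR_mem_baseChange_iff, mem_wtW, ← hρ.Wc_eq]
    rfl
  have hrW : ∀ n, ∀ v ∈ V.W n, r v ∈ V.W n := fun n v hv => by
    rw [hW, mem_wtW] at hv ⊢
    rw [← baseChange_ofR]
    exact apply_mem_of_mem_lo (by omega) (Dat.mem_lo_of_sub_one hr1) hv
  have heF : ∀ p, ∀ y ∈ wtSub (cplx ρ) {a | p ≤ a.1}, e y ∈ wtSub (cplx ρ) {a | p ≤ a.1} :=
    fun p y hy => apply_mem_wtSub (fun a (ha : 0 ≤ a.1) c (hc : p ≤ c.1) => by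
      show p ≤ (a + c).1
      rw [Prod.fst_add]
      omega) hef hy
  let φ : V ≃ₗ[ℝ] V := LinearEquiv.ofInjectiveEndo r hinj
  have hφ : ∀ v, r (φ.symm v) = v := φ.apply_symm_apply
  have hφC : ∀ x : ℂ ⊗[ℝ] V, φ.symm.toLinearMap.baseChange ℂ (r.baseChange ℂ x) = x := fun x => by
    have h1 : φ.symm.toLinearMap ∘ₗ r = LinearMap.id :=
      LinearMap.ext fun v => φ.symm_apply_apply v
    rw [← LinearMap.comp_apply, ← LinearMap.baseChange_comp, h1, LinearMap.baseChange_id]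
    rfl
  have h2 : ∀ p, ∀ x ∈ V.F p, r.baseChange ℂ x ∈ D.hodge p := by
    intro p x hx
    rw [hgF] at hx
    obtain ⟨y, hy, rfl⟩ := hx
    rw [Dat.mem_hodge, hfac', Dat.Ginv_G]
    exact heF p y hy
  have h3 : ∀ n, ∀ v ∈ wtW ρ n, φ.symm v ∈ V.W n := fun n v hv =>
    mem_of_apply_mem hinj (hrW n) (by rw [hφ, hW]; exact hv)
  have h4 : ∀ p, ∀ x ∈ D.hodge p, φ.symm.toLinearMap.baseChange ℂ x ∈ V.F p := by
    intro p x hx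
    have hx' : D.Ginv x ∈ (wtSub (cplx ρ) {a | p ≤ a.1}).map e := by
      have h : (wtSub (cplx ρ) {a | p ≤ a.1}).map e = wtSub (cplx ρ) {a | p ≤ a.1} :=
        Submodule.eq_of_le_of_finrank_eq (Submodule.map_le_iff_le_comap.2 (heF p))
          (Submodule.equivMapOfInjective e (injective_of_sub_one_mem hd he1) _).finrank_eq.symm
      rw [h]
      exact hx
    obtain ⟨y, hy, hye⟩ := hx'
    have hxy : x = r.baseChange ℂ (g y) := by
      rw [hfac', hye, Dat.G_Ginv]
    rw [hxy]
    refine FiltSpace.mem_of_eq (hφC (g y)) ?_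
    rw [hgF]
    exact Submodule.mem_map_of_mem hy
  exact ⟨D, ⟨(FiltSpace.mkIso (V := V) (V' := D.toFilt) φ
    (fun n v hv => (hW n ▸ hrW n v hv : r v ∈ wtW ρ n)) h2 h3 h4).symm⟩⟩

instance : datToMHS.EssSurj where
  mem_essImage V := by
    obtain ⟨D, ⟨e⟩⟩ := exists_toFilt_iso V.property
    exact ⟨D, ⟨(ObjectProperty.fullyFaithfulι isMHS).preimageIso e⟩⟩

instance : datToMHS.IsEquivalence where

section bilinear

variable {X X' X'' : Type*} [AddCommGroup X] [Module ℂ X] [AddCommGroup X'] [Module ℂ X']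
  [AddCommGroup X''] [Module ℂ X''] {σ : Representation ℂ ℂˣ X} {σ' : Representation ℂ ℂˣ X'}
  {σ'' : Representation ℂ ℂˣ X''} {B : X →ₗ[ℂ] X' →ₗ[ℂ] X''}

theorem wtSub_le_of_bilin (h : IsDiag σ) (h' : IsDiag σ')
    (hB : ∀ z v w, B (σ z v) (σ' z w) = σ'' z (B v w))
    (hs : Submodule.span ℂ {x | ∃ v w, x = B v w} = ⊤) {S : Set (ℤ × ℤ)} {T : Submodule ℂ X''}
    (hT : ∀ a b, a + b ∈ S → ∀ v ∈ wt σ a, ∀ w ∈ wt σ' b, B v w ∈ T) : wtSub σ'' S ≤ T := by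
  have h'' : IsDiag σ'' := h.of_bilin h' hB hs
  have key : ∀ v w, scale h'' (ind S) (B v w) ∈ T := by
    intro v w
    have h1 : wtSub σ Set.univ ≤ T.comap (scale h'' (ind S) ∘ₗ B.flip w) := wtSub_le fun a _ v hv => by
      have h2 : wtSub σ' Set.univ ≤ T.comap (scale h'' (ind S) ∘ₗ B v) := wtSub_le fun b _ w hw => by
        rw [Submodule.mem_comap, LinearMap.comp_apply, scale_of_mem h'' _ (bilin_mem_wt hB hv hw)]
        by_cases hab : a + b ∈ S
        · exact Submodule.smul_mem _ _ (hT a b hab v hv w hw)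
        · rw [ind_of_notMem hab, zero_smul]
          exact Submodule.zero_mem _
      exact h2 (h'.mem_univ w)
    exact h1 (h.mem_univ v)
  have h3 : ⊤ ≤ T.comap (scale h'' (ind S)) := by
    rw [← hs, Submodule.span_le]
    rintro _ ⟨v, w, rfl⟩
    exact key v w
  intro x hx
  rw [← (mem_wtSub_iff h'').1 hx]
  exact h3 (x := x) trivial

theorem bilin_exp [Module ℚ X] [SMulCommClass ℂ ℚ X] [Module ℚ X'] [SMulCommClass ℂ ℚ X']
    [Module ℚ X''] [SMulCommClass ℂ ℚ X''] {a : Module.End ℂ X} {a' : Module.End ℂ X'}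
    {a'' : Module.End ℂ X''} (ha : IsNilpotent a) (ha' : IsNilpotent a') (ha'' : IsNilpotent a'')
    (hB : ∀ v w, a'' (B v w) = B (a v) w + B v (a' w)) (v : X) (w : X') :
    IsNilpotent.exp a'' (B v w) = B (IsNilpotent.exp a v) (IsNilpotent.exp a' w) := by
  have h1 : IsNilpotent (a.rTensor X') := ha.map (Module.End.rTensorAlgHom ℂ X X')
  have h2 : IsNilpotent (a'.lTensor X) := ha'.map (Module.End.lTensorAlgHom ℂ X' X)
  have hc : Commute (a.rTensor X') (a'.lTensor X) := by
    refine TensorProduct.ext' fun v w => ?_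
    rfl
  have h3 := comp_exp (f := TensorProduct.lift B) (hc.isNilpotent_add h1 h2) ha''
    (fun x => by
      refine LinearMap.congr_fun (f := TensorProduct.lift B ∘ₗ (a.rTensor X' + a'.lTensor X))
        (g := a'' ∘ₗ TensorProduct.lift B) (TensorProduct.ext' fun v w => ?_) x
      simp [hB]) (v ⊗ₜ w)
  rw [TensorProduct.lift.tmul] at h3
  rw [← h3, IsNilpotent.exp_add_of_commute hc h1 h2, Module.End.mul_apply]
  have h4 : IsNilpotent.exp (a'.lTensor X) (v ⊗ₜ[ℂ] w) = v ⊗ₜ IsNilpotent.exp a' w :=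
    (comp_exp (f := TensorProduct.mk ℂ X X' v) ha' h2 (fun w => rfl) w).symm
  have h5 : ∀ w, IsNilpotent.exp (a.rTensor X') (v ⊗ₜ[ℂ] w) = IsNilpotent.exp a v ⊗ₜ w := fun w =>
    (comp_exp (f := (TensorProduct.mk ℂ X X').flip w) ha h1 (fun v => rfl) v).symm
  rw [h4, h5, TensorProduct.lift.tmul]

end bilinear

namespace Dat

section tensor

variable {D D' D'' : Dat} (μ : (D ⊗[ℝ] D') ≃ₗ[ℝ] D'')

/-- The complexification of a bilinear map. -/
def cbilin : (ℂ ⊗[ℝ] D) →ₗ[ℂ] (ℂ ⊗[ℝ] D') →ₗ[ℂ] (ℂ ⊗[ℝ] D'') :=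
  (FiltSpace.cmul D D').compr₂ (μ.toLinearMap.baseChange ℂ)

theorem cbilin_apply (x : ℂ ⊗[ℝ] D) (y : ℂ ⊗[ℝ] D') :
    cbilin μ x y = μ.toLinearMap.baseChange ℂ (FiltSpace.cmul D D' x y) := rfl

theorem cbilin_ofR (u : D) (u' : D') : cbilin μ (ofR D u) (ofR D' u') = ofR D'' (μ (u ⊗ₜ u')) := by
  rw [cbilin_apply, ofR_apply, ofR_apply, FiltSpace.cmul_tmul, mul_one, ← ofR_apply,
    baseChange_ofR]
  rfl

theorem span_cbilin : Submodule.span ℂ {x | ∃ v w, x = cbilin μ v w} = ⊤ := by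
  refine top_le_iff.1 fun x _ => ?_
  have hx : x = μ.toLinearMap.baseChange ℂ (μ.symm.toLinearMap.baseChange ℂ x) := by
    rw [← LinearMap.comp_apply, ← LinearMap.baseChange_comp, LinearEquiv.comp_symm,
      LinearMap.baseChange_id]
    rfl
  rw [hx]
  generalize μ.symm.toLinearMap.baseChange ℂ x = y
  induction y with
  | zero => rw [map_zero]; exact Submodule.zero_mem _
  | add y z hy hz => rw [map_add]; exact add_mem hy hz
  | tmul c t =>
    induction t with
    | zero => rw [TensorProduct.tmul_zero, map_zero]; exact Submodule.zero_mem _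
    | add y z hy hz => rw [TensorProduct.tmul_add, map_add]; exact add_mem hy hz
    | tmul u u' =>
      refine Submodule.subset_span ⟨c ⊗ₜ u, 1 ⊗ₜ u', ?_⟩
      rw [cbilin_apply, FiltSpace.cmul_tmul, mul_one]

variable {μ}

theorem cbilin_equivariant (hρ : ∀ z u u', μ (D.ρ z u ⊗ₜ D'.ρ z u') = D''.ρ z (μ (u ⊗ₜ u')))
    (z : ℂˣ) (x : ℂ ⊗[ℝ] D) (y : ℂ ⊗[ℝ] D') :
    cbilin μ (cplx D.ρ z x) (cplx D'.ρ z y) = cplx D''.ρ z (cbilin μ x y) := by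
  have h : μ.toLinearMap ∘ₗ TensorProduct.map (D.ρ z) (D'.ρ z) = D''.ρ z ∘ₗ μ.toLinearMap :=
    TensorProduct.ext' fun u u' => hρ z u u'
  rw [cbilin_apply, cbilin_apply, cplx_apply, cplx_apply, cplx_apply,
    ← FiltSpace.baseChange_map_cmul, ← LinearMap.comp_apply, ← LinearMap.baseChange_comp, h,
    LinearMap.baseChange_comp, LinearMap.comp_apply]

theorem ib_cbilin (hb : ∀ u u', D''.b (μ (u ⊗ₜ u')) = μ (D.b u ⊗ₜ u' + u ⊗ₜ D'.b u'))
    (x : ℂ ⊗[ℝ] D) (y : ℂ ⊗[ℝ] D') :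
    D''.ib (cbilin μ x y) = cbilin μ (D.ib x) y + cbilin μ x (D'.ib y) := by
  have h : D''.b ∘ₗ μ.toLinearMap = μ.toLinearMap ∘ₗ (TensorProduct.map D.b LinearMap.id +
      TensorProduct.map LinearMap.id D'.b) := TensorProduct.ext' fun u u' => hb u u'
  have h1 : D''.b.baseChange ℂ (cbilin μ x y) =
      cbilin μ (D.b.baseChange ℂ x) y + cbilin μ x (D'.b.baseChange ℂ y) := by
    rw [cbilin_apply, ← LinearMap.comp_apply, ← LinearMap.baseChange_comp, h,
      LinearMap.baseChange_comp, LinearMap.comp_apply, LinearMap.baseChange_add,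
      LinearMap.add_apply, FiltSpace.baseChange_map_cmul, FiltSpace.baseChange_map_cmul, map_add,
      LinearMap.baseChange_id, LinearMap.baseChange_id]
    rfl
  simp only [ib, LinearMap.smul_apply, h1, map_smul, smul_add]

theorem G_cbilin (hb : ∀ u u', D''.b (μ (u ⊗ₜ u')) = μ (D.b u ⊗ₜ u' + u ⊗ₜ D'.b u'))
    (x : ℂ ⊗[ℝ] D) (y : ℂ ⊗[ℝ] D') : D''.G (cbilin μ x y) = cbilin μ (D.G x) (D'.G y) :=
  bilin_exp D.isNilpotent_ib D'.isNilpotent_ib D''.isNilpotent_ib (ib_cbilin hb) x y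

theorem Ginv_cbilin (hb : ∀ u u', D''.b (μ (u ⊗ₜ u')) = μ (D.b u ⊗ₜ u' + u ⊗ₜ D'.b u'))
    (x : ℂ ⊗[ℝ] D) (y : ℂ ⊗[ℝ] D') :
    D''.Ginv (cbilin μ x y) = cbilin μ (D.Ginv x) (D'.Ginv y) := by
  rw [← D''.Ginv_G (cbilin μ (D.Ginv x) (D'.Ginv y)), G_cbilin hb, G_Ginv, G_Ginv]

theorem symm_cbilin (x : ℂ ⊗[ℝ] D) (y : ℂ ⊗[ℝ] D') :
    μ.symm.toLinearMap.baseChange ℂ (cbilin μ x y) = FiltSpace.cmul D D' x y := by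
  rw [cbilin_apply, ← LinearMap.comp_apply, ← LinearMap.baseChange_comp, LinearEquiv.symm_comp,
    LinearMap.baseChange_id]
  rfl

theorem cmul_mem_baseChange {A A' : Type} [AddCommGroup A] [Module ℝ A] [AddCommGroup A']
    [Module ℝ A'] {S : Submodule ℝ A} {S' : Submodule ℝ A'} {T : Submodule ℝ (A ⊗[ℝ] A')}
    (h : ∀ u ∈ S, ∀ u' ∈ S', u ⊗ₜ u' ∈ T) {x : ℂ ⊗[ℝ] A} {y : ℂ ⊗[ℝ] A'}
    (hx : x ∈ S.baseChange ℂ) (hy : y ∈ S'.baseChange ℂ) :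
    FiltSpace.cmul A A' x y ∈ T.baseChange ℂ := by
  have h1 : S.baseChange ℂ ≤ (T.baseChange ℂ).comap ((FiltSpace.cmul A A').flip y) :=
    baseChange_le fun u hu => by
      have h2 : S'.baseChange ℂ ≤ (T.baseChange ℂ).comap (FiltSpace.cmul A A' (ofR A u)) :=
        baseChange_le fun u' hu' => by
          rw [Submodule.mem_comap, ofR_apply, ofR_apply, FiltSpace.cmul_tmul, mul_one, ← ofR_apply]
          exact ofR_mem_baseChange (h u hu u' hu')
      exact h2 hy
  exact h1 hx

/-- The weight filtration of the tensor product. -/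
def tensorW (D D' : Dat) (n : ℤ) : Submodule ℝ (D ⊗[ℝ] D') :=
  (FiltSpace.tensor D.toFilt D'.toFilt).W n

/-- The Hodge filtration of the tensor product. -/
def tensorF (D D' : Dat) (p : ℤ) : Submodule ℂ (ℂ ⊗[ℝ] (D ⊗[ℝ] D')) :=
  (FiltSpace.tensor D.toFilt D'.toFilt).F p

theorem tmul_mem_tensorW {i j n : ℤ} (h : i + j = n) {u : D} {u' : D'} (hu : u ∈ wtW D.ρ i)
    (hu' : u' ∈ wtW D'.ρ j) : u ⊗ₜ[ℝ] u' ∈ tensorW D D' n :=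
  FiltSpace.tmul_mem_W (V := D.toFilt) (V' := D'.toFilt) h hu hu'

theorem cmul_mem_tensorF {i j p : ℤ} (h : i + j = p) {x : ℂ ⊗[ℝ] D} {y : ℂ ⊗[ℝ] D'}
    (hx : x ∈ D.hodge i) (hy : y ∈ D'.hodge j) : FiltSpace.cmul D D' x y ∈ tensorF D D' p :=
  FiltSpace.cmul_mem_F (V := D.toFilt) (V' := D'.toFilt) h hx hy

theorem map_tmul_mem_wtW
    (hρ : ∀ z u u', μ (D.ρ z u ⊗ₜ D'.ρ z u') = D''.ρ z (μ (u ⊗ₜ u')))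
    {i j n : ℤ} (hij : i + j = n) {u : D} {u' : D'} (hu : u ∈ wtW D.ρ i)
    (hu' : u' ∈ wtW D'.ρ j) : μ (u ⊗ₜ u') ∈ wtW D''.ρ n := by
  rw [mem_wtW, ← cbilin_ofR]
  refine bilin_mem_wtSub (cbilin_equivariant hρ) (fun a ha b hb => ?_) hu hu'
  rw [mem_le] at ha hb ⊢
  rw [Prod.fst_add, Prod.snd_add]
  omega

theorem cbilin_mem_hodge
    (hρ : ∀ z u u', μ (D.ρ z u ⊗ₜ D'.ρ z u') = D''.ρ z (μ (u ⊗ₜ u')))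
    (hb : ∀ u u', D''.b (μ (u ⊗ₜ u')) = μ (D.b u ⊗ₜ u' + u ⊗ₜ D'.b u'))
    {i j p : ℤ} (hij : i + j = p) {x : ℂ ⊗[ℝ] D} {y : ℂ ⊗[ℝ] D'}
    (hx : x ∈ D.hodge i) (hy : y ∈ D'.hodge j) : cbilin μ x y ∈ D''.hodge p := by
  rw [mem_hodge, Ginv_cbilin hb]
  refine bilin_mem_wtSub (cbilin_equivariant hρ)
    (fun a (ha : i ≤ a.1) b (hb : j ≤ b.1) => ?_) hx hy
  change p ≤ (a + b).1
  rw [Prod.fst_add]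
  omega

theorem symm_mem_tensorW
    (hρ : ∀ z u u', μ (D.ρ z u ⊗ₜ D'.ρ z u') = D''.ρ z (μ (u ⊗ₜ u')))
    {n : ℤ} {u : D''} (hu : u ∈ wtW D''.ρ n) :
    μ.symm u ∈ tensorW D D' n := by
  have h1 : wtSub (cplx D''.ρ) (le n) ≤
      ((tensorW D D' n).baseChange ℂ).comap (μ.symm.toLinearMap.baseChange ℂ) :=
    wtSub_le_of_bilin D.isDiag D'.isDiag (cbilin_equivariant hρ) (span_cbilin μ)
      fun a b hab x hx y hy => by
        rw [Submodule.mem_comap, symm_cbilin]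
        refine cmul_mem_baseChange (S := wtW D.ρ (a.1 + a.2)) (S' := wtW D'.ρ (n - (a.1 + a.2)))
          (fun u hu u' hu' => tmul_mem_tensorW (by omega) hu hu') ?_ ?_
        · rw [baseChange_wtW]
          exact wt_le_wtSub (le_refl (a.1 + a.2)) hx
        · rw [baseChange_wtW]
          refine wt_le_wtSub ?_ hy
          rw [mem_le, Prod.fst_add, Prod.snd_add] at hab
          rw [mem_le]
          omega
  have h2 := h1 hu
  rw [Submodule.mem_comap, baseChange_ofR] at h2
  exact ofR_mem_baseChange_iff.1 h2

theorem symm_mem_tensorF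
    (hρ : ∀ z u u', μ (D.ρ z u ⊗ₜ D'.ρ z u') = D''.ρ z (μ (u ⊗ₜ u')))
    (hb : ∀ u u', D''.b (μ (u ⊗ₜ u')) = μ (D.b u ⊗ₜ u' + u ⊗ₜ D'.b u'))
    {p : ℤ} {x : ℂ ⊗[ℝ] D''} (hx : x ∈ D''.hodge p) :
    μ.symm.toLinearMap.baseChange ℂ x ∈ tensorF D D' p := by
  have h1 : wtSub (cplx D''.ρ) {a | p ≤ a.1} ≤
      (tensorF D D' p).comap (μ.symm.toLinearMap.baseChange ℂ ∘ₗ D''.G) :=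
    wtSub_le_of_bilin D.isDiag D'.isDiag (cbilin_equivariant hρ) (span_cbilin μ)
      fun a b hab x hx y hy => by
        rw [Submodule.mem_comap, LinearMap.comp_apply, G_cbilin hb, symm_cbilin]
        refine cmul_mem_tensorF (i := a.1) (j := p - a.1) (by omega) ?_ ?_
        · rw [mem_hodge, Ginv_G]
          exact wt_le_wtSub (le_refl a.1) hx
        · rw [mem_hodge, Ginv_G]
          refine wt_le_wtSub ?_ hy
          change p ≤ (a + b).1 at hab
          rw [Prod.fst_add] at hab
          change p - a.1 ≤ b.1
          omega
  have h3 := h1 (D''.mem_hodge.1 hx)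
  rw [Submodule.mem_comap, LinearMap.comp_apply, G_Ginv] at h3
  exact h3

/-- A bilinear isomorphism compatible with the data identifies the filtered spaces. -/
def tensorIso (hρ : ∀ z u u', μ (D.ρ z u ⊗ₜ D'.ρ z u') = D''.ρ z (μ (u ⊗ₜ u')))
    (hb : ∀ u u', D''.b (μ (u ⊗ₜ u')) = μ (D.b u ⊗ₜ u' + u ⊗ₜ D'.b u')) :
    FiltSpace.tensor D.toFilt D'.toFilt ≅ D''.toFilt :=
  FiltSpace.mkIso (V := FiltSpace.tensor D.toFilt D'.toFilt) (V' := D''.toFilt) μ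
    (fun n => FiltSpace.tensorW_le (V := D.toFilt) (V' := D'.toFilt)
      (S := (wtW D''.ρ n).comap μ.toLinearMap)
      fun _ _ hij _ hu _ hu' => map_tmul_mem_wtW hρ hij hu hu')
    (fun p => FiltSpace.tensorF_le (V := D.toFilt) (V' := D'.toFilt)
      (S := (D''.hodge p).comap (μ.toLinearMap.baseChange ℂ))
      fun _ _ hij _ hx _ hy => cbilin_mem_hodge hρ hb hij hx hy)
    (fun _ _ hu => symm_mem_tensorW hρ hu)
    (fun _ _ hx => symm_mem_tensorF hρ hb hx)

end tensor

end Dat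

namespace EqConn

section tensor

variable {E E' : EqConn}

instance [Module.Finite Poly E] [Module.Finite Poly E'] : Module.Finite Poly (tensor E E') :=
  inferInstanceAs (Module.Finite Poly (E ⊗[Poly] E'))

instance [Module.Projective Poly E] [Module.Projective Poly E'] :
    Module.Projective Poly (tensor E E') :=
  inferInstanceAs (Module.Projective Poly (E ⊗[Poly] E'))

/-- The pure tensors, as sections of the tensor product. -/
def tm (m : E) (m' : E') : tensor E E' := m ⊗ₜ[Poly] m'

theorem tm_smul_smul (f g : Poly) (m : E) (m' : E') : tm (f • m) (g • m') = (f * g) • tm m m' :=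
  TensorProduct.smul_tmul_smul f g m m'

theorem smul_tm (f : Poly) (m : E) (m' : E') : tm (f • m) m' = f • tm m m' := rfl

theorem tm_real_smul (r : ℝ) (m : E) (m' : E') : tm (r • m) m' = r • tm m m' := rfl

theorem real_smul_tm (r : ℝ) (m : E) (m' : E') : tm m (r • m') = r • tm m m' :=
  TensorProduct.tmul_smul r m m'

theorem nabla_tm (i : Fin 2) (m : E) (m' : E') :
    (tensor E E').nabla i (tm m m') = tm (E.nabla i m) m' + tm m (E'.nabla i m') := rfl

theorem tm_add (m : E) (m' n' : E') : tm m (m' + n') = tm m m' + tm m n' :=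
  TensorProduct.tmul_add m m' n'

theorem add_tm (m n : E) (m' : E') : tm (m + n) m' = tm m m' + tm n m' :=
  TensorProduct.add_tmul m n m'

theorem tm_zero (m : E) : tm m (0 : E') = 0 := TensorProduct.tmul_zero _ m

theorem zero_tm (m' : E') : tm (0 : E) m' = 0 := TensorProduct.zero_tmul _ m'

theorem euler_tm (m : E) (m' : E') :
    (tensor E E').euler (tm m m') = tm (E.euler m) m' + tm m (E'.euler m') := by
  have h : ∀ (f : Poly) (n : E'), tm m (f • n) = f • tm m n := fun f n =>
    TensorProduct.tmul_smul f m n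
  simp only [euler_apply, nabla_tm, add_tm, tm_add, smul_tm, h, smul_add]
  abel

/-- The pure tensors as a real bilinear map. -/
def tmBil (E E' : EqConn) : E →ₗ[ℝ] E' →ₗ[ℝ] tensor E E' :=
  LinearMap.mk₂ ℝ tm add_tm tm_real_smul tm_add real_smul_tm

/-- The tensor product of radially constant sections. -/
def radialMul (E E' : EqConn) : E.radial →ₗ[ℝ] E'.radial →ₗ[ℝ] (tensor E E').radial :=
  LinearMap.mk₂ ℝ (fun u u' => ⟨tm (u : E) (u' : E'), by
      rw [mem_radial, euler_tm, mem_radial.1 u.2, mem_radial.1 u'.2, tm_zero, zero_tm, add_zero]⟩)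
    (fun _ _ _ => Subtype.ext (add_tm _ _ _)) (fun _ _ _ => rfl)
    (fun _ _ _ => Subtype.ext (tm_add _ _ _)) (fun _ _ _ => Subtype.ext (real_smul_tm _ _ _))

theorem coe_radialMul (u : E.radial) (u' : E'.radial) :
    (radialMul E E' u u' : tensor E E') = tm (u : E) (u' : E') := rfl

variable [Module.Finite Poly E] [Module.Projective Poly E]
  [Module.Finite Poly E'] [Module.Projective Poly E']

theorem ev_tm (a : Fin 2 → ℝ) (m : E) (m' : E') :
    (tensor E E').ev a (tm m m') = radialMul E E' (E.ev a m) (E'.ev a m') := by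
  have h1 : ∀ (g : Poly) (u' : E'.radial), (tensor E E').ev a (tm m (g • (u' : E'))) =
      radialMul E E' (E.ev a m) (E'.ev a (g • (u' : E'))) := fun g u' => by
    refine LinearMap.congr_fun
      (f := (tensor E E').ev a ∘ₗ (tmBil E E').flip (g • (u' : E')))
      (g := (radialMul E E').flip (E'.ev a (g • (u' : E'))) ∘ₗ E.ev a)
      (frame_ext fun f u => ?_) m
    change (tensor E E').ev a (tm (f • (u : E)) (g • (u' : E'))) =
      radialMul E E' (E.ev a (f • (u : E))) (E'.ev a (g • (u' : E')))
    rw [tm_smul_smul, ← coe_radialMul, ev_smul, ev_coe, ev_smul, ev_smul, ev_coe, ev_coe, map_smul,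
      map_smul, LinearMap.smul_apply, smul_smul, map_mul, mul_comm]
  refine LinearMap.congr_fun (f := (tensor E E').ev a ∘ₗ tmBil E E' m)
    (g := radialMul E E' (E.ev a m) ∘ₗ E'.ev a) (frame_ext ?_) m'
  exact h1

/-- Evaluation of both factors of a tensor. -/
def evPair (E E' : EqConn) [Module.Finite Poly E] [Module.Projective Poly E]
    [Module.Finite Poly E'] [Module.Projective Poly E'] :
    (E ⊗[Poly] E') →+ (E.radial ⊗[ℝ] E'.radial) :=
  TensorProduct.liftAddHom
    (AddMonoidHom.mk' (fun m => AddMonoidHom.mk' (fun m' => E.ev 0 m ⊗ₜ[ℝ] E'.ev 0 m')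
      (fun a b => by rw [map_add, TensorProduct.tmul_add]))
      (fun a b => by
        ext n
        simp only [map_add, TensorProduct.add_tmul, AddMonoidHom.mk'_apply,
          AddMonoidHom.add_apply]))
    (fun f m n => by
      simp only [AddMonoidHom.mk'_apply, ev_smul, TensorProduct.smul_tmul])

theorem evPair_tm (m : E) (m' : E') : evPair E E' (tm m m') = E.ev 0 m ⊗ₜ[ℝ] E'.ev 0 m' := rfl

theorem radialMul_bijective : Function.Bijective (TensorProduct.lift (radialMul E E')) := by
  constructor
  · have h : ∀ x : E.radial ⊗[ℝ] E'.radial,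
        evPair E E' (TensorProduct.lift (radialMul E E') x : (tensor E E').radial).1 = x := by
      intro x
      induction x with
      | zero => rw [map_zero]; exact map_zero _
      | add x y hx hy =>
        rw [map_add]
        exact (map_add (evPair E E') _ _).trans (congrArg₂ _ hx hy)
      | tmul u u' =>
        rw [TensorProduct.lift.tmul]
        exact (evPair_tm _ _).trans (by rw [ev_coe, ev_coe])
    exact fun x y hxy => by rw [← h x, hxy, h y]
  · intro u
    rw [← ev_coe 0 u]
    generalize (u : tensor E E') = x
    have h : ∀ x : E ⊗[Poly] E', ∃ t, TensorProduct.lift (radialMul E E') t =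
        (tensor E E').ev 0 (x : tensor E E') := by
      intro x
      induction x with
      | zero => exact ⟨0, (map_zero _).trans (map_zero ((tensor E E').ev 0)).symm⟩
      | add x y hx hy =>
        obtain ⟨s, hs⟩ := hx
        obtain ⟨t, ht⟩ := hy
        refine ⟨s + t, ?_⟩
        rw [map_add, hs, ht]
        exact (map_add ((tensor E E').ev 0) _ _).symm
      | tmul m m' => exact ⟨E.ev 0 m ⊗ₜ E'.ev 0 m', (ev_tm 0 m m').symm⟩
    exact h x

/-- Radially constant sections of a tensor product. -/
def radialTensor (E E' : EqConn) [Module.Finite Poly E] [Module.Projective Poly E]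
    [Module.Finite Poly E'] [Module.Projective Poly E'] :
    (E.radial ⊗[ℝ] E'.radial) ≃ₗ[ℝ] (tensor E E').radial :=
  LinearEquiv.ofBijective _ radialMul_bijective

theorem connOp_radialMul (u : E.radial) (u' : E'.radial) :
    (tensor E E').connOp (radialMul E E' u u') =
      radialMul E E' (E.connOp u) u' + radialMul E E' u (E'.connOp u') := by
  rw [connOp_apply, coe_radialMul, nabla_tm, map_add, ev_tm, ev_tm, ev_coe, ev_coe, connOp_apply,
    connOp_apply]

/-- The filtered space of a tensor product. -/
def toFiltTensor (E E' : EqConn) [Module.Finite Poly E] [Module.Projective Poly E]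
    [Module.Finite Poly E'] [Module.Projective Poly E'] :
    FiltSpace.tensor E.toDat.toFilt E'.toDat.toFilt ≅ (tensor E E').toDat.toFilt :=
  Dat.tensorIso (D := E.toDat) (D' := E'.toDat) (D'' := (tensor E E').toDat)
    (μ := radialTensor E E') (fun _ _ _ => rfl)
    (fun u u' => (connOp_radialMul u u').trans
      (map_add (radialTensor E E') (E.connOp u ⊗ₜ u') (u ⊗ₜ E'.connOp u')).symm)

end tensor

section unit

instance : Module.Finite Poly unit := inferInstanceAs (Module.Finite Poly Poly)

instance : Module.Projective Poly unit := inferInstanceAs (Module.Projective Poly Poly)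

/-- The constant function `1` as a radially constant section. -/
def radialOne : unit.radial := ⟨fn 1, by
  have h : ∀ i, unit.nabla i (fn 1) = 0 := fun i => (MvPolynomial.pderiv i).map_one_eq_zero
  rw [mem_radial, euler_apply, h, h, smul_zero, smul_zero, add_zero]⟩

/-- The function underlying a section of the unit. -/
def toFn (m : unit) : Poly := m

theorem eq_toFn_smul (m : unit) : m = toFn m • fn 1 := (mul_one (toFn m)).symm

theorem eq_smul_radialOne (u : unit.radial) :
    u = MvPolynomial.eval 0 (toFn u.1) • radialOne := by
  have h : (u : unit) = toFn u.1 • (radialOne : unit) := eq_toFn_smul u.1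
  have h2 := congrArg (unit.ev 0) h
  rwa [ev_coe, ev_smul, ev_coe] at h2

theorem radialρ_radialOne (z : ℂˣ) : unit.radialρ z radialOne = radialOne :=
  Subtype.ext (map_one (act z))

theorem connOp_radialOne : unit.connOp radialOne = 0 := by
  have h : unit.nabla 1 (radialOne : unit) = 0 := (MvPolynomial.pderiv 1).map_one_eq_zero
  rw [connOp_apply, h, map_zero]

/-- Radially constant functions are constant. -/
def radialUnit : ℝ ≃ₗ[ℝ] unit.radial where
  toFun r := r • radialOne
  map_add' r s := add_smul r s _
  map_smul' r s := mul_smul r s _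
  invFun u := MvPolynomial.eval 0 (toFn u.1)
  left_inv r := by
    change MvPolynomial.eval 0 (r • (1 : Poly)) = r
    simp
  right_inv u := (eq_smul_radialOne u).symm

end unit

end EqConn

namespace Dat

section trivial

variable {D : Dat}

theorem wtSub_of_trivial (hρ : ∀ z u, D.ρ z u = u) (S : Set (ℤ × ℤ)) [Decidable (0 ∈ S)] :
    wtSub (cplx D.ρ) S = if 0 ∈ S then ⊤ else ⊥ := by
  have h0 : ∀ x, x ∈ wt (cplx D.ρ) 0 := fun x => mem_wt.2 fun z => by
    have h1 : D.ρ z = LinearMap.id := LinearMap.ext (hρ z)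
    have h2 : chi (0 : ℤ × ℤ) z = 1 := by simp [chi_apply]
    rw [cplx_apply, h1, LinearMap.baseChange_id, h2, one_smul]
    rfl
  split_ifs with h
  · exact top_le_iff.1 fun x _ => wt_le_wtSub h (h0 x)
  · refine (Submodule.eq_bot_iff _).2 fun x hx => ?_
    have h1 := mem_wtSub_inter D.isDiag hx (wt_le_wtSub (Set.mem_singleton 0) (h0 x))
    rw [Set.inter_singleton_eq_empty.2 h, wtSub_empty] at h1
    exact (Submodule.mem_bot ℂ).1 h1

theorem wtW_of_trivial (hρ : ∀ z u, D.ρ z u = u) (n : ℤ) :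
    wtW D.ρ n = if 0 ≤ n then ⊤ else ⊥ := by
  classical
  have h : (0 : ℤ × ℤ) ∈ le n ↔ 0 ≤ n := by simp [mem_le]
  ext u
  rw [mem_wtW, wtSub_of_trivial hρ]
  by_cases hn : 0 ≤ n
  · rw [if_pos (h.2 hn), if_pos hn]
    exact ⟨fun _ => trivial, fun _ => trivial⟩
  · rw [if_neg (fun h' => hn (h.1 h')), if_neg hn, Submodule.mem_bot, Submodule.mem_bot]
    exact map_eq_zero_iff _ ofR_injective

theorem hodge_of_trivial (hρ : ∀ z u, D.ρ z u = u) (hb : D.b = 0) (p : ℤ) :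
    D.hodge p = if p ≤ 0 then ⊤ else ⊥ := by
  classical
  have h1 : D.Ginv = 1 := by
    rw [Ginv, ib, hb, LinearMap.baseChange_zero, smul_zero, neg_zero, IsNilpotent.exp_zero]
  have h2 : D.hodge p = wtSub (cplx D.ρ) {a | p ≤ a.1} := by
    rw [hodge, h1]
    exact Submodule.comap_id _
  rw [h2, wtSub_of_trivial hρ]
  exact if_congr Iff.rfl rfl rfl

theorem map_mem_ite {K X Y : Type*} [Ring K] [AddCommGroup X] [Module K X] [AddCommGroup Y]
    [Module K Y] (f : X →ₗ[K] Y) {P : Prop} [Decidable P] {v : X}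
    (hv : v ∈ (if P then (⊤ : Submodule K X) else ⊥)) :
    f v ∈ (if P then (⊤ : Submodule K Y) else ⊥) := by
  split_ifs at hv ⊢ with h
  · trivial
  · rw [(Submodule.mem_bot K).1 hv, map_zero]
    exact Submodule.zero_mem _

/-- The filtered space of a trivial line. -/
def unitIso (hρ : ∀ z u, D.ρ z u = u) (hb : D.b = 0) (e : ℝ ≃ₗ[ℝ] D) :
    FiltSpace.unit ≅ D.toFilt :=
  FiltSpace.mkIso (V := FiltSpace.unit) (V' := D.toFilt) e
    (fun n _ hv => (wtW_of_trivial hρ n).ge (map_mem_ite e.toLinearMap hv))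
    (fun p _ hv => (hodge_of_trivial hρ hb p).ge (map_mem_ite (e.toLinearMap.baseChange ℂ) hv))
    (fun n _ hv => map_mem_ite e.symm.toLinearMap ((wtW_of_trivial hρ n).le hv))
    (fun p _ hv => map_mem_ite (e.symm.toLinearMap.baseChange ℂ)
      ((hodge_of_trivial hρ hb p).le hv))

end trivial

end Dat

/-- The filtered space of the unit. -/
def EqConn.toFiltUnit : FiltSpace.unit ≅ EqConn.unit.toDat.toFilt :=
  Dat.unitIso (D := EqConn.unit.toDat)
    (fun z (u : EqConn.unit.radial) => show EqConn.unit.radialρ z u = u by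
      rw [EqConn.eq_smul_radialOne u, map_smul, EqConn.radialρ_radialOne])
    (LinearMap.ext fun (u : EqConn.unit.radial) => show EqConn.unit.connOp u = 0 by
      rw [EqConn.eq_smul_radialOne u, map_smul, EqConn.connOp_radialOne, smul_zero])
    EqConn.radialUnit

namespace FiltSpace

section iso

variable {V V' : FiltSpace}

/-- The linear isomorphism underlying an isomorphism. -/
def linEquiv (e : V ≅ V') : V ≃ₗ[ℝ] V' :=
  LinearEquiv.ofLinearMap e.hom.toLin e.inv.toLin (congrArg Hom.toLin e.inv_hom_id)
    (congrArg Hom.toLin e.hom_inv_id)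

theorem W_eq_comap (e : V ≅ V') (n : ℤ) : V.W n = (V'.W n).comap e.hom.toLin := by
  refine le_antisymm (e.hom.map_W n) fun v hv => ?_
  have h := e.inv.map_W n _ hv
  rwa [show e.inv.toLin (e.hom.toLin v) = v from (linEquiv e).symm_apply_apply v] at h

theorem inv_hom_baseChange (e : V ≅ V') (x : ℂ ⊗[ℝ] V) :
    e.inv.toLin.baseChange ℂ (e.hom.toLin.baseChange ℂ x) = x := by
  rw [← LinearMap.comp_apply, ← LinearMap.baseChange_comp, ← comp_toLin, e.hom_inv_id, id_toLin,
    LinearMap.baseChange_id, LinearMap.id_apply]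

/-- The complexification of the linear isomorphism underlying an isomorphism. -/
def complexEquiv (e : V ≅ V') : (ℂ ⊗[ℝ] V) ≃ₗ[ℂ] (ℂ ⊗[ℝ] V') :=
  { e.hom.toLin.baseChange ℂ with
    invFun := e.inv.toLin.baseChange ℂ
    left_inv := inv_hom_baseChange e
    right_inv := inv_hom_baseChange e.symm }

theorem F_eq_comap (e : V ≅ V') (p : ℤ) : V.F p = (V'.F p).comap (complexEquiv e).toLinearMap := by
  refine le_antisymm (e.hom.map_F p) fun v hv => ?_
  have h := e.inv.map_F p _ hv
  exact mem_of_eq (inv_hom_baseChange e v).symm h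

theorem Fbar_eq_comap (e : V ≅ V') (p : ℤ) :
    V.Fbar p = (V'.Fbar p).comap (complexEquiv e).toLinearMap := by
  ext x
  rw [mem_Fbar, Submodule.mem_comap, mem_Fbar, F_eq_comap e, Submodule.mem_comap]
  refine Iff.of_eq (congrArg (· ∈ V'.F p) ?_)
  exact (conj_baseChange e.hom.toLin x).symm

theorem Wc_eq_comap (e : V ≅ V') (n : ℤ) :
    V.Wc n = (V'.Wc n).comap (complexEquiv e).toLinearMap := by
  have key : ∀ {V V' : FiltSpace} (f : V ⟶ V') (x : ℂ ⊗[ℝ] V), x ∈ V.Wc n →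
      f.toLin.baseChange ℂ x ∈ V'.Wc n := fun {V V'} f x hx => by
    have h : V.Wc n ≤ (V'.Wc n).comap (f.toLin.baseChange ℂ) := baseChange_le fun v hv => by
      rw [Submodule.mem_comap, baseChange_ofR]
      exact ofR_mem_baseChange (f.map_W n v hv)
    exact h hx
  refine le_antisymm (fun x hx => key e.hom x hx) fun x hx => ?_
  exact mem_of_eq (inv_hom_baseChange e x).symm (key e.inv _ hx)

theorem comap_sup_comap {K X Y : Type*} [Ring K] [AddCommGroup X] [Module K X] [AddCommGroup Y]
    [Module K Y] (e : X ≃ₗ[K] Y) (S T : Submodule K Y) :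
    S.comap e.toLinearMap ⊔ T.comap e.toLinearMap = (S ⊔ T).comap e.toLinearMap := by
  simp only [Submodule.comap_equiv_eq_map_symm, Submodule.map_sup]

theorem onGr_eq_comap (e : V ≅ V') {G : Submodule ℂ (ℂ ⊗[ℝ] V)} {G' : Submodule ℂ (ℂ ⊗[ℝ] V')}
    (hG : G = G'.comap (complexEquiv e).toLinearMap) (n : ℤ) :
    V.onGr G n = (V'.onGr G' n).comap (complexEquiv e).toLinearMap := by
  rw [onGr, onGr, hG, Wc_eq_comap e, Wc_eq_comap e, ← Submodule.comap_inf, comap_sup_comap]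

theorem _root_.HodgeConn.IsMHS.of_iso (e : V ≅ V') (h : IsMHS V') : IsMHS V where
  finite := by
    have := h.finite
    exact (linEquiv e).symm.finiteDimensional
  W_bot := by
    obtain ⟨n, hn⟩ := h.W_bot
    refine ⟨n, ?_⟩
    rw [W_eq_comap e, hn]
    exact (LinearMap.ker_eq_bot (f := e.hom.toLin)).2 (linEquiv e).injective
  W_top := by
    obtain ⟨n, hn⟩ := h.W_top
    exact ⟨n, by rw [W_eq_comap e, hn, Submodule.comap_top]⟩
  F_bot := by
    obtain ⟨n, hn⟩ := h.F_bot
    refine ⟨n, ?_⟩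
    rw [F_eq_comap e, hn]
    exact (LinearMap.ker_eq_bot (f := (complexEquiv e).toLinearMap)).2 (complexEquiv e).injective
  F_top := by
    obtain ⟨n, hn⟩ := h.F_top
    exact ⟨n, by rw [F_eq_comap e, hn, Submodule.comap_top]⟩
  opposed p q n hn := by
    have h1 := (V'.subsingleton_grGrGr_iff p q n).1 (h.opposed p q n hn)
    rw [subsingleton_grGrGr_iff, onGr_eq_comap e (F_eq_comap e p),
      onGr_eq_comap e (F_eq_comap e (p + 1)), onGr_eq_comap e (Fbar_eq_comap e q),
      onGr_eq_comap e (Fbar_eq_comap e (q + 1)), ← Submodule.comap_inf, ← Submodule.comap_inf]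
    rw [comap_sup_comap]
    exact Submodule.comap_mono h1

end iso

end FiltSpace

theorem exists_bun_iso {V : FiltSpace} (hV : IsMHS V) :
    ∃ E : Bun, Nonempty (V ≅ E.obj.toDat.toFilt) := by
  obtain ⟨D, ⟨e⟩⟩ := exists_toFilt_iso hV
  refine ⟨bunToDat.objPreimage D, ⟨e.symm ≪≫ ?_⟩⟩
  exact isMHS.ι.mapIso (datToMHS.mapIso (bunToDat.objObjPreimageIso D).symm)

theorem isMonoidal_isMHS : isMHS.IsMonoidal where
  prop_unit := IsMHS.of_iso EqConn.toFiltUnit (Dat.isMHS_toFilt _)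
  prop_tensor V V' hV hV' := by
    obtain ⟨E, ⟨e⟩⟩ := exists_bun_iso hV
    obtain ⟨E', ⟨e'⟩⟩ := exists_bun_iso hV'
    exact IsMHS.of_iso (MonoidalCategory.tensorIso e e' ≪≫ EqConn.toFiltTensor E.obj E'.obj)
      (Dat.isMHS_toFilt _)

instance : isMHS.IsMonoidal := isMonoidal_isMHS

/-- The functor from bundles with connection to mixed Hodge structures. -/
def bunToMHS : Bun ⥤ MHS := bunToDat ⋙ datToMHS

instance : bunToMHS.IsEquivalence := inferInstanceAs (bunToDat ⋙ datToMHS).IsEquivalence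

instance : bunToMHS.Additive := inferInstanceAs (bunToDat ⋙ datToMHS).Additive

theorem bunToMHS_map_smul {E E' : Bun} (r : ℝ) (f : E ⟶ E') :
    bunToMHS.map (r • f) = r • bunToMHS.map f := rfl

theorem MHS.tensor_hom_ext {V V' V'' : MHS} {f g : V ⊗ V' ⟶ V''}
    (h : ∀ (v : V.obj) (v' : V'.obj), FiltSpace.Hom.toLin f.hom (v ⊗ₜ[ℝ] v') =
      FiltSpace.Hom.toLin g.hom (v ⊗ₜ[ℝ] v')) : f = g :=
  ObjectProperty.hom_ext _ (FiltSpace.tensor_hom_ext (V := V.obj) (V' := V'.obj) h)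

theorem MHS.tensor_hom_ext₃ {V V' V'' V₃ : MHS} {f g : (V ⊗ V') ⊗ V'' ⟶ V₃}
    (h : ∀ (v : V.obj) (v' : V'.obj) (v'' : V''.obj),
      FiltSpace.Hom.toLin f.hom ((v ⊗ₜ[ℝ] v') ⊗ₜ[ℝ] v'') =
      FiltSpace.Hom.toLin g.hom ((v ⊗ₜ[ℝ] v') ⊗ₜ[ℝ] v'')) : f = g :=
  ObjectProperty.hom_ext _
    (FiltSpace.tensor_hom_ext₃ (V := V.obj) (V' := V'.obj) (V'' := V''.obj) h)

/-- Compatibility with tensor products. -/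
def bunToMHSCoreMonoidal : bunToMHS.CoreMonoidal where
  εIso := (ObjectProperty.fullyFaithfulι isMHS).preimageIso EqConn.toFiltUnit
  μIso E E' := (ObjectProperty.fullyFaithfulι isMHS).preimageIso
    (EqConn.toFiltTensor E.obj E'.obj)
  μIso_hom_natural_left _ _ := MHS.tensor_hom_ext fun _ _ => rfl
  μIso_hom_natural_right _ _ := MHS.tensor_hom_ext fun _ _ => rfl
  associativity _ _ _ := MHS.tensor_hom_ext₃ fun _ _ _ => rfl
  left_unitality E := MHS.tensor_hom_ext fun (r : ℝ) (u : E.obj.radial) => Subtype.ext (by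
    change r • u.1 = (r • (1 : Poly)) • u.1
    rw [smul_assoc, one_smul])
  right_unitality E := MHS.tensor_hom_ext fun (u : E.obj.radial) (r : ℝ) => Subtype.ext (by
    change r • u.1 = (r • (1 : Poly)) • u.1
    rw [smul_assoc, one_smul])

theorem nonempty_braided_bunToMHS : Nonempty bunToMHS.Braided :=
  letI := bunToMHSCoreMonoidal.toMonoidal
  ⟨{ braided := fun _ _ => MHS.tensor_hom_ext fun _ _ => rfl }⟩

theorem isAbelianCat_of_equivalence {C D : Type 1} [Category.{0} C] [Preadditive C]
    [Category.{0} D] [Abelian D] (F : C ⥤ D) [F.Additive] [F.IsEquivalence] :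
    IsAbelianCat C := by
  have : Limits.HasFiniteProducts C :=
    ⟨fun n => Adjunction.hasLimitsOfShape_of_equivalence F⟩
  let _ := abelianOfEquivalence F
  exact ⟨inferInstance, inferInstance, inferInstance, inferInstance, inferInstance⟩

theorem isAbelianCat_bun : IsAbelianCat Bun := isAbelianCat_of_equivalence bunToDat

theorem isAbelianCat_MHS : IsAbelianCat MHS := by
  have : datToMHS.asEquivalence.functor.Additive := inferInstanceAs datToMHS.Additive
  exact isAbelianCat_of_equivalence datToMHS.asEquivalence.inverse

/-- The Hodge types of total weight `n`. -/
def eqSet (n : ℤ) : Set (ℤ × ℤ) := {a | a.1 + a.2 = n}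

theorem mem_eqSet {n : ℤ} {a : ℤ × ℤ} : a ∈ eqSet n ↔ a.1 + a.2 = n := Iff.rfl

namespace Dat

variable (D : Dat) {D' : Dat}

/-- The projection to the part of weight `n`. -/
def proj (n : ℤ) : D →ₗ[ℝ] D := descend (scale D.isDiag (ind (eqSet n)))

theorem proj_baseChange (n : ℤ) : (D.proj n).baseChange ℂ = scale D.isDiag (ind (eqSet n)) :=
  descend_baseChange fun v => conj_scale_ind D.isDiag (c := FiltSpace.conj D) (conj_cplx D.ρ)
    (fun a => by simp only [mem_eqSet, Prod.fst_swap, Prod.snd_swap, add_comm]) v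

theorem ofR_proj (n : ℤ) (u : D) : ofR D (D.proj n u) = scale D.isDiag (ind (eqSet n)) (ofR D u) := by
  rw [← proj_baseChange, baseChange_ofR]

theorem proj_eq_zero {n k : ℤ} (h : k < n) {u : D} (hu : u ∈ wtW D.ρ k) : D.proj n u = 0 := by
  have h1 : scale D.isDiag (ind (eqSet n)) (ofR D u) = 0 :=
    scale_eq_zero D.isDiag (S := le k) (fun a ha => ind_of_notMem fun h' => by
      rw [mem_le] at ha
      rw [mem_eqSet] at h'
      omega) (mem_wtW.1 hu)
  exact ofR_injective ((D.ofR_proj n u).trans (h1.trans (map_zero (ofR D)).symm))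

theorem proj_proj (m n : ℤ) (u : D) : D.proj m (D.proj n u) = if m = n then D.proj n u else 0 := by
  apply ofR_injective
  rw [ofR_proj, ofR_proj]
  split_ifs with h
  · rw [h, ofR_proj, (mem_wtSub_iff D.isDiag).1 (scale_ind_mem D.isDiag _)]
  · rw [map_zero]
    refine scale_eq_zero D.isDiag (fun a ha => ind_of_notMem fun h' => h ?_)
      (scale_ind_mem D.isDiag (S := eqSet n) (ofR D u))
    exact h'.symm.trans ha

theorem sub_proj_mem {n : ℤ} {u : D} (hu : u ∈ wtW D.ρ n) : u - D.proj n u ∈ wtW D.ρ (n - 1) := by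
  rw [mem_wtW, map_sub, ofR_proj,
    sub_eq_of_eq_add' (scale_add_scale D.isDiag (eqSet n) (ofR D u)).symm]
  refine wtSub_mono (fun a ha => ?_) (scale_ind_mem_of_mem (S := (eqSet n)ᶜ) D.isDiag hu)
  obtain ⟨h1, h2⟩ := ha
  rw [mem_le] at h1 ⊢
  rw [Set.mem_compl_iff, mem_eqSet] at h2
  omega

theorem mem_of_proj_eq_zero {n : ℤ} {u : D} (hu : u ∈ wtW D.ρ n) (h : D.proj n u = 0) :
    u ∈ wtW D.ρ (n - 1) := by
  have h' := D.sub_proj_mem hu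
  rwa [h, sub_zero] at h'

theorem proj_naturality (f : D ⟶ D') (n : ℤ) (u : D) :
    f.toLin (D.proj n u) = D'.proj n (f.toLin u) := by
  apply ofR_injective
  rw [ofR_proj, ← baseChange_ofR, ofR_proj, ← baseChange_ofR,
    map_scale D.isDiag D'.isDiag (baseChange_equivariant f.map_ρ)]

/-- The projection of the weight filtration to the part of weight `n`. -/
def grProj (n : ℤ) : D.toFilt.GrW n →ₗ[ℝ] D :=
  Submodule.liftQ _ (D.proj n ∘ₗ (wtW D.ρ n).subtype) fun u hu =>
    D.proj_eq_zero (show n - 1 < n by omega) hu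

theorem grProj_injective (n : ℤ) : Function.Injective (D.grProj n) := by
  rw [injective_iff_map_eq_zero]
  intro x hx
  induction x using Submodule.Quotient.induction_on with
  | H u =>
    rw [Submodule.Quotient.mk_eq_zero]
    exact D.mem_of_proj_eq_zero u.2 hx

theorem proj_grProj (m n : ℤ) (x : D.toFilt.GrW n) :
    D.proj m (D.grProj n x) = if m = n then D.grProj n x else 0 := by
  induction x using Submodule.Quotient.induction_on with
  | H u => exact D.proj_proj m n u.1

/-- The map from the associated graded space. -/
def grMap : (DirectSum ℤ fun n => D.toFilt.GrW n) →ₗ[ℝ] D :=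
  DirectSum.toModule ℝ ℤ D fun n => D.grProj n

theorem proj_grMap (m : ℤ) (x : DirectSum ℤ fun n => D.toFilt.GrW n) :
    D.proj m (D.grMap x) = D.grProj m (x m) := by
  induction x using DirectSum.induction_on with
  | zero => rw [map_zero, map_zero, DirectSum.zero_apply, map_zero]
  | add x y hx hy => rw [map_add, map_add, hx, hy, DirectSum.add_apply, map_add]
  | of n x =>
    have h : D.grMap (DirectSum.of (fun n => D.toFilt.GrW n) n x) = D.grProj n x :=
      DirectSum.toModule_lof ℝ n x
    rw [h, proj_grProj]
    split_ifs with hmn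
    · subst hmn
      rw [DirectSum.of_eq_same]
    · rw [DirectSum.of_eq_of_ne _ _ _ hmn, map_zero]

theorem grMap_bijective : Function.Bijective D.grMap := by
  constructor
  · rw [injective_iff_map_eq_zero]
    intro x hx
    refine DFinsupp.ext fun m => D.grProj_injective m ?_
    rw [← proj_grMap, hx, map_zero]
    exact (map_zero _).symm
  · rw [← LinearMap.range_eq_top]
    obtain ⟨M, hM⟩ := exists_wtW_bot (ρ := D.ρ) D.isDiag
    obtain ⟨N, hN⟩ := exists_wtW_top (ρ := D.ρ) D.isDiag
    have key : ∀ k : ℕ, wtW D.ρ (M + k) ≤ LinearMap.range D.grMap := by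
      intro k
      induction k with
      | zero =>
        rw [Nat.cast_zero, add_zero, hM]
        exact bot_le
      | succ k ih =>
        intro u hu
        have h1 := D.sub_proj_mem hu
        rw [show M + ((k + 1 : ℕ) : ℤ) - 1 = M + k by push_cast; omega] at h1
        have h2 : D.proj (M + (k + 1 : ℕ)) u ∈ LinearMap.range D.grMap :=
          ⟨DirectSum.lof ℝ ℤ (fun n => D.toFilt.GrW n) (M + (k + 1 : ℕ))
            (Submodule.Quotient.mk ⟨u, hu⟩), DirectSum.toModule_lof ℝ _ _⟩
        have := add_mem (ih h1) h2
        rwa [sub_add_cancel] at this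
    refine top_le_iff.1 ?_
    rw [← hN]
    exact (wtW_mono (by omega)).trans (key (N - M).toNat)

theorem map_proj_hodge (p n : ℤ) :
    (D.hodge p ⊓ wtSub (cplx D.ρ) (le n)).map ((D.proj n).baseChange ℂ) =
      wtSub (cplx D.ρ) ({a | p ≤ a.1} ∩ eqSet n) := by
  rw [proj_baseChange]
  apply le_antisymm
  · rintro _ ⟨x, hx, rfl⟩
    have h1 : x ∈ wtSub (cplx D.ρ) (({a | p ≤ a.1} ∩ le n) ∪ le (n - 1)) := by
      rw [← hodge_onGr]
      exact Submodule.mem_sup_left hx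
    refine wtSub_mono (fun a ha => ?_) (scale_ind_mem_of_mem (S := eqSet n) D.isDiag h1)
    refine ⟨?_, ha.2⟩
    have h2 := ha.2
    rw [mem_eqSet] at h2
    rcases ha.1 with h | h
    · exact h.1
    · rw [mem_le] at h
      omega
  · intro y hy
    have h1 : y ∈ wtSub (cplx D.ρ) (({a | p ≤ a.1} ∩ le n) ∪ le (n - 1)) :=
      wtSub_mono (fun a ha => Or.inl ⟨ha.1, le_of_eq ha.2⟩) hy
    rw [← hodge_onGr] at h1
    obtain ⟨x, hx, w, hw, hxw⟩ := Submodule.mem_sup.1 h1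
    refine ⟨x, hx, ?_⟩
    have h2 : scale D.isDiag (ind (eqSet n)) y = y :=
      (mem_wtSub_iff D.isDiag).1 (wtSub_mono Set.inter_subset_right hy)
    have h3 : scale D.isDiag (ind (eqSet n)) w = 0 :=
      scale_eq_zero D.isDiag (fun a ha => ind_of_notMem fun h' => by
        rw [mem_le] at ha
        rw [mem_eqSet] at h'
        omega) hw
    rw [← hxw, map_add, h3, add_zero] at h2
    rw [h2, hxw]

theorem map_grProj_FonGrW (p n : ℤ) :
    (D.toFilt.FonGrW n p).map ((D.grProj n).baseChange ℂ) =
      wtSub (cplx D.ρ) ({a | p ≤ a.1} ∩ eqSet n) := by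
  rw [← map_proj_hodge]
  have h1 : D.grProj n ∘ₗ ((D.toFilt.W (n - 1)).submoduleOf (D.toFilt.W n)).mkQ =
      D.proj n ∘ₗ (wtW D.ρ n).subtype := rfl
  have h2 : ((D.grProj n).baseChange ℂ) ∘ₗ
      (((D.toFilt.W (n - 1)).submoduleOf (D.toFilt.W n)).mkQ.baseChange ℂ) =
      (D.proj n).baseChange ℂ ∘ₗ (wtW D.ρ n).subtype.baseChange ℂ := by
    refine (LinearMap.baseChange_comp _ _).symm.trans
      ((congrArg (LinearMap.baseChange ℂ) h1).trans (LinearMap.baseChange_comp _ _))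
  have h3 : LinearMap.range ((wtW D.ρ n).subtype.baseChange ℂ) = wtSub (cplx D.ρ) (le n) := by
    rw [← baseChange_wtW]
    rfl
  refine (Submodule.map_comp _ _ _).symm.trans ?_
  rw [h2]
  refine (Submodule.map_comp _ _ _).trans (congrArg _ ?_)
  refine (Submodule.map_comap_eq _ _).trans ?_
  exact (congrArg (· ⊓ D.hodge p) h3).trans (inf_comm _ _)

end Dat

theorem Dat.grMap_lof (D : Dat) (n : ℤ) (x : D.toFilt.GrW n) :
    D.grMap (DirectSum.lof ℝ ℤ (fun n => D.toFilt.GrW n) n x) = D.grProj n x :=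
  DirectSum.toModule_lof ℝ n x

namespace EqConn

section fiber

variable (E : EqConn) [Module.Finite Poly E] [Module.Projective Poly E]
  {E' : EqConn} [Module.Finite Poly E'] [Module.Projective Poly E']

theorem radialPart_idealSections : E.idealSections originIdeal ≤ LinearMap.ker E.radialPart := by
  intro x hx
  replace hx : x ∈ originIdeal • (⊤ : Submodule Poly E) := hx
  induction hx using Submodule.smul_induction_on' with
  | smul f hf m _ =>
    rw [LinearMap.mem_ker, radialPart_smul, constantCoeff_of_mem_originIdeal hf, zero_smul]
  | add x hx y hy h1 h2 => exact add_mem h1 h2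

theorem mk_radialPart (m : E) :
    (Submodule.Quotient.mk (E.radialPart m : E) : E.Fiber) = Submodule.Quotient.mk m := by
  have h : (E.idealSections originIdeal).mkQ ∘ₗ E.radial.subtype ∘ₗ E.radialPart =
      (E.idealSections originIdeal).mkQ := by
    refine frame_ext fun f u => ?_
    refine ((Submodule.Quotient.eq _).2 ?_).symm
    have h1 : ((E.radialPart (f • (u : E)) : E.radial) : E) =
        (MvPolynomial.C (MvPolynomial.constantCoeff f) : Poly) • (u : E) := by
      rw [radialPart_smul, radialPart_coe]
      exact (algebraMap_smul Poly _ (u : E)).symm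
    have h2 : f • (u : E) - ((E.radialPart (f • (u : E)) : E.radial) : E) =
        (f - MvPolynomial.C (MvPolynomial.constantCoeff f)) • (u : E) := by
      rw [h1, sub_smul]
    exact FiltSpace.mem_of_eq (S := E.idealSections originIdeal) h2
      (smul_mem_idealSections E (sub_constantCoeff_mem f) _)
  exact LinearMap.congr_fun h m

/-- The restriction of radially constant sections to the origin is an isomorphism. -/
def fiberEquiv : E.radial ≃ₗ[ℝ] E.Fiber :=
  LinearEquiv.ofLinearMap ((E.idealSections originIdeal).mkQ ∘ₗ E.radial.subtype)
    (Submodule.liftQ _ E.radialPart E.radialPart_idealSections)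
    (LinearMap.ext fun x => by
      induction x using Submodule.Quotient.induction_on with
      | H m => exact E.mk_radialPart m)
    (LinearMap.ext fun u => radialPart_coe u)

theorem fiberEquiv_radialρ (z : ℂˣ) (u : E.radial) :
    E.fiberEquiv (E.radialρ z u) = E.fiberρ z (E.fiberEquiv u) := rfl

theorem map_wt_fiberEquiv (a : ℤ × ℤ) :
    (wt (cplx E.radialρ) a).map (E.fiberEquiv.toLinearMap.baseChange ℂ) =
      E.fiberPiece a.1 a.2 := by
  have hA (x) : E.fiberEquiv.toLinearMap.baseChange ℂ
      (E.fiberEquiv.symm.toLinearMap.baseChange ℂ x) = x := by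
    rw [← LinearMap.comp_apply, ← LinearMap.baseChange_comp, LinearEquiv.comp_symm,
      LinearMap.baseChange_id, LinearMap.id_apply]
  have h1 (z : ℂˣ) : E.fiberEquiv.toLinearMap ∘ₗ E.radialρ z =
      E.fiberρ z ∘ₗ E.fiberEquiv.toLinearMap := rfl
  have h1' (z : ℂˣ) (x) : E.fiberEquiv.toLinearMap.baseChange ℂ (cplx E.radialρ z x) =
      (E.fiberρ z).baseChange ℂ (E.fiberEquiv.toLinearMap.baseChange ℂ x) := by
    have := congrArg (LinearMap.baseChange ℂ) (h1 z)
    rw [LinearMap.baseChange_comp, LinearMap.baseChange_comp] at this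
    exact LinearMap.congr_fun this x
  have h2 (z : ℂˣ) : E.radialρ z ∘ₗ E.fiberEquiv.symm.toLinearMap =
      E.fiberEquiv.symm.toLinearMap ∘ₗ E.fiberρ z := by
    refine LinearMap.ext fun x => E.fiberEquiv.injective ?_
    simp only [LinearMap.comp_apply, LinearEquiv.coe_coe, fiberEquiv_radialρ,
      LinearEquiv.apply_symm_apply]
  have h2' (z : ℂˣ) (x) : cplx E.radialρ z (E.fiberEquiv.symm.toLinearMap.baseChange ℂ x) =
      E.fiberEquiv.symm.toLinearMap.baseChange ℂ ((E.fiberρ z).baseChange ℂ x) := by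
    have := congrArg (LinearMap.baseChange ℂ) (h2 z)
    rw [LinearMap.baseChange_comp, LinearMap.baseChange_comp] at this
    exact LinearMap.congr_fun this x
  apply le_antisymm
  · rintro _ ⟨x, hx, rfl⟩
    refine Submodule.mem_iInf _ |>.2 fun z => Module.End.mem_eigenspace_iff.2 ?_
    rw [← h1', mem_wt.1 hx z, map_smul, chi_apply]
  · intro y hy
    refine ⟨E.fiberEquiv.symm.toLinearMap.baseChange ℂ y, mem_wt.2 fun z => ?_, hA y⟩
    have := Module.End.mem_eigenspace_iff.1 ((Submodule.mem_iInf _).1 hy z)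
    rw [h2', this, map_smul, chi_apply]

theorem map_wtSub_fiberEquiv (p n : ℤ) :
    (wtSub (cplx E.radialρ) ({a | p ≤ a.1} ∩ eqSet n)).map
        (E.fiberEquiv.toLinearMap.baseChange ℂ) =
      ⨆ (p' : ℤ) (_ : p ≤ p'), E.fiberPiece p' (n - p') := by
  rw [wtSub, Submodule.map_iSup]
  simp_rw [Submodule.map_iSup, map_wt_fiberEquiv]
  apply le_antisymm
  · refine iSup₂_le fun a ha => ?_
    have h2 : a.2 = n - a.1 := by
      have := mem_eqSet.1 ha.2
      omega
    rw [h2]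
    exact le_iSup₂_of_le a.1 ha.1 le_rfl
  · refine iSup₂_le fun p' hp => ?_
    exact le_iSup₂_of_le (p', n - p') ⟨hp, mem_eqSet.2 (by simp)⟩ le_rfl

/-- The associated graded space of the weight filtration is the fibre at the origin. -/
def grFiberEquiv : (DirectSum ℤ fun n => E.toDat.toFilt.GrW n) ≃ₗ[ℝ] E.Fiber :=
  (LinearEquiv.ofBijective E.toDat.grMap E.toDat.grMap_bijective).trans E.fiberEquiv

theorem grFiberEquiv_lof_mk (n : ℤ) (u : wtW E.radialρ n) :
    E.grFiberEquiv (DirectSum.lof ℝ ℤ (fun n => E.toDat.toFilt.GrW n) n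
      (Submodule.Quotient.mk u)) = E.fiberEquiv (E.toDat.proj n u.1) :=
  congrArg (fun u : E.radial => E.fiberEquiv u) (E.toDat.grMap_lof n _)

theorem grFiberEquiv_comp_lof (n : ℤ) :
    E.grFiberEquiv.toLinearMap ∘ₗ DirectSum.lof ℝ ℤ (fun n => E.toDat.toFilt.GrW n) n =
      E.fiberEquiv.toLinearMap ∘ₗ E.toDat.grProj n :=
  LinearMap.ext fun x => congrArg (fun u : E.radial => E.fiberEquiv u) (E.toDat.grMap_lof n x)

variable {E} in
theorem grFiberEquiv_naturality (f : E ⟶ E') (x : DirectSum ℤ fun n => E.toDat.toFilt.GrW n) :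
    E'.grFiberEquiv (DirectSum.lmap (fun n => (Dat.toFiltMap (toDatMap f)).mapGrW n) x) =
      Hom.restrict f originIdeal (E.grFiberEquiv x) := by
  have h : E'.grFiberEquiv.toLinearMap ∘ₗ
      DirectSum.lmap (fun n => (Dat.toFiltMap (toDatMap f)).mapGrW n) =
      Hom.restrict f originIdeal ∘ₗ E.grFiberEquiv.toLinearMap := by
    refine DirectSum.linearMap_ext ℝ fun n => LinearMap.ext fun x => ?_
    induction x using Submodule.Quotient.induction_on with
    | H u =>
      have h1 : DirectSum.lmap (fun n => (Dat.toFiltMap (toDatMap f)).mapGrW n)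
          (DirectSum.lof ℝ ℤ (fun n => E.toDat.toFilt.GrW n) n (Submodule.Quotient.mk u)) =
          DirectSum.lof ℝ ℤ (fun n => E'.toDat.toFilt.GrW n) n (Submodule.Quotient.mk
            ⟨(toDatMap f).toLin u.1, map_mem_wtW (toDatMap f).map_ρ u.2⟩) :=
        DirectSum.lmap_lof _ _ _
      refine (congrArg E'.grFiberEquiv h1).trans ?_
      refine (E'.grFiberEquiv_lof_mk n _).trans ?_
      refine (congrArg (fun u : E'.radial => E'.fiberEquiv u)
        (Dat.proj_naturality _ (toDatMap f) n u.1).symm).trans ?_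
      exact (congrArg (Hom.restrict f originIdeal) (E.grFiberEquiv_lof_mk n u)).symm
  exact LinearMap.congr_fun h x

end fiber

end EqConn

/-- The associated graded space of the weight filtration is the fibre at the origin. -/
def Bun.grIsoFiber (E : Bun) : (bunToMHS ⋙ isMHS.ι ⋙ FiltSpace.grWFunctor).obj E ≅
    (isVectorBundle.ι ⋙ EqConn.fiberFunctor).obj E :=
  LinearEquiv.toModuleIso (X₁ := DirectSum ℤ fun n => E.obj.toDat.toFilt.GrW n)
    (X₂ := E.obj.Fiber) E.obj.grFiberEquiv

/-- The associated graded of the weight filtration is the fibre at the origin, naturally. -/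
def grWIso : bunToMHS ⋙ isMHS.ι ⋙ FiltSpace.grWFunctor ≅
    isVectorBundle.ι ⋙ EqConn.fiberFunctor :=
  NatIso.ofComponents (fun E => E.grIsoFiber) fun f =>
    ModuleCat.hom_ext (LinearMap.ext fun x => EqConn.grFiberEquiv_naturality f.hom x)

theorem map_grWIso_FonGrW (E : Bun) (n p : ℤ) :
    ((bunToMHS.obj E).obj.FonGrW n p).map
        (((grWIso.hom.app E).hom ∘ₗ
          DirectSum.lof ℝ ℤ (fun n => (bunToMHS.obj E).obj.GrW n) n).baseChange ℂ) =
      ⨆ (p' : ℤ) (_ : p ≤ p'), E.obj.fiberPiece p' (n - p') := by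
  have h : ((E.obj.toDat.toFilt).FonGrW n p).map
      ((E.obj.grFiberEquiv.toLinearMap ∘ₗ
        DirectSum.lof ℝ ℤ (fun n => E.obj.toDat.toFilt.GrW n) n).baseChange ℂ) =
      ⨆ (p' : ℤ) (_ : p ≤ p'), E.obj.fiberPiece p' (n - p') := by
    rw [EqConn.grFiberEquiv_comp_lof]
    refine (congrArg (Submodule.map · _) (LinearMap.baseChange_comp _ _)).trans ?_
    refine (Submodule.map_comp _ _ _).trans ?_
    refine (congrArg (Submodule.map _) (E.obj.toDat.map_grProj_FonGrW p n)).trans ?_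
    exact E.obj.map_wtSub_fiberEquiv p n
  exact h

section line

open Polynomial in
/-- The primitive of a polynomial that vanishes at `0`. -/
def prim : ℝ[X] →ₗ[ℝ] ℝ[X] :=
  Polynomial.lsum fun n => ((n : ℝ) + 1)⁻¹ • Polynomial.monomial (n + 1)

theorem prim_monomial (n : ℕ) (r : ℝ) :
    prim (Polynomial.monomial n r) = Polynomial.monomial (n + 1) (((n : ℝ) + 1)⁻¹ * r) := by
  rw [prim, Polynomial.lsum_apply, Polynomial.sum_monomial_index _ _ (by simp),
    LinearMap.smul_apply, Polynomial.smul_monomial, smul_eq_mul]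

open Polynomial in
theorem derivative_prim (p : ℝ[X]) : derivative (prim p) = p := by
  induction p using Polynomial.induction_on' with
  | add p q hp hq => rw [map_add, map_add, hp, hq]
  | monomial n r =>
    have : (n : ℝ) + 1 ≠ 0 := by positivity
    rw [prim_monomial, derivative_monomial, Nat.add_sub_cancel]
    congr 1
    push_cast
    field_simp

open Polynomial in
theorem prim_derivative (p : ℝ[X]) : prim (derivative p) = p - C (p.eval 0) := by
  induction p using Polynomial.induction_on' with
  | add p q hp hq => rw [map_add, map_add, hp, hq, eval_add, C_add]; ring
  | monomial n r =>
    rw [derivative_monomial, prim_monomial]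
    rcases n with _ | n
    · simp
    · have : (n : ℝ) + 1 ≠ 0 := by positivity
      rw [Nat.add_sub_cancel]
      simp only [eval_monomial, ne_eq, Nat.add_eq_zero_iff, one_ne_zero, and_false,
        not_false_eq_true, zero_pow, mul_zero, map_zero, sub_zero]
      congr 1
      push_cast
      field_simp

open Polynomial in
theorem eval_zero_prim (p : ℝ[X]) : (prim p).eval 0 = 0 := by
  induction p using Polynomial.induction_on' with
  | add p q hp hq => rw [map_add, eval_add, hp, hq, add_zero]
  | monomial n r => simp [prim_monomial]

/-- The restriction of functions to the line `Re t = -1/2`. -/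
def lineRes : Poly →ₐ[ℝ] Polynomial ℝ :=
  MvPolynomial.aeval ![Polynomial.C (-1 / 2), Polynomial.X]

/-- The extension of functions from the line `Re t = -1/2`. -/
def lineSec : Polynomial ℝ →ₐ[ℝ] Poly := Polynomial.aeval (MvPolynomial.X 1)

/-- The point `-1/2`. -/
def basePt : Fin 2 → ℝ := ![-1 / 2, 0]

theorem lineRes_of_mem {f : Poly} (hf : f ∈ EqConn.lineIdeal) : lineRes f = 0 := by
  obtain ⟨g, rfl⟩ := Ideal.mem_span_singleton'.1 hf
  have h : lineRes (MvPolynomial.X 0 + MvPolynomial.C (1 / 2)) = 0 := by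
    have h1 : lineRes (MvPolynomial.C (1 / 2)) = Polynomial.C (1 / 2) := lineRes.commutes _
    rw [map_add, h1, lineRes, MvPolynomial.aeval_X, Matrix.cons_val_zero, ← Polynomial.C_add]
    norm_num
  rw [map_mul, h, mul_zero]

theorem sub_lineSec_mem (f : Poly) : f - lineSec (lineRes f) ∈ EqConn.lineIdeal := by
  have h : (Ideal.Quotient.mkₐ ℝ EqConn.lineIdeal) =
      (Ideal.Quotient.mkₐ ℝ EqConn.lineIdeal).comp (lineSec.comp lineRes) := by
    refine MvPolynomial.algHom_ext fun i => ?_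
    refine Ideal.Quotient.eq.2 ?_
    change MvPolynomial.X i - lineSec (lineRes (MvPolynomial.X i)) ∈ _
    rw [lineRes, MvPolynomial.aeval_X]
    fin_cases i
    · refine Ideal.subset_span ?_
      have h1 : lineSec (Polynomial.C (-1 / 2)) = MvPolynomial.C (-1 / 2) := lineSec.commutes _
      change MvPolynomial.X 0 - lineSec (Polynomial.C (-1 / 2)) = _
      rw [h1, sub_eq_add_neg, ← MvPolynomial.C_neg]
      norm_num
    · change MvPolynomial.X 1 - lineSec Polynomial.X ∈ _
      rw [lineSec, Polynomial.aeval_X, sub_self]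
      exact zero_mem _
  exact Ideal.Quotient.eq.1 (AlgHom.congr_fun h f)

theorem lineRes_pderiv (f : Poly) :
    lineRes (MvPolynomial.pderiv 1 f) = Polynomial.derivative (lineRes f) := by
  have hC (a : ℝ) : lineRes (MvPolynomial.C a) = Polynomial.C a := lineRes.commutes a
  induction f using MvPolynomial.induction_on with
  | C a => simp [hC]
  | add p q hp hq => simp only [map_add, hp, hq]
  | mul_X p k hp =>
    rw [Derivation.leibniz, map_mul, Polynomial.derivative_mul, ← hp, map_add, smul_eq_mul,
      smul_eq_mul, map_mul, map_mul, MvPolynomial.pderiv_X]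
    have hX (k) : lineRes (MvPolynomial.X k) = ![Polynomial.C (-1 / 2), Polynomial.X] k :=
      MvPolynomial.aeval_X _ _
    fin_cases k <;> simp [hX] <;> ring

theorem pderiv_lineSec (p : Polynomial ℝ) :
    MvPolynomial.pderiv 1 (lineSec p) = lineSec (Polynomial.derivative p) := by
  have hC (a : ℝ) : lineSec (Polynomial.C a) = MvPolynomial.C a := lineSec.commutes a
  have hX : lineSec Polynomial.X = MvPolynomial.X 1 := Polynomial.aeval_X _
  induction p using Polynomial.induction_on with
  | C a => simp [hC]
  | add p q hp hq => simp only [map_add, hp, hq]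
  | monomial n a h =>
    simp only [map_mul, hC, map_pow, hX, Derivation.leibniz_pow, Derivation.leibniz,
      MvPolynomial.pderiv_C, MvPolynomial.pderiv_X_self, Polynomial.derivative_mul,
      Polynomial.derivative_C, Polynomial.derivative_X_pow, map_add, smul_eq_mul, map_natCast]
    simp

theorem eval_basePt (f : Poly) : MvPolynomial.eval basePt f = (lineRes f).eval 0 := by
  have h : MvPolynomial.aeval basePt = (Polynomial.aeval (0 : ℝ)).comp lineRes := by
    refine MvPolynomial.algHom_ext fun i => ?_
    rw [AlgHom.comp_apply, lineRes, MvPolynomial.aeval_X, MvPolynomial.aeval_X]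
    fin_cases i <;> simp [basePt]
  have := AlgHom.congr_fun h f
  rwa [AlgHom.comp_apply, MvPolynomial.aeval_eq_eval, Polynomial.coe_aeval_eq_eval] at this

theorem lineRes_lineSec (p : Polynomial ℝ) : lineRes (lineSec p) = p := by
  have h : lineRes.comp lineSec = AlgHom.id ℝ _ := by
    refine Polynomial.algHom_ext ?_
    simp [lineRes, lineSec]
  exact AlgHom.congr_fun h p

/-- A primitive along the line `Re t = -1/2`. -/
def linePrim : Poly →ₗ[ℝ] Poly := lineSec.toLinearMap ∘ₗ prim ∘ₗ lineRes.toLinearMap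

theorem linePrim_apply (f : Poly) : linePrim f = lineSec (prim (lineRes f)) := rfl

theorem linePrim_mul {f : Poly} (hf : f ∈ EqConn.lineIdeal) (g : Poly) :
    linePrim (f * g) = 0 := by
  rw [linePrim_apply, map_mul, lineRes_of_mem hf, zero_mul, map_zero, map_zero]

theorem sub_pderiv_linePrim_mem (f : Poly) :
    f - MvPolynomial.pderiv 1 (linePrim f) ∈ EqConn.lineIdeal := by
  rw [linePrim_apply, pderiv_lineSec, derivative_prim]
  exact sub_lineSec_mem f

theorem eval_linePrim (f : Poly) : MvPolynomial.eval basePt (linePrim f) = 0 := by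
  rw [eval_basePt, linePrim_apply, lineRes_lineSec, eval_zero_prim]

theorem sub_linePrim_pderiv_mem (f : Poly) :
    f - linePrim (MvPolynomial.pderiv 1 f) - MvPolynomial.C (MvPolynomial.eval basePt f) ∈
      EqConn.lineIdeal := by
  have hC (a : ℝ) : lineSec (Polynomial.C a) = MvPolynomial.C a := lineSec.commutes a
  rw [linePrim_apply, lineRes_pderiv, prim_derivative, map_sub, hC, eval_basePt,
    sub_sub, sub_add_cancel]
  exact sub_lineSec_mem f

end line

namespace EqConn

section lineSections

variable (E : EqConn) [Module.Finite Poly E] [Module.Projective Poly E]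
  {E' : EqConn} [Module.Finite Poly E'] [Module.Projective Poly E']

/-- An operator on functions as an operator on sections, with respect to the frame of radially
constant sections. -/
def onFrame (T : Poly →ₗ[ℝ] Poly) : E →ₗ[ℝ] E :=
  E.frame.restrictScalars ℝ ∘ₗ T.rTensor E.radial ∘ₗ
    E.frameEquiv.symm.toLinearMap.restrictScalars ℝ

theorem onFrame_smul_coe (T : Poly →ₗ[ℝ] Poly) (f : Poly) (u : E.radial) :
    E.onFrame T (f • (u : E)) = T f • (u : E) := by
  have h : E.frameEquiv.symm (f • (u : E)) = f ⊗ₜ u := by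
    rw [LinearEquiv.symm_apply_eq, frameEquiv_tmul]
  change E.frame (T.rTensor E.radial (E.frameEquiv.symm (f • (u : E)))) = _
  rw [h, LinearMap.rTensor_tmul, frame_tmul]

theorem onFrame_mem_spanOf (T : Poly →ₗ[ℝ] Poly) {S : Submodule ℝ E.radial} {m : E}
    (hm : m ∈ spanOf S) : E.onFrame T m ∈ spanOf S := by
  refine spanOf_induction (T := ((spanOf S).restrictScalars ℝ).comap (E.onFrame T))
    (fun f u hu => ?_) hm
  rw [Submodule.mem_comap, onFrame_smul_coe]
  exact Submodule.smul_mem _ _ (coe_mem_spanOf hu)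

/-- The connection form along `∂/∂y` with respect to the frame of radially constant sections. -/
def connForm : E →ₗ[ℝ] E := E.nabla 1 - E.onFrame (MvPolynomial.pderiv 1).toLinearMap

theorem connForm_smul_coe (f : Poly) (u : E.radial) :
    E.connForm (f • (u : E)) = f • E.nabla 1 u := by
  rw [connForm, LinearMap.sub_apply, onFrame_smul_coe, E.leibniz]
  exact add_sub_cancel_left _ _

theorem nabla_one_eq (m : E) : E.nabla 1 m =
    E.onFrame (MvPolynomial.pderiv 1).toLinearMap m + E.connForm m := by
  rw [connForm, LinearMap.sub_apply, add_sub_cancel]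

/-- Multiplication by a function. -/
def mulBy (f : Poly) : E →ₗ[ℝ] E := (LinearMap.lsmul Poly E f).restrictScalars ℝ

theorem mulBy_apply (f : Poly) (m : E) : E.mulBy f m = f • m := rfl

theorem connForm_smul (f : Poly) (m : E) : E.connForm (f • m) = f • E.connForm m := by
  refine LinearMap.congr_fun (f := E.connForm ∘ₗ E.mulBy f) (g := E.mulBy f ∘ₗ E.connForm)
    (frame_ext fun g u => ?_) m
  rw [LinearMap.comp_apply, LinearMap.comp_apply, mulBy_apply, mulBy_apply, smul_smul,
    connForm_smul_coe, connForm_smul_coe, smul_smul]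

theorem idealSections_le {V : Type} [AddCommGroup V] [Module ℝ V] (I : Ideal Poly)
    (L : E →ₗ[ℝ] V) (S : Submodule ℝ V) (h : ∀ f ∈ I, ∀ m, L (f • m) ∈ S) :
    E.idealSections I ≤ S.comap L := by
  intro x hx
  replace hx : x ∈ I • (⊤ : Submodule Poly E) := hx
  induction hx using Submodule.smul_induction_on' with
  | smul f hf m _ => exact h f hf m
  | add x hx y hy h1 h2 => exact add_mem h1 h2

theorem connForm_mem {m : E} (hm : m ∈ E.idealSections lineIdeal) :
    E.connForm m ∈ E.idealSections lineIdeal :=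
  E.idealSections_le lineIdeal E.connForm (E.idealSections lineIdeal) (fun f hf m => by
    rw [connForm_smul]
    exact smul_mem_idealSections E hf _) hm

theorem onFrame_linePrim_eq_zero {m : E} (hm : m ∈ E.idealSections lineIdeal) :
    E.onFrame linePrim m = 0 := by
  refine E.idealSections_le lineIdeal (E.onFrame linePrim) ⊥ (fun f hf m => ?_) hm
  refine LinearMap.congr_fun (f := E.onFrame linePrim ∘ₗ E.mulBy f) (g := 0)
    (frame_ext fun g u => ?_) m
  rw [LinearMap.comp_apply, mulBy_apply, smul_smul, onFrame_smul_coe, linePrim_mul hf, zero_smul,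
    LinearMap.zero_apply]

theorem sub_mem_of_frame {A B : E →ₗ[ℝ] E} {I : Ideal Poly} (a : Poly → Poly) (ha : ∀ f, a f ∈ I)
    (h : ∀ (f : Poly) (u : E.radial), A (f • (u : E)) - B (f • (u : E)) = a f • (u : E))
    (m : E) : A m - B m ∈ E.idealSections I := by
  refine (Submodule.Quotient.eq _).1 (LinearMap.congr_fun (f := (E.idealSections I).mkQ ∘ₗ A)
    (g := (E.idealSections I).mkQ ∘ₗ B) (frame_ext fun f u => ?_) m)
  refine (Submodule.Quotient.eq _).2 ?_
  rw [h]
  exact smul_mem_idealSections E (ha f) _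

theorem sub_onFrame_pderiv_linePrim_mem (m : E) :
    m - E.onFrame (MvPolynomial.pderiv 1).toLinearMap (E.onFrame linePrim m) ∈
      E.idealSections lineIdeal :=
  E.sub_mem_of_frame (A := LinearMap.id)
    (B := E.onFrame (MvPolynomial.pderiv 1).toLinearMap ∘ₗ E.onFrame linePrim) _
    sub_pderiv_linePrim_mem (fun f u => by
      rw [LinearMap.comp_apply, onFrame_smul_coe, onFrame_smul_coe, sub_smul]
      rfl) m

theorem sub_onFrame_linePrim_pderiv_mem (m : E) :
    m - (E.onFrame linePrim (E.onFrame (MvPolynomial.pderiv 1).toLinearMap m) +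
      (E.ev basePt m : E)) ∈ E.idealSections lineIdeal :=
  E.sub_mem_of_frame (A := LinearMap.id)
    (B := E.onFrame linePrim ∘ₗ E.onFrame (MvPolynomial.pderiv 1).toLinearMap +
      E.radial.subtype ∘ₗ E.ev basePt) _
    sub_linePrim_pderiv_mem (fun f u => by
      rw [LinearMap.add_apply, LinearMap.comp_apply, LinearMap.comp_apply, onFrame_smul_coe,
        onFrame_smul_coe, ev_smul, ev_coe, ← sub_sub, sub_smul, sub_smul]
      congr 1
      exact (algebraMap_smul Poly _ (u : E)).symm) m

theorem ev_onFrame_linePrim (m : E) : E.ev basePt (E.onFrame linePrim m) = 0 := by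
  refine LinearMap.congr_fun (f := E.ev basePt ∘ₗ E.onFrame linePrim) (g := 0)
    (frame_ext fun f u => ?_) m
  rw [LinearMap.comp_apply, onFrame_smul_coe, ev_smul, eval_linePrim, zero_smul,
    LinearMap.zero_apply]

theorem ev_eq_zero_of_mem {m : E} (hm : m ∈ E.idealSections lineIdeal) : E.ev basePt m = 0 := by
  refine E.idealSections_le lineIdeal (E.ev basePt) ⊥ (fun f hf m => ?_) hm
  rw [ev_smul, eval_basePt, lineRes_of_mem hf, Polynomial.eval_zero, zero_smul]
  exact zero_mem _

theorem connOp_mem_wtW {k : ℤ} {u : E.radial} (hu : u ∈ wtW E.radialρ k) :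
    E.connOp u ∈ wtW E.radialρ (k - 1) := by
  rw [mem_wtW, ← baseChange_ofR]
  refine apply_mem_wtSub (S := negSet) (S' := le k) (fun a ha b hb => ?_) connOp_mem_negSet hu
  have h1 := mem_le.1 hb
  have h2 := ha.1
  have h3 := ha.2
  rw [mem_le, Prod.fst_add, Prod.snd_add]
  omega

theorem nabla_coe_mem_spanOf {k : ℤ} (i : Fin 2) {u : E.radial} (hu : u ∈ wtW E.radialρ k) :
    E.nabla i u ∈ spanOf (wtW E.radialρ (k - 1)) := by
  refine mem_spanOf fun a ha => ?_
  obtain ⟨z, rfl⟩ := exists_pt ha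
  rw [ev_nabla]
  exact Submodule.smul_mem _ _ (ρ_mem_wtW z (E.connOp_mem_wtW (ρ_mem_wtW _ hu)))

theorem connForm_mem_spanOf {k : ℤ} {m : E} (hm : m ∈ spanOf (wtW E.radialρ k)) :
    E.connForm m ∈ spanOf (wtW E.radialρ (k - 1)) := by
  refine spanOf_induction
    (T := ((spanOf (wtW E.radialρ (k - 1))).restrictScalars ℝ).comap E.connForm)
    (fun f u hu => ?_) hm
  rw [Submodule.mem_comap, connForm_smul_coe]
  exact Submodule.smul_mem _ _ (E.nabla_coe_mem_spanOf 1 hu)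

theorem exists_nabla_one_sub_mem (n : E) :
    ∃ m, E.ev basePt m = 0 ∧ E.nabla 1 m - n ∈ E.idealSections lineIdeal := by
  obtain ⟨M, hM⟩ := exists_wtW_bot (E.isDiag_radial)
  obtain ⟨N, hN⟩ := exists_wtW_top (E.isDiag_radial)
  have key : ∀ k : ℕ, ∀ n ∈ spanOf (wtW E.radialρ (M + k)),
      ∃ m, E.ev basePt m = 0 ∧ E.nabla 1 m - n ∈ E.idealSections lineIdeal := by
    intro k
    induction k with
    | zero =>
      intro n hn
      have hn0 : n = 0 := eq_zero_of_ev fun a _ => by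
        have := ev_mem_of_mem_spanOf a hn
        rwa [Nat.cast_zero, add_zero, hM, Submodule.mem_bot] at this
      exact ⟨0, map_zero _, by rw [hn0, map_zero, sub_zero]; exact zero_mem _⟩
    | succ k ih =>
      intro n hn
      have h1 := E.connForm_mem_spanOf (E.onFrame_mem_spanOf linePrim hn)
      rw [show M + ((k + 1 : ℕ) : ℤ) - 1 = M + k by push_cast; omega] at h1
      obtain ⟨m, hm, hm'⟩ := ih _ h1
      refine ⟨E.onFrame linePrim n - m, by rw [map_sub, ev_onFrame_linePrim, hm, sub_zero], ?_⟩
      have h2 : E.nabla 1 (E.onFrame linePrim n - m) - n =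
          -((E.nabla 1 m - E.connForm (E.onFrame linePrim n)) +
          (n - E.onFrame (MvPolynomial.pderiv 1).toLinearMap (E.onFrame linePrim n))) := by
        rw [map_sub, E.nabla_one_eq (E.onFrame linePrim n)]
        abel
      rw [h2]
      exact neg_mem (add_mem hm' (E.sub_onFrame_pderiv_linePrim_mem n))
  refine key (N - M).toNat n (mem_spanOf fun a _ => ?_)
  exact wtW_mono (by omega) (hN.symm ▸ Submodule.mem_top : E.ev a n ∈ wtW E.radialρ N)

theorem mem_idealSections_of_nabla_one {m : E}
    (h : E.nabla 1 m ∈ E.idealSections lineIdeal) (h0 : E.ev basePt m = 0) :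
    m ∈ E.idealSections lineIdeal := by
  obtain ⟨M, hM⟩ := exists_wtW_bot (E.isDiag_radial)
  obtain ⟨N, hN⟩ := exists_wtW_top (E.isDiag_radial)
  have key : ∀ k : ℕ, ∃ n ∈ spanOf (wtW E.radialρ (N - k)), m - n ∈ E.idealSections lineIdeal := by
    intro k
    induction k with
    | zero =>
      refine ⟨m, mem_spanOf fun a _ => ?_, by rw [sub_self]; exact zero_mem _⟩
      rw [Nat.cast_zero, sub_zero, hN]
      exact Submodule.mem_top
    | succ k ih =>
      obtain ⟨n, hn, hmn⟩ := ih
      have h1 := E.connForm_mem_spanOf hn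
      rw [show N - (k : ℤ) - 1 = N - ((k + 1 : ℕ) : ℤ) by push_cast; omega] at h1
      refine ⟨-E.onFrame linePrim (E.connForm n), neg_mem (E.onFrame_mem_spanOf linePrim h1), ?_⟩
      have h2 := E.sub_onFrame_linePrim_pderiv_mem m
      rw [h0, Submodule.coe_zero, add_zero] at h2
      have h3 : E.onFrame linePrim (E.nabla 1 m - E.connForm (m - n)) = 0 :=
        E.onFrame_linePrim_eq_zero (sub_mem h (E.connForm_mem hmn))
      have h4 : E.onFrame linePrim (E.onFrame (MvPolynomial.pderiv 1).toLinearMap m) =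
          -E.onFrame linePrim (E.connForm n) := by
        rw [← sub_eq_zero, sub_neg_eq_add, ← map_add, ← h3]
        congr 1
        rw [E.nabla_one_eq m, map_sub]
        abel
      rwa [h4] at h2
  obtain ⟨n, hn, hmn⟩ := key (N - M).toNat
  have hn0 : n = 0 := eq_zero_of_ev fun a _ => by
    have h2 : ∀ k ≤ M, ∀ u ∈ wtW E.radialρ k, u = 0 := fun k hk u hu => by
      have := wtW_mono hk hu
      rwa [hM, Submodule.mem_bot] at this
    exact h2 (N - ((N - M).toNat : ℤ)) (by omega) _ (ev_mem_of_mem_spanOf a hn)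
  rwa [hn0, sub_zero] at hmn

/-- Evaluation of horizontal sections over the line `Re t = -1/2` at the point `-1/2`. -/
def lineEv : E.lineSections →ₗ[ℝ] E.radial :=
  Submodule.liftQ _ (E.ev basePt) (fun _ hm => E.ev_eq_zero_of_mem hm) ∘ₗ
    E.lineSections.subtype

theorem lineEv_bijective : Function.Bijective E.lineEv := by
  constructor
  · rw [injective_iff_map_eq_zero]
    rintro ⟨x, hx⟩ h0
    induction x using Submodule.Quotient.induction_on with
    | H m =>
      refine Subtype.ext ((Submodule.Quotient.mk_eq_zero _).2 ?_)
      exact E.mem_idealSections_of_nabla_one ((Submodule.Quotient.mk_eq_zero _).1 hx) h0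
  · intro u
    obtain ⟨m, hm, hm'⟩ := E.exists_nabla_one_sub_mem (E.nabla 1 u)
    refine ⟨⟨Submodule.Quotient.mk ((u : E) - m), ?_⟩, ?_⟩
    · refine (Submodule.Quotient.mk_eq_zero _).2 ?_
      have h := neg_mem hm'
      rwa [neg_sub, ← map_sub] at h
    · refine (map_sub (E.ev basePt) _ _).trans ?_
      rw [ev_coe, hm, sub_zero]

end lineSections

end EqConn

/-- The underlying space is the space of horizontal sections over the line `Re t = -1/2`. -/
def Bun.radialIso (E : Bun) : (bunToMHS ⋙ isMHS.ι ⋙ FiltSpace.forgetFunctor).obj E ≅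
    (isVectorBundle.ι ⋙ EqConn.lineSectionsFunctor).obj E :=
  (LinearEquiv.toModuleIso (X₁ := E.obj.lineSections) (X₂ := E.obj.radial)
    (LinearEquiv.ofBijective E.obj.lineEv E.obj.lineEv_bijective)).symm

theorem nonempty_lineSectionsIso : Nonempty (bunToMHS ⋙ isMHS.ι ⋙ FiltSpace.forgetFunctor ≅
    isVectorBundle.ι ⋙ EqConn.lineSectionsFunctor) := by
  refine ⟨(NatIso.ofComponents (fun E => E.radialIso.symm) fun {E E'} f => ?_).symm⟩
  refine ModuleCat.hom_ext (LinearMap.ext fun x => ?_)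
  obtain ⟨x, hx⟩ := x
  induction x using Submodule.Quotient.induction_on with
  | H m => exact EqConn.Hom.ev_toLin f.hom basePt m

theorem pderiv_comm (i j : Fin 2) (f : Poly) : MvPolynomial.pderiv i (MvPolynomial.pderiv j f) =
    MvPolynomial.pderiv j (MvPolynomial.pderiv i f) := by
  have h : ⁅MvPolynomial.pderiv (R := ℝ) i, MvPolynomial.pderiv (R := ℝ) j⁆ = 0 := by
    refine MvPolynomial.derivation_ext fun k => ?_
    rw [Derivation.commutator_apply, MvPolynomial.pderiv_X, MvPolynomial.pderiv_X,
      Derivation.zero_apply]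
    have hs (l k : Fin 2) : (Pi.single l 1 : Fin 2 → Poly) k =
        MvPolynomial.C ((Pi.single l 1 : Fin 2 → ℝ) k) := by
      rw [Pi.single_apply, Pi.single_apply]
      split_ifs <;> simp
    rw [hs, hs, MvPolynomial.pderiv_C, MvPolynomial.pderiv_C, sub_zero]
  have h' := congrArg (fun D : Derivation ℝ Poly Poly => D f) h
  simp only [Derivation.commutator_apply, Derivation.zero_apply] at h'
  exact sub_eq_zero.1 h'

namespace EqConn

variable {E : EqConn} [Module.Finite Poly E] [Module.Projective Poly E]

theorem eq_zero_of_euler {m : E} (h : E.euler m = -m) : m = 0 := by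
  have hi := (Module.End.eigenspaces_iSupIndep E.euler) (-1)
  have htop : ⨆ (μ : ℝ) (_ : μ ≠ -1), Module.End.eigenspace E.euler μ = ⊤ := by
    rw [← top_le_iff, ← E.iSup_eigenspace_euler]
    refine iSup_le fun j => le_iSup₂_of_le (j : ℝ) ?_ le_rfl
    have : (0 : ℝ) ≤ j := Nat.cast_nonneg j
    linarith
  rw [htop, disjoint_top] at hi
  have hm : m ∈ Module.End.eigenspace E.euler (-1) := by
    rw [Module.End.mem_eigenspace_iff, h, neg_one_smul]
  rwa [hi, Submodule.mem_bot] at hm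

theorem isFlat_of_connOp (h : E.connOp = 0) : E.IsFlat := by
  have h1 (i : Fin 2) (u : E.radial) : E.nabla i u = 0 := eq_zero_of_ev fun a ha => by
    obtain ⟨z, rfl⟩ := exists_pt ha
    rw [ev_nabla, h, LinearMap.zero_apply, map_zero, smul_zero]
  have h2 (i : Fin 2) (f : Poly) (u : E.radial) :
      E.nabla i (f • (u : E)) = MvPolynomial.pderiv i f • (u : E) := by
    rw [E.leibniz, h1, smul_zero, add_zero]
  intro m
  refine LinearMap.congr_fun (f := E.nabla 0 ∘ₗ E.nabla 1) (g := E.nabla 1 ∘ₗ E.nabla 0)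
    (frame_ext fun f u => ?_) m
  rw [LinearMap.comp_apply, LinearMap.comp_apply, h2, h2, h2, h2, pderiv_comm]

theorem connOp_of_isFlat (h : E.IsFlat) : E.connOp = 0 := by
  have h1 (u : E.radial) : E.nabla 1 u = 0 := by
    apply eq_zero_of_euler
    have hu : E.nabla 1 (E.euler u) = 0 := by
      rw [mem_radial.1 u.2, map_zero]
    rw [euler_apply, map_add, E.leibniz, E.leibniz, MvPolynomial.pderiv_X_self,
      MvPolynomial.pderiv_X_of_ne (by decide), zero_smul, zero_add, one_smul, ← h u.1] at hu
    rw [euler_apply, eq_neg_iff_add_eq_zero, ← hu]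
    abel
  refine LinearMap.ext fun u => ?_
  rw [connOp_apply, h1, map_zero, LinearMap.zero_apply]

theorem isFlat_iff : E.IsFlat ↔ E.connOp = 0 := ⟨connOp_of_isFlat, isFlat_of_connOp⟩

end EqConn

theorem FiltSpace.subsingleton_GrW_of_iso {V V' : FiltSpace} (e : V ≅ V') {n : ℤ}
    (h : Subsingleton (V.GrW n)) : Subsingleton (V'.GrW n) := by
  have h1 (x : V'.GrW n) : Hom.mapGrW e.hom n (Hom.mapGrW e.inv n x) = x := by
    have h2 := e.inv_hom_id
    induction x using Submodule.Quotient.induction_on with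
    | H v =>
      refine congrArg Submodule.Quotient.mk (Subtype.ext ?_)
      exact LinearMap.congr_fun (congrArg Hom.toLin h2) v.1
  exact (Function.LeftInverse.injective h1).subsingleton

namespace Dat

variable {D : Dat}

theorem b_mem_wtW {k : ℤ} {u : D} (hu : u ∈ wtW D.ρ k) : D.b u ∈ wtW D.ρ (k - 1) := by
  rw [mem_wtW, ← baseChange_ofR]
  refine apply_mem_wtSub (S := negSet) (S' := le k) (fun a ha b hb => ?_) D.b_mem hu
  have h1 := mem_le.1 hb
  have h2 := ha.1
  have h3 := ha.2
  rw [mem_le, Prod.fst_add, Prod.snd_add]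
  omega

theorem wtW_eq_of_subsingleton {n : ℤ} (h : Subsingleton (D.toFilt.GrW n)) :
    wtW D.ρ n ≤ wtW D.ρ (n - 1) := fun u hu =>
  (Submodule.Quotient.mk_eq_zero (p := (D.toFilt.W (n - 1)).submoduleOf (D.toFilt.W n))
    (x := ⟨u, hu⟩)).1 (Subsingleton.elim _ _)

theorem b_eq_zero_of_pure {k : ℤ} (h : ∀ n, n ≠ k → Subsingleton (D.toFilt.GrW n)) :
    D.b = 0 := by
  obtain ⟨M, hM⟩ := exists_wtW_bot (ρ := D.ρ) D.isDiag
  obtain ⟨N, hN⟩ := exists_wtW_top (ρ := D.ρ) D.isDiag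
  have hlow : wtW D.ρ (k - 1) = ⊥ := by
    have key : ∀ j : ℕ, wtW D.ρ (k - 1) ≤ wtW D.ρ (k - 1 - j) := fun j => by
      induction j with
      | zero => simp
      | succ j ih =>
        refine ih.trans ((wtW_eq_of_subsingleton (h _ (by omega))).trans (wtW_mono ?_))
        push_cast
        omega
    rw [← le_bot_iff, ← hM]
    exact (key (k - 1 - M).toNat).trans (wtW_mono (by omega))
  have htop : wtW D.ρ k = ⊤ := by
    have key : ∀ j : ℕ, wtW D.ρ (k + j) ≤ wtW D.ρ k := fun j => by
      induction j with
      | zero => simp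
      | succ j ih =>
        refine (wtW_eq_of_subsingleton (h _ (by omega))).trans ((wtW_mono ?_).trans ih)
        push_cast
        omega
    rw [← top_le_iff, ← hN]
    exact (wtW_mono (by omega)).trans (key (N - k).toNat)
  refine LinearMap.ext fun u => ?_
  have h1 : D.b u ∈ wtW D.ρ (k - 1) := b_mem_wtW (htop.symm ▸ Submodule.mem_top)
  rwa [hlow, Submodule.mem_bot] at h1

theorem b_eq_zero_of_isSplit (h : IsSplit (datToMHS.obj D)) : D.b = 0 := by
  obtain ⟨m, X, b, hX, ⟨hb⟩, ⟨e⟩⟩ := h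
  have hD (i : Fin m) : ∃ D' : Dat, D'.b = 0 ∧ Nonempty (X i ≅ datToMHS.obj D') := by
    obtain ⟨k, hk⟩ := hX i
    let a := datToMHS.objObjPreimageIso (X i)
    exact ⟨datToMHS.objPreimage (X i), b_eq_zero_of_pure (k := k) fun n hn =>
      FiltSpace.subsingleton_GrW_of_iso (isMHS.ι.mapIso a.symm) (hk n hn), ⟨a.symm⟩⟩
  choose D' hD' a using hD
  have a (i : Fin m) : X i ≅ datToMHS.obj (D' i) := (a i).some
  let p (i : Fin m) : D ⟶ D' i := datToMHS.preimage (e.hom ≫ b.π i ≫ (a i).hom)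
  let q (i : Fin m) : D' i ⟶ D := datToMHS.preimage ((a i).inv ≫ b.ι i ≫ e.inv)
  have hpq : ∑ i, p i ≫ q i = 𝟙 D := by
    apply datToMHS.map_injective
    rw [Functor.map_sum, datToMHS.map_id]
    simp only [p, q, Functor.map_comp, Functor.map_preimage, Category.assoc,
      Iso.hom_inv_id_assoc]
    have h1 := congrArg (fun f => e.hom ≫ f ≫ e.inv) (Limits.IsBilimit.total hb)
    simpa only [Preadditive.sum_comp, Preadditive.comp_sum, Category.assoc, Category.id_comp,
      Iso.hom_inv_id] using h1
  refine LinearMap.ext fun u => ?_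
  have h1 : ∑ i, (q i).toLin ((p i).toLin (D.b u)) = D.b u := by
    have := LinearMap.congr_fun (congrArg Hom.toLin hpq) (D.b u)
    rw [sum_toLin, LinearMap.sum_apply] at this
    exact this
  rw [← h1, LinearMap.zero_apply]
  refine Finset.sum_eq_zero fun i _ => ?_
  rw [(p i).map_b, hD', LinearMap.zero_apply, map_zero]

theorem proj_ρ (n : ℤ) (z : ℂˣ) (u : D) : D.proj n (D.ρ z u) = D.ρ z (D.proj n u) := by
  apply ofR_injective
  have h (v : D) : ofR D (D.ρ z v) = cplx D.ρ z (ofR D v) := (baseChange_ofR _ _).symm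
  rw [ofR_proj, h, h, ofR_proj, ← scale_chi D.isDiag, scale_scale, scale_scale, mul_comm]

theorem exists_sum_proj : ∃ (m : ℕ) (w : Fin m → ℤ), Function.Injective w ∧
    ∑ i, D.proj (w i) = LinearMap.id := by
  obtain ⟨N, hN⟩ := exists_wtW_eq (ρ := D.ρ) D.isDiag
  refine ⟨(2 * N + 1).toNat, fun i => i - N, fun i j h => ?_, baseChange_injective ?_⟩
  · apply Fin.ext
    have : (i : ℤ) - N = j - N := h
    omega
  · have hsum : (∑ i : Fin (2 * N + 1).toNat, D.proj (i - N)).baseChange ℂ =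
        ∑ i : Fin (2 * N + 1).toNat, (D.proj (i - N)).baseChange ℂ :=
      map_sum (LinearMap.baseChangeHom ℝ ℂ D D) _ _
    rw [hsum, LinearMap.baseChange_id]
    refine D.isDiag.ext fun a v hv => ?_
    rw [LinearMap.sum_apply, LinearMap.id_apply]
    by_cases ha : wt (cplx D.ρ) a = ⊥
    · rw [ha, Submodule.mem_bot] at hv
      simp [hv]
    · obtain ⟨h1, h2⟩ := hN a ha
      have hi : (a.1 + a.2 + N).toNat < (2 * N + 1).toNat := by omega
      rw [Finset.sum_eq_single ⟨(a.1 + a.2 + N).toNat, hi⟩]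
      · rw [proj_baseChange, scale_of_mem _ _ hv, ind_of_mem, one_smul]
        rw [mem_eqSet]
        change _ = ((a.1 + a.2 + N).toNat : ℤ) - N
        omega
      · intro i _ hne
        rw [proj_baseChange, scale_of_mem _ _ hv, ind_of_notMem, zero_smul]
        intro h
        rw [mem_eqSet] at h
        exact hne (Fin.ext (by change (i : ℕ) = (a.1 + a.2 + N).toNat; omega))
      · simp

/-- The part of weight `n`, if `b = 0`. -/
def weightPiece (hb : D.b = 0) (n : ℤ) : Dat :=
  D.sub (LinearMap.range (D.proj n))
    (fun z v hv => by
      obtain ⟨w, rfl⟩ := hv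
      exact ⟨D.ρ z w, proj_ρ n z w⟩)
    (fun v _ => by
      rw [hb, LinearMap.zero_apply]
      exact zero_mem _)

/-- The inclusion of the part of weight `n`. -/
def weightPieceι (hb : D.b = 0) (n : ℤ) : weightPiece hb n ⟶ D := subι _ _ _

/-- The projection to the part of weight `n`. -/
def weightPieceπ (hb : D.b = 0) (n : ℤ) : D ⟶ weightPiece hb n where
  toLin := (D.proj n).rangeRestrict
  map_ρ z v := Subtype.ext (proj_ρ n z v)
  map_b v := Subtype.ext (by
    change D.proj n (D.b v) = D.b (D.proj n v)
    rw [hb, LinearMap.zero_apply, LinearMap.zero_apply, map_zero])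

theorem subsingleton_GrW_weightPiece (hb : D.b = 0) {n k : ℤ} (h : n ≠ k) :
    Subsingleton ((weightPiece hb k).toFilt.GrW n) := by
  have h1 (u : weightPiece hb k) : (weightPiece hb k).proj n u = 0 := by
    refine Subtype.val_injective ?_
    have h2 : ((weightPieceι hb k).toLin ((weightPiece hb k).proj n u)) =
        D.proj n ((weightPieceι hb k).toLin u) := proj_naturality _ _ _ _
    refine h2.trans ?_
    obtain ⟨u, v, rfl⟩ := u
    exact (D.proj_proj n k v).trans (if_neg h)
  refine ⟨fun x y => (weightPiece hb k).grProj_injective n ?_⟩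
  induction x using Submodule.Quotient.induction_on with
  | H u =>
    induction y using Submodule.Quotient.induction_on with
    | H v => exact (h1 u.1).trans (h1 v.1).symm

theorem isSplit_of_b_eq_zero (hb : D.b = 0) : IsSplit (datToMHS.obj D) := by
  obtain ⟨m, w, hw, hsum⟩ := D.exists_sum_proj
  let b : Limits.Bicone fun i => datToMHS.obj (weightPiece hb (w i)) :=
    { pt := datToMHS.obj D
      π := fun i => datToMHS.map (weightPieceπ hb (w i))
      ι := fun i => datToMHS.map (weightPieceι hb (w i))
      ι_π := fun i j => by
        split_ifs with h
        · subst h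
          rw [eqToHom_refl, ← Functor.map_comp, ← datToMHS.map_id]
          refine congrArg _ (hom_ext (LinearMap.ext fun u => Subtype.val_injective ?_))
          obtain ⟨u, v, rfl⟩ := u
          exact (D.proj_proj _ _ v).trans (if_pos rfl)
        · rw [← Functor.map_comp, ← datToMHS.map_zero]
          refine congrArg _ (hom_ext (LinearMap.ext fun u => Subtype.val_injective ?_))
          obtain ⟨u, v, rfl⟩ := u
          exact (D.proj_proj _ _ v).trans (if_neg fun h' => h (hw h').symm) }
  refine ⟨m, _, b, fun i => ⟨w i, fun n hn => subsingleton_GrW_weightPiece hb hn⟩,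
    ⟨Limits.isBilimitOfTotal b ?_⟩, ⟨Iso.refl _⟩⟩
  have h1 : ∑ i, weightPieceπ hb (w i) ≫ weightPieceι hb (w i) = 𝟙 D := by
    refine hom_ext ?_
    rw [sum_toLin]
    exact hsum
  have h2 := congrArg datToMHS.map h1
  rw [Functor.map_sum, datToMHS.map_id] at h2
  exact h2

end Dat

theorem isFlat_iff_isSplit (E : Bun) : E.obj.IsFlat ↔ IsSplit (bunToMHS.obj E) :=
  EqConn.isFlat_iff.trans
    ⟨fun h => Dat.isSplit_of_b_eq_zero (D := E.obj.toDat) h,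
      fun h => Dat.b_eq_zero_of_isSplit (D := E.obj.toDat) h⟩

section derived

variable {C D H : Type*} [Category C] [Category D] [Category H] {F : C ⥤ H} {L : C ⥤ D}
  {RF : D ⥤ H} (α : F ⟶ L ⋙ RF) (W : MorphismProperty C) [L.IsLocalization W]

/-- A natural transformation to a functor that inverts `W` is determined on resolutions. -/
theorem isRightDerivedFunctor_of_resolutions [W.HasLeftCalculusOfFractions]
    (h : ∀ K : C, ∃ (J : C) (s : K ⟶ J), W s ∧ IsIso (α.app J)) :
    RF.IsRightDerivedFunctor α W := by
  choose J s hs hα using h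
  have hL {K J : C} {s : K ⟶ J} (hs : W s) : IsIso (L.map s) := Localization.inverts L W s hs
  have hLs (K : C) : IsIso (L.map (s K)) := hL (hs K)
  rw [Functor.isRightDerivedFunctor_iff_isLeftKanExtension]
  have key (G : D ⥤ H) (β : F ⟶ L ⋙ G) :
      ∃ γ : L ⋙ RF ⟶ L ⋙ G, α ≫ γ = β := by
    let c (K : C) : RF.obj (L.obj K) ⟶ G.obj (L.obj K) :=
      RF.map (L.map (s K)) ≫ inv (α.app (J K)) ≫ β.app (J K) ≫ inv (G.map (L.map (s K)))
    have hc (K J' : C) (v : J K ⟶ J') [IsIso (α.app J')] : c K ≫ G.map (L.map (s K ≫ v)) =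
        RF.map (L.map (s K ≫ v)) ≫ inv (α.app J') ≫ β.app J' := by
      have h1 : inv (α.app (J K)) ≫ F.map v = RF.map (L.map v) ≫ inv (α.app J') := by
        rw [IsIso.inv_comp_eq, ← Category.assoc, IsIso.eq_comp_inv]
        exact α.naturality v
      have h2 : β.app (J K) ≫ G.map (L.map v) = F.map v ≫ β.app J' := (β.naturality v).symm
      simp only [c, Category.assoc, Functor.map_comp, IsIso.inv_hom_id_assoc]
      rw [h2, reassoc_of% h1]
    refine ⟨{ app := c, naturality := fun K K' f => ?_ }, ?_⟩
    · obtain ⟨ψ, hψ⟩ := MorphismProperty.HasLeftCalculusOfFractions.exists_leftFraction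
        (MorphismProperty.RightFraction.mk (s K) (hs K) (f ≫ s K') : W.RightFraction (J K) (J K'))
      have hψ' : f ≫ s K' ≫ ψ.s = s K ≫ ψ.f := by simpa using hψ
      have e : f ≫ s K' ≫ ψ.s ≫ s ψ.Y' = s K ≫ ψ.f ≫ s ψ.Y' := by
        simpa using congrArg (· ≫ s ψ.Y') hψ'
      have : IsIso (L.map (s K' ≫ ψ.s ≫ s ψ.Y')) := by
        have := hL ψ.hs
        rw [L.map_comp, L.map_comp]
        infer_instance
      rw [← cancel_mono (G.map (L.map (s K' ≫ ψ.s ≫ s ψ.Y')))]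
      refine (Category.assoc _ _ _).trans ?_
      refine (congrArg (RF.map (L.map f) ≫ ·) (hc K' _ _)).trans ?_
      refine Eq.trans ?_ (Category.assoc _ _ _).symm
      refine Eq.trans ?_ (congrArg (c K ≫ ·) (G.map_comp _ _))
      refine Eq.trans ?_ (congrArg (fun t => c K ≫ G.map t) (L.map_comp _ _))
      rw [e, hc, ← Category.assoc, ← RF.map_comp, ← L.map_comp, e]
    · ext K
      change α.app K ≫ c K = _
      have h1 : α.app K ≫ RF.map (L.map (s K)) = F.map (s K) ≫ α.app (J K) :=
        (α.naturality (s K)).symm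
      have h2 : F.map (s K) ≫ β.app (J K) = β.app K ≫ G.map (L.map (s K)) := β.naturality (s K)
      simp only [c]
      rw [reassoc_of% h1, IsIso.hom_inv_id_assoc, reassoc_of% h2, IsIso.hom_inv_id,
        Category.comp_id]
  have := Localization.full_whiskeringLeft L W H
  have key' (G : D ⥤ H) (β : F ⟶ L ⋙ G) :
      ∃ γ : RF ⟶ G, α ≫ Functor.whiskerLeft L γ = β := by
    obtain ⟨γ, hγ⟩ := key G β
    obtain ⟨γ', rfl⟩ := ((Functor.whiskeringLeft C D H).obj L).map_surjective γ
    exact ⟨γ', hγ⟩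
  choose d hd using key'
  have uniq (G : D ⥤ H) (γ γ' : RF ⟶ G)
      (h : α ≫ Functor.whiskerLeft L γ = α ≫ Functor.whiskerLeft L γ') : γ = γ' := by
    refine (Localization.faithful_whiskeringLeft L W H).map_injective ?_
    change Functor.whiskerLeft L γ = Functor.whiskerLeft L γ'
    ext K
    have hJ : γ.app (L.obj (J K)) = γ'.app (L.obj (J K)) := by
      have h1 := NatTrans.congr_app h (J K)
      exact (cancel_epi (α.app (J K))).1 h1
    have h1 := γ.naturality (L.map (s K))
    rw [hJ, γ'.naturality] at h1
    exact ((cancel_mono (G.map (L.map (s K)))).1 h1).symm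
  exact ⟨⟨Limits.IsInitial.ofUniqueHom
    (fun Y => StructuredArrow.homMk (d Y.right Y.hom) (hd Y.right Y.hom)) fun Y g =>
      StructuredArrow.ext _ _ (uniq Y.right _ _
        ((StructuredArrow.w g).trans (hd Y.right Y.hom).symm))⟩⟩

end derived

section cocone

open CochainComplex CochainComplex.HomComplex

variable {C : Type*} [Category C] [Abelian C] {K L M : CochainComplex C ℤ}

theorem mappingCocone_ext (φ : K ⟶ L) {p q : ℤ} (hpq : p + -1 = q) {A : C}
    {f g : A ⟶ (mappingCocone φ).X p} (h1 : f ≫ (mappingCocone.fst φ).f p =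
      g ≫ (mappingCocone.fst φ).f p) (h2 : f ≫ (mappingCocone.snd φ).v p q hpq =
      g ≫ (mappingCocone.snd φ).v p q hpq) : f = g := by
  rw [← Category.comp_id f, ← Category.comp_id g, ← mappingCocone.id_X φ p q hpq,
    Preadditive.comp_add, Preadditive.comp_add, reassoc_of% h1, reassoc_of% h2]

theorem mappingCocone_d_snd (φ : K ⟶ L) {i j k : ℤ} (hij : i + 1 = j) (hki : k + 1 = i) :
    (mappingCocone φ).d i j ≫ (mappingCocone.snd φ).v j i (by omega) =
      -((mappingCocone.fst φ).f i ≫ φ.f i) - (mappingCocone.snd φ).v i k (by omega) ≫ L.d k i := by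
  obtain rfl : i = j + -1 := by omega
  obtain rfl : k = j + -1 + -1 := by omega
  have h := mappingCone.d_snd_v φ (j + -1 + -1) (j + -1) (by omega)
  have aux {X₁ X₂ X₃ X₄ X₅ : C} {d : X₁ ⟶ X₂} {s : X₂ ⟶ X₃} {f : X₁ ⟶ X₄} {a : X₄ ⟶ X₃}
      {s' : X₁ ⟶ X₅} {d' : X₅ ⟶ X₃} (h : d ≫ s = f ≫ a + s' ≫ d') :
      (-d) ≫ 𝟙 _ ≫ s = -((- -(𝟙 _ ≫ f)) ≫ a) - (𝟙 _ ≫ s') ≫ d' := by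
    simp [h]
    abel
  simp [mappingCocone, mappingCocone.snd, mappingCocone.fst,
    Cochain.leftShift_v _ _ _ _ _ _ _ _ (add_zero _), Int.negOnePow_even 2 ⟨1, rfl⟩,
    Cochain.leftShift_v (n := 1) _ _ _ _ _ (j + -1) _ (j + -1 + -1) (by omega)]
  exact aux h

/-- The kernel of a degreewise epimorphism is quasi-isomorphic to the mapping cocone. -/
theorem quasiIso_lift_of_shortExact (i : M ⟶ K) (φ : K ⟶ L) (w : i ≫ φ = 0)
    [∀ n, Mono (i.f n)] [∀ n, Epi (φ.f n)]
    (hex : ∀ n, (ShortComplex.mk (i.f n) (φ.f n)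
      (by rw [← HomologicalComplex.comp_f, w, HomologicalComplex.zero_f])).Exact)
    (h0 : δ (-1) 0 (0 : Cochain M L (-1)) + Cochain.ofHom (i ≫ φ) = 0) :
    QuasiIso (mappingCocone.lift φ i 0 h0) := by
  have wf (n : ℤ) : i.f n ≫ φ.f n = 0 := by
    rw [← HomologicalComplex.comp_f, w, HomologicalComplex.zero_f]
  have hfst (n : ℤ) : (mappingCocone.lift φ i 0 h0).f n ≫ (mappingCocone.fst φ).f n = i.f n :=
    mappingCocone.lift_f_fst_f _ _ _ _ _
  have hsnd (n m : ℤ) (h : n + -1 = m) :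
      (mappingCocone.lift φ i 0 h0).f n ≫ (mappingCocone.snd φ).v n m h = 0 := by
    rw [mappingCocone.lift_f_snd_v, Cochain.zero_v]
  have hd (n m : ℤ) : (mappingCocone φ).d n m ≫ (mappingCocone.fst φ).f m =
      (mappingCocone.fst φ).f n ≫ K.d n m := ((mappingCocone.fst φ).comm n m).symm
  refine ⟨fun n => ?_⟩
  rw [quasiIsoAt_iff_isIso_homologyMap]
  obtain ⟨m, hm⟩ : ∃ m, m + 1 = n := ⟨n - 1, by omega⟩
  obtain ⟨l, hl⟩ : ∃ l, l + 1 = m := ⟨m - 1, by omega⟩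
  have hp : (ComplexShape.up ℤ).prev n = m := by rw [← hm]; simp
  have hn : (ComplexShape.up ℤ).next n = n + 1 := by simp
  have h1 : Mono (HomologicalComplex.homologyMap (mappingCocone.lift φ i 0 h0) n) := by
    rw [HomologicalComplex.mono_homologyMap_iff_up_to_refinements _ m n (n + 1) hp hn]
    intro A x hx y hxy
    have e1 : x ≫ i.f n = (y ≫ (mappingCocone.fst φ).f m) ≫ K.d m n := by
      have := congrArg (· ≫ (mappingCocone.fst φ).f n) hxy
      simp only [Category.assoc] at this
      rw [hfst, hd] at this
      rw [this, Category.assoc]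
    have e2 : (y ≫ (mappingCocone.fst φ).f m) ≫ φ.f m =
        -((y ≫ (mappingCocone.snd φ).v m l (by omega)) ≫ L.d l m) := by
      have := congrArg (· ≫ (mappingCocone.snd φ).v n m (by omega)) hxy
      rw [Category.assoc, hsnd, Category.assoc, mappingCocone_d_snd φ hm hl,
        Limits.comp_zero] at this
      rw [eq_neg_iff_add_eq_zero, Category.assoc, Category.assoc]
      have h3 := this.symm
      rw [Preadditive.comp_sub, Preadditive.comp_neg, ← neg_add', neg_eq_zero] at h3
      exact h3
    obtain ⟨A₁, π₁, _, a, ha⟩ := surjective_up_to_refinements_of_epi (φ.f l)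
      (y ≫ (mappingCocone.snd φ).v m l (by omega))
    have e3 : (π₁ ≫ y ≫ (mappingCocone.fst φ).f m + a ≫ K.d l m) ≫ φ.f m = 0 := by
      rw [Preadditive.add_comp, Category.assoc, e2, Preadditive.comp_neg, ← Category.assoc π₁, ha,
        Category.assoc, Category.assoc, φ.comm, neg_add_cancel]
    obtain ⟨A₂, π₂, _, x', hx'⟩ := (hex m).exact_up_to_refinements _ e3
    dsimp at hx'
    refine ⟨A₂, π₂ ≫ π₁, epi_comp _ _, x', ?_⟩
    rw [← cancel_mono (i.f n), Category.assoc, Category.assoc, Category.assoc, e1, ← i.comm,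
      ← reassoc_of% hx']
    simp
  have h2 : Epi (HomologicalComplex.homologyMap (mappingCocone.lift φ i 0 h0) n) := by
    rw [HomologicalComplex.epi_homologyMap_iff_up_to_refinements _ m n (n + 1) hp hn]
    intro A y hy
    have e1 : (y ≫ (mappingCocone.fst φ).f n) ≫ K.d n (n + 1) = 0 := by
      rw [Category.assoc, ← hd, reassoc_of% hy, Limits.zero_comp]
    have e2 : (y ≫ (mappingCocone.fst φ).f n) ≫ φ.f n =
        -((y ≫ (mappingCocone.snd φ).v n m (by omega)) ≫ L.d m n) := by
      have := congrArg (· ≫ (mappingCocone.snd φ).v (n + 1) n (by omega)) hy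
      rw [Category.assoc, mappingCocone_d_snd φ rfl hm, Limits.zero_comp] at this
      rw [eq_neg_iff_add_eq_zero, Category.assoc, Category.assoc]
      rw [Preadditive.comp_sub, Preadditive.comp_neg, ← neg_add', neg_eq_zero] at this
      exact this
    obtain ⟨A₁, π₁, _, a, ha⟩ := surjective_up_to_refinements_of_epi (φ.f m)
      (y ≫ (mappingCocone.snd φ).v n m (by omega))
    have e3 : (π₁ ≫ y ≫ (mappingCocone.fst φ).f n + a ≫ K.d m n) ≫ φ.f n = 0 := by
      rw [Preadditive.add_comp, Category.assoc, e2, Preadditive.comp_neg, ← Category.assoc π₁, ha,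
        Category.assoc, Category.assoc, φ.comm, neg_add_cancel]
    obtain ⟨A₂, π₂, _, x, hx⟩ := (hex n).exact_up_to_refinements _ e3
    dsimp at hx
    refine ⟨A₂, π₂ ≫ π₁, epi_comp _ _, x, ?_, -(π₂ ≫ a) ≫ (mappingCocone.inl φ).v m m (by omega),
      ?_⟩
    · rw [← cancel_mono (i.f (n + 1)), Category.assoc, ← i.comm, ← reassoc_of% hx]
      simp only [Preadditive.add_comp, Preadditive.comp_add, Category.assoc]
      rw [← Category.assoc y, e1]
      simp
    · refine mappingCocone_ext φ (show n + -1 = m by omega) ?_ ?_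
      · rw [Preadditive.add_comp, Category.assoc x, hfst, ← hx]
        simp only [Category.assoc, Preadditive.neg_comp]
        rw [hd, mappingCocone.inl_v_fst_f_assoc]
        simp
      · rw [Preadditive.add_comp, Category.assoc x, hsnd]
        simp only [Category.assoc, Preadditive.neg_comp]
        rw [mappingCocone_d_snd φ hm hl]
        simp [ha]
  exact isIso_of_mono_of_epi _

end cocone

section resolution

open CochainComplex CochainComplex.HomComplex

variable {C : Type*} [Category C] [Abelian C]

/-- If every object embeds in an object with a property that is stable under quotients and direct
sums, every complex is quasi-isomorphic to a complex of objects with this property. -/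
theorem exists_quasiIso_of_embeddings (P : C → Prop)
    (hemb : ∀ Y, ∃ (J : C) (i : Y ⟶ J), Mono i ∧ P J)
    (hquot : ∀ {Y Z : C} (f : Y ⟶ Z), Epi f → P Y → P Z)
    (hsum : ∀ {Y Y₁ Y₂ : C} {p₁ : Y ⟶ Y₁} {i₁ : Y₁ ⟶ Y} {p₂ : Y ⟶ Y₂} {i₂ : Y₂ ⟶ Y},
      p₁ ≫ i₁ + p₂ ≫ i₂ = 𝟙 Y → P Y₁ → P Y₂ → P Y) (K : CochainComplex C ℤ) :
    ∃ (J : CochainComplex C ℤ) (s : K ⟶ J), QuasiIso s ∧ ∀ n, P (J.X n) := by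
  choose J i hi hP using hemb
  let Z : CochainComplex C ℤ :=
    { X := fun n => J (K.X n)
      d := fun _ _ => 0 }
  let e : K ⟶ mappingCone (𝟙 Z) := mappingCone.lift _
    (Cocycle.mk (Cochain.mk fun p q _ => K.d p q ≫ i (K.X q)) 2 (by omega) (by
      ext p q hpq
      simp [Z, δ_v 1 2 (by omega) _ p q hpq (p + 1) (p + 1) (by omega) rfl]))
    (Cochain.ofHoms fun n => i (K.X n)) (by
      ext p q hpq
      simp [Z, δ_v 0 1 (by omega) _ p q hpq p q (by omega) (by omega)])
  have he (n : ℤ) : Mono (e.f n) := by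
    have h : e.f n ≫ (mappingCone.snd (𝟙 Z)).v n n (add_zero n) = i (K.X n) := by
      simp [e]
    have := hi (K.X n)
    exact mono_of_mono_fac h
  have : Mono e := HomologicalComplex.mono_of_mono_f e he
  let S := ShortComplex.mk e (Limits.cokernel.π e) (Limits.cokernel.condition e)
  have hS : S.ShortExact := { exact := ShortComplex.exact_cokernel e }
  have hSn (n : ℤ) := hS.map_of_exact (HomologicalComplex.eval C (ComplexShape.up ℤ) n)
  have hπ (n : ℤ) : Epi ((Limits.cokernel.π e).f n) := (hSn n).epi_g
  have hM (n : ℤ) : P ((mappingCone (𝟙 Z)).X n) :=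
    hsum (mappingCone.id_X (𝟙 Z) n (n + 1) rfl) (hP _) (hP _)
  refine ⟨mappingCocone (Limits.cokernel.π e), mappingCocone.lift _ e 0 (by simp),
    quasiIso_lift_of_shortExact _ _ (Limits.cokernel.condition e) (fun n => (hSn n).exact) _,
    fun n => ?_⟩
  exact hsum (mappingCocone.id_X (Limits.cokernel.π e) n (n + -1) rfl) (hM n)
    (hquot _ (hπ _) (hM _))

end resolution

section fibre

open CochainComplex CochainComplex.HomComplex

variable {C M : Type*} [Category C] [Abelian C] [Category M] [Abelian M]
  {A B : C ⥤ M} [A.Additive] [B.Additive] (d : A ⟶ B)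

/-- The map of complexes induced by a natural transformation. -/
abbrev onComplex (K : CochainComplex C ℤ) : (A.mapHomologicalComplex (ComplexShape.up ℤ)).obj K ⟶
    (B.mapHomologicalComplex (ComplexShape.up ℤ)).obj K :=
  (NatTrans.mapHomologicalComplex d (ComplexShape.up ℤ)).app K

/-- The mapping cone of a natural transformation, as a functor on complexes. -/
def coneFunctor : CochainComplex C ℤ ⥤ CochainComplex M ℤ where
  obj K := mappingCone (onComplex d K)
  map f := mappingCone.map _ _ ((A.mapHomologicalComplex _).map f)
    ((B.mapHomologicalComplex _).map f)
    ((NatTrans.mapHomologicalComplex d (ComplexShape.up ℤ)).naturality f).symm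
  map_id K := by
    simp only [CategoryTheory.Functor.map_id]
    exact mappingCone.map_id _
  map_comp f g := by
    simp only [Functor.map_comp]
    exact mappingCone.map_comp _ _ _ _ _ _ _ _ _

/-- The mapping cocone of a natural transformation, as a functor on complexes. -/
def coconeFunctor : CochainComplex C ℤ ⥤ CochainComplex M ℤ :=
  coneFunctor d ⋙ shiftFunctor (CochainComplex M ℤ) (-1 : ℤ)

theorem mappingCocone_fst_f {K L : CochainComplex M ℤ} (φ : K ⟶ L) (n : ℤ) :
    (mappingCocone.fst φ).f n = (mappingCone.fst φ).1.v (n + -1) n (by omega) := by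
  simp [mappingCocone.fst, Cochain.leftShift_v (n := 1) _ _ _ _ _ n _ (n + -1) (by omega)]
  exact (neg_neg _).trans (Category.id_comp _)

theorem mappingCocone_snd_v {K L : CochainComplex M ℤ} (φ : K ⟶ L) (n : ℤ) :
    (mappingCocone.snd φ).v n (n + -1) rfl =
      (mappingCone.snd φ).v (n + -1) (n + -1) (add_zero _) := by
  refine ((mappingCone.snd φ).leftShift_v (-1) (-1) (zero_add _) n (n + -1) rfl (n + -1)
    (add_zero _)).trans ?_
  rw [show (-1 * -1 + -1 * (-1 - 1) / 2 : ℤ).negOnePow = 1 from Int.negOnePow_even _ ⟨1, rfl⟩]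
  exact (one_smul _ _).trans (Category.id_comp _)

theorem mappingCone_map_fst {K₁ L₁ K₂ L₂ : CochainComplex M ℤ} (φ₁ : K₁ ⟶ L₁) (φ₂ : K₂ ⟶ L₂)
    (a : K₁ ⟶ K₂) (b : L₁ ⟶ L₂) (comm : φ₁ ≫ b = a ≫ φ₂) {n m : ℤ} (h : n + 1 = m) :
    (mappingCone.map φ₁ φ₂ a b comm).f n ≫ (mappingCone.fst φ₂).1.v n m h =
      (mappingCone.fst φ₁).1.v n m h ≫ a.f m := by
  refine mappingCone.ext_from _ m n h ?_ ?_ <;> simp [mappingCone.map]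

theorem mappingCone_map_snd {K₁ L₁ K₂ L₂ : CochainComplex M ℤ} (φ₁ : K₁ ⟶ L₁) (φ₂ : K₂ ⟶ L₂)
    (a : K₁ ⟶ K₂) (b : L₁ ⟶ L₂) (comm : φ₁ ≫ b = a ≫ φ₂) (n : ℤ) :
    (mappingCone.map φ₁ φ₂ a b comm).f n ≫ (mappingCone.snd φ₂).v n n (add_zero n) =
      (mappingCone.snd φ₁).v n n (add_zero n) ≫ b.f n := by
  refine mappingCone.ext_from _ (n + 1) n rfl ?_ ?_ <;> simp [mappingCone.map]

theorem coneFunctor_map_fst {K L : CochainComplex C ℤ} (f : K ⟶ L) {n m : ℤ} (h : n + 1 = m) :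
    ((coneFunctor d).map f).f n ≫ (mappingCone.fst (onComplex d L)).1.v n m h =
      (mappingCone.fst (onComplex d K)).1.v n m h ≫ A.map (f.f m) := by
  exact mappingCone_map_fst _ _ _ _
    ((NatTrans.mapHomologicalComplex d (ComplexShape.up ℤ)).naturality f).symm h

theorem coneFunctor_map_snd {K L : CochainComplex C ℤ} (f : K ⟶ L) (n : ℤ) :
    ((coneFunctor d).map f).f n ≫ (mappingCone.snd (onComplex d L)).v n n (add_zero n) =
      (mappingCone.snd (onComplex d K)).v n n (add_zero n) ≫ B.map (f.f n) := by
  exact mappingCone_map_snd _ _ _ _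
    ((NatTrans.mapHomologicalComplex d (ComplexShape.up ℤ)).naturality f).symm n

theorem coconeFunctor_map_fst {K L : CochainComplex C ℤ} (f : K ⟶ L) (n : ℤ) :
    ((coconeFunctor d).map f).f n ≫ (mappingCocone.fst (onComplex d L)).f n =
      (mappingCocone.fst (onComplex d K)).f n ≫ A.map (f.f n) := by
  rw [mappingCocone_fst_f, mappingCocone_fst_f]
  exact coneFunctor_map_fst d f (show n + -1 + 1 = n by omega)

theorem coconeFunctor_map_snd {K L : CochainComplex C ℤ} (f : K ⟶ L) {n m : ℤ} (h : n + -1 = m) :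
    ((coconeFunctor d).map f).f n ≫ (mappingCocone.snd (onComplex d L)).v n m h =
      (mappingCocone.snd (onComplex d K)).v n m h ≫ B.map (f.f m) := by
  subst h
  rw [mappingCocone_snd_v, mappingCocone_snd_v]
  exact coneFunctor_map_snd d f (n + -1)

theorem quasiIso_coconeFunctor_map [A.PreservesHomology] [B.PreservesHomology]
    {K L : CochainComplex C ℤ} (f : K ⟶ L) [QuasiIso f] :
    QuasiIso ((coconeFunctor d).map f) := by
  let _ : HasDerivedCategory M := HasDerivedCategory.standard _
  have h : QuasiIso ((coneFunctor d).map f) := by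
    rw [← DerivedCategory.isIso_Q_map_iff_quasiIso]
    exact Pretriangulated.isIso₃_of_isIso₁₂
      (DerivedCategory.Q.mapTriangle.map (mappingCone.triangleMap (onComplex d K) (onComplex d L)
        ((A.mapHomologicalComplex _).map f) ((B.mapHomologicalComplex _).map f)
        ((NatTrans.mapHomologicalComplex d (ComplexShape.up ℤ)).naturality f).symm))
      (DerivedCategory.mappingCone_triangle_distinguished _)
      (DerivedCategory.mappingCone_triangle_distinguished _)
      (inferInstanceAs (IsIso (DerivedCategory.Q.map ((A.mapHomologicalComplex _).map f))))
      (inferInstanceAs (IsIso (DerivedCategory.Q.map ((B.mapHomologicalComplex _).map f))))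
  exact (quasiIso_shift_iff _ _).2 h

variable {H : C ⥤ M} [H.Additive] (ι : H ⟶ A) (w : ι ≫ d = 0)

theorem onComplex_comp_eq_zero (w : ι ≫ d = 0) (K : CochainComplex C ℤ) :
    onComplex ι K ≫ onComplex d K = 0 := by
  ext n
  exact NatTrans.congr_app w (K.X n)

/-- The map from the kernel of a natural transformation to its mapping cocone. -/
def toCocone : H.mapHomologicalComplex (ComplexShape.up ℤ) ⟶ coconeFunctor d where
  app K := mappingCocone.lift (onComplex d K) (onComplex ι K) 0
    (by rw [onComplex_comp_eq_zero d ι w]; simp)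
  naturality K L f := by
    ext n
    refine mappingCocone_ext (onComplex d L) (show n + -1 = n + -1 from rfl) ?_ ?_
    · refine (Category.assoc _ _ _).trans ?_
      refine (congrArg (_ ≫ ·) (mappingCocone.lift_f_fst_f _ _ _ _ n)).trans ?_
      refine Eq.trans ?_ (Category.assoc _ _ _).symm
      refine Eq.trans ?_ (congrArg (_ ≫ ·) (coconeFunctor_map_fst d f n).symm)
      refine Eq.trans ?_ (Category.assoc _ _ _)
      refine Eq.trans ?_ (congrArg (· ≫ _) (mappingCocone.lift_f_fst_f _ _ _ _ n).symm)
      exact ι.naturality (f.f n)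
    · refine (Category.assoc _ _ _).trans ?_
      refine (congrArg (_ ≫ ·) (mappingCocone.lift_f_snd_v _ _ _ _ n _ rfl)).trans ?_
      refine Eq.trans ?_ (Category.assoc _ _ _).symm
      refine Eq.trans ?_ (congrArg (_ ≫ ·) (coconeFunctor_map_snd d f rfl).symm)
      refine Eq.trans ?_ (Category.assoc _ _ _)
      refine Eq.trans ?_ (congrArg (· ≫ _) (mappingCocone.lift_f_snd_v _ _ _ _ n _ rfl).symm)
      exact (Limits.comp_zero).trans (Limits.zero_comp).symm

theorem quasiIso_toCocone_app (hι : ∀ Y, Mono (ι.app Y))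
    (hex : ∀ Y, (ShortComplex.mk (ι.app Y) (d.app Y) (NatTrans.congr_app w Y)).Exact)
    (K : CochainComplex C ℤ) (hK : ∀ n, Epi (d.app (K.X n))) :
    QuasiIso ((toCocone d ι w).app K) := by
  have h1 (n : ℤ) : Mono ((onComplex ι K).f n) := hι (K.X n)
  have h2 (n : ℤ) : Epi ((onComplex d K).f n) := hK n
  exact quasiIso_lift_of_shortExact (onComplex ι K) (onComplex d K)
    (onComplex_comp_eq_zero d ι w K) (fun n => hex (K.X n))
    (by rw [onComplex_comp_eq_zero d ι w]; simp)

theorem epi_app_of_epi [B.PreservesEpimorphisms] {Y Z : C} (f : Y ⟶ Z) (hf : Epi f)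
    (hY : Epi (d.app Y)) : Epi (d.app Z) := by
  have h : Epi (d.app Y ≫ B.map f) := epi_comp _ _
  rw [← d.naturality] at h
  exact epi_of_epi (A.map f) _

theorem epi_app_of_sum {Y Y₁ Y₂ : C} {p₁ : Y ⟶ Y₁} {i₁ : Y₁ ⟶ Y} {p₂ : Y ⟶ Y₂} {i₂ : Y₂ ⟶ Y}
    (h : p₁ ≫ i₁ + p₂ ≫ i₂ = 𝟙 Y) (h₁ : Epi (d.app Y₁)) (h₂ : Epi (d.app Y₂)) :
    Epi (d.app Y) := by
  refine ⟨fun {Z} g g' hg => ?_⟩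
  have key {Y' : C} (i : Y' ⟶ Y) (hY : Epi (d.app Y')) : B.map i ≫ g = B.map i ≫ g' := by
    rw [← cancel_epi (d.app Y'), ← d.naturality_assoc, ← d.naturality_assoc, hg]
  have e : B.map p₁ ≫ B.map i₁ + B.map p₂ ≫ B.map i₂ = 𝟙 (B.obj Y) := by
    rw [← B.map_comp, ← B.map_comp, ← B.map_add, h, B.map_id]
  rw [← Category.id_comp g, ← Category.id_comp g', ← e, Preadditive.add_comp,
    Preadditive.add_comp, Category.assoc, Category.assoc, Category.assoc, Category.assoc,
    key i₁ h₁, key i₂ h₂]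

end fibre

section RHom

open CochainComplex

variable {C : Type 1} [Category.{0} C] [Abelian C] [Linear ℝ C]
  [HasDerivedCategory.{1} C] [HasDerivedCategory.{1} (ModuleCat.{0} ℝ)]
  {A B : C ⥤ ModuleCat.{0} ℝ} [A.Additive] [B.Additive] [A.PreservesHomology]
  [B.PreservesHomology] (d : A ⟶ B) {X : C}
  (ι : (linearCoyoneda ℝ C).obj (Opposite.op X) ⟶ A) (w : ι ≫ d = 0)

/-- A functor with a two-term description by exact functors is derived from its kernel. -/
theorem isRHom_of_cocone (hι : ∀ Y, Mono (ι.app Y))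
    (hex : ∀ Y, (ShortComplex.mk (ι.app Y) (d.app Y) (NatTrans.congr_app w Y)).Exact)
    (hemb : ∀ Y, ∃ (J : C) (i : Y ⟶ J), Mono i ∧ Epi (d.app J)) :
    IsRHom C X (CochainComplex.singleFunctor C 0 ⋙ coconeFunctor d ⋙ DerivedCategory.Q) := by
  have hinv : (HomologicalComplex.quasiIso C (ComplexShape.up ℤ)).IsInvertedBy
      (coconeFunctor d ⋙ DerivedCategory.Q) := fun K L f hf => by
    have : QuasiIso f := hf
    have := quasiIso_coconeFunctor_map d f
    exact inferInstanceAs (IsIso (DerivedCategory.Q.map ((coconeFunctor d).map f)))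
  let RF : DerivedCategory C ⥤ DerivedCategory (ModuleCat.{0} ℝ) :=
    Localization.lift (coconeFunctor d ⋙ DerivedCategory.Q) hinv DerivedCategory.Q
  let e : DerivedCategory.Q ⋙ RF ≅ coconeFunctor d ⋙ DerivedCategory.Q :=
    Localization.Lifting.iso DerivedCategory.Q
      (HomologicalComplex.quasiIso C (ComplexShape.up ℤ)) _ _
  let α' : HomotopyCategory.quotient C (ComplexShape.up ℤ) ⋙ homFunctor C X ⟶
      HomotopyCategory.quotient C (ComplexShape.up ℤ) ⋙ DerivedCategory.Qh ⋙ RF :=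
    { app := fun K => DerivedCategory.Q.map ((toCocone d ι w).app K) ≫ e.inv.app K
      naturality := fun K L f => by
        refine (Category.assoc _ _ _).symm.trans ?_
        refine (congrArg (· ≫ e.inv.app L) (DerivedCategory.Q.map_comp _ _).symm).trans ?_
        refine (congrArg (fun t => DerivedCategory.Q.map t ≫ e.inv.app L)
          ((toCocone d ι w).naturality f)).trans ?_
        rw [DerivedCategory.Q.map_comp, Category.assoc]
        refine Eq.trans ?_ (Category.assoc _ _ _).symm
        exact congrArg (_ ≫ ·) (e.inv.naturality f) }
  let α : homFunctor C X ⟶ DerivedCategory.Qh ⋙ RF := Quotient.natTransLift _ α'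
  have hα (K : CochainComplex C ℤ) (hK : ∀ n, Epi (d.app (K.X n))) :
      IsIso (α.app ((HomotopyCategory.quotient C (ComplexShape.up ℤ)).obj K)) := by
    have := quasiIso_toCocone_app d ι w hι hex K hK
    exact inferInstanceAs (IsIso (DerivedCategory.Q.map ((toCocone d ι w).app K) ≫ e.inv.app K))
  refine ⟨RF, α, isRightDerivedFunctor_of_resolutions α _ fun K => ?_,
    ⟨(Functor.isoWhiskerLeft _ e.symm) ≪≫ (Functor.associator _ _ _).symm ≪≫
      Functor.isoWhiskerRight (DerivedCategory.singleFunctorIsoCompQ C 0).symm RF⟩⟩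
  obtain ⟨K, rfl⟩ := HomotopyCategory.quotient_obj_surjective K
  obtain ⟨J, s, hs, hJ⟩ := exists_quasiIso_of_embeddings (fun Y => Epi (d.app Y)) hemb
    (fun f hf hY => epi_app_of_epi d f hf hY) (fun h h₁ h₂ => epi_app_of_sum d h h₁ h₂) K
  exact ⟨_, (HomotopyCategory.quotient C _).map s,
    (HomotopyCategory.quotient_map_mem_quasiIso_iff s).2 hs, hα J hJ⟩

end RHom

section double

open CochainComplex CochainComplex.HomComplex

variable {M : Type*} [Category M] [Abelian M] {K L : CochainComplex M ℤ} (φ : K ⟶ L)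
  {X Y : M} {f : X ⟶ Y} (a : X ≅ K.X 0) (b : Y ≅ L.X 0) (w : f ≫ b.hom = a.hom ≫ φ.f 0)

/-- The mapping cocone of a map between complexes in degree `0` is a two-term complex. -/
def doubleToCocone (hK : Limits.IsZero (K.X 1)) (hL : Limits.IsZero (L.X (-1)))
    (hL' : Limits.IsZero (L.X 1)) (hK' : Limits.IsZero (K.X 2)) :
    HomologicalComplex.double f EqConn.rel01 ⟶ mappingCocone φ :=
  HomologicalComplex.mkHomFromDouble EqConn.rel01 zero_ne_one
    (a.hom ≫ (mappingCocone.inl φ).v 0 0 (add_zero 0))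
    (-(b.hom ≫ (mappingCocone.inr φ).1.v 0 1 (zero_add 1)))
    (by
      refine mappingCocone_ext φ (show (1 : ℤ) + -1 = 0 by omega) (hK.eq_of_tgt _ _) ?_
      rw [Category.assoc, Category.assoc, mappingCocone_d_snd φ (zero_add 1) (by omega : -1 + 1 = (0 : ℤ)),
        hL.eq_of_src (L.d (-1) 0) 0, Limits.comp_zero, sub_zero, Preadditive.comp_neg,
        mappingCocone.inl_v_fst_f_assoc, Preadditive.comp_neg, Preadditive.comp_neg,
        Preadditive.neg_comp, Category.assoc, Category.assoc, mappingCocone.inr_v_snd_v,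
        Category.comp_id, w])
    (fun k hk => by
      obtain rfl : k = 2 := by rw [← hk]; rfl
      exact mappingCocone_ext φ (show (2 : ℤ) + -1 = 1 by omega) (hK'.eq_of_tgt _ _)
        (hL'.eq_of_tgt _ _))

variable {φ} in
theorem isIso_doubleToCocone (hK : ∀ n ≠ 0, Limits.IsZero (K.X n))
    (hL : ∀ n ≠ 0, Limits.IsZero (L.X n)) :
    IsIso (doubleToCocone φ a b w (hK _ (by omega)) (hL _ (by omega)) (hL _ (by omega))
      (hK _ (by omega))) := by
  refine @HomologicalComplex.Hom.isIso_of_components _ _ _ _ _ _ _ _ fun n => ?_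
  by_cases h0 : n = 0
  · subst h0
    refine ⟨(mappingCocone.fst φ).f 0 ≫ a.inv ≫ (HomologicalComplex.doubleXIso₀ f EqConn.rel01).inv,
      by simp [doubleToCocone], ?_⟩
    refine mappingCocone_ext φ (show (0 : ℤ) + -1 = -1 by omega) ?_
      ((hL _ (by omega)).eq_of_tgt _ _)
    simp [doubleToCocone]
  by_cases h1 : n = 1
  · subst h1
    refine ⟨-((mappingCocone.snd φ).v 1 0 (by omega) ≫ b.inv ≫
      (HomologicalComplex.doubleXIso₁ f EqConn.rel01 zero_ne_one).inv),
      by simp [doubleToCocone], ?_⟩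
    refine mappingCocone_ext φ (show (1 : ℤ) + -1 = 0 by omega)
      ((hK _ (by omega)).eq_of_tgt _ _) ?_
    simp [doubleToCocone]
  · have hZ : Limits.IsZero ((mappingCocone φ).X n) := by
      rw [Limits.IsZero.iff_id_eq_zero]
      exact mappingCocone_ext φ rfl ((hK n h0).eq_of_tgt _ _) ((hL _ (by omega)).eq_of_tgt _ _)
    exact ⟨0, (HomologicalComplex.isZero_double_X f EqConn.rel01 n h0 h1).eq_of_src _ _,
      hZ.eq_of_src _ _⟩

theorem doubleToCocone_naturality {K' L' : CochainComplex M ℤ} (φ' : K' ⟶ L') {X' Y' : M}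
    {f' : X' ⟶ Y'} (a' : X' ≅ K'.X 0) (b' : Y' ≅ L'.X 0) (w' : f' ≫ b'.hom = a'.hom ≫ φ'.f 0)
    (hK : ∀ n ≠ 0, Limits.IsZero (K.X n)) (hL : ∀ n ≠ 0, Limits.IsZero (L.X n))
    (hK' : ∀ n ≠ 0, Limits.IsZero (K'.X n)) (hL' : ∀ n ≠ 0, Limits.IsZero (L'.X n))
    {x : X ⟶ X'} {y : Y ⟶ Y'} {k : K.X 0 ⟶ K'.X 0} {l : L.X 0 ⟶ L'.X 0}
    (hx : x ≫ a'.hom = a.hom ≫ k) (hy : y ≫ b'.hom = b.hom ≫ l)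
    {g : HomologicalComplex.double f EqConn.rel01 ⟶ HomologicalComplex.double f' EqConn.rel01}
    (h0 : g.f 0 = (HomologicalComplex.doubleXIso₀ f EqConn.rel01).hom ≫ x ≫
      (HomologicalComplex.doubleXIso₀ f' EqConn.rel01).inv)
    (h1 : g.f 1 = (HomologicalComplex.doubleXIso₁ f EqConn.rel01 zero_ne_one).hom ≫ y ≫
      (HomologicalComplex.doubleXIso₁ f' EqConn.rel01 zero_ne_one).inv)
    {c : mappingCocone φ ⟶ mappingCocone φ'}
    (hfst : c.f 0 ≫ (mappingCocone.fst φ').f 0 = (mappingCocone.fst φ).f 0 ≫ k)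
    (hsnd : c.f 1 ≫ (mappingCocone.snd φ').v 1 0 (by omega) =
      (mappingCocone.snd φ).v 1 0 (by omega) ≫ l) :
    g ≫ doubleToCocone φ' a' b' w' (hK' _ (by omega)) (hL' _ (by omega)) (hL' _ (by omega))
        (hK' _ (by omega)) =
      doubleToCocone φ a b w (hK _ (by omega)) (hL _ (by omega)) (hL _ (by omega))
        (hK _ (by omega)) ≫ c := by
  refine HomologicalComplex.from_double_hom_ext ?_ ?_
  · refine mappingCocone_ext φ' (show (0 : ℤ) + -1 = -1 by omega) ?_
      ((hL' _ (by omega)).eq_of_tgt _ _)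
    simp [doubleToCocone, h0, hfst, hx]
  · refine mappingCocone_ext φ' (show (1 : ℤ) + -1 = 0 by omega)
      ((hK' _ (by omega)).eq_of_tgt _ _) ?_
    simp [doubleToCocone, h1, hsnd, hy]

end double

section fibre

open CochainComplex CochainComplex.HomComplex

variable {C M : Type*} [Category C] [Abelian C] [Category M] [Abelian M]
  {A B : C ⥤ M} [A.Additive] [B.Additive] (d : A ⟶ B)

theorem isZero_map_single (A : C ⥤ M) [A.Additive] (Y : C) (n : ℤ) (hn : n ≠ 0) :
    Limits.IsZero (((A.mapHomologicalComplex (ComplexShape.up ℤ)).obj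
      ((CochainComplex.singleFunctor C 0).obj Y)).X n) :=
  A.map_isZero (HomologicalComplex.isZero_single_obj_X (ComplexShape.up ℤ) 0 Y n hn)

/-- The degree `0` part of the image of an object placed in degree `0`. -/
def mapSingleIso (A : C ⥤ M) [A.Additive] (Y : C) :
    A.obj Y ≅ ((A.mapHomologicalComplex (ComplexShape.up ℤ)).obj
      ((CochainComplex.singleFunctor C 0).obj Y)).X 0 :=
  A.mapIso (HomologicalComplex.singleObjXSelf (ComplexShape.up ℤ) 0 Y).symm

theorem mapSingleIso_naturality (A : C ⥤ M) [A.Additive] {Y Y' : C} (f : Y ⟶ Y') :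
    A.map f ≫ (mapSingleIso A Y').hom =
      (mapSingleIso A Y).hom ≫ A.map (((CochainComplex.singleFunctor C 0).map f).f 0) := by
  refine (A.map_comp _ _).symm.trans (Eq.trans (congrArg A.map ?_) (A.map_comp _ _))
  exact ((congrArg (_ ≫ ·) (HomologicalComplex.single_map_f_self (ComplexShape.up ℤ) 0 f)).trans (by simp; rfl)).symm

/-- The comparison of a two-term complex with a mapping cocone. -/
def doubleIsoCocone (Y : C) : HomologicalComplex.double (d.app Y) EqConn.rel01 ≅
    (CochainComplex.singleFunctor C 0 ⋙ coconeFunctor d).obj Y :=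
  @asIso _ _ _ _ _
    (isIso_doubleToCocone (φ := onComplex d ((CochainComplex.singleFunctor C 0).obj Y))
      (mapSingleIso A Y) (mapSingleIso B Y) (d.naturality _).symm (isZero_map_single A Y)
      (isZero_map_single B Y))

theorem doubleIsoCocone_naturality {Y Y' : C} (f : Y ⟶ Y')
    {g : HomologicalComplex.double (d.app Y) EqConn.rel01 ⟶
      HomologicalComplex.double (d.app Y') EqConn.rel01}
    (h0 : g.f 0 = (HomologicalComplex.doubleXIso₀ (d.app Y) EqConn.rel01).hom ≫ A.map f ≫
      (HomologicalComplex.doubleXIso₀ (d.app Y') EqConn.rel01).inv)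
    (h1 : g.f 1 = (HomologicalComplex.doubleXIso₁ (d.app Y) EqConn.rel01 zero_ne_one).hom ≫
      B.map f ≫ (HomologicalComplex.doubleXIso₁ (d.app Y') EqConn.rel01 zero_ne_one).inv) :
    g ≫ (doubleIsoCocone d Y').hom = (doubleIsoCocone d Y).hom ≫
      (CochainComplex.singleFunctor C 0 ⋙ coconeFunctor d).map f :=
  doubleToCocone_naturality _ _ _ (d.naturality _).symm _ _ _ (d.naturality _).symm
    (isZero_map_single A Y) (isZero_map_single B Y)
    (isZero_map_single A Y') (isZero_map_single B Y') (mapSingleIso_naturality A f)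
    (mapSingleIso_naturality B f) h0 h1 (coconeFunctor_map_fst d _ 0)
    (coconeFunctor_map_snd d _ _)

end fibre

section invariants

variable {V V' : Type} [AddCommGroup V] [Module ℝ V] [AddCommGroup V'] [Module ℝ V']
  {ρ : Representation ℝ ℂˣ V} {ρ' : Representation ℝ ℂˣ V'}

theorem chi_zero (z : ℂˣ) : chi 0 z = 1 := by simp [chi_apply]

/-- Invariant vectors lift to invariant vectors. -/
theorem exists_invariant_of_mem_range (hρ : ∀ v, IsRegularMap fun z => ρ z v)
    (hρ' : ∀ v, IsRegularMap fun z => ρ' z v) {f : V →ₗ[ℝ] V'}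
    (hf : ∀ z v, f (ρ z v) = ρ' z (f v)) {v : V} (hv : ∀ z, ρ' z (f v) = f v) :
    ∃ w, (∀ z, ρ z w = w) ∧ f w = f v := by
  have h := isDiag_cplx hρ
  have h' := isDiag_cplx hρ'
  have h0 : ofR V' (f v) ∈ wt (cplx ρ') 0 := mem_wt.2 fun z => by
    rw [chi_zero, one_smul, cplx_apply, ofR_apply, LinearMap.baseChange_tmul, hv z]
  have h1 : scale h (ind {0}) (ofR V v) ∈ wt (cplx ρ) 0 := by
    rw [← wtSub_singleton]
    exact scale_ind_mem h _
  refine ⟨reC V (scale h (ind {0}) (ofR V v)), fun z => ?_, ?_⟩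
  · rw [← reC_baseChange, ← cplx_apply, mem_wt.1 h1 z, chi_zero, one_smul]
  · rw [← reC_baseChange, map_scale h h' (baseChange_equivariant hf)]
    have e : f.baseChange ℂ (ofR V v) = ofR V' (f v) := LinearMap.baseChange_tmul _ _ _
    rw [e, scale_of_mem h' _ h0, ind_of_mem (Set.mem_singleton _), one_smul, reC_ofR]

theorem formAct_apply (ρ : Representation ℝ ℂˣ V) (z : ℂˣ) (ω : Fin 2 → V) (i : Fin 2) :
    formAct ρ z ω i = ∑ j, jac z i j • ρ z (ω j) := by
  simp [formAct]

/-- The action on forms as a representation. -/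
def formρ (ρ : Representation ℝ ℂˣ V) : Representation ℝ ℂˣ (Fin 2 → V) where
  toFun := formAct ρ
  map_one' := by
    ext ω i
    simp [formAct, jac_one, Matrix.one_apply]
  map_mul' z w := by
    refine LinearMap.ext fun ω => funext fun i => ?_
    rw [Module.End.mul_apply]
    simp only [formAct_apply, jac_mul, Matrix.mul_apply, Fin.sum_univ_two, map_add, map_smul,
      map_mul, Module.End.mul_apply, smul_add, add_smul, mul_smul]
    abel

theorem formρ_apply (z : ℂˣ) (ω : Fin 2 → V) : formρ ρ z ω = formAct ρ z ω := rfl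

theorem formρ_regular (hρ : ∀ v, IsRegularMap fun z => ρ z v) (ω : Fin 2 → V) :
    IsRegularMap fun z => formρ ρ z ω := by
  have key (i j : Fin 2) : IsRegularMap fun z => jac z i j • ρ z (ω j) := by
    have h : IsRegularMap fun z => jac z i j • (1 : ℝ) := isRegularMap_smul (jac_regular i j) 1
    simpa using h.bilin (hρ (ω j)) (LinearMap.lsmul ℝ V)
  have h (i : Fin 2) := ((key i 0).add (key i 1)).map (LinearMap.single ℝ (fun _ : Fin 2 => V) i)
  refine (congrArg IsRegularMap (funext fun z => ?_)).mp ((h 0).add (h 1))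
  funext i
  rw [formρ_apply, formAct_apply, Fin.sum_univ_two]
  fin_cases i <;> simp

end invariants

namespace EqConn

section exact

variable {E E' E'' : EqConn} [Module.Finite Poly E] [Module.Projective Poly E]
  [Module.Finite Poly E'] [Module.Projective Poly E']
  [Module.Finite Poly E''] [Module.Projective Poly E'']

theorem mem_range_of_radial (f : E ⟶ E') (g : E' ⟶ E'')
    (h : LinearMap.ker (Hom.mapRadial g) ≤ LinearMap.range (Hom.mapRadial f)) {m : E'}
    (hm : g.toLin m = 0) : ∃ n, f.toLin n = m := by
  have h1 : m ∈ spanOf (LinearMap.ker (Hom.mapRadial g)) := mem_spanOf fun a _ => by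
    rw [LinearMap.mem_ker, ← Hom.ev_toLin, hm, map_zero]
  refine spanOf_induction (T := (LinearMap.range f.toLin).restrictScalars ℝ)
    (fun p u hu => ?_) h1
  obtain ⟨v, rfl⟩ := h hu
  exact Submodule.smul_mem _ p ⟨(v : E), rfl⟩

theorem exists_mapInvSections (f : E ⟶ E') (g : E' ⟶ E'')
    (h : LinearMap.ker (Hom.mapRadial g) ≤ LinearMap.range (Hom.mapRadial f)) (m : E'.invSections)
    (hm : Hom.mapInvSections g m = 0) : ∃ n, Hom.mapInvSections f n = m := by
  obtain ⟨n, hn⟩ := mem_range_of_radial f g h (m := m.1) (congrArg Subtype.val hm)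
  obtain ⟨w, hw, hwn⟩ := exists_invariant_of_mem_range E.ρ_regular E'.ρ_regular
    (f := Hom.toReal f) (v := n) f.map_ρ (fun z => by
      change E'.ρ z (f.toLin n) = f.toLin n
      rw [hn]
      exact m.2 z)
  exact ⟨⟨w, hw⟩, Subtype.ext (hwn.trans hn)⟩

theorem exists_mapInvForms (f : E ⟶ E') (g : E' ⟶ E'')
    (h : LinearMap.ker (Hom.mapRadial g) ≤ LinearMap.range (Hom.mapRadial f)) (m : E'.invForms)
    (hm : Hom.mapInvForms g m = 0) : ∃ n, Hom.mapInvForms f n = m := by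
  choose n hn using fun i => mem_range_of_radial f g h (m := m.1 i)
    (congrFun (congrArg Subtype.val hm) i)
  obtain ⟨w, hw, hwn⟩ := exists_invariant_of_mem_range (formρ_regular E.ρ_regular)
    (formρ_regular E'.ρ_regular) (f := (Hom.toReal f).compLeft (Fin 2)) (v := n)
    (fun z ω => by
      funext i
      simp [formρ_apply, formAct_apply, f.map_ρ])
    (fun z => by
      have e : (Hom.toReal f).compLeft (Fin 2) n = m.1 := funext hn
      rw [e]
      exact m.2 z)
  exact ⟨⟨w, hw⟩, Subtype.ext (hwn.trans (funext hn))⟩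

end exact

section extension

theorem eval_act_real (s : ℝˣ) (x : Fin 2 → ℝ) (f : Poly) :
    MvPolynomial.eval x (act (Units.map (algebraMap ℝ ℂ).toMonoidHom s⁻¹) f) =
      MvPolynomial.eval (fun i => (s : ℝ) * x i) f := by
  induction f using MvPolynomial.induction_on with
  | C a =>
    rw [show act _ (MvPolynomial.C a) = MvPolynomial.C a from (act _).commutes a]
    simp
  | add p q hp hq => simp only [map_add, hp, hq]
  | mul_X p k hp =>
    rw [map_mul, map_mul, map_mul, hp, act_X]
    fin_cases k <;> simp [jac, Fin.sum_univ_two]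

theorem jac_real (s : ℝˣ) (i j : Fin 2) :
    jac (Units.map (algebraMap ℝ ℂ).toMonoidHom s⁻¹) i j = if i = j then (s : ℝ) else 0 := by
  fin_cases i <;> fin_cases j <;> simp [jac]

theorem invForms_unit (ω : unit.invForms) : ω = 0 := by
  refine Subtype.ext (funext fun i => ?_)
  refine (MvPolynomial.funext fun x => ?_ : toFn (ω.1 i) = 0)
  have key (s : ℝ) (hs : s ≠ 0) : s * MvPolynomial.eval (fun i => s * x i) (toFn (ω.1 i)) =
      MvPolynomial.eval x (toFn (ω.1 i)) := by
    let z : ℂˣ := Units.map (algebraMap ℝ ℂ).toMonoidHom (Units.mk0 s hs)⁻¹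
    have h : ∑ j, jac z i j • act z (toFn (ω.1 j)) = toFn (ω.1 i) :=
      (formAct_apply unit.ρ z ω.1 i).symm.trans (congrFun (ω.2 z) i)
    simp only [z, jac_real, ite_smul, zero_smul, Finset.sum_ite_eq, Finset.mem_univ, if_true] at h
    have h' := congrArg (MvPolynomial.eval x) h
    rw [MvPolynomial.smul_eval, eval_act_real] at h'
    exact h'
  have hc : Continuous fun s : ℝ => s * MvPolynomial.eval (fun i => s * x i) (toFn (ω.1 i)) := by
    have := MvPolynomial.continuous_eval (toFn (ω.1 i))
    fun_prop
  have h0 := (hc.tendsto 0).mono_left (nhdsWithin_le_nhds (s := {0}ᶜ))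
  have h1 : Filter.Tendsto (fun s : ℝ => s * MvPolynomial.eval (fun i => s * x i) (toFn (ω.1 i)))
      (nhdsWithin 0 {0}ᶜ) (nhds (MvPolynomial.eval x (toFn (ω.1 i)))) :=
    tendsto_const_nhds.congr' (Filter.eventuallyEq_of_mem self_mem_nhdsWithin
      fun s hs => (key s hs).symm)
  have := tendsto_nhds_unique h0 h1
  simpa using this.symm

instance (E : EqConn) [Module.Finite Poly E] [Module.Projective Poly E] :
    FiniteDimensional ℝ E.invForms := by
  let L : E.invForms →ₗ[ℝ] (Fin 2 → E.radial) :=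
    LinearMap.compLeft (E.ev (pt 1)) (Fin 2) ∘ₗ E.invForms.subtype
  refine FiniteDimensional.of_injective L ?_
  rw [← LinearMap.ker_eq_bot, LinearMap.ker_eq_bot']
  intro ω hω
  refine Subtype.ext (funext fun i => eq_zero_of_ev fun a ha => ?_)
  obtain ⟨z, rfl⟩ := exists_pt ha
  rw [← ω.2 z, formAct_apply, map_sum]
  refine Finset.sum_eq_zero fun j _ => ?_
  have : E.ev (pt 1) (ω.1 j) = 0 := congrFun hω j
  rw [map_smul, ev_pt_ρ, this, map_zero, smul_zero]

variable (E : EqConn) {k : ℕ} (ω : Fin k → E.invForms)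

/-- The action on the direct sum of `E` and a power of the structure sheaf. -/
def extensionρ (k : ℕ) : Representation ℝ ℂˣ (E × (Fin k → unit)) where
  toFun z := (E.ρ z).prodMap ((unit.ρ z).compLeft (Fin k))
  map_one' := by
    refine LinearMap.ext fun x => Prod.ext ?_ (funext fun j => ?_) <;> simp
  map_mul' z w := by
    refine LinearMap.ext fun x => Prod.ext ?_ (funext fun j => ?_) <;> simp

variable {E} in
theorem extensionρ_fst (z : ℂˣ) (x : E × (Fin k → unit)) :
    (E.extensionρ k z x).1 = E.ρ z x.1 := rfl

variable {E} in
theorem extensionρ_snd (z : ℂˣ) (x : E × (Fin k → unit)) (j : Fin k) :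
    (E.extensionρ k z x).2 j = unit.ρ z (x.2 j) := rfl

theorem extensionρ_regular (x : E × (Fin k → unit)) :
    IsRegularMap fun z => E.extensionρ k z x := by
  have h1 := (E.ρ_regular x.1).map (LinearMap.inl ℝ E (Fin k → unit))
  have h2 (s : Finset (Fin k)) : IsRegularMap fun z =>
      ∑ j ∈ s, LinearMap.inr ℝ E (Fin k → unit) (Pi.single j (unit.ρ z (x.2 j))) := by
    induction s using Finset.induction_on with
    | empty => simpa using isRegularMap_zero
    | insert j s hj ih =>
      simp only [Finset.sum_insert hj]
      exact ((unit.ρ_regular (x.2 j)).map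
        (LinearMap.inr ℝ E (Fin k → unit) ∘ₗ LinearMap.single ℝ (fun _ => (unit : Type)) j)).add ih
  refine (congrArg IsRegularMap (funext fun z => ?_)).mp (h1.add (h2 Finset.univ))
  rw [← map_sum, Finset.univ_sum_single (fun j => unit.ρ z (x.2 j))]
  refine Prod.ext ?_ (funext fun j => ?_) <;> simp [extensionρ_fst, extensionρ_snd]

/-- The connection `(m, f) ↦ (∇ m + ∑ f_j ω_j, d f)`. -/
def extensionNabla (i : Fin 2) : E × (Fin k → unit) →ₗ[ℝ] E × (Fin k → unit) :=
  LinearMap.prod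
    ((E.nabla i).coprod (∑ j, (E.smulBil.flip ((ω j).1 i)) ∘ₗ LinearMap.proj j))
    ((unit.nabla i).compLeft (Fin k) ∘ₗ LinearMap.snd ℝ E (Fin k → unit))

theorem extensionNabla_fst (i : Fin 2) (x : E × (Fin k → unit)) :
    (E.extensionNabla ω i x).1 = E.nabla i x.1 + ∑ j, toFn (x.2 j) • (ω j).1 i := by
  change E.nabla i x.1 + (∑ j, (E.smulBil.flip ((ω j).1 i)) ∘ₗ LinearMap.proj j :
    (Fin k → unit) →ₗ[ℝ] E) x.2 = _
  rw [LinearMap.sum_apply]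
  rfl

/-- The extension of a power of the structure sheaf by `E` defined by invariant `E`-valued
forms. -/
def extension : EqConn where
  carrier := E × (Fin k → unit)
  ρ := E.extensionρ k
  ρ_smul z f x := Prod.ext (E.ρ_smul z f x.1) (funext fun j => unit.ρ_smul z f (x.2 j))
  ρ_regular := E.extensionρ_regular
  nabla := E.extensionNabla ω
  leibniz i f x := by
    refine Prod.ext ?_ (funext fun j => unit.leibniz i f (x.2 j))
    have e (j : Fin k) : toFn ((f • x).2 j) = f * toFn (x.2 j) := rfl
    simp only [extensionNabla_fst, e, Prod.fst_add, Prod.smul_fst, E.leibniz, smul_add,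
      Finset.smul_sum, mul_smul, add_assoc]
  invariant z x := by
    refine funext fun i => Prod.ext ?_ (funext fun j => ?_)
    · have e (j : Fin k) : (ω j).1 i = ∑ l, jac z i l • E.ρ z ((ω j).1 l) := by
        rw [← formAct_apply, (ω j).2 z]
      have e' (j : Fin k) : toFn ((E.extensionρ k z x).2 j) = act z (toFn (x.2 j)) := rfl
      rw [extensionNabla_fst, formAct_apply, Fin.sum_univ_two, extensionρ_fst, E.nabla_ρ,
        Prod.fst_add, Prod.smul_fst, Prod.smul_fst, extensionρ_fst, extensionρ_fst,
        extensionNabla_fst, extensionNabla_fst, map_add, map_add, map_sum, map_sum]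
      simp only [e, e', E.ρ_smul, Fin.sum_univ_two, smul_add, Finset.sum_add_distrib,
        Finset.smul_sum]
      simp only [smul_comm (_ : ℝ) (_ : Poly)]
      abel
    · rw [formAct_apply, Fin.sum_univ_two, Prod.snd_add, Prod.smul_snd, Prod.smul_snd]
      exact (unit.nabla_ρ i z (x.2 j)).trans (Fin.sum_univ_two _)

instance [Module.Finite Poly E] : Module.Finite Poly (E.extension ω) :=
  inferInstanceAs (Module.Finite Poly (E × (Fin k → unit)))

instance [Module.Projective Poly E] : Module.Projective Poly (E.extension ω) :=
  have : Module.Projective Poly (Fin k → unit) :=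
    inferInstanceAs (Module.Projective Poly (Fin k → Poly))
  inferInstanceAs (Module.Projective Poly (E × (Fin k → unit)))

/-- The inclusion of `E` into an extension. -/
def toExtension : E ⟶ E.extension ω where
  toLin := LinearMap.inl Poly E (Fin k → unit)
  map_ρ z m := Prod.ext rfl (funext fun _ => (map_zero (unit.ρ z)).symm)
  map_nabla i m := by
    refine Prod.ext ?_ (funext fun _ => (map_zero (unit.nabla i)).symm)
    refine Eq.symm ((E.extensionNabla_fst ω i (m, 0)).trans ?_)
    have e (j : Fin k) : toFn ((0 : Fin k → unit) j) = 0 := rfl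
    simp only [e, zero_smul, Finset.sum_const_zero, add_zero]
    rfl

theorem invNabla_extension_surjective (hω : Submodule.span ℝ (Set.range ω) = ⊤) :
    Function.Surjective (E.extension ω).invNabla := by
  intro η
  let η' : Fin 2 → E × (Fin k → unit) := η.1
  have hη (z : ℂˣ) (i : Fin 2) : ∑ l, jac z i l • E.extensionρ k z (η' l) = η' i :=
    (formAct_apply (E.extensionρ k) z η' i).symm.trans (congrFun (η.2 z) i)
  have h2 (i : Fin 2) (j : Fin k) : (η' i).2 j = 0 := by
    have h : (fun i => (η' i).2 j) ∈ unit.invForms := fun z => funext fun i => by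
      rw [formAct_apply, ← hη z i, Fin.sum_univ_two, Fin.sum_univ_two]
      rfl
    exact congrFun (congrArg Subtype.val (invForms_unit ⟨_, h⟩)) i
  have h1 : (fun i => (η' i).1) ∈ E.invForms := fun z => funext fun i => by
    rw [formAct_apply, ← hη z i, Fin.sum_univ_two, Fin.sum_univ_two]
    rfl
  have hs : (⟨_, h1⟩ : E.invForms) ∈ Submodule.span ℝ (Set.range ω) := hω ▸ Submodule.mem_top
  obtain ⟨c, hc⟩ := (Submodule.mem_span_range_iff_exists_fun ℝ).1 hs
  let x : E × (Fin k → unit) := (0, fun j => fn (MvPolynomial.C (c j)))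
  have hx : ∀ z, E.extensionρ k z x = x := fun z =>
    Prod.ext (map_zero (E.ρ z)) (funext fun j => (act z).commutes (c j))
  refine ⟨⟨x, hx⟩, Subtype.ext (funext fun i => ?_)⟩
  refine (Prod.ext ?_ (funext fun j => ?_) : E.extensionNabla ω i x = η' i)
  · rw [extensionNabla_fst]
    have e := congrFun (congrArg Subtype.val hc) i
    refine Eq.trans ?_ e
    have ec (j : Fin k) : toFn (x.2 j) = MvPolynomial.C (c j) := rfl
    have e0 : E.nabla i x.1 = 0 := map_zero _
    simp only [e0, zero_add, ec, Submodule.coe_sum, Submodule.coe_smul, Finset.sum_apply,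
      Pi.smul_apply]
    exact Finset.sum_congr rfl fun j _ => algebraMap_smul Poly (c j) _
  · rw [h2 i j]
    exact MvPolynomial.pderiv_C

end extension

section sections

variable (E : EqConn)

/-- The map from the structure sheaf defined by an invariant horizontal section. -/
def ofSection (m : E) (hm : ∀ z, E.ρ z m = m) (hm' : ∀ i, E.nabla i m = 0) : unit ⟶ E where
  toLin := LinearMap.toSpanSingleton Poly E m
  map_ρ z f := by
    refine Eq.symm ((E.ρ_smul z (toFn f) m).trans ?_)
    rw [hm z]
    rfl
  map_nabla i f := by
    refine Eq.symm ((E.leibniz i (toFn f) m).trans ?_)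
    rw [hm' i, smul_zero, add_zero]
    rfl

variable {E} in
theorem ofSection_one {m : E} (hm : ∀ z, E.ρ z m = m) (hm' : ∀ i, E.nabla i m = 0) :
    (ofSection E m hm hm').toLin (fn 1) = m := one_smul Poly m

variable {E} in
theorem unit_hom_ext {f g : unit ⟶ E} (h : f.toLin (fn 1) = g.toLin (fn 1)) : f = g := by
  refine hom_ext (LinearMap.ext fun x => ?_)
  rw [eq_toFn_smul x, map_smul, map_smul, h]

variable {E} in
theorem ρ_map_one (f : unit ⟶ E) (z : ℂˣ) : E.ρ z (f.toLin (fn 1)) = f.toLin (fn 1) := by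
  rw [← f.map_ρ]
  exact congrArg f.toLin (map_one (act z))

variable {E} in
theorem nabla_map_one (f : unit ⟶ E) (i : Fin 2) : E.nabla i (f.toLin (fn 1)) = 0 := by
  rw [← f.map_nabla]
  exact (congrArg f.toLin (MvPolynomial.pderiv_one)).trans (map_zero f.toLin)

end sections

end EqConn

theorem Dat.ker_le_range_of_exact {S : ShortComplex Dat} (hS : S.Exact) :
    LinearMap.ker S.g.toLin ≤ LinearMap.range S.f.toLin := by
  have h := (ShortComplex.exact_iff_of_forks S
    (Dat.isKernel (Dat.kerι S.g) S.g (Dat.kerι_injective _) (Dat.range_kerι _).symm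
      (Dat.kerι_comp _))
    (Dat.isCokernel S.f (Dat.cokerπ S.f) (Dat.cokerπ_surjective _) (Dat.ker_cokerπ _)
      (Dat.comp_cokerπ _))).1 hS
  have h' : Dat.kerι S.g ≫ Dat.cokerπ S.f = 0 := h
  intro v hv
  rw [← Dat.ker_cokerπ]
  rw [← Dat.range_kerι] at hv
  obtain ⟨w, rfl⟩ := hv
  exact LinearMap.congr_fun (congrArg Dat.Hom.toLin h') w

/-- The functor of invariant sections. -/
def invSectionsFunctor : Bun ⥤ ModuleCat.{0} ℝ where
  obj E := ModuleCat.of ℝ E.obj.invSections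
  map f := ModuleCat.ofHom (EqConn.Hom.mapInvSections f.hom)
  map_id _ := rfl
  map_comp _ _ := rfl

/-- The functor of invariant forms. -/
def invFormsFunctor : Bun ⥤ ModuleCat.{0} ℝ where
  obj E := ModuleCat.of ℝ E.obj.invForms
  map f := ModuleCat.ofHom (EqConn.Hom.mapInvForms f.hom)
  map_id _ := rfl
  map_comp _ _ := rfl

instance : invSectionsFunctor.Additive where
  map_add := rfl

instance : invFormsFunctor.Additive where
  map_add := rfl

/-- The connection, as a map from invariant sections to invariant forms. -/
def invNablaTrans : invSectionsFunctor ⟶ invFormsFunctor where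
  app E := ModuleCat.ofHom E.obj.invNabla
  naturality E E' f := by
    ext m
    exact Subtype.ext (funext fun i => (f.hom.map_nabla i m.1).symm)

theorem EqConn.deRhamMap_f_zero {E E' : EqConn} (f : E ⟶ E') : (EqConn.deRhamMap f).f 0 =
    (HomologicalComplex.doubleXIso₀ (ModuleCat.ofHom E.invNabla) EqConn.rel01).hom ≫
      ModuleCat.ofHom f.mapInvSections ≫
      (HomologicalComplex.doubleXIso₀ (ModuleCat.ofHom E'.invNabla) EqConn.rel01).inv := by
  rw [EqConn.deRhamMap, HomologicalComplex.mkHomFromDouble_f₀]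

theorem EqConn.deRhamMap_f_one {E E' : EqConn} (f : E ⟶ E') : (EqConn.deRhamMap f).f 1 =
    (HomologicalComplex.doubleXIso₁ (ModuleCat.ofHom E.invNabla) EqConn.rel01 zero_ne_one).hom ≫
      ModuleCat.ofHom f.mapInvForms ≫
      (HomologicalComplex.doubleXIso₁ (ModuleCat.ofHom E'.invNabla) EqConn.rel01
        zero_ne_one).inv := by
  rw [EqConn.deRhamMap, HomologicalComplex.mkHomFromDouble_f₁]

section RHom

variable {C : Type 1} [Category.{0} C] [Abelian C] [Linear ℝ C] (G : C ⥤ Bun)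
  [G.IsEquivalence] [G.Additive] [G.Linear ℝ]

theorem ker_mapRadial_le {S : ShortComplex C} (hS : S.Exact) :
    LinearMap.ker (EqConn.Hom.mapRadial (G.map S.g).hom) ≤
      LinearMap.range (EqConn.Hom.mapRadial (G.map S.f).hom) :=
  Dat.ker_le_range_of_exact (hS.map (G ⋙ bunToDat))

instance : (G ⋙ invSectionsFunctor).PreservesHomology :=
  Functor.preservesHomology_of_map_exact _ fun S hS => by
    rw [ShortComplex.moduleCat_exact_iff]
    exact EqConn.exists_mapInvSections _ _ (ker_mapRadial_le G hS)

instance : (G ⋙ invFormsFunctor).PreservesHomology :=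
  Functor.preservesHomology_of_map_exact _ fun S hS => by
    rw [ShortComplex.moduleCat_exact_iff]
    exact EqConn.exists_mapInvForms _ _ (ker_mapRadial_le G hS)

/-- The structure sheaf, as a vector bundle with connection. -/
def Bun.one : Bun := ⟨EqConn.unit, isVectorBundle.prop_unit⟩

variable {G} {X : C}

section unit

variable (u : Bun.one ≅ G.obj X)

/-- The section defined by a map from the object that corresponds to the structure sheaf. -/
def homToSections : (linearCoyoneda ℝ C).obj (Opposite.op X) ⟶ G ⋙ invSectionsFunctor where
  app Y := ModuleCat.ofHom
    { toFun := fun φ : X ⟶ Y => (⟨EqConn.Hom.toLin (u.hom ≫ G.map φ).hom (EqConn.fn 1),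
        EqConn.ρ_map_one (u.hom ≫ G.map φ).hom⟩ : (G.obj Y).obj.invSections)
      map_add' := fun φ ψ => Subtype.ext (by rw [G.map_add]; rfl)
      map_smul' := fun r φ => Subtype.ext (by rw [G.map_smul]; rfl) }
  naturality Y Y' f := by
    ext φ
    refine Subtype.ext ?_
    exact congrArg (fun t : G.obj X ⟶ G.obj Y' => EqConn.Hom.toLin (u.hom ≫ t).hom (EqConn.fn 1))
      (G.map_comp (X := X) φ f)

theorem homToSections_comp :
    homToSections u ≫ Functor.whiskerLeft G invNablaTrans = 0 := by
  ext Y φ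
  exact Subtype.ext (funext fun i => EqConn.nabla_map_one (u.hom ≫ G.map φ).hom i)

theorem mono_homToSections (Y : C) : Mono ((homToSections u).app Y) := by
  rw [ModuleCat.mono_iff_injective]
  intro φ ψ h
  have h1 : u.hom ≫ G.map φ = u.hom ≫ G.map ψ :=
    ObjectProperty.hom_ext _ (EqConn.unit_hom_ext (congrArg Subtype.val h))
  exact G.map_injective ((cancel_epi u.hom).1 h1)

theorem exact_homToSections (Y : C) :
    (ShortComplex.mk ((homToSections u).app Y) ((Functor.whiskerLeft G invNablaTrans).app Y)
      (NatTrans.congr_app (homToSections_comp u) Y)).Exact := by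
  rw [ShortComplex.moduleCat_exact_iff]
  intro (m : (G.obj Y).obj.invSections) hm
  have hm' (i : Fin 2) : (G.obj Y).obj.nabla i m.1 = 0 := congrFun (congrArg Subtype.val hm) i
  let ψ : Bun.one ⟶ G.obj Y := ObjectProperty.homMk (EqConn.ofSection _ m.1 m.2 hm')
  refine ⟨(G.preimage (u.inv ≫ ψ) : X ⟶ Y), Subtype.ext ?_⟩
  change EqConn.Hom.toLin (u.hom ≫ G.map (G.preimage (u.inv ≫ ψ))).hom (EqConn.fn 1) = m.1
  rw [G.map_preimage, Iso.hom_inv_id_assoc]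
  exact EqConn.ofSection_one m.2 hm'

end unit

theorem exists_mono_epi_invNabla (Y : C) : ∃ (J : C) (i : Y ⟶ J), Mono i ∧
    Epi ((Functor.whiskerLeft G invNablaTrans).app J) := by
  let E := G.obj Y
  obtain ⟨k, ω, hω⟩ := Module.Finite.exists_fin (R := ℝ) (M := E.obj.invForms)
  let B : Bun := ⟨E.obj.extension ω, inferInstance, inferInstance⟩
  let j : E ⟶ B := ObjectProperty.homMk (E.obj.toExtension ω)
  have hj : Mono j := ⟨fun f g h => ObjectProperty.hom_ext _ (EqConn.hom_ext
    (LinearMap.ext fun m => congrArg Prod.fst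
      (LinearMap.congr_fun (congrArg (fun t => EqConn.Hom.toLin t.hom) h) m)))⟩
  have hB : Epi (invNablaTrans.app B) :=
    (ModuleCat.epi_iff_surjective _).2 (EqConn.invNabla_extension_surjective _ ω hω)
  let e := G.objObjPreimageIso B
  refine ⟨G.objPreimage B, G.preimage (j ≫ e.inv), ?_, ?_⟩
  · have : Mono (G.map (G.preimage (j ≫ e.inv))) := by
      rw [G.map_preimage]
      exact mono_comp _ _
    exact G.mono_of_mono_map this
  · have h : invNablaTrans.app (G.obj (G.objPreimage B)) =
        invSectionsFunctor.map e.hom ≫ invNablaTrans.app B ≫ invFormsFunctor.map e.inv := by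
      rw [← invNablaTrans.naturality, ← invSectionsFunctor.map_comp_assoc, e.hom_inv_id,
        invSectionsFunctor.map_id, Category.id_comp]
    change Epi (invNablaTrans.app (G.obj (G.objPreimage B)))
    rw [h]
    infer_instance

variable (G) in
/-- The invariant de Rham sequence as a mapping cocone. -/
def deRhamIsoCocone : (G ⋙ isVectorBundle.ι) ⋙ EqConn.deRhamFunctor ≅
    CochainComplex.singleFunctor C 0 ⋙ coconeFunctor (Functor.whiskerLeft G invNablaTrans) :=
  NatIso.ofComponents (doubleIsoCocone (Functor.whiskerLeft G invNablaTrans)) fun f =>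
    doubleIsoCocone_naturality (Functor.whiskerLeft G invNablaTrans) f
      (EqConn.deRhamMap_f_zero (G.map f).hom)
      (EqConn.deRhamMap_f_one (G.map f).hom)

variable [HasDerivedCategory.{1} C] [HasDerivedCategory.{1} (ModuleCat.{0} ℝ)]

theorem IsRHom.of_iso {T T' : C ⥤ DerivedCategory (ModuleCat.{0} ℝ)} (h : IsRHom C X T)
    (e : T' ≅ T) : IsRHom C X T' := by
  obtain ⟨RF, α, hα, ⟨e'⟩⟩ := h
  exact ⟨RF, α, hα, ⟨e ≪≫ e'⟩⟩

/-- The invariant de Rham sequence computes maps in the derived category. -/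
theorem isRHom_deRham (u : Bun.one ≅ G.obj X) : IsRHom C X ((G ⋙ isVectorBundle.ι) ⋙ EqConn.deRhamFunctor ⋙
    DerivedCategory.Q) :=
  (isRHom_of_cocone (Functor.whiskerLeft G invNablaTrans) (homToSections u)
    (homToSections_comp u) (mono_homToSections u) (exact_homToSections u)
    exists_mono_epi_invNabla).of_iso
    (Functor.isoWhiskerRight (deRhamIsoCocone G) DerivedCategory.Q)

end RHom

instance : bunToMHS.Linear ℝ where
  map_smul f r := bunToMHS_map_smul r f

theorem exists_isRHom_deRham [HasDerivedCategory.{1} (ModuleCat.{0} ℝ)] :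
    letI : Abelian MHS := isAbelianCat_MHS.abelian
    ∀ [HasDerivedCategory.{1} MHS],
    ∃ T : MHS ⥤ DerivedCategory (ModuleCat.{0} ℝ), IsRHom MHS (𝟙_ MHS) T ∧
      Nonempty (bunToMHS.asEquivalence.functor ⋙ T ≅
        isVectorBundle.ι ⋙ EqConn.deRhamFunctor ⋙ DerivedCategory.Q) := by
  let : Abelian MHS := isAbelianCat_MHS.abelian
  intro _
  let e := bunToMHS.asEquivalence
  have : e.functor.Additive := inferInstanceAs bunToMHS.Additive
  have : e.functor.Linear ℝ := inferInstanceAs (bunToMHS.Linear ℝ)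
  have h : e.inverse.Additive := e.inverse_additive
  have h' : e.inverse.Linear ℝ := inferInstance
  refine ⟨(e.inverse ⋙ isVectorBundle.ι) ⋙ EqConn.deRhamFunctor ⋙ DerivedCategory.Q,
    isRHom_deRham (G := e.inverse)
      (e.unitIso.app Bun.one ≪≫ e.inverse.mapIso bunToMHSCoreMonoidal.εIso.symm), ⟨?_⟩⟩
  exact (Functor.associator _ _ _).symm ≪≫ Functor.isoWhiskerRight
    ((Functor.associator _ _ _).symm ≪≫ Functor.isoWhiskerRight e.unitIso.symm _ ≪≫
      Functor.leftUnitor _) _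

end HodgeConn

end

theorem mainTheorem1 :
    -- tensor products of mixed Hodge structures are mixed Hodge structures; both categories are
    -- abelian
    ∃ (_ : HodgeConn.isMHS.IsMonoidal) (_ : HodgeConn.IsAbelianCat HodgeConn.Bun)
      (aM : HodgeConn.IsAbelianCat HodgeConn.MHS) (h : HodgeConn.Bun ≌ HodgeConn.MHS),
      -- `h` is an equivalence of `ℝ`-linear symmetric monoidal categories
      h.functor.Additive ∧ (∀ (E E' : HodgeConn.Bun) (r : ℝ) (f : E ⟶ E'),
        h.functor.map (r • f) = r • h.functor.map f) ∧
      Nonempty h.functor.Braided ∧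
      -- (a) `gr^W (h E)` is naturally identified with the fibre `E_0`, in such a way that
      -- the Hodge filtration of `gr_n^W` corresponds to the action of `ℂ^*` on `E_0`
      (∃ φ : h.functor ⋙ HodgeConn.isMHS.ι ⋙ HodgeConn.FiltSpace.grWFunctor ≅
          HodgeConn.isVectorBundle.ι ⋙ HodgeConn.EqConn.fiberFunctor,
        ∀ (E : HodgeConn.Bun) (n p : ℤ),
          ((h.functor.obj E).obj.FonGrW n p).map
              (((φ.hom.app E).hom ∘ₗ
                DirectSum.lof ℝ ℤ (fun n => (h.functor.obj E).obj.GrW n) n).baseChange ℂ) =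
            ⨆ (p' : ℤ) (_ : p ≤ p'), E.obj.fiberPiece p' (n - p')) ∧
      -- (b) the space underlying `h E` is naturally identified with the space of covariantly
      -- constant sections of `E` over the line `Re t = -1/2`
      Nonempty (h.functor ⋙ HodgeConn.isMHS.ι ⋙ HodgeConn.FiltSpace.forgetFunctor ≅
          HodgeConn.isVectorBundle.ι ⋙ HodgeConn.EqConn.lineSectionsFunctor) ∧
      -- (c) flat connections correspond to split mixed Hodge structures
      (∀ E : HodgeConn.Bun, E.obj.IsFlat ↔ HodgeConn.IsSplit (h.functor.obj E)) ∧
      -- (d) `RHom(ℝ(0), h E)` is the invariant global de Rham sequence of `E`, naturally in `E`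
      (letI : Abelian HodgeConn.MHS := aM.abelian
       letI : HasDerivedCategory.{1} HodgeConn.MHS := HasDerivedCategory.standard _
       letI : HasDerivedCategory.{1} (ModuleCat.{0} ℝ) := HasDerivedCategory.standard _
       ∃ T : HodgeConn.MHS ⥤ DerivedCategory (ModuleCat.{0} ℝ),
        HodgeConn.IsRHom HodgeConn.MHS (𝟙_ HodgeConn.MHS) T ∧
        Nonempty (h.functor ⋙ T ≅
          HodgeConn.isVectorBundle.ι ⋙ HodgeConn.EqConn.deRhamFunctor ⋙ DerivedCategory.Q)) := by
  refine ⟨HodgeConn.isMonoidal_isMHS, HodgeConn.isAbelianCat_bun, HodgeConn.isAbelianCat_MHS,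
    HodgeConn.bunToMHS.asEquivalence, inferInstanceAs HodgeConn.bunToMHS.Additive,
    fun _ _ r f => HodgeConn.bunToMHS_map_smul r f, HodgeConn.nonempty_braided_bunToMHS,
    ⟨HodgeConn.grWIso, HodgeConn.map_grWIso_FonGrW⟩, HodgeConn.nonempty_lineSectionsIso,
    HodgeConn.isFlat_iff_isSplit, ?_⟩
  let : Abelian HodgeConn.MHS := HodgeConn.isAbelianCat_MHS.abelian
  let : HasDerivedCategory.{1} HodgeConn.MHS := HasDerivedCategory.standard _
  let : HasDerivedCategory.{1} (ModuleCat.{0} ℝ) := HasDerivedCategory.standard _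
  exact HodgeConn.exists_isRHom_deRham
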